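/- Let $\mathcal F(f)(y)=\int_{\mathbb R}e^{2\pi i xy}f(x)\,dx=\mathcal F_+(f)+i\,\mathcal F_-(f)$, where $\mathcal F_+$ is the cosine and $\mathcal F_-$ the sine transform; on even tempered distributions $\mathcal F_+=\mathcal F$, and on odd ones $\mathcal F_-=-i\mathcal F$. For $a>0$ let $P_a$ be the restriction to $[-a,a]$ and $F_a^{\pm}=P_a\mathcal F_\pm P_a$, the integral operator on $L^2(-a,a;dx)$ with kernel $\cos(2\pi xy)$, resp. $\sin(2\pi xy)$; $\det(1\pm F_a^{+})$, $\det(1\pm F_a^-)$ are Fredholm determinants. *Cosine case.* For every $a>0$ there are unique locally integrable functions $\phi_a^{+},\phi_a^-$ on $\mathbb R$ with, for all $x\in\mathbb R$, $$\phi_a^{\pm}(x)\pm\int_{-a}^a\cos(2\pi xt)\,\phi_a^\pm(t)\,dt=2\cos(2\pi ax).$$ They are bounded, hence tempered distributions. Put $\mu(a)=a\phi_a^+(a)+a\phi_a^-(a)$ and $$A_a=\tfrac{\sqrt a}{2}\big(\mathcal F\phi_a^++\phi_a^+\big),\qquad B_a=\tfrac{i\sqrt a}{2}\big(\mathcal F\phi_a^--\phi_a^-\big).$$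 Then: 1. $A_a$ and $B_a$ are even tempered distributions which vanish on $(-a,a)$, and $\mathcal F A_a=A_a$, $\mathcal F B_a=-B_a$. 2. There are entire functions $\mathcal A_a(s)$, $\mathcal B_a(s)$ which for $\Re s$ large are equal to $\pi^{-s/2}\Gamma(\tfrac s2)\int_0^\infty A_a(t)t^{-s}\,dt$ and $\pi^{-s/2}\Gamma(\tfrac s2)\int_0^\infty B_a(t)t^{-s}\,dt$. 3. $\mathcal A_a$ and $\mathcal B_a$ are the structure functions of the de Branges–Sonine space. That is, let $K_a$ be the space of even $f\in L^2(\mathbb R)$ such that $f$ and $\mathcal F f$ vanish almost everywhere on $(-a,a)$, with norm $\big(\int_0^\infty|f|^2dt\big)^{1/2}$. For each $f\in K_a$ the function $\pi^{-s/2}\Gamma(\frac s2)\int_0^\infty f(t)t^{-s}dt$ $(\Re s>\frac12)$ extends to an entire function $\widehat f$. With $E^*(s)=\overline{E(1-\bar s)}$ one has $\mathcal A_a^*=\mathcal A_a$, $\mathcal B_a^*=\mathcal B_a$. The function $E_a=\mathcal A_a-i\mathcal B_a$ satisfies $|E_a(1-\bar s)|<|E_a(s)|$ for $\Re s>\frac12$.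 For every $w\in\mathbb C$ there is $Z_w\in K_a$ with $\widehat f(w)=\int_0^\infty\overline{Z_w(t)}f(t)\,dt$ for all $f\in K_a$, and $$(z+\bar w-1)\,\widehat{Z_w}(z)=E_a(z)\overline{E_a(w)}-E_a^*(z)\overline{E_a^*(w)}\qquad(z\in\mathbb C).$$ 4. For $\gamma\in\mathbb C$, $s=\frac12+i\gamma$, $u\in\mathbb R$, put $\mathcal A^s(u)=\mathcal A_{e^u}(s)$, $\mathcal B^s(u)=\mathcal B_{e^u}(s)$, $\mu_+(u)=\mu(e^u)$. These functions of $u$ satisfy the Dirac system $$\frac{d}{du}\mathcal A^s=-\gamma\,\mathcal B^s-\mu_+\,\mathcal A^s,\qquad \frac{d}{du}\mathcal B^s=\gamma\,\mathcal A^s+\mu_+\,\mathcal B^s .$$ 5. For every $a>0$ the determinants $\det(1\pm F_a^+)$ are positive. With $a=e^u$, the functions $u\mapsto\log\det(1\pm F_a^+)$, $\mathcal A^s$, $\mathcal B^s$ are $C^2$ on $\mathbb R$, and $$-\frac{d^2}{du^2}\mathcal A^s+\Big(-2\frac{d^2}{du^2}\log\det(1+F_a^+)\Big)\mathcal A^s=\gamma^2\mathcal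 A^s,$$ $$-\frac{d^2}{du^2}\mathcal B^s+\Big(-2\frac{d^2}{du^2}\log\det(1-F_a^+)\Big)\mathcal B^s=\gamma^2\mathcal B^s .$$ *Sine case.* All of the above holds with $\cos$, $\mathcal F$ (acting on even objects), "even", $F_a^+$ and $\pi^{-s/2}\Gamma(\frac s2)$ replaced throughout by $\sin$, $\mathcal F_-$, "odd", $F_a^-$ and $\pi^{-(s+1)/2}\Gamma(\frac{s+1}2)$. -/

import Mathlib

open scoped SchwartzMap FourierTransform ENNReal
open MeasureTheory

noncomputable section

namespace FourierDirac

/-- Selects the cosine transform (even functions) or the sine transform (odd functions). -/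
inductive Parity where
  | even : Parity
  | odd : Parity

/-- `cos` for the even case, `sin` for the odd case. -/
def trig : Parity → ℝ → ℝ
  | .even => Real.cos
  | .odd => Real.sin

/-- `f (-x) = sign * f x` for functions of the given parity. -/
def parSign : Parity → ℂ
  | .even => 1
  | .odd => -1

/-- The completing factor: `π ^ (-s/2) Γ(s/2)` in the even case,
`π ^ (-(s+1)/2) Γ((s+1)/2)` in the odd case. -/
def gammaFactor : Parity → ℂ → ℂ
  | .even => fun s => Complex.Gammaℝ s
  | .odd => fun s => Complex.Gammaℝ (s + 1)

/-! ### Fredholm determinants -/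

/-- The Fredholm determinant `det (1 + σ K)` of the integral operator `K` on `L²(-a, a; dx)` with
kernel `k`, given by the Fredholm series. -/
def fredholmDet (k : ℝ → ℝ → ℝ) (a σ : ℝ) : ℝ :=
  ∑' n : ℕ, σ ^ n / (n.factorial : ℝ) *
    ∫ x in Set.univ.pi (fun _ : Fin n => Set.Icc (-a) a),
      Matrix.det (Matrix.of fun i j : Fin n => k (x i) (x j))

/-- `det (1 + σ F_a)`, where `F_a = P_a ℱ_± P_a` is the finite cosine (or sine) transform, with
kernel `cos (2 π x y)` (or `sin (2 π x y)`) on `[-a, a]`. -/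
def detF (p : Parity) (σ a : ℝ) : ℝ :=
  fredholmDet (fun x y => trig p (2 * Real.pi * x * y)) a σ

/-- The function `u ↦ log det (1 + σ F_a)` with `a = exp u`. -/
def logDetF (p : Parity) (σ u : ℝ) : ℝ := Real.log (detF p σ (Real.exp u))

/-- The potential `-2 (d²/du²) log det (1 + σ F_a)`, `a = exp u`. -/
def potential (p : Parity) (σ u : ℝ) : ℝ := -2 * iteratedDeriv 2 (logDetF p σ) u

/-! ### The functions `φ_a^±` (and `ψ_a^±`) -/

/-- `φ` is a locally integrable solution of
`φ(x) + σ ∫_{-a}^{a} cos(2πxt) φ(t) dt = 2 cos(2πax)` (with `sin` in place of `cos` in the odd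
case). -/
def IsPhi (p : Parity) (σ a : ℝ) (φ : ℝ → ℝ) : Prop :=
  LocallyIntegrable φ ∧
    ∀ x, φ x + σ * ∫ t in (-a)..a, trig p (2 * Real.pi * x * t) * φ t =
      2 * trig p (2 * Real.pi * a * x)

open Classical in
/-- The solution of the equation `IsPhi` (`0` if there were none).  In the even case `phi p 1 a` is
`φ_a^+` and `phi p (-1) a` is `φ_a^-`; in the odd case they are `ψ_a^+` and `ψ_a^-`. -/
def phi (p : Parity) (σ a : ℝ) : ℝ → ℝ :=
  if h : ∃ φ, IsPhi p σ a φ then h.choose else 0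

/-- `μ(a) = a φ_a^+(a) + a φ_a^-(a)` (with `ψ` in place of `φ` in the odd case). -/
def mu (p : Parity) (a : ℝ) : ℝ := a * phi p 1 a a + a * phi p (-1) a a

lemma continuous_trig (p : Parity) : Continuous (trig p) := by
  cases p
  · exact Real.continuous_cos
  · exact Real.continuous_sin

lemma abs_trig_le (p : Parity) (x : ℝ) : |trig p x| ≤ 1 := by
  cases p
  · exact Real.abs_cos_le_one x
  · exact Real.abs_sin_le_one x

lemma IsPhi.memLp {p : Parity} {σ a : ℝ} {φ : ℝ → ℝ} (h : IsPhi p σ a φ) :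
    MemLp (fun x => (φ x : ℂ)) ∞ volume := by
  obtain ⟨hl, he⟩ := h
  have hint : IntervalIntegrable φ volume (-a) a :=
    (hl.integrableOn_isCompact isCompact_uIcc).intervalIntegrable
  have hb : ∀ x t, ‖trig p (2 * Real.pi * x * t) * φ t‖ ≤ ‖φ t‖ := by
    intro x t
    rw [norm_mul]
    exact mul_le_of_le_one_left (norm_nonneg _) (abs_trig_le p _)
  have hc : Continuous fun x => ∫ t in (-a)..a, trig p (2 * Real.pi * x * t) * φ t := by
    refine intervalIntegral.continuous_of_dominated_interval (bound := fun t => ‖φ t‖) ?_ ?_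
      hint.norm ?_
    · intro x
      have hm : AEStronglyMeasurable φ volume := hl.aestronglyMeasurable
      exact (((continuous_trig p).comp (by fun_prop)).aestronglyMeasurable.mul hm).restrict
    · exact fun x => Filter.Eventually.of_forall fun t _ => hb x t
    · refine Filter.Eventually.of_forall fun t _ => ?_
      exact ((continuous_trig p).comp (by fun_prop)).mul continuous_const
  have heq : φ = fun x => 2 * trig p (2 * Real.pi * a * x) -
      σ * ∫ t in (-a)..a, trig p (2 * Real.pi * x * t) * φ t := by
    funext x
    linarith [he x]
  have hφ : Continuous φ := by
    rw [heq]
    exact (continuous_const.mul ((continuous_trig p).comp (by fun_prop))).sub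
      (continuous_const.mul hc)
  have hle : ∀ x, ‖φ x‖ ≤ 2 + |σ| * |∫ t in (-a)..a, ‖φ t‖| := by
    intro x
    have h1 : φ x = 2 * trig p (2 * Real.pi * a * x) -
      σ * ∫ t in (-a)..a, trig p (2 * Real.pi * x * t) * φ t := by linarith [he x]
    rw [h1]
    refine (norm_sub_le _ _).trans (add_le_add ?_ ?_)
    · rw [norm_mul]
      have := abs_trig_le p (2 * Real.pi * a * x)
      simpa using this
    · rw [norm_mul]
      refine mul_le_mul_of_nonneg_left ?_ (abs_nonneg σ)
      exact intervalIntegral.norm_integral_le_abs_of_norm_le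
        (Filter.Eventually.of_forall fun t => hb x t) hint.norm
  refine memLp_top_of_bound (Complex.continuous_ofReal.comp hφ).aestronglyMeasurable
    (2 + |σ| * |∫ t in (-a)..a, ‖φ t‖|) (Filter.Eventually.of_forall fun x => ?_)
  simpa using hle x

lemma phi_memLp (p : Parity) (σ a : ℝ) : MemLp (fun x => (phi p σ a x : ℂ)) ∞ volume := by
  unfold phi
  split_ifs with h
  · exact h.choose_spec.memLp
  · simp

/-! ### The distributions `A_a` and `B_a` -/

/-- The function `phi p σ a` (which is bounded) as a tempered distribution. -/
def phiDist (p : Parity) (σ a : ℝ) : 𝓢'(ℝ, ℂ) :=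
  Lp.toTemperedDistribution (phi_memLp p σ a).toLp

/-- The cosine transform `ℱ_+` on even, resp. the sine transform `ℱ_-` on odd tempered
distributions.  With `ℱ(f)(y) = ∫ exp(2πixy) f(x) dx`, which is `𝓕⁻` in Mathlib, one has
`ℱ = ℱ_+ + i ℱ_-`, so `ℱ = ℱ_+` on even distributions and `ℱ_- = -i ℱ` on odd ones. -/
def parityFourier (p : Parity) (T : 𝓢'(ℝ, ℂ)) : 𝓢'(ℝ, ℂ) :=
  match p with
  | .even => 𝓕⁻ T
  | .odd => (-Complex.I) • 𝓕⁻ T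

/-- `A_a = (√a / 2) (ℱ φ_a^+ + φ_a^+)`. -/
def distA (p : Parity) (a : ℝ) : 𝓢'(ℝ, ℂ) :=
  ((Real.sqrt a : ℂ) / 2) • (parityFourier p (phiDist p 1 a) + phiDist p 1 a)

/-- `B_a = (i √a / 2) (ℱ φ_a^- - φ_a^-)`. -/
def distB (p : Parity) (a : ℝ) : 𝓢'(ℝ, ℂ) :=
  (Complex.I * (Real.sqrt a : ℂ) / 2) • (parityFourier p (phiDist p (-1) a) - phiDist p (-1) a)

/-- `T` has the given parity, is an eigenvector of the cosine (sine) transform for the eigenvalue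
`ε`, and vanishes on `(-a, a)`; for `ε = ±1` its transform then vanishes there as well. -/
def IsSonineDistribution (p : Parity) (a : ℝ) (ε : ℂ) (T : 𝓢'(ℝ, ℂ)) : Prop :=
  (∀ g g' : 𝓢(ℝ, ℂ), (∀ x, g' x = g (-x)) → T g' = parSign p * T g) ∧
    parityFourier p T = ε • T ∧
    Distribution.IsVanishingOn T (Set.Ioo (-a) a)

/-! ### Right Mellin transforms -/

/-- `∫_0^∞ T(t) t^{-s} dt = m` for a tempered distribution `T` vanishing on `(-a, a)`: the test
functions are `t ^ (-s)`, smoothly cut off to the left of `a / 2` (where they are set to zero for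
`t ≤ a / 4`) and smoothly truncated between `R` and `2 R`; the value is the limit as `R → ∞`. -/
def HasRightMellin (a : ℝ) (T : 𝓢'(ℝ, ℂ)) (s m : ℂ) : Prop :=
  ∃ g : ℝ → 𝓢(ℝ, ℂ),
    (∀ R > 0, ∀ t : ℝ, g R t =
      (Real.smoothTransition (4 * t / a - 1) : ℂ) * (Real.smoothTransition (2 - t / R) : ℂ) *
        (t : ℂ) ^ (-s)) ∧
    Filter.Tendsto (fun R => T (g R)) Filter.atTop (nhds m)

/-- `M` is the entire function which for `Re s` large equals the right Mellin transform of `T`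
times the Gamma factor. -/
def IsCompletedMellin (p : Parity) (a : ℝ) (T : 𝓢'(ℝ, ℂ)) (M : ℂ → ℂ) : Prop :=
  Differentiable ℂ M ∧
    ∃ σ₀ : ℝ, ∀ s : ℂ, σ₀ < s.re → ∃ m, HasRightMellin a T s m ∧ M s = gammaFactor p s * m

open Classical in
/-- The completed right Mellin transform, as an entire function (`0` if there were none). -/
def completedMellin (p : Parity) (a : ℝ) (T : 𝓢'(ℝ, ℂ)) : ℂ → ℂ :=
  if h : ∃ M, IsCompletedMellin p a T M then h.choose else 0

/-- `𝒜_a(s)`. -/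
def calA (p : Parity) (a : ℝ) : ℂ → ℂ := completedMellin p a (distA p a)

/-- `ℬ_a(s)`. -/
def calB (p : Parity) (a : ℝ) : ℂ → ℂ := completedMellin p a (distB p a)

/-! ### The de Branges Sonine spaces and their structure functions -/

/-- The Sonine space: the square integrable functions of the given parity which vanish, together
with their Fourier transform, on `(-a, a)`. -/
def sonineSpace (p : Parity) (a : ℝ) : Set (Lp ℂ 2 (volume : Measure ℝ)) :=
  {f | (∀ᵐ x : ℝ, f (-x) = parSign p * f x) ∧
    (∀ᵐ x : ℝ, x ∈ Set.Ioo (-a) a → f x = 0) ∧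
    (∀ᵐ x : ℝ, x ∈ Set.Ioo (-a) a → (𝓕 f : Lp ℂ 2 (volume : Measure ℝ)) x = 0)}

/-- `F` is the entire function which for `Re s > 1/2` equals the completed right Mellin transform
of the square integrable function `f` (vanishing near `0`). -/
def IsSonineTransform (p : Parity) (f : Lp ℂ 2 (volume : Measure ℝ)) (F : ℂ → ℂ) : Prop :=
  Differentiable ℂ F ∧ ∀ s : ℂ, 1 / 2 < s.re →
    F s = gammaFactor p s * ∫ t in Set.Ioi (0 : ℝ), f t * (t : ℂ) ^ (-s)

/-- `A`, `B` are the structure functions of the Hilbert space of entire functions `F`, the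
completed right Mellin transforms of the elements `f` of the Sonine space, with norm
`‖F‖² = ∫_0^∞ |f(t)|² dt`, the axis of symmetry being the critical line.
With `E = A - i B` and `E^*(s) = conj (E (1 - conj s))` this means: `A` and `B` are entire and
equal to their own `*`, `E` satisfies the Hermite-Biehler inequality `|E^*| < |E|` on
`Re s > 1/2`, and the space has the reproducing kernel
`K(w, z) = (E(z) conj E(w) - E^*(z) conj E^*(w)) / (z + conj w - 1)`. -/
structure IsStructurePair (p : Parity) (a : ℝ) (A B : ℂ → ℂ) : Prop where
  entire_A : Differentiable ℂ A
  entire_B : Differentiable ℂ B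
  symm_A : ∀ s, star (A (1 - star s)) = A s
  symm_B : ∀ s, star (B (1 - star s)) = B s
  hermite_biehler : ∀ s : ℂ, 1 / 2 < s.re →
    ‖A (1 - star s) - Complex.I * B (1 - star s)‖ < ‖A s - Complex.I * B s‖
  transform_exists : ∀ f ∈ sonineSpace p a, ∃ F, IsSonineTransform p f F
  kernel : ∀ w : ℂ, ∃ Z ∈ sonineSpace p a, ∃ K : ℂ → ℂ, IsSonineTransform p Z K ∧
    (∀ f ∈ sonineSpace p a, ∀ F, IsSonineTransform p f F →
      F w = ∫ t in Set.Ioi (0 : ℝ), star (Z t) * f t) ∧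
    ∀ z : ℂ, (z + star w - 1) * K z =
      (A z - Complex.I * B z) * star (A w - Complex.I * B w) -
        star (A (1 - star z) - Complex.I * B (1 - star z)) *
          (A (1 - star w) - Complex.I * B (1 - star w))

/-- `𝒜^s(u) = 𝒜_a(s)` with `a = exp u` and `s = 1/2 + i γ`. -/
def scrA (p : Parity) (γ : ℂ) (u : ℝ) : ℂ := calA p (Real.exp u) (1 / 2 + Complex.I * γ)

/-- `ℬ^s(u) = ℬ_a(s)` with `a = exp u` and `s = 1/2 + i γ`. -/
def scrB (p : Parity) (γ : ℂ) (u : ℝ) : ℂ := calB p (Real.exp u) (1 / 2 + Complex.I * γ)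

/-- `μ_±(u) = μ(a)` with `a = exp u`. -/
def muU (p : Parity) (u : ℝ) : ℝ := mu p (Real.exp u)

end FourierDirac

end

/-! Both signs are handled at once through a parameter σ = ±1. Write T for the cosine (sine)
transform on functions of the chosen parity, a unitary involution, and T_a for its truncation to
[-a, a].

Uniqueness is the main tool (`eq_zero_of_homogeneous`). If W + σ T_a W = 0 on the line, then W is,
up to sign, the transform of its own restriction to [-a, a]. Plancherel leaves no mass outside [-a,
a], and W is the restriction of an entire function, so W = 0. Existence follows from the Fredholm
alternative, once the operator is rescaled to C([-1, 1]), where it is compact and smooth in u = log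
a. From then on an identity between solutions is proved by checking that both sides solve the same
integral equation. The operator x d/dx + 1/2 anticommutes with T, so differentiation in u couples σ
with -σ; this gives `PsiU_eq`, the evolution equation of φ_a.

The distributions A_a and B_a are multiples of δ_a plus its mirror image plus σ φ_a restricted to
|x| > a (`coreDist_apply`). Testing them on Gaussians gives theta functions with θ(1/v) = σ v θ(v).
Riemann's splitting at v = 1 shows that their Mellin transforms are entire, and writes them as
pairings `xi` with the rapidly decreasing function `cutPow`. The Euler operator exchanges the two
signs of `cutPow` (`hasDerivAt_cutPow`), as it does for φ_a; together these give the Dirac system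
(`hasDerivAt_xi`).

Iterating the Dirac system gives Schrödinger equations with potentials μ² ∓ μ'. Differentiating the
Fredholm series termwise, and recognising its minor as a multiple of φ_a by uniqueness, gives d/du
log det(1 + σ T_a) = σ a φ_a(a) (`hasDerivAt_detF`). At the edge x = a the evolution equation yields
(a φ_a^-(a) - a φ_a^+(a))' = μ² (`muPsi_sq`). As μ is the sum of the two edge values, the potentials
are -2 (log det)''. Positivity holds for small a and propagates along the linear equation for the
determinant.

The Sonine space is the orthogonal sum of the eigenspaces of T. On each of them the same splitting
turns evaluation of the completed Mellin transform into integration against `cutPow` over (a, ∞),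
and the representing vector is explicit: beyond a it is half of X + g, where X is `cutPow` and g
solves the integral equation with the tail transform of X on the right (`repVec`). The edge value of
X + g is `xi` (`sonZ_self`), and X + g satisfies a first order system coupling both signs
(`hasDerivAt_sonZ`). Integration by parts gives a formula of Christoffel–Darboux type
(`sonZ_identity`, `kerT_mul`), which is the de Branges kernel. The Hermite–Biehler inequality is the
positivity of this kernel on the diagonal, strict because the evaluators do not vanish
(`kerVec_ne_zero`). -/

noncomputable section

namespace FourierDirac

/-! ### The kernel of the cosine and sine transforms -/

/-- `cos` or `sin` on the complex plane. -/
def trigC : Parity → ℂ → ℂ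
  | .even => Complex.cos
  | .odd => Complex.sin

/-- `cos (2πx)` or `sin (2πx)`, as a complex number. -/
def wave (p : Parity) (x : ℝ) : ℂ := (trig p (2 * Real.pi * x) : ℂ)

/-- The derivative of `wave`. -/
def waveD (p : Parity) (x : ℝ) : ℂ :=
  match p with
  | .even => ((-(2 * Real.pi * Real.sin (2 * Real.pi * x)) : ℝ) : ℂ)
  | .odd => ((2 * Real.pi * Real.cos (2 * Real.pi * x) : ℝ) : ℂ)

/-- The factor turning the Fourier transform of a function of the given parity into its cosine or
sine transform. -/
def parUnit : Parity → ℂ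
  | .even => 1
  | .odd => Complex.I

lemma norm_parUnit (p : Parity) : ‖parUnit p‖ = 1 := by cases p <;> simp [parUnit]

lemma parUnit_ne_zero (p : Parity) : parUnit p ≠ 0 := by cases p <;> simp [parUnit]

lemma parUnit_mul_self (p : Parity) : parUnit p * parUnit p = parSign p := by
  cases p <;> simp [parUnit, parSign]

lemma parSign_mul_self (p : Parity) : parSign p * parSign p = 1 := by
  cases p <;> simp [parSign]

lemma norm_parSign (p : Parity) : ‖parSign p‖ = 1 := by cases p <;> simp [parSign]

lemma star_parSign (p : Parity) : star (parSign p) = parSign p := by cases p <;> simp [parSign]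

lemma continuous_wave (p : Parity) : Continuous (wave p) :=
  Complex.continuous_ofReal.comp ((continuous_trig p).comp (by fun_prop))

@[fun_prop]
lemma Continuous.wave {X : Type*} [TopologicalSpace X] {f : X → ℝ} (hf : Continuous f)
    (p : Parity) : Continuous fun x => wave p (f x) := (continuous_wave p).comp hf

lemma norm_wave_le (p : Parity) (x : ℝ) : ‖wave p x‖ ≤ 1 := by
  rw [wave, Complex.norm_real]
  exact abs_trig_le p _

lemma wave_neg (p : Parity) (x : ℝ) : wave p (-x) = parSign p * wave p x := by
  cases p <;> simp [wave, trig, parSign]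

lemma star_wave (p : Parity) (x : ℝ) : star (wave p x) = wave p x := by
  simp [wave]

lemma hasDerivAt_wave (p : Parity) (x : ℝ) : HasDerivAt (wave p) (waveD p x) x := by
  have h : HasDerivAt (fun y : ℝ => 2 * Real.pi * y) (2 * Real.pi) x := by
    simpa using (hasDerivAt_id x).const_mul (2 * Real.pi)
  cases p
  · have := (h.cos).ofReal_comp
    refine this.congr_deriv ?_
    simp only [waveD]
    push_cast
    ring
  · have := (h.sin).ofReal_comp
    refine this.congr_deriv ?_
    simp only [waveD]
    push_cast
    ring

lemma continuous_waveD (p : Parity) : Continuous (waveD p) := by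
  cases p
  · exact Complex.continuous_ofReal.comp (by fun_prop)
  · exact Complex.continuous_ofReal.comp (by fun_prop)

@[fun_prop]
lemma Continuous.waveD {X : Type*} [TopologicalSpace X] {f : X → ℝ} (hf : Continuous f)
    (p : Parity) : Continuous fun x => waveD p (f x) := (continuous_waveD p).comp hf

lemma norm_waveD_le (p : Parity) (x : ℝ) : ‖waveD p x‖ ≤ 2 * Real.pi := by
  have h : (0 : ℝ) ≤ 2 * Real.pi := by positivity
  cases p
  · rw [waveD, Complex.norm_real, norm_neg, norm_mul, Real.norm_of_nonneg h]
    exact mul_le_of_le_one_right h (Real.abs_sin_le_one _)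
  · rw [waveD, Complex.norm_real, norm_mul, Real.norm_of_nonneg h]
    exact mul_le_of_le_one_right h (Real.abs_cos_le_one _)

lemma wave_eq_trigC (p : Parity) (x : ℝ) : wave p x = trigC p (2 * Real.pi * x) := by
  cases p <;> simp [wave, trig, trigC]

lemma differentiable_trigC (p : Parity) : Differentiable ℂ (trigC p) := by
  cases p
  · exact Complex.differentiable_cos
  · exact Complex.differentiable_sin

/-- Averaging the Fourier integral over t and -t turns the exponential into a cosine or a multiple
of a sine. The unit in the odd case is `I` because `𝓕` has the kernel exp(-2πixt), opposite to the
sign convention of the theorem. -/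
lemma parUnit_mul_fourier {p : Parity} {h : ℝ → ℂ} (hi : Integrable h)
    (hp : ∀ x, h (-x) = parSign p * h x) (x : ℝ) :
    parUnit p * 𝓕 h x = ∫ t, wave p (x * t) * h t := by
  have hi' : ∀ c : ℝ, Integrable fun t : ℝ => Complex.exp (↑(c * t * x) * Complex.I) • h t := by
    intro c
    refine hi.bdd_mul (c := 1) (by fun_prop) (Filter.Eventually.of_forall fun t => ?_)
    rw [Complex.norm_exp_ofReal_mul_I]
  have h1 : 𝓕 h x = ∫ t, Complex.exp (↑(2 * Real.pi * t * x) * Complex.I) • h (-t) := by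
    rw [Real.fourier_real_eq_integral_exp_smul, ← integral_neg_eq_self]
    refine integral_congr_ae (Filter.Eventually.of_forall fun t => ?_)
    simp only [mul_neg, neg_mul, neg_neg]
  have h2 := Real.fourier_real_eq_integral_exp_smul h x
  have h3 : ∀ t, wave p (x * t) * h t = parUnit p / 2 *
      (Complex.exp (↑(-2 * Real.pi * t * x) * Complex.I) • h t +
        Complex.exp (↑(2 * Real.pi * t * x) * Complex.I) • h (-t)) := by
    intro t
    rw [hp]
    have e1 : ((2 * Real.pi * (x * t) : ℝ) : ℂ) * Complex.I =
      ((2 * Real.pi * t * x : ℝ) : ℂ) * Complex.I := by push_cast; ring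
    have e2 : -((2 * Real.pi * (x * t) : ℝ) : ℂ) * Complex.I =
      ((-2 * Real.pi * t * x : ℝ) : ℂ) * Complex.I := by push_cast; ring
    cases p
    · simp only [wave, trig, Complex.ofReal_cos, Complex.cos, parSign, parUnit, smul_eq_mul, e1, e2]
      ring
    · simp only [wave, trig, Complex.ofReal_sin, Complex.sin, parSign, parUnit, smul_eq_mul, e1, e2]
      ring
  simp_rw [h3]
  rw [integral_const_mul, integral_add (hi' _), ← h1, ← h2]
  · ring
  · simp_rw [hp]
    refine ((hi' (2 * Real.pi)).const_mul (parSign p)).congr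
      (Filter.Eventually.of_forall fun t => ?_)
    simp only [smul_eq_mul]
    ring

/-! ### The Fourier transform on `L¹ ∩ L²` -/

/-- By duality: the L² transform and the Fourier integral have the same integral against every test
function, the former because it agrees with the transform of distributions, the latter by Fubini. -/
lemma fourier_toLp_ae_eq {f : ℝ → ℂ} (h1 : Integrable f) (h2 : MemLp f 2) :
    (𝓕 h2.toLp : Lp ℂ 2 (volume : Measure ℝ)) =ᵐ[volume] 𝓕 f := by
  have hc : Continuous (𝓕 f) := VectorFourier.fourierIntegral_continuous Real.continuous_fourierChar
    (by exact continuous_inner) h1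
  refine ae_eq_of_integral_contDiff_smul_eq
    ((Lp.memLp _).locallyIntegrable (by norm_num)) hc.locallyIntegrable ?_
  intro g g_smooth g_cpt
  have hg₁ : HasCompactSupport (Complex.ofRealCLM ∘ g) := g_cpt.comp_left rfl
  have hg₂ : ContDiff ℝ ((⊤ : ℕ∞) : WithTop ℕ∞) (Complex.ofRealCLM ∘ g) :=
    Complex.ofRealCLM.contDiff.comp g_smooth
  set G : 𝓢(ℝ, ℂ) := hg₁.toSchwartzMap hg₂ with hG
  have e1 := congrArg (fun T : 𝓢'(ℝ, ℂ) => T G) (Lp.fourier_toTemperedDistribution_eq h2.toLp)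
  simp only [TemperedDistribution.fourier_apply, Lp.toTemperedDistribution_apply] at e1
  have e2 : ∫ x, g x • (𝓕 h2.toLp : Lp ℂ 2 (volume : Measure ℝ)) x =
      ∫ x, G x • (𝓕 h2.toLp : Lp ℂ 2 (volume : Measure ℝ)) x := by
    refine integral_congr_ae (Filter.Eventually.of_forall fun x => ?_)
    simp [hG]
  have e3 : ∫ x, g x • 𝓕 f x = ∫ x, G x • 𝓕 f x := by
    refine integral_congr_ae (Filter.Eventually.of_forall fun x => ?_)
    simp [hG]
  rw [e2, e3, ← e1]
  have e4 : ∫ x, 𝓕 G x • (h2.toLp : Lp ℂ 2 (volume : Measure ℝ)) x = ∫ x, 𝓕 G x • f x := by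
    refine integral_congr_ae ?_
    filter_upwards [h2.coeFn_toLp] with x hx
    rw [hx]
  rw [e4, SchwartzMap.fourier_coe]
  have := VectorFourier.integral_fourierIntegral_smul_eq_flip (L := innerₗ ℝ)
    (μ := volume) (ν := volume) (f := (G : ℝ → ℂ)) (g := f) Real.continuous_fourierChar
    (by exact continuous_inner) G.integrable h1
  rw [flip_innerₗ] at this
  exact this

lemma integral_norm_sq_fourier {f : ℝ → ℂ} (h1 : Integrable f) (h2 : MemLp f 2) :
    MemLp (𝓕 f) 2 ∧ ∫ x, ‖𝓕 f x‖ ^ 2 = ∫ x, ‖f x‖ ^ 2 := by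
  have hae := fourier_toLp_ae_eq h1 h2
  have hm : MemLp (𝓕 f) 2 := (memLp_congr_ae hae).1 (Lp.memLp _)
  refine ⟨hm, ?_⟩
  have key : ∀ {g : ℝ → ℂ} (G : Lp ℂ 2 (volume : Measure ℝ)), G =ᵐ[volume] g →
      ∫ x, ‖g x‖ ^ 2 = ‖G‖ ^ 2 := by
    intro g G hg
    have := L2.inner_def (𝕜 := ℂ) G G
    rw [inner_self_eq_norm_sq_to_K] at this
    have e : ∫ x, inner ℂ (G x) (G x) = ∫ x, ((‖g x‖ ^ 2 : ℝ) : ℂ) := by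
      refine integral_congr_ae ?_
      filter_upwards [hg] with x hx
      rw [hx, inner_self_eq_norm_sq_to_K]
      simp
    rw [e, integral_complex_ofReal] at this
    have h3 : ((‖G‖ ^ 2 : ℝ) : ℂ) = ((∫ x, ‖g x‖ ^ 2 : ℝ) : ℂ) := by
      rw [← this]
      simp
    exact (Complex.ofReal_injective h3).symm
  rw [key _ hae, key _ h2.coeFn_toLp, Lp.norm_fourier_eq]

/-! ### Uniqueness for the integral equations -/

/-- `∫_{-a}^a trig (2πxt) f(t) dt`. -/
def finT (p : Parity) (a : ℝ) (f : ℝ → ℂ) (x : ℝ) : ℂ := ∫ t in (-a)..a, wave p (x * t) * f t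

lemma finT_neg (p : Parity) (a : ℝ) (f : ℝ → ℂ) (x : ℝ) :
    finT p a f (-x) = parSign p * finT p a f x := by
  simp only [finT, neg_mul, wave_neg, mul_assoc]
  exact intervalIntegral.integral_const_mul _ _

/-- The entire extension of `finT`. -/
def finTC (p : Parity) (a : ℝ) (f : ℝ → ℂ) (z : ℂ) : ℂ :=
  ∫ t in (-a)..a, trigC p (2 * Real.pi * (z * t)) * f t

lemma finTC_ofReal (p : Parity) (a : ℝ) (f : ℝ → ℂ) (x : ℝ) :
    finTC p a f x = finT p a f x := by
  refine intervalIntegral.integral_congr fun t _ => ?_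
  simp only [wave_eq_trigC]
  push_cast
  rfl

lemma differentiable_finTC (p : Parity) (a : ℝ) {f : ℝ → ℂ} (hf : Continuous f) :
    Differentiable ℂ (finTC p a f) := by
  intro z
  have hdc : Continuous (deriv (trigC p)) :=
    ((differentiable_trigC p).contDiff (n := 1)).continuous_deriv le_rfl
  let F' : ℂ → ℝ → ℂ := fun z t => deriv (trigC p) (2 * Real.pi * (z * t)) *
    (2 * Real.pi * t) * f t
  have hF' : Continuous (Function.uncurry F') := by
    simp only [F', Function.uncurry_def]
    fun_prop
  obtain ⟨M, hM⟩ := ((isCompact_closedBall z 1).prod (isCompact_uIcc (a := -a) (b := a))).exists_bound_of_continuousOn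
    hF'.continuousOn
  have hc : Continuous (trigC p) := (differentiable_trigC p).continuous
  have := intervalIntegral.hasDerivAt_integral_of_dominated_loc_of_deriv_le
    (μ := volume) (a := -a) (b := a) (F := fun z t => trigC p (2 * Real.pi * (z * t)) * f t)
    (F' := F') (x₀ := z) (s := Metric.ball z 1) (bound := fun _ => M)
    (Metric.ball_mem_nhds z one_pos)
    (Filter.Eventually.of_forall fun w => by
      exact (Continuous.aestronglyMeasurable (by fun_prop)).restrict)
    (Continuous.intervalIntegrable (by fun_prop) _ _)
    (Continuous.aestronglyMeasurable (by fun_prop)).restrict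
    (Filter.Eventually.of_forall fun t ht w hw => hM (w, t)
      ⟨Metric.ball_subset_closedBall hw, Set.uIoc_subset_uIcc ht⟩)
    (intervalIntegrable_const)
    (Filter.Eventually.of_forall fun t _ w _ => by
      have h1 : HasDerivAt (fun w : ℂ => 2 * (Real.pi : ℂ) * (w * t)) (2 * Real.pi * t) w := by
        simpa using ((hasDerivAt_id w).mul_const (t : ℂ)).const_mul (2 * (Real.pi : ℂ))
      exact (((differentiable_trigC p _).hasDerivAt.comp w h1).mul_const (f t)))
  exact this.2.differentiableAt

lemma continuous_finT (p : Parity) (a : ℝ) {f : ℝ → ℂ} (hf : Continuous f) :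
    Continuous (finT p a f) := by
  have : finT p a f = fun x : ℝ => finTC p a f x := funext fun x => (finTC_ofReal p a f x).symm
  rw [this]
  exact (differentiable_finTC p a hf).continuous.comp Complex.continuous_ofReal

/-- The equation makes W on the whole line equal, up to a unit, to the Fourier transform of W
restricted to [-a, a]. By Plancherel the L² norm of W on the line is its norm on [-a, a], so W
vanishes outside. Being the restriction of an entire function, it vanishes identically. -/
lemma eq_zero_of_homogeneous {p : Parity} {σ a : ℝ} (hσ : σ ^ 2 = 1) (ha : 0 < a) {W : ℝ → ℂ}
    (hc : Continuous W) (h : ∀ x, W x + σ * finT p a W x = 0) : W = 0 := by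
  have hW : ∀ x, W x = -σ * finT p a W x := fun x => by linear_combination h x
  have hpar : ∀ x, W (-x) = parSign p * W x := by
    intro x
    rw [hW (-x), hW x, finT_neg]
    ring
  set S := Set.Icc (-a) a with hS
  set f : ℝ → ℂ := S.indicator W with hf
  have hf1 : Integrable f := by
    rw [hf, integrable_indicator_iff measurableSet_Icc]
    exact hc.continuousOn.integrableOn_Icc
  have hf2 : MemLp f 2 := by
    rw [hf, memLp_indicator_iff_restrict measurableSet_Icc]
    obtain ⟨M, hM⟩ := isCompact_Icc.exists_bound_of_continuousOn (s := S) hc.continuousOn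
    exact MemLp.of_bound hc.aestronglyMeasurable.restrict M
      ((ae_restrict_iff' measurableSet_Icc).2 (Filter.Eventually.of_forall hM))
  have hfp : ∀ x, f (-x) = parSign p * f x := by
    intro x
    by_cases hx : x ∈ S
    · have hx' : -x ∈ S := ⟨by linarith [hx.2], by linarith [hx.1]⟩
      rw [hf, Set.indicator_of_mem hx, Set.indicator_of_mem hx', hpar]
    · have hx' : -x ∉ S := fun h => hx ⟨by linarith [h.2], by linarith [h.1]⟩
      rw [hf, Set.indicator_of_notMem hx, Set.indicator_of_notMem hx', mul_zero]
  have hft : ∀ x, parUnit p * 𝓕 f x = finT p a W x := by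
    intro x
    rw [parUnit_mul_fourier hf1 hfp, finT, intervalIntegral.integral_of_le (by linarith),
      ← integral_Icc_eq_integral_Ioc, ← integral_indicator measurableSet_Icc]
    refine integral_congr_ae (Filter.Eventually.of_forall fun t => ?_)
    simp only [hf, Set.indicator_mul_right, ← hS]
  have hnorm : ∀ x, ‖𝓕 f x‖ = ‖W x‖ := by
    intro x
    have h1 : |σ| = 1 := by
      rw [← sq_eq_sq₀ (abs_nonneg _) zero_le_one, sq_abs, hσ, one_pow]
    rw [hW x, ← hft x, norm_mul, norm_mul, norm_parUnit, norm_neg, Complex.norm_real,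
      Real.norm_eq_abs, h1, one_mul, one_mul]
  obtain ⟨hm, he⟩ := integral_norm_sq_fourier hf1 hf2
  simp_rw [hnorm] at he
  have hWi : Integrable fun x => ‖W x‖ ^ 2 := by
    have := hm.integrable_norm_pow (by norm_num)
    simpa [hnorm] using this
  have hfs : ∀ x, ‖f x‖ ^ 2 = S.indicator (fun x => ‖W x‖ ^ 2) x := by
    intro x
    by_cases hx : x ∈ S <;> simp [hf, hx]
  simp_rw [hfs] at he
  rw [integral_indicator measurableSet_Icc, ← integral_add_compl measurableSet_Icc hWi] at he
  -- The half-line beyond `a` is enough: its interior point `a + 1` serves as accumulation point of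
  -- zeros in the identity theorem below.
  have h0 : ∫ x in Set.Ioi a, ‖W x‖ ^ 2 = 0 := by
    have hz : ∫ x in Sᶜ, ‖W x‖ ^ 2 = 0 := by linarith
    refine le_antisymm ?_ (integral_nonneg fun x => by positivity)
    rw [← hz]
    refine setIntegral_mono_set hWi.integrableOn
      (Filter.Eventually.of_forall fun x => by positivity) (LE.le.eventuallyLE ?_)
    exact fun x hx hx' => not_lt.2 hx'.2 hx
  have hz : ∀ x ∈ Set.Ioi a, W x = 0 := by
    rw [setIntegral_eq_zero_iff_of_nonneg_ae
      (Filter.Eventually.of_forall fun x => by positivity) hWi.integrableOn] at h0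
    have hae : W =ᵐ[volume.restrict (Set.Ioi a)] fun _ => 0 := by
      filter_upwards [h0] with x hx
      simpa using hx
    exact Measure.eqOn_open_of_ae_eq hae isOpen_Ioi hc.continuousOn continuousOn_const
  have hA : finTC p a W = 0 := by
    have h1 : AnalyticOnNhd ℂ (finTC p a W) Set.univ := by
      rw [Complex.analyticOnNhd_univ_iff_differentiable]
      exact differentiable_finTC p a hc
    have h2 : AnalyticOnNhd ℂ (0 : ℂ → ℂ) Set.univ := analyticOnNhd_const
    refine h1.eq_of_frequently_eq (z₀ := ((a + 1 : ℝ) : ℂ)) h2 ?_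
    have hσ0 : (σ : ℂ) ≠ 0 := by
      intro h0
      have : σ = 0 := by exact_mod_cast h0
      simp [this] at hσ
    have ht : Filter.Tendsto (fun x : ℝ => (x : ℂ)) (nhdsWithin (a + 1) {a + 1}ᶜ)
        (nhdsWithin ((a + 1 : ℝ) : ℂ) {((a + 1 : ℝ) : ℂ)}ᶜ) := by
      refine tendsto_nhdsWithin_of_tendsto_nhds_of_eventually_within _
        (Complex.continuous_ofReal.continuousAt.tendsto.mono_left nhdsWithin_le_nhds) ?_
      filter_upwards [self_mem_nhdsWithin] with x hx
      exact fun h => hx (Complex.ofReal_injective h)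
    refine ht.frequently (Filter.Eventually.frequently ?_)
    have : ∀ᶠ x in nhdsWithin (a + 1) {a + 1}ᶜ, x ∈ Set.Ioi a :=
      nhdsWithin_le_nhds (Ioi_mem_nhds (by linarith))
    filter_upwards [this] with x hx
    have := hW x
    rw [hz x hx] at this
    rw [finTC_ofReal]
    simpa [hσ0] using this.symm
  funext x
  rw [hW x, ← finTC_ofReal, hA]
  simp

/-! ### Integral operators on `C([-1, 1])` -/

/-- The interval `[-1, 1]`. -/
abbrev Seg : Type := Set.Icc (-1 : ℝ) 1

/-- The extension of a function on `[-1, 1]` to the line by its values at the end points. -/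
def ext (f : C(Seg, ℂ)) : ℝ → ℂ := Set.IccExtend (by norm_num : (-1 : ℝ) ≤ 1) f

lemma continuous_ext (f : C(Seg, ℂ)) : Continuous (ext f) := f.continuous.Icc_extend'

lemma ext_coe (f : C(Seg, ℂ)) (y : Seg) : ext f y = f y := Set.IccExtend_val _ _ y

lemma norm_ext_le (f : C(Seg, ℂ)) (x : ℝ) : ‖ext f x‖ ≤ ‖f‖ := f.norm_coe_le_norm _

lemma ext_mul (f g : C(Seg, ℂ)) (x : ℝ) : ext (f * g) x = ext f x * ext g x := rfl

/-- Integration over `[-1, 1]`. -/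
def intSeg : C(Seg, ℂ) →L[ℂ] ℂ :=
  LinearMap.mkContinuous
    { toFun := fun f => ∫ s in (-1 : ℝ)..1, ext f s
      map_add' := fun f g => by
        rw [← intervalIntegral.integral_add ((continuous_ext f).intervalIntegrable _ _)
          ((continuous_ext g).intervalIntegrable _ _)]
        rfl
      map_smul' := fun c f => by
        rw [RingHom.id_apply, smul_eq_mul, ← intervalIntegral.integral_const_mul]
        rfl } 2 (fun f => by
      have := intervalIntegral.norm_integral_le_of_norm_le_const
        (a := (-1 : ℝ)) (b := 1) (f := ext f) (C := ‖f‖) fun x _ => norm_ext_le f x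
      norm_num at this
      rw [mul_comm] at this
      exact this)

lemma intSeg_apply (f : C(Seg, ℂ)) : intSeg f = ∫ s in (-1 : ℝ)..1, ext f s := rfl

lemma norm_intSeg_le (f : C(Seg, ℂ)) : ‖intSeg f‖ ≤ 2 * ‖f‖ := by
  have := intervalIntegral.norm_integral_le_of_norm_le_const
    (a := (-1 : ℝ)) (b := 1) (f := ext f) (C := ‖f‖) fun x _ => norm_ext_le f x
  norm_num at this
  rw [mul_comm] at this
  exact this

/-- The integral operator on `C([-1, 1])` with a continuous kernel. -/
def kernOp : C(Seg × Seg, ℂ) →L[ℂ] C(Seg, ℂ) →L[ℂ] C(Seg, ℂ) :=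
  LinearMap.mkContinuous₂
    (LinearMap.mk₂ ℂ (fun κ f => (⟨fun y => intSeg (κ.curry y * f), by fun_prop⟩ : C(Seg, ℂ)))
      (fun κ κ' f => by
        ext y
        have : (κ + κ').curry y * f = κ.curry y * f + κ'.curry y * f := by
          ext s; simp [add_mul]
        exact (congrArg intSeg this).trans (map_add _ _ _))
      (fun c κ f => by
        ext y
        have : (c • κ).curry y * f = c • (κ.curry y * f) := by
          ext s; simp [mul_assoc]
        exact (congrArg intSeg this).trans (map_smul _ _ _))
      (fun κ f g => by
        ext y
        simp [mul_add])
      (fun c κ f => by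
        ext y
        have : κ.curry y * c • f = c • (κ.curry y * f) := mul_smul_comm _ _ _
        exact (congrArg intSeg this).trans (map_smul _ _ _))) 2 (fun κ f => by
      rw [ContinuousMap.norm_le _ (by positivity)]
      intro y
      refine (norm_intSeg_le _).trans ?_
      rw [mul_assoc]
      refine mul_le_mul_of_nonneg_left ((norm_mul_le _ _).trans ?_) (by norm_num)
      refine mul_le_mul_of_nonneg_right ?_ (norm_nonneg _)
      rw [ContinuousMap.norm_le _ (norm_nonneg _)]
      exact fun s => κ.norm_coe_le_norm (y, s))

lemma kernOp_apply (κ : C(Seg × Seg, ℂ)) (f : C(Seg, ℂ)) (y : Seg) :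
    kernOp κ f y = intSeg (κ.curry y * f) := rfl

/-- The function `(y, s) ↦ y s`. -/
def prodFun : C(Seg × Seg, ℂ) := ⟨fun q => ((q.1 : ℝ) : ℂ) * ((q.2 : ℝ) : ℂ), by fun_prop⟩

/-- The function `s ↦ y s`. -/
def linFun (y : ℝ) : C(Seg, ℂ) := ⟨fun s => (y : ℂ) * ((s : ℝ) : ℂ), by fun_prop⟩

/-- The kernel (ys)^n = y^n s^n separates the variables, so the operator has rank at most one. -/
lemma isCompactOperator_kernOp_pow (n : ℕ) : IsCompactOperator (kernOp (prodFun ^ n)) := by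
  let φ : C(Seg, ℂ) →L[ℂ] ℂ := intSeg ∘L (ContinuousLinearMap.mul ℂ C(Seg, ℂ) (linFun 1 ^ n))
  have h : kernOp (prodFun ^ n) = (ContinuousLinearMap.toSpanSingleton ℂ (linFun 1 ^ n)) ∘L φ := by
    ext f y
    have : (prodFun ^ n).curry y * f = ((y : ℝ) : ℂ) ^ n • (linFun 1 ^ n * f) := by
      ext s
      simp [prodFun, linFun, mul_pow, mul_assoc]
    rw [kernOp_apply, this, map_smul]
    simp [φ, linFun, mul_comm]
  rw [h]
  have hφ : IsCompactOperator φ := isCompactOperator_of_locallyCompactSpace_dom φ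
  exact hφ.clm_comp (ContinuousLinearMap.toSpanSingleton ℂ (linFun 1 ^ n))

/-- The exponential series of the kernel converges uniformly, hence the operators converge in norm,
and the partial sums have finite rank. -/
lemma isCompactOperator_kernOp_exp (c : ℂ) :
    IsCompactOperator (kernOp (NormedSpace.exp (c • prodFun))) := by
  have h := NormedSpace.exp_series_hasSum_exp' (𝕂 := ℂ) (c • prodFun)
  have h2 := (h.mapL kernOp).tendsto_sum_nat
  refine isCompactOperator_of_tendsto h2 (Filter.Eventually.of_forall fun n => ?_)
  have : ∀ k, IsCompactOperator (kernOp ((k.factorial : ℂ)⁻¹ • (c • prodFun) ^ k)) := by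
    intro k
    rw [smul_pow, map_smul, map_smul]
    exact IsCompactOperator.smul (f := (c ^ k • kernOp (prodFun ^ k) : C(Seg, ℂ) →L[ℂ] C(Seg, ℂ)))
      (IsCompactOperator.smul (isCompactOperator_kernOp_pow k) (c ^ k)) ((k.factorial : ℂ)⁻¹)
  induction n with
  | zero =>
    rw [Finset.sum_range_zero]
    exact isCompactOperator_zero
  | succ n ih =>
    rw [Finset.sum_range_succ]
    exact ih.add (this n)

/-! ### Families of waves -/

section WaveFamily

variable {X : Type*} [TopologicalSpace X] [CompactSpace X]

/-- The function `x ↦ trig (2π l m(x))`, depending on the parameter `l`. -/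
def waveFam (p : Parity) (m : C(X, ℂ)) (l : ℝ) : C(X, ℂ) :=
  match p with
  | .even => (1 / 2 : ℂ) • NormedSpace.exp (((l : ℂ) * (2 * Real.pi * Complex.I)) • m) +
      (1 / 2 : ℂ) • NormedSpace.exp ((-(l : ℂ) * (2 * Real.pi * Complex.I)) • m)
  | .odd => (-Complex.I / 2 : ℂ) • NormedSpace.exp (((l : ℂ) * (2 * Real.pi * Complex.I)) • m) +
      (Complex.I / 2 : ℂ) • NormedSpace.exp ((-(l : ℂ) * (2 * Real.pi * Complex.I)) • m)

lemma exp_apply (f : C(X, ℂ)) (x : X) : NormedSpace.exp f x = Complex.exp (f x) := by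
  have := NormedSpace.map_exp (𝔸 := C(X, ℂ)) (𝔹 := ℂ)
    (ContinuousMap.evalAlgHom ℂ ℂ x : C(X, ℂ) →ₐ[ℂ] ℂ) (continuous_eval_const x) f
  rw [Complex.exp_eq_exp_ℂ]
  exact this

lemma waveFam_apply (p : Parity) (m : C(X, ℂ)) (l : ℝ) (x : X) {y : ℝ} (hy : m x = y) :
    waveFam p m l x = wave p (l * y) := by
  have e1 : (l : ℂ) * (2 * Real.pi * Complex.I) * y =
    ((2 * Real.pi * (l * y) : ℝ) : ℂ) * Complex.I := by push_cast; ring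
  have e2 : -(l : ℂ) * (2 * Real.pi * Complex.I) * y =
    -((2 * Real.pi * (l * y) : ℝ) : ℂ) * Complex.I := by push_cast; ring
  cases p
  · simp only [waveFam, ContinuousMap.add_apply, ContinuousMap.smul_apply, exp_apply, smul_eq_mul,
      wave, trig, Complex.ofReal_cos, Complex.cos, hy, e1, e2]
    ring
  · simp only [waveFam, ContinuousMap.add_apply, ContinuousMap.smul_apply, exp_apply, smul_eq_mul,
      wave, trig, Complex.ofReal_sin, Complex.sin, hy, e1, e2]
    ring

/-- In the Banach algebra C(X) the exponential is analytic for the uniform norm, so smoothness in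
`l` holds uniformly in x and not merely pointwise. -/
lemma contDiff_waveFam (p : Parity) (m : C(X, ℂ)) {n : ℕ∞} : ContDiff ℝ n (waveFam p m) := by
  have h : ∀ c : ℂ, ContDiff ℝ n fun l : ℝ => NormedSpace.exp (((l : ℂ) * c) • m) := by
    intro c
    have h1 : ContDiff ℂ n (NormedSpace.exp : C(X, ℂ) → C(X, ℂ)) :=
      AnalyticOnNhd.contDiff fun x _ => NormedSpace.exp_analytic (𝕂 := ℂ) x
    have h2 : ContDiff ℝ n fun l : ℝ => ((l : ℂ) * c) • m :=
      (Complex.ofRealCLM.contDiff.mul contDiff_const).smul contDiff_const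
    exact (h1.restrict_scalars ℝ).comp h2
  have h' : ∀ c : ℂ, ContDiff ℝ n fun l : ℝ => NormedSpace.exp ((-(l : ℂ) * c) • m) := by
    intro c
    simpa using h (-c)
  cases p
  · exact ((h _).const_smul _).add ((h' _).const_smul _)
  · exact ((h _).const_smul _).add ((h' _).const_smul _)

end WaveFamily

/-! ### The rescaled finite transform -/

/-- The finite transform on `[-a, a]`, `a = exp u`, rescaled to `[-1, 1]`. -/
def opT (p : Parity) (u : ℝ) : C(Seg, ℂ) →L[ℂ] C(Seg, ℂ) :=
  kernOp ((Real.exp u : ℂ) • waveFam p prodFun (Real.exp (2 * u)))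

lemma isCompactOperator_opT (p : Parity) (u : ℝ) : IsCompactOperator (opT p u) := by
  have h : ∀ c d : ℂ, IsCompactOperator (d • kernOp (NormedSpace.exp (c • prodFun))) :=
    fun c d => IsCompactOperator.smul (isCompactOperator_kernOp_exp c) d
  cases p
  · simp only [opT, waveFam, map_add, map_smul, smul_add, smul_smul]
    exact (h _ _).add (h _ _)
  · simp only [opT, waveFam, map_add, map_smul, smul_add, smul_smul]
    exact (h _ _).add (h _ _)

/-- The purpose of rescaling: the space C([-1, 1]) does not move with a, only the kernel does, and
smoothness in u passes from the kernel to the inverse operator and to the solutions. -/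
lemma contDiff_opT (p : Parity) {n : ℕ∞} : ContDiff ℝ n (opT p) := by
  have h1 : ContDiff ℝ n fun u : ℝ => (Real.exp u : ℂ) :=
    Complex.ofRealCLM.contDiff.comp Real.contDiff_exp
  have h2 : ContDiff ℝ n fun u : ℝ => waveFam p prodFun (Real.exp (2 * u)) :=
    (contDiff_waveFam p prodFun).comp (by fun_prop)
  have h3 : ContDiff ℂ n (fun κ => kernOp κ) :=
    ContinuousLinearMap.contDiff (𝕜 := ℂ) (E := C(Seg × Seg, ℂ)) (F := C(Seg, ℂ) →L[ℂ] C(Seg, ℂ))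
      kernOp
  exact (h3.restrict_scalars ℝ).comp (h1.smul h2)

/-- The rescaled finite transform of a function on the line, evaluated on the line:
`e^u ∫_{-1}^1 trig (2π e^{2u} y s) f(s) ds`. -/
def scT (p : Parity) (u : ℝ) (f : ℝ → ℂ) (y : ℝ) : ℂ :=
  Real.exp u * ∫ s in (-1 : ℝ)..1, wave p (Real.exp (2 * u) * (y * s)) * f s

lemma scT_ext (p : Parity) (u : ℝ) (f : C(Seg, ℂ)) (y : ℝ) :
    scT p u (ext f) y = Real.exp u * intSeg (waveFam p (linFun y) (Real.exp (2 * u)) * f) := by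
  rw [scT, intSeg_apply]
  congr 1
  refine intervalIntegral.integral_congr fun s hs => ?_
  rw [Set.uIcc_of_le (by norm_num)] at hs
  simp only [ext_mul]
  congr 1
  rw [ext, Set.IccExtend_of_mem _ _ hs,
    waveFam_apply (y := y * s) p (linFun y) _ ⟨s, hs⟩ (by simp [linFun])]

lemma opT_apply (p : Parity) (u : ℝ) (f : C(Seg, ℂ)) (y : Seg) :
    opT p u f y = scT p u (ext f) y := by
  rw [scT_ext, opT, kernOp_apply, ← smul_eq_mul (Real.exp u : ℂ), ← map_smul]
  congr 1
  ext s
  simp only [ContinuousMap.mul_apply, ContinuousMap.smul_apply, ContinuousMap.curry_apply,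
    smul_eq_mul]
  rw [waveFam_apply (y := y * s) p _ _ (y, s) (by simp [prodFun]),
    waveFam_apply (y := y * s) p _ _ s (by simp [linFun]), mul_assoc]

lemma scT_congr {p : Parity} {u : ℝ} {f g : ℝ → ℂ} (h : ∀ s ∈ Set.Icc (-1 : ℝ) 1, f s = g s)
    (y : ℝ) : scT p u f y = scT p u g y := by
  rw [scT, scT]
  congr 1
  refine intervalIntegral.integral_congr fun s hs => ?_
  rw [Set.uIcc_of_le (by norm_num)] at hs
  simp only [h s hs]

lemma scT_eq_finT (p : Parity) (u : ℝ) (f : ℝ → ℂ) (y : ℝ) :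
    scT p u f y =
      finT p (Real.exp u) (fun t => f (Real.exp (-u) * t)) (Real.exp u * y) := by
  rw [scT, finT]
  have h : Real.exp (-u) * Real.exp u = 1 := by rw [← Real.exp_add]; simp
  have h' : ∀ s : ℝ, s = Real.exp (-u) * (Real.exp u * s) := fun s => by
    rw [← mul_assoc, h, one_mul]
  have := intervalIntegral.smul_integral_comp_mul_left (a := -1) (b := 1) (c := (Real.exp u))
    (f := fun t => wave p (Real.exp u * y * t) * f (Real.exp (-u) * t))
  rw [mul_neg, mul_one] at this
  rw [← this, Complex.real_smul]
  congr 1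
  refine intervalIntegral.integral_congr fun s _ => ?_
  simp only [← h' s]
  congr 2
  rw [two_mul, Real.exp_add]
  ring

lemma continuous_scT (p : Parity) (u : ℝ) {f : ℝ → ℂ} (hf : Continuous f) :
    Continuous (scT p u f) := by
  have : scT p u f = fun y => finT p (Real.exp u) (fun t => f (Real.exp (-u) * t))
    (Real.exp u * y) := funext fun y => scT_eq_finT p u f y
  rw [this]
  exact (continuous_finT p _ (by fun_prop)).comp (by fun_prop)

lemma eq_zero_of_scT {p : Parity} {σ : ℝ} (hσ : σ ^ 2 = 1) (u : ℝ) {W : ℝ → ℂ}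
    (hc : Continuous W) (h : ∀ y, W y + σ * scT p u W y = 0) : W = 0 := by
  have h1 : (fun t => W (Real.exp (-u) * t)) = 0 := by
    refine eq_zero_of_homogeneous (p := p) hσ (Real.exp_pos u) (by fun_prop) fun x => ?_
    have := h (Real.exp (-u) * x)
    rw [scT_eq_finT, ← mul_assoc, ← Real.exp_add] at this
    simpa using this
  funext y
  have := congrFun h1 (Real.exp u * y)
  simpa [← mul_assoc, ← Real.exp_add] using this

/-- Fredholm alternative for a compact operator. An eigenfunction for the eigenvalue -1 lives only
on [-1, 1], but the other side of the eigenvalue equation extends it to a continuous W on the line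
which still solves the homogeneous equation, so uniqueness on the line applies. -/
lemma isUnit_one_add_opT {p : Parity} {σ : ℝ} (hσ : σ ^ 2 = 1) (u : ℝ) :
    IsUnit (1 + (σ : ℂ) • opT p u) := by
  have hσ' : (σ : ℂ) ≠ 0 := by
    intro h0
    have : σ = 0 := by exact_mod_cast h0
    simp [this] at hσ
  have hc : IsCompactOperator ((σ : ℂ) • opT p u) :=
    IsCompactOperator.smul (isCompactOperator_opT p u) (σ : ℂ)
  rcases hc.hasEigenvalue_or_mem_resolventSet (μ := (-1 : ℂ)) (by norm_num) with h | h
  · exfalso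
    obtain ⟨f, hf⟩ := h.exists_hasEigenvector
    have hf1 : (σ : ℂ) • opT p u f = (-1 : ℂ) • f := hf.apply_eq_smul
    let W : ℝ → ℂ := fun y => -(σ : ℂ) * scT p u (ext f) y
    have hfW : ∀ y : Seg, f y = W y := by
      intro y
      have := congrArg (fun g : C(Seg, ℂ) => g y) hf1
      simp only [ContinuousMap.smul_apply, opT_apply, smul_eq_mul] at this
      simp only [W]
      linear_combination this
    have hW0 : W = 0 := by
      refine eq_zero_of_scT (p := p) hσ u
        (continuous_const.mul (continuous_scT p u (continuous_ext f))) fun y => ?_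
      rw [scT_congr (g := ext f)]
      · simp only [W]
        ring
      · intro s hs
        rw [← hfW ⟨s, hs⟩, ← ext_coe]
    refine hf.2 (ContinuousMap.ext fun y => ?_)
    rw [hfW, hW0]
    rfl
  · rw [spectrum.mem_resolventSet_iff] at h
    have h2 := h.neg
    rw [add_comm]
    simpa [Algebra.algebraMap_eq_smul_one] using h2

/-- The solution of `f + σ T f = b` in `C([-1, 1])`. -/
def solveSeg (p : Parity) (σ u : ℝ) (b : C(Seg, ℂ)) : C(Seg, ℂ) :=
  Ring.inverse (1 + (σ : ℂ) • opT p u) b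

lemma solveSeg_spec {p : Parity} {σ : ℝ} (hσ : σ ^ 2 = 1) (u : ℝ) (b : C(Seg, ℂ)) :
    solveSeg p σ u b + (σ : ℂ) • opT p u (solveSeg p σ u b) = b := by
  have h := Ring.mul_inverse_cancel _ (isUnit_one_add_opT (p := p) hσ u)
  exact congrArg (fun A : C(Seg, ℂ) →L[ℂ] C(Seg, ℂ) => A b) h

lemma contDiff_inverse_opT {p : Parity} {σ : ℝ} (hσ : σ ^ 2 = 1) {n : ℕ∞} :
    ContDiff ℝ n fun u => Ring.inverse (1 + (σ : ℂ) • opT p u) := by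
  rw [contDiff_iff_contDiffAt]
  intro u
  obtain ⟨U, hU⟩ := isUnit_one_add_opT (p := p) hσ u
  have h1 : ContDiffAt ℝ n (Ring.inverse : (C(Seg, ℂ) →L[ℂ] C(Seg, ℂ)) → _)
      (1 + (σ : ℂ) • opT p u) := by
    rw [← hU]
    exact (contDiffAt_ringInverse (R := C(Seg, ℂ) →L[ℂ] C(Seg, ℂ)) ℂ U).restrict_scalars ℝ
  have h2 : ContDiff ℝ n fun u => 1 + (σ : ℂ) • opT p u :=
    contDiff_const.add ((contDiff_opT p).const_smul _)
  exact h1.comp u h2.contDiffAt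

/-- Solutions of the inhomogeneous equation on `[-a, a]`, as functions on the line. -/
lemma exists_solution (p : Parity) {σ a : ℝ} (hσ : σ ^ 2 = 1) (ha : 0 < a) {b : ℝ → ℂ}
    (hb : Continuous b) : ∃ g : ℝ → ℂ, Continuous g ∧ ∀ x, g x + σ * finT p a g x = b x := by
  obtain ⟨u, rfl⟩ : ∃ u, a = Real.exp u := ⟨Real.log a, (Real.exp_log ha).symm⟩
  let bs : C(Seg, ℂ) := ⟨fun y => b (Real.exp u * y), by fun_prop⟩
  set f := solveSeg p σ u bs with hf
  let W : ℝ → ℂ := fun y => b (Real.exp u * y) - σ * scT p u (ext f) y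
  have hW : Continuous W := by
    have := continuous_scT p u (continuous_ext f)
    fun_prop
  have hfW : ∀ s ∈ Set.Icc (-1 : ℝ) 1, W s = ext f s := by
    intro s hs
    have := congrArg (fun g : C(Seg, ℂ) => g ⟨s, hs⟩) (solveSeg_spec (p := p) hσ u bs)
    simp only [ContinuousMap.add_apply, ContinuousMap.smul_apply, opT_apply, smul_eq_mul] at this
    have h2 := ext_coe f ⟨s, hs⟩
    simp only at h2
    rw [h2]
    simp only [W]
    simp only [bs, ContinuousMap.coe_mk, ← hf] at this
    linear_combination -this
  refine ⟨fun t => W (Real.exp (-u) * t), by fun_prop, fun x => ?_⟩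
  have h1 := scT_eq_finT p u W (Real.exp (-u) * x)
  rw [← mul_assoc, ← Real.exp_add] at h1
  simp only [add_neg_cancel, Real.exp_zero, one_mul] at h1
  rw [← h1, scT_congr hfW]
  simp only [W]
  rw [← mul_assoc, ← Real.exp_add]
  simp

/-! ### Linearity and derivatives of the rescaled transform -/

lemma intervalIntegrable_wave_mul (p : Parity) (c a b : ℝ) {f : ℝ → ℂ} (hf : Continuous f) :
    IntervalIntegrable (fun s => wave p (c * s) * f s) volume a b :=
  Continuous.intervalIntegrable (by fun_prop) _ _

lemma scT_add (p : Parity) (u : ℝ) {f g : ℝ → ℂ} (hf : Continuous f) (hg : Continuous g) (y : ℝ) :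
    scT p u (fun s => f s + g s) y = scT p u f y + scT p u g y := by
  simp only [scT, mul_add, ← mul_assoc]
  rw [intervalIntegral.integral_add (intervalIntegrable_wave_mul p _ _ _ hf)
    (intervalIntegrable_wave_mul p _ _ _ hg), mul_add]

lemma scT_const_mul (p : Parity) (u : ℝ) (c : ℂ) (f : ℝ → ℂ) (y : ℝ) :
    scT p u (fun s => c * f s) y = c * scT p u f y := by
  have h : ∀ s, wave p (Real.exp (2 * u) * (y * s)) * (c * f s) =
    c * (wave p (Real.exp (2 * u) * (y * s)) * f s) := fun s => by ring
  simp only [scT, h, intervalIntegral.integral_const_mul]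
  ring

lemma scT_neg (p : Parity) (u : ℝ) (f : ℝ → ℂ) (y : ℝ) :
    scT p u f (-y) = parSign p * scT p u f y := by
  simp only [scT, neg_mul, mul_neg, wave_neg, mul_assoc]
  rw [intervalIntegral.integral_const_mul]
  ring

lemma star_scT (p : Parity) (u : ℝ) (f : ℝ → ℂ) (y : ℝ) :
    star (scT p u f y) = scT p u (fun s => star (f s)) y := by
  simp only [scT, star_mul']
  congr 1
  · exact Complex.conj_ofReal _
  · rw [intervalIntegral.integral_of_le (by norm_num), intervalIntegral.integral_of_le (by norm_num)]
    have := integral_conj (μ := volume.restrict (Set.Ioc (-1 : ℝ) 1))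
      (f := fun s => wave p (Real.exp (2 * u) * (y * s)) * f s)
    refine this.symm.trans (integral_congr_ae (Filter.Eventually.of_forall fun s => ?_))
    simp only [map_mul]
    congr 1
    exact star_wave p _

/-- The derivative of `scT p u f`. -/
def scTD (p : Parity) (u : ℝ) (f : ℝ → ℂ) (y : ℝ) : ℂ :=
  Real.exp u * ∫ s in (-1 : ℝ)..1,
    waveD p (Real.exp (2 * u) * (y * s)) * (Real.exp (2 * u) * s : ℝ) * f s

lemma scTD_congr {p : Parity} {u : ℝ} {f g : ℝ → ℂ} (h : ∀ s ∈ Set.Icc (-1 : ℝ) 1, f s = g s)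
    (y : ℝ) : scTD p u f y = scTD p u g y := by
  rw [scTD, scTD]
  congr 1
  refine intervalIntegral.integral_congr fun s hs => ?_
  rw [Set.uIcc_of_le (by norm_num)] at hs
  simp only [h s hs]

lemma hasDerivAt_wave_mul (p : Parity) (c s y : ℝ) :
    HasDerivAt (fun y => wave p (c * (y * s))) (waveD p (c * (y * s)) * (c * s : ℝ)) y := by
  have h1 : HasDerivAt (fun y : ℝ => c * (y * s)) (c * s) y := by
    simpa using ((hasDerivAt_id y).mul_const s).const_mul c
  have := (hasDerivAt_wave p (c * (y * s))).scomp y h1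
  refine this.congr_deriv ?_
  rw [Complex.real_smul, mul_comm]

lemma norm_waveD_mul_le (p : Parity) {c s M : ℝ} (x : ℝ) {f : ℝ → ℂ} (hf : ‖f s‖ ≤ M)
    (hs : s ∈ Set.uIoc (-1 : ℝ) 1) (hc : 0 ≤ c) :
    ‖waveD p x * (c * s : ℝ) * f s‖ ≤ 2 * Real.pi * c * M := by
  have hs1 : |s| ≤ 1 := by
    rw [Set.uIoc_of_le (by norm_num)] at hs
    exact abs_le.2 ⟨hs.1.le, hs.2⟩
  rw [norm_mul, norm_mul, Complex.norm_real, norm_mul, Real.norm_of_nonneg hc, Real.norm_eq_abs,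
    ← mul_assoc]
  have h1 : ‖waveD p x‖ * c ≤ 2 * Real.pi * c := mul_le_mul_of_nonneg_right (norm_waveD_le p x) hc
  have h2 : ‖waveD p x‖ * c * |s| ≤ 2 * Real.pi * c :=
    (mul_le_of_le_one_right (by positivity) hs1).trans h1
  exact mul_le_mul h2 hf (norm_nonneg _) (by positivity)

lemma hasDerivAt_scT (p : Parity) (u : ℝ) {f : ℝ → ℂ} (hf : Continuous f) (y : ℝ) :
    HasDerivAt (scT p u f) (scTD p u f y) y := by
  obtain ⟨M, hM⟩ := (isCompact_uIcc (a := (-1 : ℝ)) (b := 1)).exists_bound_of_continuousOn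
    hf.continuousOn
  have := intervalIntegral.hasDerivAt_integral_of_dominated_loc_of_deriv_le
    (μ := volume) (a := (-1 : ℝ)) (b := 1)
    (F := fun y s => wave p (Real.exp (2 * u) * (y * s)) * f s)
    (F' := fun y s => waveD p (Real.exp (2 * u) * (y * s)) * (Real.exp (2 * u) * s : ℝ) * f s)
    (x₀ := y) (s := Set.univ) (bound := fun _ => 2 * Real.pi * Real.exp (2 * u) * M)
    Filter.univ_mem
    (Filter.Eventually.of_forall fun w => (Continuous.aestronglyMeasurable (by fun_prop)).restrict)
    (Continuous.intervalIntegrable (by fun_prop) _ _)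
    (Continuous.aestronglyMeasurable (by fun_prop)).restrict
    (Filter.Eventually.of_forall fun s hs w _ =>
      norm_waveD_mul_le p _ (hM s (Set.uIoc_subset_uIcc hs)) hs (Real.exp_pos _).le)
    intervalIntegrable_const
    (Filter.Eventually.of_forall fun s _ w _ =>
      (hasDerivAt_wave_mul p (Real.exp (2 * u)) s w).mul_const (f s))
  exact this.2.const_mul _

lemma continuous_scTD (p : Parity) (u : ℝ) {f : ℝ → ℂ} (hf : Continuous f) :
    Continuous (scTD p u f) := by
  refine continuous_const.mul ?_
  refine intervalIntegral.continuous_parametric_intervalIntegral_of_continuous' ?_ _ _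
  simp only [Function.uncurry_def]
  fun_prop

lemma norm_scT_le (p : Parity) (u : ℝ) {f : ℝ → ℂ} {M : ℝ}
    (hM : ∀ s ∈ Set.Icc (-1 : ℝ) 1, ‖f s‖ ≤ M) (y : ℝ) :
    ‖scT p u f y‖ ≤ 2 * Real.exp u * M := by
  rw [scT, norm_mul, Complex.norm_real, Real.norm_of_nonneg (Real.exp_pos u).le]
  have := intervalIntegral.norm_integral_le_of_norm_le_const (a := (-1 : ℝ)) (b := 1) (C := M)
    (f := fun s => wave p (Real.exp (2 * u) * (y * s)) * f s) fun s hs => by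
      rw [Set.uIoc_of_le (by norm_num)] at hs
      rw [norm_mul]
      exact (mul_le_of_le_one_left (norm_nonneg _) (norm_wave_le p _)).trans
        (hM s ⟨hs.1.le, hs.2⟩)
  norm_num at this
  nlinarith [Real.exp_pos u]

lemma norm_scTD_le (p : Parity) (u : ℝ) {f : ℝ → ℂ} {M : ℝ}
    (hM : ∀ s ∈ Set.Icc (-1 : ℝ) 1, ‖f s‖ ≤ M) (y : ℝ) :
    ‖scTD p u f y‖ ≤ 2 * Real.exp u * (2 * Real.pi * Real.exp (2 * u) * M) := by
  rw [scTD, norm_mul, Complex.norm_real, Real.norm_of_nonneg (Real.exp_pos u).le]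
  have := intervalIntegral.norm_integral_le_of_norm_le_const (a := (-1 : ℝ)) (b := 1)
    (C := 2 * Real.pi * Real.exp (2 * u) * M)
    (f := fun s => waveD p (Real.exp (2 * u) * (y * s)) * (Real.exp (2 * u) * s : ℝ) * f s)
    fun s hs => norm_waveD_mul_le p _ (hM s (by
      rw [Set.uIoc_of_le (by norm_num)] at hs; exact ⟨hs.1.le, hs.2⟩)) hs (Real.exp_pos _).le
  rw [show |(1 : ℝ) - -1| = 2 by norm_num] at this
  refine (mul_le_mul_of_nonneg_left this (Real.exp_pos u).le).trans (le_of_eq ?_)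
  ring

/-- The Euler operator `y d/dy` applied to the rescaled transform. -/
lemma mul_scTD (p : Parity) (u : ℝ) {f f' : ℝ → ℂ} (hf : ∀ x, HasDerivAt f (f' x) x)
    (hf' : Continuous f') (hp : f (-1) = parSign p * f 1) (y : ℝ) :
    y * scTD p u f y = 2 * Real.exp u * f 1 * wave p (Real.exp (2 * u) * y) -
      scT p u f y - scT p u (fun s => s * f' s) y := by
  have hfc : Continuous f := continuous_iff_continuousAt.2 fun x => (hf x).continuousAt
  have hd : ∀ s, HasDerivAt (fun s : ℝ => (s : ℂ) * f s) (f s + s * f' s) s := by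
    intro s
    exact ((Complex.ofRealCLM.hasDerivAt (x := s)).mul (hf s)).congr_deriv (by simp)
  have hw : ∀ s : ℝ, HasDerivAt (fun s => wave p (Real.exp (2 * u) * (y * s)))
      (waveD p (Real.exp (2 * u) * (y * s)) * (Real.exp (2 * u) * y : ℝ)) s := by
    intro s
    have := hasDerivAt_wave_mul p (Real.exp (2 * u)) y s
    simpa only [mul_comm y] using this
  -- The wave depends on y and s through the product ys, so y d/dy acts as s d/ds and can be
  -- integrated by parts. The boundary terms at s = 1 and s = -1 are equal by parity, whence the
  -- factor 2.
  have key := intervalIntegral.integral_mul_deriv_eq_deriv_mul (a := (-1 : ℝ)) (b := 1)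
    (fun s _ => hw s) (fun s _ => hd s) (Continuous.intervalIntegrable (by fun_prop) _ _)
    (Continuous.intervalIntegrable (by fun_prop) _ _)
  have e1 : scT p u f y + scT p u (fun s => s * f' s) y = Real.exp u *
      ∫ s in (-1 : ℝ)..1, wave p (Real.exp (2 * u) * (y * s)) * (f s + s * f' s) := by
    rw [← scT_add p u hfc (by fun_prop)]
    rfl
  have e2 : y * scTD p u f y = Real.exp u * ∫ s in (-1 : ℝ)..1,
      waveD p (Real.exp (2 * u) * (y * s)) * (Real.exp (2 * u) * y : ℝ) * (s * f s) := by
    rw [scTD, mul_left_comm, ← intervalIntegral.integral_const_mul]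
    congr 1
    refine intervalIntegral.integral_congr fun s _ => ?_
    push_cast
    ring
  have hw1 : wave p (Real.exp (2 * u) * (y * -1)) = parSign p * wave p (Real.exp (2 * u) * y) := by
    rw [← wave_neg]
    congr 1
    ring
  rw [hw1, hp] at key
  rw [mul_one] at key
  push_cast at key e1 e2 ⊢
  linear_combination e2 + e1 + (Complex.exp u) * key +
    Complex.exp u * wave p (Real.exp (2 * u) * y) * f 1 * parSign_mul_self p

/-! ### The rescaled solutions -/

/-- The solution `φ_a(a y)`, `a = exp u`, on `[-1, 1]`. -/
def sol (p : Parity) (σ u : ℝ) : C(Seg, ℂ) :=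
  solveSeg p σ u ((2 : ℂ) • waveFam p (linFun 1) (Real.exp (2 * u)))

/-- The solution `φ_a(a y)`, `a = exp u`, on the line. -/
def Psi (p : Parity) (σ u y : ℝ) : ℂ :=
  2 * wave p (Real.exp (2 * u) * y) - σ * scT p u (ext (sol p σ u)) y

/-- The derivative of `Psi` in `y`. -/
def PsiY (p : Parity) (σ u y : ℝ) : ℂ :=
  2 * (waveD p (Real.exp (2 * u) * y) * Real.exp (2 * u)) - σ * scTD p u (ext (sol p σ u)) y

section

variable {p : Parity} {σ : ℝ}

lemma continuous_Psi (u : ℝ) : Continuous (Psi p σ u) := by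
  have := continuous_scT p u (continuous_ext (sol p σ u))
  unfold Psi
  fun_prop

lemma continuous_PsiY (u : ℝ) : Continuous (PsiY p σ u) := by
  have := continuous_scTD p u (continuous_ext (sol p σ u))
  unfold PsiY
  fun_prop

lemma hasDerivAt_Psi (u y : ℝ) : HasDerivAt (Psi p σ u) (PsiY p σ u y) y := by
  have h1 := hasDerivAt_wave_mul p (Real.exp (2 * u)) 1 y
  simp only [mul_one] at h1
  exact (h1.const_mul 2).sub ((hasDerivAt_scT p u (continuous_ext _) y).const_mul _)

lemma Psi_neg (u y : ℝ) : Psi p σ u (-y) = parSign p * Psi p σ u y := by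
  simp only [Psi, mul_neg, wave_neg, scT_neg]
  ring

lemma Psi_of_mem (hσ : σ ^ 2 = 1) (u : ℝ) {y : ℝ} (hy : y ∈ Set.Icc (-1 : ℝ) 1) :
    Psi p σ u y = ext (sol p σ u) y := by
  have := congrArg (fun g : C(Seg, ℂ) => g ⟨y, hy⟩) (solveSeg_spec (p := p) hσ u
    ((2 : ℂ) • waveFam p (linFun 1) (Real.exp (2 * u))))
  simp only [ContinuousMap.add_apply, ContinuousMap.smul_apply, opT_apply, smul_eq_mul] at this
  rw [waveFam_apply (y := y) p _ _ _ (by simp [linFun])] at this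
  have h2 := ext_coe (sol p σ u) ⟨y, hy⟩
  simp only at h2
  rw [h2, Psi, ← this]
  simp only [sol]
  ring

lemma Psi_eq (hσ : σ ^ 2 = 1) (u y : ℝ) :
    Psi p σ u y + σ * scT p u (Psi p σ u) y = 2 * wave p (Real.exp (2 * u) * y) := by
  rw [scT_congr (fun s hs => Psi_of_mem hσ u hs), Psi]
  ring

/-- The kernel and the right-hand side are real, so the conjugate solves the same equation. -/
lemma Psi_star (hσ : σ ^ 2 = 1) (u y : ℝ) : star (Psi p σ u y) = Psi p σ u y := by
  have h : (fun y => star (Psi p σ u y) - Psi p σ u y) = 0 := by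
    have hc := continuous_Psi (p := p) (σ := σ) u
    have hcs : Continuous fun y => star (Psi p σ u y) := hc.star
    refine eq_zero_of_scT (p := p) hσ u (hcs.sub hc) fun y => ?_
    have h1 := Psi_eq (p := p) hσ u y
    have h2 := congrArg star h1
    simp only [star_add, star_mul', star_scT, star_wave] at h2
    have h3 : scT p u (fun y => star (Psi p σ u y) - Psi p σ u y) y =
        scT p u (fun y => star (Psi p σ u y)) y - scT p u (Psi p σ u) y := by
      have := scT_add p u hcs (g := fun y => (-1) * Psi p σ u y) (by fun_prop) y
      rw [scT_const_mul] at this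
      simpa [sub_eq_add_neg] using this
    rw [h3]
    simp only [Complex.star_def, Complex.conj_ofReal, map_ofNat] at h2 ⊢
    linear_combination h2 - h1
  exact sub_eq_zero.1 (congrFun h y)

lemma contDiff_sol (hσ : σ ^ 2 = 1) {n : ℕ∞} : ContDiff ℝ n (sol p σ) := by
  have h1 := contDiff_inverse_opT (p := p) hσ (n := n)
  have h2 : ContDiff ℝ n fun u : ℝ => (2 : ℂ) • waveFam p (linFun 1) (Real.exp (2 * u)) :=
    ((contDiff_waveFam p _).comp (by fun_prop)).const_smul _
  have h3 : ContDiff ℂ n fun q : (C(Seg, ℂ) →L[ℂ] C(Seg, ℂ)) × C(Seg, ℂ) => q.1 q.2 :=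
    isBoundedBilinearMap_apply.contDiff
  exact (h3.restrict_scalars ℝ).comp (h1.prodMk h2)

lemma Psi_eq_intSeg (u y : ℝ) : Psi p σ u y = 2 * wave p (Real.exp (2 * u) * y) -
    σ * (Real.exp u * intSeg (waveFam p (linFun y) (Real.exp (2 * u)) * sol p σ u)) := by
  rw [Psi, scT_ext]

lemma contDiff_wave (p : Parity) {n : ℕ∞} : ContDiff ℝ n (wave p) := by
  cases p
  · exact Complex.ofRealCLM.contDiff.comp (Real.contDiff_cos.comp (by fun_prop))
  · exact Complex.ofRealCLM.contDiff.comp (Real.contDiff_sin.comp (by fun_prop))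

lemma contDiff_Psi (hσ : σ ^ 2 = 1) (y : ℝ) {n : ℕ∞} : ContDiff ℝ n fun u => Psi p σ u y := by
  simp only [Psi_eq_intSeg]
  have h0 : ContDiff ℝ n fun u : ℝ => wave p (Real.exp (2 * u) * y) :=
    (contDiff_wave p).comp (by fun_prop)
  have h1 : ContDiff ℝ n fun u : ℝ => (Real.exp u : ℂ) :=
    Complex.ofRealCLM.contDiff.comp Real.contDiff_exp
  have h2 : ContDiff ℝ n fun u : ℝ => waveFam p (linFun y) (Real.exp (2 * u)) :=
    (contDiff_waveFam p _).comp (by fun_prop)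
  have h3 : ContDiff ℝ n fun u => intSeg (waveFam p (linFun y) (Real.exp (2 * u)) * sol p σ u) :=
    (intSeg.contDiff.restrict_scalars ℝ).comp (h2.mul (contDiff_sol hσ))
  exact (contDiff_const.mul h0).sub (contDiff_const.mul (h1.mul h3))

/-- The derivative of `Psi` in `u`. -/
def PsiU (p : Parity) (σ u y : ℝ) : ℂ :=
  4 * (Real.exp (2 * u) * y * waveD p (Real.exp (2 * u) * y)) -
    σ * (scT p u (ext (sol p σ u)) y + 2 * (y * scTD p u (ext (sol p σ u)) y) +
      scT p u (ext (deriv (sol p σ) u)) y)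

lemma continuous_PsiU (u : ℝ) : Continuous (PsiU p σ u) := by
  have h1 := continuous_scT p u (continuous_ext (sol p σ u))
  have h2 := continuous_scTD p u (continuous_ext (sol p σ u))
  have h3 := continuous_scT p u (continuous_ext (deriv (sol p σ) u))
  unfold PsiU
  fun_prop

lemma hasDerivAt_coe_apply {X : Type*} [TopologicalSpace X] [CompactSpace X] {F : ℝ → C(X, ℂ)}
    {F' : C(X, ℂ)} {u : ℝ} (h : HasDerivAt F F' u) (x : X) :
    HasDerivAt (fun v => F v x) (F' x) u := by
  have := ((ContinuousMap.evalCLM ℂ x : C(X, ℂ) →L[ℂ] ℂ).restrictScalars ℝ).hasFDerivAt.comp_hasDerivAt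
    u h
  exact this

/-- The variable u enters through the prefactor e^u, through the argument e^{2u} y s of the wave and
through the solution itself. Differentiating the argument in u amounts to 2 y d/dy, which explains
the term with `scTD`. -/
lemma hasDerivAt_Psi_u (hσ : σ ^ 2 = 1) (u y : ℝ) :
    HasDerivAt (fun u => Psi p σ u y) (PsiU p σ u y) u := by
  have hexp : HasDerivAt (fun u : ℝ => Real.exp (2 * u)) (2 * Real.exp (2 * u)) u := by
    have := ((hasDerivAt_id u).const_mul (2 : ℝ)).exp
    refine this.congr_deriv ?_
    simp [mul_comm]
  have hw : ∀ s : ℝ, HasDerivAt (fun u : ℝ => wave p (Real.exp (2 * u) * s))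
      (2 * (Real.exp (2 * u) * s * waveD p (Real.exp (2 * u) * s))) u := by
    intro s
    have := (hasDerivAt_wave p (Real.exp (2 * u) * s)).scomp u (hexp.mul_const s)
    refine this.congr_deriv ?_
    rw [Complex.real_smul]
    push_cast
    ring
  have hS : HasDerivAt (sol p σ) (deriv (sol p σ) u) u :=
    (((contDiff_sol (p := p) hσ (n := 1)).differentiable (by norm_num)) u).hasDerivAt
  set W := fun u : ℝ => waveFam p (linFun y) (Real.exp (2 * u)) with hWdef
  have hWc : ContDiff ℝ (1 : ℕ∞) W := (contDiff_waveFam p _).comp (by fun_prop)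
  have hW : HasDerivAt W (deriv W u) u := (hWc.differentiable (by norm_num) u).hasDerivAt
  have hWv : ∀ s : Seg, deriv W u s =
      2 * (Real.exp (2 * u) * (y * s) * waveD p (Real.exp (2 * u) * (y * s))) := by
    intro s
    have h1 := hasDerivAt_coe_apply hW s
    have h2 : (fun v => W v s) = fun v => wave p (Real.exp (2 * v) * (y * s)) := by
      funext v
      exact waveFam_apply p _ _ _ (by simp [linFun])
    rw [h2] at h1
    have := h1.unique (hw (y * s))
    rw [this]
    push_cast
    ring
  have hI : HasDerivAt (fun u => intSeg (W u * sol p σ u))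
      (intSeg (deriv W u * sol p σ u + W u * deriv (sol p σ) u)) u :=
    (intSeg.restrictScalars ℝ).hasFDerivAt.comp_hasDerivAt u (hW.mul hS)
  have he : HasDerivAt (fun u : ℝ => (Real.exp u : ℂ)) (Real.exp u : ℂ) u :=
    (Real.hasDerivAt_exp u).ofReal_comp
  have := ((hw y).const_mul (2 : ℂ)).sub ((he.mul hI).const_mul (σ : ℂ))
  have hfun : (fun u => Psi p σ u y) = fun u => 2 * wave p (Real.exp (2 * u) * y) -
      σ * (Real.exp u * intSeg (W u * sol p σ u)) := funext fun v => Psi_eq_intSeg v y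
  rw [hfun]
  refine this.congr_deriv ?_
  have e1 : Real.exp u * intSeg (deriv W u * sol p σ u) =
      2 * (y * scTD p u (ext (sol p σ u)) y) := by
    have : intSeg (deriv W u * sol p σ u) = 2 * (y * ∫ s in (-1 : ℝ)..1,
        waveD p (Real.exp (2 * u) * (y * s)) * (Real.exp (2 * u) * s : ℝ) *
          ext (sol p σ u) s) := by
      rw [intSeg_apply, ← intervalIntegral.integral_const_mul, ← intervalIntegral.integral_const_mul]
      refine intervalIntegral.integral_congr fun s hs => ?_
      rw [Set.uIcc_of_le (by norm_num)] at hs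
      have h2 := ext_coe (deriv W u) ⟨s, hs⟩
      simp only at h2
      simp only [ext_mul, h2, hWv]
      push_cast
      ring
    rw [this, scTD]
    ring
  rw [map_add, PsiU, scT_ext, scT_ext]
  linear_combination (-σ : ℂ) * e1

/-- The rescaled version of `μ`. -/
def muPsi (p : Parity) (u : ℝ) : ℂ := Real.exp u * (Psi p 1 u 1 + Psi p (-1) u 1)

/-- The differential equation linking the `u` and `y` derivatives of the solutions. -/
lemma PsiU_eq (hσ : σ ^ 2 = 1) (u y : ℝ) :
    PsiU p σ u y = y * (PsiY p σ u y + PsiY p (-σ) u y) +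
      (1 / 2) * (Psi p (-σ) u y - Psi p σ u y) -
        σ * (Real.exp u * (Psi p σ u 1 + Psi p (-σ) u 1)) * Psi p σ u y := by
  have hσ' : (-σ) ^ 2 = 1 := by rw [neg_sq, hσ]
  set μ : ℂ := Real.exp u * (Psi p σ u 1 + Psi p (-σ) u 1) with hμ
  -- `R` is the claimed right-hand side. `PsiU - R` will be seen to solve the homogeneous equation.
  let R : ℝ → ℂ := fun y => (y * PsiY p σ u y + y * PsiY p (-σ) u y) +
      ((1 / 2) * Psi p (-σ) u y + (-(1 / 2) - σ * μ) * Psi p σ u y)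
  have c1 := continuous_Psi (p := p) (σ := σ) u
  have c2 := continuous_Psi (p := p) (σ := -σ) u
  have c3 := continuous_PsiY (p := p) (σ := σ) u
  have c4 := continuous_PsiY (p := p) (σ := -σ) u
  have c5 := continuous_PsiU (p := p) (σ := σ) u
  have hR : Continuous R := by fun_prop
  -- On [-1, 1] the derivative of `sol` in C([-1, 1]) is the pointwise derivative, so the formula
  -- for `PsiU` becomes an integral equation for `PsiU` itself.
  have hN : ∀ s ∈ Set.Icc (-1 : ℝ) 1, ext (deriv (sol p σ) u) s = PsiU p σ u s := by
    intro s hs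
    have hS : HasDerivAt (sol p σ) (deriv (sol p σ) u) u :=
      (((contDiff_sol (p := p) hσ (n := 1)).differentiable (by norm_num)) u).hasDerivAt
    have h1 := hasDerivAt_coe_apply hS ⟨s, hs⟩
    have h2 : (fun v => sol p σ v ⟨s, hs⟩) = fun v => Psi p σ v s := by
      funext v
      rw [Psi_of_mem hσ v hs, ← ext_coe]
    rw [h2] at h1
    rw [(hasDerivAt_Psi_u hσ u s).unique h1, ← ext_coe]
  have h : (fun y => PsiU p σ u y + (-1) * R y) = 0 := by
    refine eq_zero_of_scT (p := p) hσ u (by fun_prop) fun y => ?_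
    have t1 : scT p u (fun y => PsiU p σ u y + (-1) * R y) y =
        scT p u (PsiU p σ u) y - (scT p u (fun s => s * PsiY p σ u s) y +
          scT p u (fun s => s * PsiY p (-σ) u s) y + ((1 / 2) * scT p u (Psi p (-σ) u) y +
            (-(1 / 2) - σ * μ) * scT p u (Psi p σ u) y)) := by
      rw [scT_add p u c5 (by fun_prop), scT_const_mul, scT_add p u (by fun_prop) (by fun_prop),
        scT_add p u (by fun_prop) (by fun_prop), scT_add p u (by fun_prop) (by fun_prop),
        scT_const_mul, scT_const_mul]
      ring
    have p1 := Psi_eq (p := p) hσ u y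
    have p2 := Psi_eq (p := p) hσ' u y
    have q1 := mul_scTD p u (fun x => hasDerivAt_Psi (p := p) (σ := σ) u x) c3 (Psi_neg u 1) y
    have q2 := mul_scTD p u (fun x => hasDerivAt_Psi (p := p) (σ := -σ) u x) c4 (Psi_neg u 1) y
    have d1 : PsiY p σ u y = 2 * (waveD p (Real.exp (2 * u) * y) * Real.exp (2 * u)) -
      σ * scTD p u (Psi p σ u) y := by
      rw [PsiY, scTD_congr (fun s hs => Psi_of_mem hσ u hs)]
    have d2 : PsiY p (-σ) u y = 2 * (waveD p (Real.exp (2 * u) * y) * Real.exp (2 * u)) -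
      (-σ : ℝ) * scTD p u (Psi p (-σ) u) y := by
      rw [PsiY, scTD_congr (fun s hs => Psi_of_mem hσ' u hs)]
    have n1 : PsiU p σ u y = 4 * (Real.exp (2 * u) * y * waveD p (Real.exp (2 * u) * y)) -
      σ * (scT p u (Psi p σ u) y + 2 * (y * scTD p u (Psi p σ u) y) +
        scT p u (PsiU p σ u) y) := by
      conv_lhs => rw [PsiU]
      rw [scT_congr (g := Psi p σ u) (fun s hs => (Psi_of_mem hσ u hs).symm),
        scTD_congr (g := Psi p σ u) (fun s hs => (Psi_of_mem hσ u hs).symm), scT_congr hN]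
    rw [t1]
    simp only [R]
    simp only [Complex.ofReal_neg] at p2 d2
    -- The boundary terms in `q1` and `q2` add up to 2σμ times the wave, which is σμ times the
    -- right-hand side of the equation for `Psi p σ u`. This is the origin of the μ term in `R`.
    linear_combination n1 - y * d1 - y * d2 - σ * q1 - σ * q2 + (1 / 2 + σ * μ) * p1 -
      (1 / 2) * p2 + 2 * σ * wave p (Real.exp (2 * u) * y) * hμ
  have := congrFun h y
  simp only [R, Pi.zero_apply] at this
  linear_combination this

end

section

variable {p : Parity} {σ : ℝ}

/-- Bounds uniform in y and locally uniform in u, which justify differentiating integrals over a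
half-line in u. Only the u-derivative grows with y, since the waves oscillate in e^{2u} y. -/
lemma exists_bound_Psi (hσ : σ ^ 2 = 1) (u₀ : ℝ) : ∃ C, 0 ≤ C ∧ ∀ u ∈ Set.Icc (u₀ - 1) (u₀ + 1),
    ∀ y, ‖Psi p σ u y‖ ≤ C ∧ ‖PsiU p σ u y‖ ≤ C * (1 + |y|) ∧ ‖PsiY p σ u y‖ ≤ C := by
  have hcs := contDiff_sol (p := p) hσ (n := 1)
  obtain ⟨M, hM⟩ := (isCompact_Icc (a := u₀ - 1) (b := u₀ + 1)).exists_bound_of_continuousOn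
    hcs.continuous.continuousOn
  obtain ⟨M', hM'⟩ := (isCompact_Icc (a := u₀ - 1) (b := u₀ + 1)).exists_bound_of_continuousOn
    (hcs.continuous_deriv le_rfl).continuousOn
  have hM0 : 0 ≤ M := (norm_nonneg _).trans (hM u₀ ⟨by linarith, by linarith⟩)
  have hM0' : 0 ≤ M' := (norm_nonneg _).trans (hM' u₀ ⟨by linarith, by linarith⟩)
  have hσ1 : |σ| = 1 := by
    rw [← sq_eq_sq₀ (abs_nonneg _) zero_le_one, sq_abs, hσ, one_pow]
  set E := Real.exp (u₀ + 1) with hE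
  set E2 := Real.exp (2 * (u₀ + 1)) with hE2
  have hE0 : 0 < E := Real.exp_pos _
  have hE20 : 0 < E2 := Real.exp_pos _
  have hpi := Real.pi_pos
  refine ⟨2 + 8 * Real.pi * E2 + 4 * Real.pi * E2 + 2 * E * M + 2 * E * M' +
    3 * (2 * E * (2 * Real.pi * E2 * M)), by positivity, fun u hu y => ?_⟩
  have hEu : Real.exp u ≤ E := Real.exp_le_exp.2 hu.2
  have hE2u : Real.exp (2 * u) ≤ E2 := Real.exp_le_exp.2 (by linarith [hu.2])
  have hb : ∀ s ∈ Set.Icc (-1 : ℝ) 1, ‖ext (sol p σ u) s‖ ≤ M :=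
    fun s _ => (norm_ext_le _ _).trans (hM u hu)
  have hb' : ∀ s ∈ Set.Icc (-1 : ℝ) 1, ‖ext (deriv (sol p σ) u) s‖ ≤ M' :=
    fun s _ => (norm_ext_le _ _).trans (hM' u hu)
  have h1 : ‖scT p u (ext (sol p σ u)) y‖ ≤ 2 * E * M :=
    (norm_scT_le p u hb y).trans (by gcongr)
  have h2 : ‖scT p u (ext (deriv (sol p σ) u)) y‖ ≤ 2 * E * M' :=
    (norm_scT_le p u hb' y).trans (by gcongr)
  have h3 : ‖scTD p u (ext (sol p σ u)) y‖ ≤ 2 * E * (2 * Real.pi * E2 * M) :=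
    (norm_scTD_le p u hb y).trans (by gcongr)
  have hs : ∀ z : ℂ, ‖(σ : ℂ) * z‖ = ‖z‖ := fun z => by
    rw [norm_mul, Complex.norm_real, Real.norm_eq_abs, hσ1, one_mul]
  have hw := norm_wave_le p (Real.exp (2 * u) * y)
  have hwd : ‖waveD p (Real.exp (2 * u) * y) * Real.exp (2 * u)‖ ≤ 2 * Real.pi * E2 := by
    rw [norm_mul, Complex.norm_real, Real.norm_of_nonneg (Real.exp_pos _).le]
    exact mul_le_mul (norm_waveD_le _ _) hE2u (Real.exp_pos _).le (by positivity)
  refine ⟨?_, ?_, ?_⟩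
  · refine (norm_sub_le _ _).trans ?_
    rw [hs, norm_mul]
    norm_num
    have : 0 ≤ Real.pi * E2 * M * E := by positivity
    have : 0 ≤ Real.pi * E2 := by positivity
    have : 0 ≤ E * M' := by positivity
    nlinarith
  · refine (norm_sub_le _ _).trans ?_
    rw [hs]
    have e1 : ‖4 * (Real.exp (2 * u) * y * waveD p (Real.exp (2 * u) * y))‖ ≤
        4 * (2 * Real.pi * E2) * |y| := by
      have : 4 * (Real.exp (2 * u) * y * waveD p (Real.exp (2 * u) * y)) =
        4 * (waveD p (Real.exp (2 * u) * y) * Real.exp (2 * u)) * y := by ring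
      rw [this, norm_mul, norm_mul, Complex.norm_real, Real.norm_eq_abs]
      norm_num at hwd ⊢
      gcongr
    have e2 : ‖2 * (y * scTD p u (ext (sol p σ u)) y)‖ ≤
        2 * (2 * E * (2 * Real.pi * E2 * M)) * |y| := by
      rw [norm_mul, norm_mul, Complex.norm_real, Real.norm_eq_abs]
      norm_num
      nlinarith [abs_nonneg y]
    have e3 := norm_add₃_le (a := scT p u (ext (sol p σ u)) y)
      (b := 2 * (y * scTD p u (ext (sol p σ u)) y)) (c := scT p u (ext (deriv (sol p σ) u)) y)
    have : 0 ≤ E * M * |y| := by positivity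
    have : 0 ≤ E * M' * |y| := by positivity
    have : 0 ≤ E2 * Real.pi * |y| := by positivity
    have : 0 ≤ E2 * Real.pi := by positivity
    have : 0 ≤ E * (Real.pi * E2 * M) := by positivity
    have : 0 ≤ E * (Real.pi * E2 * M) * |y| := by positivity
    nlinarith [abs_nonneg y]
  · refine (norm_sub_le _ _).trans ?_
    rw [hs, norm_mul]
    norm_num at hwd ⊢
    have : 0 ≤ Real.pi * E2 * M * E := by positivity
    have : 0 ≤ Real.pi * E2 := by positivity
    have : 0 ≤ E * M' := by positivity
    have : 0 ≤ E * M := by positivity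
    nlinarith

/-- At y = 1 the y-derivatives enter the evolution equations of both signs identically and cancel in
the difference; the undifferentiated terms cancel as well, except for μ times the sum of the edge
values, which is μ². This identity turns the potentials into second logarithmic derivatives of
determinants. -/
lemma muPsi_sq (p : Parity) (u : ℝ) :
    HasDerivAt (fun u : ℝ => Real.exp u * Psi p (-1) u 1 - Real.exp u * Psi p 1 u 1)
      (muPsi p u ^ 2) u := by
  have he : HasDerivAt (fun u : ℝ => (Real.exp u : ℂ)) (Real.exp u : ℂ) u :=
    (Real.hasDerivAt_exp u).ofReal_comp
  have h1 := hasDerivAt_Psi_u (p := p) (σ := 1) (by norm_num) u 1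
  have h2 := hasDerivAt_Psi_u (p := p) (σ := -1) (by norm_num) u 1
  refine ((he.mul h2).sub (he.mul h1)).congr_deriv ?_
  rw [PsiU_eq (by norm_num), PsiU_eq (by norm_num), muPsi]
  push_cast [neg_neg]
  ring

end

/-! ### The functions `φ_a` -/

lemma IsPhi.continuous {p : Parity} {σ a : ℝ} {φ : ℝ → ℝ} (h : IsPhi p σ a φ) : Continuous φ := by
  obtain ⟨hl, he⟩ := h
  have hint : IntervalIntegrable φ volume (-a) a :=
    (hl.integrableOn_isCompact isCompact_uIcc).intervalIntegrable
  have hc : Continuous fun x => ∫ t in (-a)..a, trig p (2 * Real.pi * x * t) * φ t := by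
    refine intervalIntegral.continuous_of_dominated_interval (bound := fun t => ‖φ t‖)
      (fun x => (((continuous_trig p).comp (by fun_prop)).aestronglyMeasurable.mul
        hl.aestronglyMeasurable).restrict)
      (fun x => Filter.Eventually.of_forall fun t _ => ?_) hint.norm
      (Filter.Eventually.of_forall fun t _ =>
        ((continuous_trig p).comp (by fun_prop)).mul continuous_const)
    rw [norm_mul]
    exact mul_le_of_le_one_left (norm_nonneg _) (abs_trig_le p _)
  have heq : φ = fun x => 2 * trig p (2 * Real.pi * a * x) -
      σ * ∫ t in (-a)..a, trig p (2 * Real.pi * x * t) * φ t := by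
    funext x
    linarith [he x]
  rw [heq]
  exact (continuous_const.mul ((continuous_trig p).comp (by fun_prop))).sub
    (continuous_const.mul hc)

lemma finT_ofReal (p : Parity) (a : ℝ) (φ : ℝ → ℝ) (x : ℝ) :
    finT p a (fun t => (φ t : ℂ)) x =
      ((∫ t in (-a)..a, trig p (2 * Real.pi * x * t) * φ t : ℝ) : ℂ) := by
  rw [finT, ← intervalIntegral.integral_ofReal]
  refine intervalIntegral.integral_congr fun t _ => ?_
  simp only [wave]
  push_cast
  ring_nf

lemma isPhi_iff {p : Parity} {σ a : ℝ} {φ : ℝ → ℝ} : IsPhi p σ a φ ↔ Continuous φ ∧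
    ∀ x, (φ x : ℂ) + σ * finT p a (fun t => (φ t : ℂ)) x = 2 * wave p (a * x) := by
  have key : ∀ x, ((φ x : ℂ) + σ * finT p a (fun t => (φ t : ℂ)) x = 2 * wave p (a * x)) ↔
      φ x + σ * ∫ t in (-a)..a, trig p (2 * Real.pi * x * t) * φ t =
        2 * trig p (2 * Real.pi * a * x) := by
    intro x
    rw [finT_ofReal, wave, ← mul_assoc]
    norm_cast
  constructor
  · exact fun h => ⟨h.continuous, fun x => (key x).2 (h.2 x)⟩
  · exact fun h => ⟨h.1.locallyIntegrable, fun x => (key x).1 (h.2 x)⟩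

lemma finT_sub (p : Parity) (a : ℝ) {f g : ℝ → ℂ} (hf : Continuous f) (hg : Continuous g) (x : ℝ) :
    finT p a (fun t => f t - g t) x = finT p a f x - finT p a g x := by
  simp only [finT, mul_sub]
  exact intervalIntegral.integral_sub (Continuous.intervalIntegrable (by fun_prop) _ _)
    (Continuous.intervalIntegrable (by fun_prop) _ _)

lemma eq_of_finT_eq {p : Parity} {σ a : ℝ} (hσ : σ ^ 2 = 1) (ha : 0 < a) {f g b : ℝ → ℂ}
    (hf : Continuous f) (hg : Continuous g) (h1 : ∀ x, f x + σ * finT p a f x = b x)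
    (h2 : ∀ x, g x + σ * finT p a g x = b x) : f = g := by
  have : (fun x => f x - g x) = 0 := by
    refine eq_zero_of_homogeneous (p := p) hσ ha (hf.sub hg) fun x => ?_
    rw [finT_sub p a hf hg]
    linear_combination h1 x - h2 x
  funext x
  exact sub_eq_zero.1 (congrFun this x)

lemma Psi_finT {p : Parity} {σ : ℝ} (hσ : σ ^ 2 = 1) (u x : ℝ) :
    Psi p σ u (Real.exp (-u) * x) +
      σ * finT p (Real.exp u) (fun t => Psi p σ u (Real.exp (-u) * t)) x =
        2 * wave p (Real.exp u * x) := by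
  have h := Psi_eq (p := p) hσ u (Real.exp (-u) * x)
  rw [scT_eq_finT, ← mul_assoc, ← mul_assoc, ← Real.exp_add, ← Real.exp_add] at h
  simp only [add_neg_cancel, Real.exp_zero, one_mul] at h
  rw [h]
  congr 3
  ring_nf

lemma existsUnique_isPhi (p : Parity) {σ a : ℝ} (hσ : σ ^ 2 = 1) (ha : 0 < a) :
    ∃! φ, IsPhi p σ a φ := by
  obtain ⟨u, rfl⟩ : ∃ u, a = Real.exp u := ⟨Real.log a, (Real.exp_log ha).symm⟩
  have hc := continuous_Psi (p := p) (σ := σ) u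
  have hre : ∀ y, ((Psi p σ u y).re : ℂ) = Psi p σ u y := fun y =>
    Complex.conj_eq_iff_re.1 (Psi_star hσ u y)
  refine ⟨fun x => (Psi p σ u (Real.exp (-u) * x)).re, isPhi_iff.2
    ⟨Complex.continuous_re.comp (hc.comp (by fun_prop)), fun x => ?_⟩,
    fun φ hφ => ?_⟩
  · simp only [hre]
    exact Psi_finT hσ u x
  · obtain ⟨h1, h2⟩ := isPhi_iff.1 hφ
    have := eq_of_finT_eq hσ ha (Complex.continuous_ofReal.comp h1) (by fun_prop) h2 (Psi_finT hσ u)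
    funext x
    have hx := congrFun this x
    simp only [Function.comp_apply] at hx
    rw [← hx, Complex.ofReal_re]

lemma isPhi_phi (p : Parity) {σ a : ℝ} (hσ : σ ^ 2 = 1) (ha : 0 < a) :
    IsPhi p σ a (phi p σ a) := by
  have h : ∃ φ, IsPhi p σ a φ := (existsUnique_isPhi p hσ ha).exists
  rw [phi, dif_pos h]
  exact h.choose_spec

lemma phi_exp (p : Parity) {σ : ℝ} (hσ : σ ^ 2 = 1) (u x : ℝ) :
    (phi p σ (Real.exp u) x : ℂ) = Psi p σ u (Real.exp (-u) * x) := by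
  obtain ⟨h1, h2⟩ := isPhi_iff.1 (isPhi_phi p hσ (Real.exp_pos u))
  have hc := continuous_Psi (p := p) (σ := σ) u
  exact congrFun (eq_of_finT_eq hσ (Real.exp_pos u) (Complex.continuous_ofReal.comp h1)
    (by fun_prop) h2 (Psi_finT hσ u)) x

lemma phi_exp_mul (p : Parity) {σ : ℝ} (hσ : σ ^ 2 = 1) (u y : ℝ) :
    (phi p σ (Real.exp u) (Real.exp u * y) : ℂ) = Psi p σ u y := by
  rw [phi_exp p hσ, ← mul_assoc, ← Real.exp_add]
  simp

lemma phi_exp_self (p : Parity) {σ : ℝ} (hσ : σ ^ 2 = 1) (u : ℝ) :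
    (phi p σ (Real.exp u) (Real.exp u) : ℂ) = Psi p σ u 1 := by
  rw [← phi_exp_mul p hσ, mul_one]

lemma muU_eq (p : Parity) (u : ℝ) : (muU p u : ℂ) = muPsi p u := by
  rw [muU, mu, muPsi, ← phi_exp_self p (by norm_num), ← phi_exp_self p (by norm_num)]
  push_cast
  ring

/-! ### Pairings with the solutions -/

lemma integrable_wave_mul (p : Parity) (c : ℝ) {h : ℝ → ℂ} (hi : Integrable h) :
    Integrable fun x => wave p (c * x) * h x :=
  hi.bdd_mul (c := 1) (by fun_prop) (Filter.Eventually.of_forall fun x => norm_wave_le p _)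

/-- For h of no particular parity, integration against the wave sees only one parity component of
the Fourier transform; test functions need not have a parity. -/
lemma parUnit_inv_mul_integral {p : Parity} {h : ℝ → ℂ} (hi : Integrable h) (t : ℝ) :
    (parUnit p)⁻¹ * ∫ x, wave p (t * x) * h x = (1 / 2) * (𝓕 h t + parSign p * 𝓕 h (-t)) := by
  have hi' : ∀ c : ℝ, Integrable fun x : ℝ =>
      Complex.exp (↑(-2 * Real.pi * x * c) * Complex.I) • h x := by
    intro c
    refine hi.bdd_mul (c := 1) (by fun_prop) (Filter.Eventually.of_forall fun x => ?_)
    rw [Complex.norm_exp_ofReal_mul_I]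
  have h3 : ∀ x, wave p (t * x) * h x = parUnit p / 2 *
      (Complex.exp (↑(-2 * Real.pi * x * t) * Complex.I) • h x +
        parSign p * (Complex.exp (↑(-2 * Real.pi * x * -t) * Complex.I) • h x)) := by
    intro x
    have e1 : ((2 * Real.pi * (t * x) : ℝ) : ℂ) * Complex.I =
      ((-2 * Real.pi * x * -t : ℝ) : ℂ) * Complex.I := by push_cast; ring
    have e2 : -((2 * Real.pi * (t * x) : ℝ) : ℂ) * Complex.I =
      ((-2 * Real.pi * x * t : ℝ) : ℂ) * Complex.I := by push_cast; ring
    cases p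
    · simp only [wave, trig, Complex.ofReal_cos, Complex.cos, parSign, parUnit, smul_eq_mul, e1, e2]
      ring
    · simp only [wave, trig, Complex.ofReal_sin, Complex.sin, parSign, parUnit, smul_eq_mul, e1, e2]
      ring
  simp_rw [h3]
  rw [integral_const_mul, integral_add (hi' _) ((hi' _).const_mul _), integral_const_mul,
    ← Real.fourier_real_eq_integral_exp_smul, ← Real.fourier_real_eq_integral_exp_smul]
  field_simp [parUnit_ne_zero p]

section

variable {p : Parity} {σ a : ℝ}

lemma phi_eq (hσ : σ ^ 2 = 1) (ha : 0 < a) (x : ℝ) :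
    (phi p σ a x : ℂ) = 2 * wave p (a * x) - σ * finT p a (fun t => (phi p σ a t : ℂ)) x := by
  rw [← (isPhi_iff.1 (isPhi_phi p hσ ha)).2 x]
  ring

lemma continuous_phi (hσ : σ ^ 2 = 1) (ha : 0 < a) : Continuous (phi p σ a) :=
  (isPhi_iff.1 (isPhi_phi p hσ ha)).1

lemma phi_neg (hσ : σ ^ 2 = 1) (ha : 0 < a) (x : ℝ) :
    (phi p σ a (-x) : ℂ) = parSign p * phi p σ a x := by
  rw [phi_eq hσ ha, phi_eq hσ ha x, finT_neg, mul_neg, wave_neg]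
  ring

lemma exists_bound_phi (hσ : σ ^ 2 = 1) (ha : 0 < a) :
    ∃ C, 0 ≤ C ∧ ∀ x, ‖(phi p σ a x : ℂ)‖ ≤ C := by
  obtain ⟨C, hC, h⟩ := exists_bound_Psi (p := p) hσ (Real.log a)
  refine ⟨C, hC, fun x => ?_⟩
  have := (h (Real.log a) ⟨by linarith, by linarith⟩ (Real.exp (-Real.log a) * x)).1
  rwa [← phi_exp p hσ, Real.exp_log ha] at this

lemma integrable_phi_mul (hσ : σ ^ 2 = 1) (ha : 0 < a) {h : ℝ → ℂ} (hi : Integrable h) :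
    Integrable fun x => (phi p σ a x : ℂ) * h x := by
  obtain ⟨C, _, hC⟩ := exists_bound_phi (p := p) hσ ha
  exact hi.bdd_mul (c := C)
    (Complex.continuous_ofReal.comp (continuous_phi hσ ha)).aestronglyMeasurable
    (Filter.Eventually.of_forall hC)

/-- The pairing of `φ_a` with an integrable function, in terms of its cosine or sine transform. -/
lemma integral_phi_mul (hσ : σ ^ 2 = 1) (ha : 0 < a) {h : ℝ → ℂ} (hi : Integrable h) :
    ∫ x, (phi p σ a x : ℂ) * h x = 2 * (∫ x, wave p (a * x) * h x) -
      σ * ∫ t in (-a)..a, (phi p σ a t : ℂ) * ∫ x, wave p (t * x) * h x := by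
  have hφ : Continuous fun t => (phi p σ a t : ℂ) :=
    Complex.continuous_ofReal.comp (continuous_phi hσ ha)
  have hT : Continuous (finT p a fun t => (phi p σ a t : ℂ)) := continuous_finT p a hφ
  obtain ⟨C, hC0, hC⟩ := exists_bound_phi (p := p) hσ ha
  have hi2 : Integrable fun x => finT p a (fun t => (phi p σ a t : ℂ)) x * h x := by
    refine hi.bdd_mul (c := C * |a - -a|) hT.aestronglyMeasurable
      (Filter.Eventually.of_forall fun x => ?_)
    refine intervalIntegral.norm_integral_le_of_norm_le_const fun t _ => ?_
    rw [norm_mul]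
    exact (mul_le_of_le_one_left (norm_nonneg _) (norm_wave_le _ _)).trans (hC t)
  have e1 : ∫ x, (phi p σ a x : ℂ) * h x = ∫ x, (2 * (wave p (a * x) * h x) -
      σ * (finT p a (fun t => (phi p σ a t : ℂ)) x * h x)) := by
    refine integral_congr_ae (Filter.Eventually.of_forall fun x => ?_)
    simp only
    rw [phi_eq hσ ha]
    ring
  rw [e1, integral_sub ((integrable_wave_mul p a hi).const_mul _) (hi2.const_mul _),
    integral_const_mul, integral_const_mul]
  congr 2
  have hle : -a ≤ a := by linarith
  have e2 : ∀ x, finT p a (fun t => (phi p σ a t : ℂ)) x * h x =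
      ∫ t in Set.Ioc (-a) a, wave p (x * t) * phi p σ a t * h x := by
    intro x
    rw [finT, intervalIntegral.integral_of_le hle, integral_mul_const]
  simp_rw [e2]
  rw [integral_integral_swap, intervalIntegral.integral_of_le hle]
  · refine integral_congr_ae (Filter.Eventually.of_forall fun t => ?_)
    simp only
    rw [← integral_const_mul]
    refine integral_congr_ae (Filter.Eventually.of_forall fun x => ?_)
    simp only
    rw [mul_comm x t]
    ring
  · have : Integrable (fun q : ℝ × ℝ => h q.1 * (1 : ℂ))
        (volume.prod (volume.restrict (Set.Ioc (-a) a))) :=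
      hi.mul_prod (integrable_const (1 : ℂ))
    simp only [mul_one] at this
    refine (this.bdd_mul (f := fun q : ℝ × ℝ => wave p (q.1 * q.2) * phi p σ a q.2) (c := C)
      (((continuous_wave p).comp (by fun_prop : Continuous fun q : ℝ × ℝ => q.1 * q.2)).mul
        (hφ.comp continuous_snd)).aestronglyMeasurable
      (Filter.Eventually.of_forall fun q => ?_))
    rw [norm_mul]
    exact (mul_le_of_le_one_left (norm_nonneg _) (norm_wave_le _ _)).trans (hC _)

end

/-! ### The distributions -/

lemma phiDist_apply (p : Parity) (σ a : ℝ) (g : 𝓢(ℝ, ℂ)) :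
    phiDist p σ a g = ∫ x, (phi p σ a x : ℂ) * g x := by
  rw [phiDist, Lp.toTemperedDistribution_apply]
  refine integral_congr_ae ?_
  filter_upwards [(phi_memLp p σ a).coeFn_toLp] with x hx
  rw [hx, smul_eq_mul, mul_comm]

lemma parityFourier_apply (p : Parity) (T : 𝓢'(ℝ, ℂ)) (g : 𝓢(ℝ, ℂ)) :
    parityFourier p T g = (parUnit p)⁻¹ * T (𝓕⁻ g) := by
  cases p
  · simp [parityFourier, parUnit]
  · simp [parityFourier, parUnit]

lemma parUnit_inv_mul_integral_fourierInv (p : Parity) (g : 𝓢(ℝ, ℂ)) (t : ℝ) :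
    (parUnit p)⁻¹ * ∫ x, wave p (t * x) * (𝓕⁻ g) x = (1 / 2) * (g t + parSign p * g (-t)) := by
  rw [parUnit_inv_mul_integral (𝓕⁻ g).integrable, ← SchwartzMap.fourier_coe,
    FourierTransform.fourier_fourierInv_eq]

section

variable {p : Parity} {σ a : ℝ}

lemma integral_wave_schwartz (p : Parity) (g : 𝓢(ℝ, ℂ)) (t : ℝ) :
    ∫ x, wave p (t * x) * (𝓕⁻ g) x = parUnit p * ((1 / 2) * (g t + parSign p * g (-t))) := by
  rw [← parUnit_inv_mul_integral_fourierInv, mul_inv_cancel_left₀ (parUnit_ne_zero p)]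

lemma intervalIntegral_symm (f : ℝ → ℂ) (a : ℝ) :
    ∫ t in (-a)..a, f (-t) = ∫ t in (-a)..a, f t := by
  rw [intervalIntegral.integral_comp_neg]
  simp

/-- By its equation φ_a is 2 `wave p (a x)` minus σ times the transform of φ_a restricted to [-a,
a]. Transforming back yields point masses at ±a and -σ φ_a on [-a, a]. -/
lemma parityFourier_phiDist (hσ : σ ^ 2 = 1) (ha : 0 < a) (g : 𝓢(ℝ, ℂ)) :
    parityFourier p (phiDist p σ a) g = g a + parSign p * g (-a) -
      σ * ∫ t in (-a)..a, (phi p σ a t : ℂ) * g t := by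
  have hφ : Continuous fun t => (phi p σ a t : ℂ) :=
    Complex.continuous_ofReal.comp (continuous_phi hσ ha)
  rw [parityFourier_apply, phiDist_apply, integral_phi_mul hσ ha (𝓕⁻ g).integrable]
  simp_rw [integral_wave_schwartz]
  have hg : Continuous g := g.continuous
  -- The symmetrisation of g is absorbed because φ_a already has the parity `p`.
  have e1 : ∫ t in (-a)..a, (phi p σ a t : ℂ) *
      (parUnit p * ((1 / 2) * (g t + parSign p * g (-t)))) =
      parUnit p * ∫ t in (-a)..a, (phi p σ a t : ℂ) * g t := by
    have e2 : ∀ t, (phi p σ a t : ℂ) * (parUnit p * ((1 / 2) * (g t + parSign p * g (-t)))) =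
        (parUnit p / 2) * (phi p σ a t * g t) +
        (parUnit p / 2) * (fun t => (phi p σ a t : ℂ) * g t) (-t) := by
      intro t
      simp only
      rw [phi_neg hσ ha]
      ring
    simp_rw [e2]
    rw [intervalIntegral.integral_add, intervalIntegral.integral_const_mul,
      intervalIntegral.integral_const_mul,
      intervalIntegral_symm (fun t => (phi p σ a t : ℂ) * g t)]
    · ring
    · exact Continuous.intervalIntegrable (by fun_prop) _ _
    · exact (continuous_const.mul ((hφ.mul hg).comp continuous_neg)).intervalIntegrable _ _
  rw [e1]
  field_simp [parUnit_ne_zero p]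

/-- `A_a` and `B_a` up to constant factors. -/
def coreDist (p : Parity) (σ a : ℝ) : 𝓢'(ℝ, ℂ) :=
  parityFourier p (phiDist p σ a) + (σ : ℂ) • phiDist p σ a

lemma distA_eq (p : Parity) (a : ℝ) : distA p a = ((Real.sqrt a : ℂ) / 2) • coreDist p 1 a := by
  simp [distA, coreDist]

lemma distB_eq (p : Parity) (a : ℝ) :
    distB p a = (Complex.I * (Real.sqrt a : ℂ) / 2) • coreDist p (-1) a := by
  ext g
  have h1 : distB p a g = (Complex.I * (Real.sqrt a : ℂ) / 2) *
      (parityFourier p (phiDist p (-1) a) g - phiDist p (-1) a g) := rfl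
  have h2 : ((Complex.I * (Real.sqrt a : ℂ) / 2) • coreDist p (-1) a) g =
      (Complex.I * (Real.sqrt a : ℂ) / 2) *
        (parityFourier p (phiDist p (-1) a) g + ((-1 : ℝ) : ℂ) * phiDist p (-1) a g) := rfl
  rw [h1, h2]
  push_cast
  ring

/-- Adding σ φ_a cancels the part -σ φ_a of the transform on [-a, a]. What remains consists of the
masses at ±a and of σ φ_a on |x| > a, so the vanishing on (-a, a) becomes visible. -/
lemma coreDist_apply (hσ : σ ^ 2 = 1) (ha : 0 < a) (g : 𝓢(ℝ, ℂ)) :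
    coreDist p σ a g = g a + parSign p * g (-a) +
      σ * ((∫ x, (phi p σ a x : ℂ) * g x) - ∫ t in (-a)..a, (phi p σ a t : ℂ) * g t) := by
  have : coreDist p σ a g = parityFourier p (phiDist p σ a) g + σ * phiDist p σ a g := rfl
  rw [this, parityFourier_phiDist hσ ha, phiDist_apply]
  ring

lemma phiDist_parity (hσ : σ ^ 2 = 1) (ha : 0 < a) {g g' : 𝓢(ℝ, ℂ)} (h : ∀ x, g' x = g (-x)) :
    phiDist p σ a g' = parSign p * phiDist p σ a g := by
  rw [phiDist_apply, phiDist_apply, ← integral_const_mul, ← integral_neg_eq_self]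
  refine integral_congr_ae (Filter.Eventually.of_forall fun x => ?_)
  simp only [h, neg_neg]
  rw [phi_neg hσ ha]
  ring

/-- The transform is an involution on distributions of the given parity, so adding σ times a
distribution to its transform produces an eigenvector for σ, as σ² = 1. Vanishing is read off from
`coreDist_apply`. -/
lemma isSonineDistribution_coreDist (hσ : σ ^ 2 = 1) (ha : 0 < a) :
    IsSonineDistribution p a σ (coreDist p σ a) := by
  have hσc : (σ : ℂ) * σ = 1 := by
    have : σ * σ = 1 := by rw [← sq, hσ]
    exact_mod_cast this
  refine ⟨fun g g' h => ?_, ?_, fun g hg => ?_⟩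
  · have h1 := phiDist_parity (p := p) hσ ha h
    rw [phiDist_apply, phiDist_apply] at h1
    have h2 : ∫ t in (-a)..a, (phi p σ a t : ℂ) * g' t =
        parSign p * ∫ t in (-a)..a, (phi p σ a t : ℂ) * g t := by
      rw [← intervalIntegral.integral_const_mul, ← intervalIntegral_symm]
      refine intervalIntegral.integral_congr fun t _ => ?_
      simp only [h, neg_neg]
      rw [phi_neg hσ ha]
      ring
    rw [coreDist_apply hσ ha, coreDist_apply hσ ha, h1, h2, h, h, neg_neg]
    linear_combination (-g (-a)) * parSign_mul_self p
  · ext g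
    have h2 : parityFourier p (parityFourier p (phiDist p σ a)) g = phiDist p σ a g := by
      rw [parityFourier_apply, parityFourier_apply]
      have h3 : ∀ x, (𝓕⁻ (𝓕⁻ g)) x = g (-x) := by
        intro x
        rw [SchwartzMap.fourierInv_coe, Real.fourierInv_eq_fourier_neg, ← SchwartzMap.fourier_coe,
          FourierTransform.fourier_fourierInv_eq]
      rw [phiDist_parity hσ ha h3, ← parUnit_mul_self]
      field_simp [parUnit_ne_zero p]
    have h3 : parityFourier p (coreDist p σ a) g =
        parityFourier p (parityFourier p (phiDist p σ a)) g +
          σ * parityFourier p (phiDist p σ a) g := by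
      rw [parityFourier_apply, parityFourier_apply _ (parityFourier p _),
        parityFourier_apply _ (phiDist p σ a) g]
      have : coreDist p σ a (𝓕⁻ g) =
        parityFourier p (phiDist p σ a) (𝓕⁻ g) + σ * phiDist p σ a (𝓕⁻ g) := rfl
      rw [this]
      ring
    have h4 : ((σ : ℂ) • coreDist p σ a) g =
      σ * (parityFourier p (phiDist p σ a) g + σ * phiDist p σ a g) := rfl
    rw [h3, h2, h4]
    linear_combination (-phiDist p σ a g) * hσc
  · have h0 : ∀ x, x ∉ Set.Ioo (-a) a → g x = 0 := fun x hx => by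
      by_contra hne
      exact hx (hg (subset_tsupport _ hne))
    rw [coreDist_apply hσ ha, h0 a (by simp), h0 (-a) (by simp)]
    have : ∫ x, (phi p σ a x : ℂ) * g x = ∫ t in (-a)..a, (phi p σ a t : ℂ) * g t := by
      rw [intervalIntegral.integral_of_le (by linarith), setIntegral_eq_integral_of_forall_compl_eq_zero]
      intro x hx
      rw [h0 x (fun h => hx ⟨h.1, h.2.le⟩), mul_zero]
    rw [this]
    ring

lemma IsSonineDistribution.smul {ε : ℂ} {T : 𝓢'(ℝ, ℂ)} (h : IsSonineDistribution p a ε T) (c : ℂ) :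
    IsSonineDistribution p a ε (c • T) := by
  obtain ⟨h1, h2, h3⟩ := h
  have hs : ∀ (T : 𝓢'(ℝ, ℂ)) (g : 𝓢(ℝ, ℂ)), (c • T) g = c * T g := fun _ _ => rfl
  refine ⟨fun g g' hg => ?_, ?_, fun g hg => ?_⟩
  · rw [hs, hs, h1 g g' hg]
    ring
  · ext g
    have h4 := congrArg (fun S : 𝓢'(ℝ, ℂ) => S g) h2
    have h5 : (ε • (c • T)) g = ε * (c * T g) := rfl
    have h6 : (ε • T) g = ε * T g := rfl
    simp only [h6] at h4
    rw [parityFourier_apply, hs, h5]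
    rw [parityFourier_apply] at h4
    linear_combination c * h4
  · rw [hs, h3 g hg, mul_zero]

end

/-! ### Gaussians -/

/-- The Gaussian `exp (-πx²)`, resp. `x exp (-πx²)`. -/
def gau (p : Parity) (x : ℝ) : ℂ :=
  match p with
  | .even => (Real.exp (-Real.pi * x ^ 2) : ℂ)
  | .odd => ((x * Real.exp (-Real.pi * x ^ 2) : ℝ) : ℂ)

/-- The derivative of the Gaussian. -/
def gauD (p : Parity) (x : ℝ) : ℂ :=
  match p with
  | .even => ((-(2 * Real.pi * x) * Real.exp (-Real.pi * x ^ 2) : ℝ) : ℂ)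
  | .odd => (((1 - 2 * Real.pi * x ^ 2) * Real.exp (-Real.pi * x ^ 2) : ℝ) : ℂ)

lemma hasDerivAt_gauss (x : ℝ) : HasDerivAt (fun x : ℝ => Real.exp (-Real.pi * x ^ 2))
    (-(2 * Real.pi * x) * Real.exp (-Real.pi * x ^ 2)) x := by
  have h1 : HasDerivAt (fun x : ℝ => -Real.pi * x ^ 2) (-Real.pi * (2 * x)) x := by
    simpa using (hasDerivAt_pow 2 x).const_mul (-Real.pi)
  refine h1.exp.congr_deriv ?_
  ring

lemma hasDerivAt_gau (p : Parity) (x : ℝ) : HasDerivAt (gau p) (gauD p x) x := by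
  cases p
  · exact (hasDerivAt_gauss x).ofReal_comp
  · refine (((hasDerivAt_id x).mul (hasDerivAt_gauss x)).ofReal_comp).congr_deriv ?_
    simp only [gauD, id]
    push_cast
    ring

lemma continuous_gau (p : Parity) : Continuous (gau p) :=
  continuous_iff_continuousAt.2 fun x => (hasDerivAt_gau p x).continuousAt

@[fun_prop]
lemma Continuous.gau {X : Type*} [TopologicalSpace X] {f : X → ℝ} (hf : Continuous f)
    (p : Parity) : Continuous fun x => gau p (f x) := (continuous_gau p).comp hf

lemma gau_neg (p : Parity) (x : ℝ) : gau p (-x) = parSign p * gau p x := by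
  cases p <;> simp [gau, parSign]

lemma star_gau (p : Parity) (x : ℝ) : star (gau p x) = gau p x := by
  cases p
  · exact Complex.conj_ofReal _
  · exact Complex.conj_ofReal _

lemma integrable_gau (p : Parity) : Integrable (gau p) := by
  cases p
  · exact (integrable_exp_neg_mul_sq Real.pi_pos).ofReal
  · exact (integrable_mul_exp_neg_mul_sq Real.pi_pos).ofReal

lemma integrable_gau_mul (p : Parity) {v : ℝ} (hv : v ≠ 0) : Integrable fun x => gau p (v * x) :=
  (integrable_gau p).comp_mul_left' hv

lemma exists_gauss_bound (k : ℕ) {r : ℝ} (hr : 0 ≤ r) :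
    ∃ C, 0 < C ∧ ∀ x > 0, x ^ k * Real.exp (-Real.pi * x ^ 2) ≤ C * x ^ (-r) := by
  obtain ⟨n, hn⟩ := exists_nat_ge (r + k)
  refine ⟨max 1 n.factorial, by positivity, fun x hx => ?_⟩
  have hx2 : x ^ k * Real.exp (-Real.pi * x ^ 2) =
      (x ^ (r + k) * Real.exp (-Real.pi * x ^ 2)) * x ^ (-r) := by
    rw [Real.rpow_add hx, Real.rpow_natCast, mul_right_comm, mul_right_comm (x ^ r),
      ← Real.rpow_add hx]
    simp
  rw [hx2]
  refine mul_le_mul_of_nonneg_right ?_ (Real.rpow_nonneg hx.le _)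
  rcases le_total x 1 with h1 | h1
  · refine le_trans ?_ (le_max_left _ _)
    have e1 : x ^ (r + k) ≤ 1 := Real.rpow_le_one hx.le h1 (by positivity)
    have e2 : Real.exp (-Real.pi * x ^ 2) ≤ 1 := by
      rw [Real.exp_le_one_iff]
      have := Real.pi_pos
      nlinarith [sq_nonneg x]
    exact mul_le_one₀ e1 (Real.exp_pos _).le e2
  · refine le_trans ?_ (le_max_right _ _)
    have hpi : 1 ≤ Real.pi := by linarith [Real.pi_gt_three]
    have e1 : x ^ (r + k) ≤ (Real.pi * x ^ 2) ^ n := by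
      calc x ^ (r + k) ≤ x ^ (n : ℝ) := Real.rpow_le_rpow_of_exponent_le h1 hn
        _ = x ^ n := Real.rpow_natCast _ _
        _ ≤ (Real.pi * x ^ 2) ^ n := by
          refine pow_le_pow_left₀ hx.le ?_ n
          nlinarith [sq_nonneg x]
    have e2 := Real.pow_div_factorial_le_exp (Real.pi * x ^ 2) (by positivity) n
    rw [div_le_iff₀ (by positivity)] at e2
    rw [neg_mul, Real.exp_neg, ← div_eq_mul_inv, div_le_iff₀ (Real.exp_pos _)]
    linarith

/-- One negative power bounds the Gaussian on all of (0, ∞), and its exponent may be chosen as large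
as desired. This is the only decay used: small exponents serve near v = 0 and large ones at
infinity. -/
lemma exists_gau_bound (p : Parity) {r : ℝ} (hr : 0 ≤ r) :
    ∃ C, 0 < C ∧ ∀ x > 0, ‖gau p x‖ ≤ C * x ^ (-r) := by
  cases p
  · obtain ⟨C, hC, h⟩ := exists_gauss_bound 0 hr
    refine ⟨C, hC, fun x hx => ?_⟩
    have := h x hx
    rwa [pow_zero, one_mul, ← Real.norm_of_nonneg (Real.exp_pos _).le, ← Complex.norm_real] at this
  · obtain ⟨C, hC, h⟩ := exists_gauss_bound 1 hr
    refine ⟨C, hC, fun x hx => ?_⟩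
    have := h x hx
    rwa [pow_one, ← Real.norm_of_nonneg (mul_pos hx (Real.exp_pos _)).le,
      ← Complex.norm_real] at this

/-! ### Gaussians and the Fourier transform -/

lemma integral_wave_mul_gau (p : Parity) (t : ℝ) : ∫ x, wave p (t * x) * gau p x = gau p t := by
  have hev : ∀ t, ∫ x, wave .even (t * x) * gau .even x = gau .even t := by
    intro t
    rw [← parUnit_mul_fourier (integrable_gau _) (gau_neg _)]
    have h := fourier_gaussian_pi (b := 1) (by simp)
    have h2 : (fun x : ℝ => Complex.exp (-Real.pi * 1 * x ^ 2)) = gau .even := by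
      funext x
      simp [gau]
    rw [h2] at h
    rw [h]
    simp [parUnit, gau]
  cases p
  · exact hev t
  · have hpi : (Real.pi : ℂ) ≠ 0 := by exact_mod_cast Real.pi_ne_zero
    have hw : ∀ x, HasDerivAt (fun x => wave .odd (t * x)) (2 * Real.pi * t * wave .even (t * x)) x := by
      intro x
      have h1 : HasDerivAt (fun x : ℝ => t * x) t x := by
        simpa using (hasDerivAt_id x).const_mul t
      refine ((hasDerivAt_wave .odd (t * x)).scomp x h1).congr_deriv ?_
      rw [Complex.real_smul]
      simp only [waveD, wave, trig]
      push_cast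
      ring
    have hg : ∀ x, gauD .even x = -(2 * Real.pi) * gau .odd x := by
      intro x
      simp only [gauD, gau]
      push_cast
      ring
    have hi1 := integrable_wave_mul .odd t (integrable_gau .odd)
    have hi2 := integrable_wave_mul .odd t (integrable_gau .even)
    have hi3 := integrable_wave_mul .even t (integrable_gau .even)
    -- The odd Gaussian is -1/(2π) times the derivative of the even one; integration by parts
    -- reduces the sine transform to the cosine transform.
    have key := integral_mul_deriv_eq_deriv_mul_of_integrable (u := fun x => wave .odd (t * x))
      (v := gau .even) (v' := gauD .even) (fun x _ => hw x) (fun x _ => hasDerivAt_gau .even x)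
      ((hi1.const_mul (-(2 * Real.pi) : ℂ)).congr (Filter.Eventually.of_forall fun x => by
        simp only [Pi.mul_apply, hg]; ring))
      ((hi3.const_mul (2 * Real.pi * t : ℂ)).congr (Filter.Eventually.of_forall fun x => by
        simp only [Pi.mul_apply]; ring)) hi2
    have e1 : ∫ x, wave .odd (t * x) * gauD .even x =
        -(2 * Real.pi) * ∫ x, wave .odd (t * x) * gau .odd x := by
      rw [← integral_const_mul]
      refine integral_congr_ae (Filter.Eventually.of_forall fun x => ?_)
      simp only [hg]
      ring
    have e2 : ∫ x, 2 * Real.pi * t * wave .even (t * x) * gau .even x =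
        2 * Real.pi * t * gau .even t := by
      rw [← hev t, ← integral_const_mul]
      refine integral_congr_ae (Filter.Eventually.of_forall fun x => ?_)
      simp only
      ring
    rw [e1, e2] at key
    have e3 : gau .odd t = t * gau .even t := by simp [gau]
    rw [e3]
    have h2pi : (2 * Real.pi : ℂ) ≠ 0 := mul_ne_zero two_ne_zero hpi
    refine mul_left_cancel₀ h2pi ?_
    linear_combination -key

lemma integral_wave_mul_gau_mul (p : Parity) (t : ℝ) {v : ℝ} (hv : 0 < v) :
    ∫ x, wave p (t * x) * gau p (v * x) = (v : ℂ)⁻¹ * gau p (t / v) := by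
  have h := Measure.integral_comp_mul_left (fun x => wave p (t / v * x) * gau p x) v
  rw [integral_wave_mul_gau, abs_of_pos (inv_pos.2 hv), Complex.real_smul] at h
  rw [← Complex.ofReal_inv, ← h]
  refine integral_congr_ae (Filter.Eventually.of_forall fun x => ?_)
  simp only
  congr 2
  field_simp

/-! ### The functional equation -/

/-- The functional `X ↦ X(a) + σ ∫_a^∞ φ_a(t) X(t) dt`. -/
def coreFun (p : Parity) (σ a : ℝ) (X : ℝ → ℂ) : ℂ :=
  X a + σ * ∫ t in Set.Ioi a, (phi p σ a t : ℂ) * X t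

section

variable {p : Parity} {σ a : ℝ}

lemma integral_eq_of_even {f : ℝ → ℂ} (ha : 0 < a) (hf : ∀ x, f (-x) = f x) (hi : Integrable f) :
    2 * ∫ x in Set.Ioi a, f x = (∫ x, f x) - ∫ x in (-a)..a, f x := by
  have h1 : ∫ x in Set.Iic (-a), f x = ∫ x in Set.Ioi a, f x := by
    rw [← integral_comp_neg_Ioi]
    simp only [hf]
  rw [intervalIntegral.integral_of_le (by linarith), ← integral_add_compl measurableSet_Ioc hi]
  have h2 : (Set.Ioc (-a) a)ᶜ = Set.Iic (-a) ∪ Set.Ioi a := by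
    ext x
    simp only [Set.mem_compl_iff, Set.mem_Ioc, Set.mem_union, Set.mem_Iic, Set.mem_Ioi, not_and_or,
      not_lt, not_le]
  rw [h2, setIntegral_union (Set.disjoint_left.2 fun x hx hx' => by
    simp only [Set.mem_Iic, Set.mem_Ioi] at hx hx'; linarith) measurableSet_Ioi hi.integrableOn
    hi.integrableOn, h1]
  ring

lemma phi_mul_even (hσ : σ ^ 2 = 1) (ha : 0 < a) {X : ℝ → ℂ} (hX : ∀ x, X (-x) = parSign p * X x)
    (x : ℝ) : (phi p σ a (-x) : ℂ) * X (-x) = phi p σ a x * X x := by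
  rw [phi_neg hσ ha, hX]
  linear_combination (phi p σ a x * X x) * parSign_mul_self p

/-- The eigenvalue equation of `coreDist` tested on a Gaussian, whose transform is a Gaussian of
inverse width: the functional equation of a theta function. -/
lemma coreFun_gau_inv (hσ : σ ^ 2 = 1) (ha : 0 < a) {v : ℝ} (hv : 0 < v) :
    coreFun p σ a (fun t => gau p (v⁻¹ * t)) =
      σ * v * coreFun p σ a (fun t => gau p (v * t)) := by
  have hφ : Continuous fun t => (phi p σ a t : ℂ) :=
    Complex.continuous_ofReal.comp (continuous_phi hσ ha)
  have hσc : (σ : ℂ) * σ = 1 := by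
    have : σ * σ = 1 := by rw [← sq, hσ]
    exact_mod_cast this
  -- The integral over the whole line is rewritten by `integral_phi_mul`. In the result the terms
  -- for v and for v⁻¹ are exchanged, up to the factor σv, when v is replaced by v⁻¹.
  have key : ∀ v : ℝ, 0 < v → 2 * coreFun p σ a (fun t => gau p (v * t)) =
      2 * gau p (v * a) + 2 * σ * ((v : ℂ)⁻¹ * gau p (v⁻¹ * a)) -
        (v : ℂ)⁻¹ * (∫ t in (-a)..a, (phi p σ a t : ℂ) * gau p (v⁻¹ * t)) -
          σ * ∫ t in (-a)..a, (phi p σ a t : ℂ) * gau p (v * t) := by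
    intro v hv
    have hi := integrable_gau_mul p hv.ne'
    have h1 := integral_eq_of_even (f := fun t => (phi p σ a t : ℂ) * gau p (v * t)) ha
      (phi_mul_even (X := fun t => gau p (v * t)) hσ ha fun x => by rw [mul_neg, gau_neg])
      (integrable_phi_mul hσ ha hi)
    rw [integral_phi_mul hσ ha hi] at h1
    simp_rw [integral_wave_mul_gau_mul p _ hv] at h1
    have h2 : ∫ t in (-a)..a, (phi p σ a t : ℂ) * ((v : ℂ)⁻¹ * gau p (t / v)) =
        (v : ℂ)⁻¹ * ∫ t in (-a)..a, (phi p σ a t : ℂ) * gau p (v⁻¹ * t) := by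
      rw [← intervalIntegral.integral_const_mul]
      refine intervalIntegral.integral_congr fun t _ => ?_
      rw [div_eq_inv_mul]
      ring
    rw [h2, div_eq_inv_mul] at h1
    rw [coreFun]
    linear_combination σ * h1 - (v : ℂ)⁻¹ *
      (∫ t in (-a)..a, (phi p σ a t : ℂ) * gau p (v⁻¹ * t)) * hσc
  have k1 := key v hv
  have k2 := key v⁻¹ (inv_pos.2 hv)
  rw [inv_inv, Complex.ofReal_inv, inv_inv] at k2
  have hv0 : (v : ℂ) * (v : ℂ)⁻¹ = 1 := mul_inv_cancel₀ (by exact_mod_cast hv.ne')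
  refine mul_left_cancel₀ (two_ne_zero (α := ℂ)) ?_
  linear_combination k2 - σ * v * k1 +
    (-(2 * gau p (v⁻¹ * a)) * (σ * σ) + σ * (∫ t in (-a)..a, (phi p σ a t : ℂ) * gau p (v⁻¹ * t))) * hv0
      + (-(2 * gau p (v⁻¹ * a)) + v * (∫ t in (-a)..a, (phi p σ a t : ℂ) * gau p (v * t))) * hσc

end

/-! ### Incomplete Mellin transforms of Gaussians -/

/-- `∫_t^∞ G(w) w^{s-1} dw` for the Gaussian `G`. -/
def incMellin (p : Parity) (s : ℂ) (t : ℝ) : ℂ := ∫ w in Set.Ioi t, (w : ℂ) ^ (s - 1) * gau p w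

/-- The function `2 ∫_1^∞ G(tv) (v^{s-1} + σ v^{-s}) dv` for the Gaussian `G`. -/
def cutPow (p : Parity) (σ : ℝ) (s : ℂ) (t : ℝ) : ℂ :=
  2 * ((t : ℂ) ^ (-s) * incMellin p s t + σ * ((t : ℂ) ^ (s - 1) * incMellin p (1 - s) t))

lemma norm_cpow_mul_gau_le {p : Parity} {C r : ℝ} (h : ∀ x > 0, ‖gau p x‖ ≤ C * x ^ (-r)) (s : ℂ)
    {w : ℝ} (hw : 0 < w) : ‖(w : ℂ) ^ s * gau p w‖ ≤ C * w ^ (s.re - r) := by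
  rw [norm_mul, Complex.norm_cpow_eq_rpow_re_of_pos hw]
  refine (mul_le_mul_of_nonneg_left (h w hw) (Real.rpow_nonneg hw.le _)).trans (le_of_eq ?_)
  rw [mul_left_comm, ← Real.rpow_add hw, sub_eq_add_neg]

lemma continuousOn_cpow_mul_gau (p : Parity) (s : ℂ) :
    ContinuousOn (fun w : ℝ => (w : ℂ) ^ s * gau p w) (Set.Ioi 0) := by
  refine ContinuousOn.mul (fun w hw => ?_) (continuous_gau p).continuousOn
  exact (Complex.continuousAt_ofReal_cpow_const w s (Or.inr (ne_of_gt hw))).continuousWithinAt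

lemma integrableOn_cpow_mul_gau (p : Parity) (s : ℂ) {t : ℝ} (ht : 0 < t) :
    IntegrableOn (fun w : ℝ => (w : ℂ) ^ s * gau p w) (Set.Ioi t) := by
  obtain ⟨C, hC, h⟩ := exists_gau_bound p (r := max 0 (s.re + 2)) (le_max_left _ _)
  have h2 : s.re - max 0 (s.re + 2) < -1 := by
    have := le_max_right 0 (s.re + 2)
    linarith
  refine ((integrableOn_Ioi_rpow_of_lt h2 ht).const_mul C).mono'
    (((continuousOn_cpow_mul_gau p s).mono (Set.Ioi_subset_Ioi ht.le)).aestronglyMeasurable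
      measurableSet_Ioi) ?_
  refine (ae_restrict_iff' measurableSet_Ioi).2 (Filter.Eventually.of_forall fun w hw => ?_)
  exact norm_cpow_mul_gau_le h s (ht.trans hw)

lemma hasDerivAt_incMellin (p : Parity) (s : ℂ) {t : ℝ} (ht : 0 < t) :
    HasDerivAt (incMellin p s) (-((t : ℂ) ^ (s - 1) * gau p t)) t := by
  have hc := continuousOn_cpow_mul_gau p (s - 1)
  have h0 : 0 < t / 2 := by linarith
  have h1 : ∀ x ∈ Set.Ioi (t / 2), incMellin p s x = incMellin p s (t / 2) -
      ∫ w in (t / 2)..x, (w : ℂ) ^ (s - 1) * gau p w := by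
    intro x hx
    rw [incMellin, incMellin, ← intervalIntegral.integral_Ioi_sub_Ioi'
      (integrableOn_cpow_mul_gau p _ h0) (integrableOn_cpow_mul_gau p _ (h0.trans hx))]
    ring
  have h2 : HasDerivAt (fun x => ∫ w in (t / 2)..x, (w : ℂ) ^ (s - 1) * gau p w)
      ((t : ℂ) ^ (s - 1) * gau p t) t := by
    refine intervalIntegral.integral_hasDerivAt_right ?_ ?_ (hc.continuousAt (Ioi_mem_nhds ht))
    · refine (hc.mono ?_).intervalIntegrable
      rw [Set.uIcc_of_le (by linarith)]
      exact fun x hx => h0.trans_le hx.1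
    · exact hc.stronglyMeasurableAtFilter isOpen_Ioi t ht
  refine (h2.const_sub (incMellin p s (t / 2))).congr_of_eventuallyEq ?_
  filter_upwards [Ioi_mem_nhds (by linarith : t / 2 < t)] with x hx
  exact h1 x hx

lemma norm_incMellin_le {p : Parity} {C r : ℝ} (h : ∀ x > 0, ‖gau p x‖ ≤ C * x ^ (-r)) {s : ℂ}
    (hr : s.re < r) {t : ℝ} (ht : 0 < t) :
    ‖incMellin p s t‖ ≤ C / (r - s.re) * t ^ (s.re - r) := by
  have h2 : (s - 1).re - r < -1 := by
    simp only [Complex.sub_re, Complex.one_re]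
    linarith
  have h3 := norm_integral_le_of_norm_le ((integrableOn_Ioi_rpow_of_lt h2 ht).const_mul C)
    ((ae_restrict_iff' measurableSet_Ioi).2 (Filter.Eventually.of_forall fun w hw =>
      norm_cpow_mul_gau_le h (s - 1) (ht.trans hw)))
  rw [integral_const_mul, integral_Ioi_rpow_of_lt h2 ht] at h3
  refine h3.trans (le_of_eq ?_)
  have e : (s - 1).re - r + 1 = s.re - r := by
    simp only [Complex.sub_re, Complex.one_re]
    ring
  have hne : r - s.re ≠ 0 := by linarith
  have hne' : s.re - r ≠ 0 := by linarith
  rw [e]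
  field_simp
  ring

/-- The derivative of `cutPow`, multiplied by the variable. -/
lemma hasDerivAt_cutPow (p : Parity) (σ : ℝ) (s : ℂ) {t : ℝ} (ht : 0 < t) :
    HasDerivAt (cutPow p σ s)
      (((1 / 2 - s) * cutPow p (-σ) s t - 2 * (1 + σ) * gau p t - (1 / 2) * cutPow p σ s t) / t)
      t := by
  have htc : (t : ℂ) ≠ 0 := by exact_mod_cast ht.ne'
  have hp : ∀ c : ℂ, HasDerivAt (fun x : ℝ => (x : ℂ) ^ c) (c * (t : ℂ) ^ (c - 1)) t := by
    intro c
    have h1 : HasDerivAt (fun z : ℂ => z ^ c) (c * (t : ℂ) ^ (c - 1) * 1) t :=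
      (hasDerivAt_id (t : ℂ)).cpow_const (Complex.ofReal_mem_slitPlane.2 ht)
    rw [mul_one] at h1
    exact h1.comp_ofReal
  have h := (((hp (-s)).mul (hasDerivAt_incMellin p s ht)).add
    (((hp (s - 1)).mul (hasDerivAt_incMellin p (1 - s) ht)).const_mul (σ : ℂ))).const_mul (2 : ℂ)
  -- Under t d/dt the powers t^{-s} and t^{s-1} acquire the factors -s = (1/2 - s) - 1/2 and s - 1 =
  -- -(1/2 - s) - 1/2. The opposite signs of 1/2 - s are what exchanges σ and -σ.
  refine h.congr_deriv ?_
  have e1 : (t : ℂ) ^ (-s) * (t : ℂ) ^ (s - 1) = (t : ℂ)⁻¹ := by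
    rw [← Complex.cpow_add _ _ htc, ← Complex.cpow_neg_one]
    congr 1
    ring
  have e2 : (t : ℂ) ^ (s - 1) * (t : ℂ) ^ (1 - s - 1) = (t : ℂ)⁻¹ := by
    rw [← Complex.cpow_add _ _ htc, ← Complex.cpow_neg_one]
    congr 1
    ring
  have e3 : (t : ℂ) ^ (-s - 1) = (t : ℂ) ^ (-s) * (t : ℂ)⁻¹ := by
    rw [Complex.cpow_sub _ _ htc, Complex.cpow_one, div_eq_mul_inv]
  have e4 : (t : ℂ) ^ (s - 1 - 1) = (t : ℂ) ^ (s - 1) * (t : ℂ)⁻¹ := by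
    rw [Complex.cpow_sub _ 1 htc, Complex.cpow_one, div_eq_mul_inv]
  simp only [cutPow, Complex.ofReal_neg, e3, e4, div_eq_mul_inv _ (t : ℂ)]
  linear_combination (-2 * gau p t) * e1 + (-2 * σ * gau p t) * e2

lemma exists_cutPow_bound (p : Parity) (σ : ℝ) (s : ℂ) {r : ℝ} (h0 : 0 ≤ r) (h1 : s.re < r)
    (h2 : 1 - s.re < r) : ∃ C, 0 ≤ C ∧ ∀ t > 0, ‖cutPow p σ s t‖ ≤ C * t ^ (-r) := by
  obtain ⟨C, hC, h⟩ := exists_gau_bound p h0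
  have h2' : (1 - s).re < r := by simpa using h2
  have hp1 : 0 < r - s.re := by linarith
  have hp2 : 0 < r - (1 - s).re := by linarith
  refine ⟨2 * (C / (r - s.re) + |σ| * (C / (r - (1 - s).re))), by positivity, fun t ht => ?_⟩
  have b1 := norm_incMellin_le h h1 ht
  have b2 := norm_incMellin_le h h2' ht
  have e1 : ‖(t : ℂ) ^ (-s) * incMellin p s t‖ ≤ C / (r - s.re) * t ^ (-r) := by
    rw [norm_mul, Complex.norm_cpow_eq_rpow_re_of_pos ht]
    refine (mul_le_mul_of_nonneg_left b1 (Real.rpow_nonneg ht.le _)).trans (le_of_eq ?_)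
    rw [mul_left_comm, ← Real.rpow_add ht, Complex.neg_re]
    congr 2
    ring
  have e2 : ‖(t : ℂ) ^ (s - 1) * incMellin p (1 - s) t‖ ≤ C / (r - (1 - s).re) * t ^ (-r) := by
    rw [norm_mul, Complex.norm_cpow_eq_rpow_re_of_pos ht]
    refine (mul_le_mul_of_nonneg_left b2 (Real.rpow_nonneg ht.le _)).trans (le_of_eq ?_)
    rw [mul_left_comm, ← Real.rpow_add ht]
    congr 2
    simp only [Complex.sub_re, Complex.one_re]
    ring
  have e3 : ‖(σ : ℂ) * ((t : ℂ) ^ (s - 1) * incMellin p (1 - s) t)‖ ≤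
      |σ| * (C / (r - (1 - s).re) * t ^ (-r)) := by
    rw [norm_mul, Complex.norm_real, Real.norm_eq_abs]
    exact mul_le_mul_of_nonneg_left e2 (abs_nonneg σ)
  rw [cutPow, norm_mul, Complex.norm_ofNat]
  refine (mul_le_mul_of_nonneg_left ((norm_add_le _ _).trans (add_le_add e1 e3)) (by norm_num)).trans
    (le_of_eq ?_)
  ring

lemma cutPow_one_sub {p : Parity} {σ : ℝ} (hσ : σ ^ 2 = 1) (s : ℂ) (t : ℝ) :
    cutPow p σ (1 - s) t = σ * cutPow p σ s t := by
  have hσc : (σ : ℂ) * σ = 1 := by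
    have : σ * σ = 1 := by rw [← sq, hσ]
    exact_mod_cast this
  have e1 : -(1 - s) = s - 1 := by ring
  have e2 : 1 - s - 1 = -s := by ring
  have e3 : 1 - (1 - s) = s := by ring
  simp only [cutPow, e1, e2, e3]
  linear_combination (-2 * ((t : ℂ) ^ (s - 1) * incMellin p (1 - s) t)) * hσc

lemma star_cpow_ofReal {t : ℝ} (ht : 0 < t) (c : ℂ) : star ((t : ℂ) ^ c) = (t : ℂ) ^ (star c) := by
  simp only [Complex.star_def]
  rw [Complex.cpow_conj _ _ (by
    rw [Complex.arg_ofReal_of_nonneg ht.le]; exact Real.pi_pos.ne), Complex.conj_ofReal]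

lemma star_integral (m : Measure ℝ) (f : ℝ → ℂ) : star (∫ x, f x ∂m) = ∫ x, star (f x) ∂m :=
  integral_conj.symm

lemma star_incMellin (p : Parity) (s : ℂ) {t : ℝ} (ht : 0 < t) :
    star (incMellin p s t) = incMellin p (star s) t := by
  rw [incMellin, star_integral, incMellin]
  refine setIntegral_congr_fun measurableSet_Ioi fun w hw => ?_
  simp only [star_mul', star_gau]
  rw [star_cpow_ofReal (ht.trans hw), star_sub, star_one]

lemma star_cutPow (p : Parity) (σ : ℝ) (s : ℂ) {t : ℝ} (ht : 0 < t) :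
    star (cutPow p σ s t) = cutPow p σ (star s) t := by
  have h2 : star (2 : ℂ) = 2 := Complex.conj_ofNat 2
  have hσ : star (σ : ℂ) = σ := Complex.conj_ofReal σ
  simp only [cutPow, star_mul', star_add, h2, hσ, star_cpow_ofReal ht, star_incMellin p _ ht,
    star_neg, star_sub, star_one]

/-! ### Theta functions and their Mellin transforms -/

/-- `h` is a density with respect to the measure `m` on `[a, ∞)`, for which `t ^ (-r)` is
integrable. -/
structure IsMellinDensity (m : Measure ℝ) (h : ℝ → ℂ) (a r : ℝ) : Prop where
  pos : 0 < a
  nonneg : 0 ≤ r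
  le : ∀ᵐ t ∂m, a ≤ t
  meas : AEStronglyMeasurable h m
  int : Integrable (fun t => ‖h t‖ * t ^ (-r)) m

/-- The theta function `2 ∫ h(t) G(vt) dm(t)`. -/
def theta (p : Parity) (m : Measure ℝ) (h : ℝ → ℂ) (v : ℝ) : ℂ := 2 * ∫ t, h t * gau p (v * t) ∂m

section

variable {m : Measure ℝ} {h : ℝ → ℂ} {a r : ℝ} {p : Parity}

lemma IsMellinDensity.ae_pos (H : IsMellinDensity m h a r) : ∀ᵐ t ∂m, 0 < t := by
  filter_upwards [H.le] with t ht using H.pos.trans_le ht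

lemma IsMellinDensity.mono (H : IsMellinDensity m h a r) {r' : ℝ} (hr : r ≤ r') :
    IsMellinDensity m h a r' := by
  refine ⟨H.pos, H.nonneg.trans hr, H.le, H.meas, ?_⟩
  refine (H.int.const_mul (a ^ (r - r'))).mono' ?_ ?_
  · exact H.meas.norm.mul (by fun_prop : Measurable fun t : ℝ => t ^ (-r')).aestronglyMeasurable
  · filter_upwards [H.le] with t ht
    have ht0 := H.pos.trans_le ht
    rw [norm_mul, norm_norm, Real.norm_of_nonneg (Real.rpow_nonneg ht0.le _), mul_left_comm]
    refine mul_le_mul_of_nonneg_left ?_ (norm_nonneg _)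
    have e : t ^ (-r') = t ^ (r - r') * t ^ (-r) := by
      rw [← Real.rpow_add ht0]
      congr 1
      ring
    rw [e]
    exact mul_le_mul_of_nonneg_right (Real.rpow_le_rpow_of_nonpos H.pos ht (by linarith))
      (Real.rpow_nonneg ht0.le _)

lemma IsMellinDensity.aestronglyMeasurable_of_continuousOn (H : IsMellinDensity m h a r)
    {X : ℝ → ℂ} (hX : ContinuousOn X (Set.Ioi 0)) : AEStronglyMeasurable X m := by
  rw [← Measure.restrict_eq_self_of_ae_mem (s := Set.Ioi 0) (μ := m) H.ae_pos]
  exact hX.aestronglyMeasurable measurableSet_Ioi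

lemma IsMellinDensity.integrable_mul (H : IsMellinDensity m h a r) {X : ℝ → ℂ} {C : ℝ}
    (hX : ContinuousOn X (Set.Ioi 0)) (hb : ∀ t > 0, ‖X t‖ ≤ C * t ^ (-r)) :
    Integrable (fun t => h t * X t) m := by
  refine (H.int.const_mul C).mono' (H.meas.mul (H.aestronglyMeasurable_of_continuousOn hX)) ?_
  filter_upwards [H.ae_pos] with t ht
  rw [norm_mul, mul_left_comm]
  exact mul_le_mul_of_nonneg_left (hb t ht) (norm_nonneg _)

lemma norm_gau_mul_le {C : ℝ} (h : ∀ x > 0, ‖gau p x‖ ≤ C * x ^ (-r)) {v t : ℝ} (hv : 0 < v)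
    (ht : 0 < t) : ‖gau p (v * t)‖ ≤ C * v ^ (-r) * t ^ (-r) := by
  refine (h _ (mul_pos hv ht)).trans (le_of_eq ?_)
  rw [Real.mul_rpow hv.le ht.le, mul_assoc]

lemma IsMellinDensity.norm_theta_le (H : IsMellinDensity m h a r) {C : ℝ}
    (hC : ∀ x > 0, ‖gau p x‖ ≤ C * x ^ (-r)) {v : ℝ} (hv : 0 < v) :
    ‖theta p m h v‖ ≤ 2 * (C * v ^ (-r) * ∫ t, ‖h t‖ * t ^ (-r) ∂m) := by
  rw [theta, norm_mul, Complex.norm_ofNat]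
  refine mul_le_mul_of_nonneg_left ?_ zero_le_two
  rw [← integral_const_mul]
  refine norm_integral_le_of_norm_le (H.int.const_mul _) ?_
  filter_upwards [H.ae_pos] with t ht
  rw [norm_mul, mul_left_comm]
  exact mul_le_mul_of_nonneg_left (norm_gau_mul_le hC hv ht) (norm_nonneg _)

lemma IsMellinDensity.continuousOn_theta (H : IsMellinDensity m h a r) :
    ContinuousOn (theta p m h) (Set.Ioi 0) := by
  obtain ⟨C, hC, hb⟩ := exists_gau_bound p H.nonneg
  intro v hv
  refine ContinuousAt.continuousWithinAt (continuousAt_const.mul ?_)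
  have hv0 : 0 < v / 2 := half_pos hv
  refine continuousAt_of_dominated (bound := fun t => C * (v / 2) ^ (-r) * (‖h t‖ * t ^ (-r)))
    ?_ ?_ (H.int.const_mul _) ?_
  · exact Filter.Eventually.of_forall fun x => H.meas.mul
      (by fun_prop : Continuous fun t => gau p (x * t)).aestronglyMeasurable
  · filter_upwards [Ioi_mem_nhds (half_lt_self hv : v / 2 < v)] with x hx
    filter_upwards [H.ae_pos] with t ht
    have hx0 : 0 < x := hv0.trans hx
    rw [norm_mul, mul_left_comm]
    refine mul_le_mul_of_nonneg_left ((norm_gau_mul_le hb hx0 ht).trans ?_) (norm_nonneg _)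
    refine mul_le_mul_of_nonneg_right ?_ (Real.rpow_nonneg ht.le _)
    exact mul_le_mul_of_nonneg_left
      (Real.rpow_le_rpow_of_nonpos hv0 (le_of_lt hx) (by linarith [H.nonneg])) hC.le
  · exact Filter.Eventually.of_forall fun t => by fun_prop

lemma IsMellinDensity.theta_isBigO (H : IsMellinDensity m h a r) (k : ℝ) :
    (theta p m h · - 0) =O[Filter.atTop] (· ^ k) := by
  have H' := H.mono (le_max_left r (-k))
  obtain ⟨C, hC, hb⟩ := exists_gau_bound p H'.nonneg
  refine Asymptotics.IsBigO.of_bound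
    (2 * (C * ∫ t, ‖h t‖ * t ^ (-max r (-k)) ∂m)) ?_
  filter_upwards [Filter.eventually_ge_atTop 1] with v hv
  have hv0 : 0 < v := one_pos.trans_le hv
  rw [sub_zero, Real.norm_of_nonneg (Real.rpow_nonneg hv0.le _)]
  refine (H'.norm_theta_le hb hv0).trans ?_
  have h1 : v ^ (-max r (-k)) ≤ v ^ k :=
    Real.rpow_le_rpow_of_exponent_le hv (by linarith [le_max_right r (-k)])
  have h2 : 0 ≤ ∫ t, ‖h t‖ * t ^ (-max r (-k)) ∂m := integral_nonneg_of_ae <| by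
    filter_upwards [H.ae_pos] with t ht
    have := Real.rpow_nonneg ht.le (-max r (-k))
    positivity
  calc _ = 2 * (C * ∫ t, ‖h t‖ * t ^ (-max r (-k)) ∂m) * v ^ (-max r (-k)) := by ring
    _ ≤ _ := mul_le_mul_of_nonneg_left h1 (by positivity)

/-- Mellin transforms of theta functions with a functional equation are entire. -/
lemma IsMellinDensity.differentiable_mellin (H : IsMellinDensity m h a r) {σ : ℝ} (hσ : σ ^ 2 = 1)
    (hfe : ∀ v > 0, theta p m h v⁻¹ = σ * v * theta p m h v) :
    Differentiable ℂ (mellin (theta p m h)) := by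
  have hσ0 : (σ : ℂ) ≠ 0 := by
    intro h0
    rw [Complex.ofReal_eq_zero.1 h0] at hσ
    norm_num at hσ
  let P : WeakFEPair ℂ :=
    { f := theta p m h
      g := theta p m h
      k := 1
      ε := σ
      f₀ := 0
      g₀ := 0
      hf_int := H.continuousOn_theta.locallyIntegrableOn measurableSet_Ioi
      hg_int := H.continuousOn_theta.locallyIntegrableOn measurableSet_Ioi
      hk := one_pos
      hε := hσ0
      h_feq := fun x hx => by
        rw [one_div, hfe x hx, Real.rpow_one, smul_eq_mul]
      hf_top := H.theta_isBigO
      hg_top := H.theta_isBigO }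
  have hP : IsStrongFEPair P := ⟨rfl, rfl⟩
  have := hP.differentiable_Λ
  rwa [hP.Λ_eq] at this

lemma IsMellinDensity.integrable_prod (H : IsMellinDensity m h a r) {S : Set ℝ} {s : ℂ}
    (hm : MeasurableSet S) (hS : S ⊆ Set.Ioi 0)
    (hi : IntegrableOn (fun v : ℝ => v ^ (s.re - 1 - r)) S) :
    Integrable (Function.uncurry fun v t : ℝ => (v : ℂ) ^ (s - 1) * (h t * gau p (v * t)))
      ((volume.restrict S).prod m) := by
  obtain ⟨C, hC, hb⟩ := exists_gau_bound p H.nonneg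
  refine ((hi.const_mul C).mul_prod H.int).mono' ?_ ?_
  · refine AEStronglyMeasurable.mul (f := fun z : ℝ × ℝ => (z.1 : ℂ) ^ (s - 1)) ?_
      (AEStronglyMeasurable.mul (f := fun z : ℝ × ℝ => h z.2) H.meas.comp_snd
        (by fun_prop : Continuous fun z : ℝ × ℝ => gau p (z.1 * z.2)).aestronglyMeasurable)
    exact (by fun_prop : Measurable fun z : ℝ × ℝ => (z.1 : ℂ) ^ (s - 1)).aestronglyMeasurable
  · filter_upwards [Measure.quasiMeasurePreserving_fst.ae (ae_restrict_mem hm),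
      Measure.quasiMeasurePreserving_snd.ae H.ae_pos] with z hz hz'
    have hz1 : 0 < z.1 := hS hz
    simp only [Function.uncurry]
    rw [norm_mul, norm_mul, Complex.norm_cpow_eq_rpow_re_of_pos hz1]
    have e : z.1 ^ (s.re - 1 - r) = z.1 ^ ((s - 1).re) * z.1 ^ (-r) := by
      rw [← Real.rpow_add hz1]
      simp [sub_eq_add_neg]
    rw [e]
    calc _ ≤ z.1 ^ ((s - 1).re) * (‖h z.2‖ * (C * z.1 ^ (-r) * z.2 ^ (-r))) :=
          mul_le_mul_of_nonneg_left (mul_le_mul_of_nonneg_left (norm_gau_mul_le hb hz1 hz')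
            (norm_nonneg _)) (Real.rpow_nonneg hz1.le _)
      _ = _ := by ring

variable [SFinite m]

/-- Fubini for a Mellin integral of the theta function over a part of the half-line. The exponent of
the density must suit the part: below Re s near 0, above Re s near infinity; `IsMellinDensity.mono`
allows it to be raised. -/
lemma IsMellinDensity.swap (H : IsMellinDensity m h a r) {S : Set ℝ} {s : ℂ}
    (hm : MeasurableSet S) (hS : S ⊆ Set.Ioi 0)
    (hi : IntegrableOn (fun v : ℝ => v ^ (s.re - 1 - r)) S) :
    IntegrableOn (fun v : ℝ => (v : ℂ) ^ (s - 1) * theta p m h v) S ∧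
    Integrable (fun t => h t * (2 * ∫ v in S, (v : ℂ) ^ (s - 1) * gau p (v * t))) m ∧
    ∫ v in S, (v : ℂ) ^ (s - 1) * theta p m h v =
      ∫ t, h t * (2 * ∫ v in S, (v : ℂ) ^ (s - 1) * gau p (v * t)) ∂m := by
  have key := H.integrable_prod (p := p) hm hS hi
  have e1 : ∀ v : ℝ, (v : ℂ) ^ (s - 1) * theta p m h v =
      2 * ∫ t, (v : ℂ) ^ (s - 1) * (h t * gau p (v * t)) ∂m := by
    intro v
    rw [theta, integral_const_mul]
    ring
  have e2 : ∀ t : ℝ, h t * (2 * ∫ v in S, (v : ℂ) ^ (s - 1) * gau p (v * t)) =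
      2 * ∫ v in S, (v : ℂ) ^ (s - 1) * (h t * gau p (v * t)) := by
    intro t
    rw [mul_left_comm, ← integral_const_mul (h t)]
    congr 2
    ext v
    ring
  simp_rw [e1, e2]
  refine ⟨key.integral_prod_left.const_mul 2, key.integral_prod_right.const_mul 2, ?_⟩
  rw [integral_const_mul, integral_const_mul, integral_integral_swap key]

end

lemma integral_cpow_mul_gau_mul (p : Parity) (s : ℂ) {t : ℝ} (ht : 0 < t) :
    ∫ v in Set.Ioi (1 : ℝ), (v : ℂ) ^ (s - 1) * gau p (v * t) = (t : ℂ) ^ (-s) * incMellin p s t := by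
  have h1 := integral_comp_mul_right_Ioi (fun w : ℝ => (w : ℂ) ^ (s - 1) * gau p w) 1 ht
  rw [one_mul] at h1
  have ht0 : (t : ℂ) ≠ 0 := by exact_mod_cast ht.ne'
  have h2 : ∫ v in Set.Ioi (1 : ℝ), ((v * t : ℝ) : ℂ) ^ (s - 1) * gau p (v * t) =
      (t : ℂ) ^ (s - 1) * ∫ v in Set.Ioi (1 : ℝ), (v : ℂ) ^ (s - 1) * gau p (v * t) := by
    rw [← integral_const_mul]
    refine setIntegral_congr_fun measurableSet_Ioi fun v hv => ?_
    have hv0 : (0 : ℝ) ≤ v := (one_pos.trans hv).le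
    rw [Complex.ofReal_mul, Complex.mul_cpow_ofReal_nonneg hv0 ht.le]
    ring
  rw [h2] at h1
  have h3 : (t : ℂ) ^ (-s) * (t : ℂ) ^ (s - 1) = (t : ℂ)⁻¹ := by
    rw [← Complex.cpow_add _ _ ht0, ← Complex.cpow_neg_one]
    congr 1
    ring
  have h4 : (t : ℂ) ^ (s - 1) ≠ 0 := by
    rw [Complex.cpow_ne_zero_iff]
    exact Or.inl ht0
  refine mul_left_cancel₀ h4 ?_
  rw [h1, incMellin, Complex.real_smul, Complex.ofReal_inv]
  linear_combination -(∫ w in Set.Ioi t, (w : ℂ) ^ (s - 1) * gau p w) * h3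

lemma mellin_gauss {s : ℂ} (hs : 0 < s.re) :
    2 * mellin (fun v : ℝ => ((Real.exp (-Real.pi * v ^ 2) : ℝ) : ℂ)) s = Complex.Gammaℝ s := by
  have h1 := mellin_comp_rpow (fun v : ℝ => ((Real.exp (-(Real.pi * v)) : ℝ) : ℂ)) s 2
  have h2 : 0 < (s / 2).re := by
    rw [Complex.div_ofNat_re]
    positivity
  have h3 := Complex.integral_cpow_mul_exp_neg_mul_Ioi h2 Real.pi_pos
  have h4 : mellin (fun v : ℝ => ((Real.exp (-(Real.pi * v)) : ℝ) : ℂ)) (s / 2) =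
      (1 / (Real.pi : ℂ)) ^ (s / 2) * Complex.Gamma (s / 2) := by
    rw [← h3, mellin]
    simp only [smul_eq_mul]
    push_cast
    rfl
  have h5 : mellin (fun v : ℝ => ((Real.exp (-Real.pi * v ^ 2) : ℝ) : ℂ)) s =
      mellin (fun v : ℝ => ((Real.exp (-(Real.pi * v ^ (2 : ℝ))) : ℝ) : ℂ)) s := by
    simp only [Real.rpow_two, neg_mul]
  rw [h5, h1, Complex.ofReal_ofNat, h4, Complex.Gammaℝ_def, one_div, Complex.inv_cpow, neg_div,
    Complex.cpow_neg, abs_two, Complex.real_smul]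
  · push_cast
    ring
  · rw [Complex.arg_ofReal_of_nonneg Real.pi_pos.le]
    exact Real.pi_pos.ne

lemma mellin_gau (p : Parity) {s : ℂ} (hs : 0 < s.re) : 2 * mellin (gau p) s = gammaFactor p s := by
  cases p
  · exact mellin_gauss hs
  · change _ = Complex.Gammaℝ (s + 1)
    rw [← mellin_gauss (s := s + 1) (by simp; linarith), ← mellin_cpow_smul]
    congr 2
    ext v
    simp [gau]

lemma integral_Ioi_cpow_mul_gau_mul (p : Parity) {s : ℂ} (hs : 0 < s.re) {t : ℝ} (ht : 0 < t) :
    2 * ∫ v in Set.Ioi (0 : ℝ), (v : ℂ) ^ (s - 1) * gau p (v * t) =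
      gammaFactor p s * (t : ℂ) ^ (-s) := by
  have h1 := mellin_comp_mul_right (gau p) s ht
  rw [mellin] at h1
  simp only [smul_eq_mul] at h1
  rw [h1, ← mellin_gau p hs]
  ring

section

variable {m : Measure ℝ} [SFinite m] {h : ℝ → ℂ} {a r : ℝ} {p : Parity}

lemma integrableOn_Ioi_one_rpow {s : ℝ} (hs : s < -1) :
    IntegrableOn (fun v : ℝ => v ^ s) (Set.Ioi 1) := integrableOn_Ioi_rpow_of_lt hs one_pos

/-- Integration in v first gives the Gamma factor times t^{-s}. The half-line is cut at v = 1
because no single power bound of the Gaussian is integrable at both ends. -/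
lemma IsMellinDensity.mellin_eq (H : IsMellinDensity m h a r) {s : ℂ} (hs : r < s.re) :
    mellin (theta p m h) s = gammaFactor p s * ∫ t, h t * (t : ℂ) ^ (-s) ∂m := by
  have hi0 : IntegrableOn (fun v : ℝ => v ^ (s.re - 1 - r)) (Set.Ioc 0 1) := by
    rw [← intervalIntegrable_iff_integrableOn_Ioc_of_le zero_le_one]
    exact intervalIntegral.intervalIntegrable_rpow' (by linarith)
  have hi1 : IntegrableOn (fun v : ℝ => v ^ (s.re - 1 - (s.re + 1))) (Set.Ioi 1) :=
    integrableOn_Ioi_one_rpow (by linarith)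
  obtain ⟨a1, b1, c1⟩ := H.swap (p := p) measurableSet_Ioc (fun v hv => hv.1) hi0
  obtain ⟨a2, b2, c2⟩ := (H.mono (by linarith : r ≤ s.re + 1)).swap (p := p) measurableSet_Ioi
    (Set.Ioi_subset_Ioi zero_le_one) hi1
  have hu : Set.Ioi (0 : ℝ) = Set.Ioc 0 1 ∪ Set.Ioi 1 := (Set.Ioc_union_Ioi_eq_Ioi zero_le_one).symm
  have hd : Disjoint (Set.Ioc (0 : ℝ) 1) (Set.Ioi 1) :=
    Set.disjoint_left.2 fun x hx hx' => not_lt.2 hx.2 hx'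
  rw [mellin]
  simp only [smul_eq_mul]
  rw [hu, setIntegral_union hd measurableSet_Ioi a1 a2, c1, c2, ← integral_add b1 b2,
    ← integral_const_mul]
  refine integral_congr_ae ?_
  filter_upwards [H.ae_pos] with t ht
  have hc : ContinuousOn (fun v : ℝ => (v : ℂ) ^ (s - 1) * gau p (v * t)) (Set.Ioi 0) := by
    refine ContinuousOn.mul (fun w hw => ?_) (by fun_prop)
    exact (Complex.continuousAt_ofReal_cpow_const w _ (Or.inr (ne_of_gt hw))).continuousWithinAt
  have hs0 : 0 < s.re := H.nonneg.trans_lt hs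
  have hint : IntegrableOn (fun v : ℝ => (v : ℂ) ^ (s - 1) * gau p (v * t)) (Set.Ioi 0) := by
    rw [hu]
    have aux : ∀ (S : Set ℝ) (R : ℝ), MeasurableSet S → S ⊆ Set.Ioi 0 → 0 ≤ R →
        IntegrableOn (fun v : ℝ => v ^ (s.re - 1 - R)) S →
        IntegrableOn (fun v : ℝ => (v : ℂ) ^ (s - 1) * gau p (v * t)) S := by
      intro S R hm hS hR hi
      obtain ⟨C, hC, hb⟩ := exists_gau_bound p hR
      refine (hi.mul_const (C * t ^ (-R))).mono' ((hc.mono hS).aestronglyMeasurable hm) ?_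
      filter_upwards [ae_restrict_mem hm] with v hv
      have hv0 : 0 < v := hS hv
      rw [norm_mul, Complex.norm_cpow_eq_rpow_re_of_pos hv0]
      refine (mul_le_mul_of_nonneg_left (norm_gau_mul_le hb hv0 ht)
        (Real.rpow_nonneg hv0.le _)).trans (le_of_eq ?_)
      have e : v ^ (s.re - 1 - R) = v ^ ((s - 1).re) * v ^ (-R) := by
        rw [← Real.rpow_add hv0]
        simp [sub_eq_add_neg]
      rw [e]
      ring
    exact (aux _ r measurableSet_Ioc (fun v hv => hv.1) H.nonneg hi0).union
      (aux _ (s.re + 1) measurableSet_Ioi (Set.Ioi_subset_Ioi zero_le_one) (by linarith) hi1)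
  have h3 := integral_Ioi_cpow_mul_gau_mul p hs0 ht
  rw [hu, setIntegral_union hd measurableSet_Ioi (hint.mono_set (fun v hv => hv.1))
    (hint.mono_set (Set.Ioi_subset_Ioi zero_le_one))] at h3
  linear_combination h t * h3

/-- The Mellin transform of a theta function with a functional equation, as an integral over
`v > 1`. -/
lemma IsMellinDensity.mellin_eq_cutPow (H : IsMellinDensity m h a r) {σ : ℝ}
    (hfe : ∀ v > 0, theta p m h v⁻¹ = σ * v * theta p m h v) (s : ℂ) :
    mellin (theta p m h) s = ∫ t, h t * cutPow p σ s t ∂m := by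
  have hstep : ∀ s : ℂ, IntegrableOn (fun v : ℝ => (v : ℂ) ^ (s - 1) * theta p m h v) (Set.Ioi 1) ∧
      Integrable (fun t => h t * (2 * ∫ v in Set.Ioi (1 : ℝ), (v : ℂ) ^ (s - 1) * gau p (v * t))) m ∧
      ∫ v in Set.Ioi (1 : ℝ), (v : ℂ) ^ (s - 1) * theta p m h v =
        ∫ t, h t * (2 * ∫ v in Set.Ioi (1 : ℝ), (v : ℂ) ^ (s - 1) * gau p (v * t)) ∂m := fun s =>
    (H.mono (le_max_left r (s.re + 1))).swap measurableSet_Ioi (Set.Ioi_subset_Ioi zero_le_one)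
      (integrableOn_Ioi_one_rpow (by linarith [le_max_right r (s.re + 1)]))
  obtain ⟨a1, b1, c1⟩ := hstep s
  obtain ⟨a2, b2, c2⟩ := hstep (1 - s)
  have hd : Disjoint (Set.Ioc (0 : ℝ) 1) (Set.Ioi 1) :=
    Set.disjoint_left.2 fun x hx hx' => not_lt.2 hx.2 hx'
  have hF : ∀ s : ℂ, mellin ((Set.Ioi 1).indicator (theta p m h)) s =
      ∫ v in Set.Ioi (1 : ℝ), (v : ℂ) ^ (s - 1) * theta p m h v := by
    intro s
    have : ∀ v : ℝ, (v : ℂ) ^ (s - 1) • (Set.Ioi 1).indicator (theta p m h) v =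
        (Set.Ioi 1).indicator (fun v : ℝ => (v : ℂ) ^ (s - 1) * theta p m h v) v := by
      intro v
      by_cases hv : v ∈ Set.Ioi 1 <;> simp [hv]
    simp_rw [mellin, this]
    rw [setIntegral_indicator measurableSet_Ioi, Set.inter_eq_right.2
      (Set.Ioi_subset_Ioi zero_le_one)]
  -- Riemann's trick: the substitution v ↦ 1/v and the functional equation turn the part v < 1 at s
  -- into σ times the part v > 1 at 1 - s.
  have hconv : MellinConvergent ((Set.Ioi 1).indicator (theta p m h)) s ∧
      MellinConvergent ((Set.Iio 1).indicator (theta p m h)) s ∧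
      mellin ((Set.Iio 1).indicator (theta p m h)) s =
        σ * mellin ((Set.Ioi 1).indicator (theta p m h)) (1 - s) := by
    have hc : ∀ s : ℂ, IntegrableOn (fun v : ℝ => (v : ℂ) ^ (s - 1) * theta p m h v) (Set.Ioi 1) →
        MellinConvergent ((Set.Ioi 1).indicator (theta p m h)) s := by
      intro s hs
      have : ∀ v : ℝ, (v : ℂ) ^ (s - 1) • (Set.Ioi 1).indicator (theta p m h) v =
          (Set.Ioi 1).indicator (fun v : ℝ => (v : ℂ) ^ (s - 1) * theta p m h v) v := by
        intro v
        by_cases hv : v ∈ Set.Ioi 1 <;> simp [hv]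
      simp_rw [MellinConvergent, this]
      exact ((integrable_indicator_iff measurableSet_Ioi).2 hs).integrableOn
    have e : Set.EqOn (fun v : ℝ => (Set.Iio 1).indicator (theta p m h) v⁻¹)
        (fun v : ℝ => (v : ℂ) ^ (1 : ℂ) • (σ : ℂ) • (Set.Ioi 1).indicator (theta p m h) v)
        (Set.Ioi 0) := by
      intro v hv
      have hv' : (0 : ℝ) < v := hv
      by_cases h1 : 1 < v
      · have h2 : v⁻¹ < 1 := inv_lt_one_of_one_lt₀ h1
        simp only [Set.indicator_of_mem (s := Set.Iio 1) (a := v⁻¹) h2,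
          Set.indicator_of_mem (s := Set.Ioi 1) (a := v) h1]
        rw [hfe v hv, Complex.cpow_one, smul_eq_mul, smul_eq_mul]
        ring
      · have h2 : v⁻¹ ∉ Set.Iio 1 := fun h3 => h1 ((inv_lt_one₀ hv').1 h3)
        simp [Set.indicator_of_notMem (s := Set.Iio 1) h2,
          Set.indicator_of_notMem (s := Set.Ioi 1) (a := v) h1]
    refine ⟨hc s a1, ?_, ?_⟩
    · have h1 : MellinConvergent (fun v : ℝ => (v : ℂ) ^ (1 : ℂ) • (σ : ℂ) •
          (Set.Ioi 1).indicator (theta p m h) v) (-s) := by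
        rw [MellinConvergent.cpow_smul]
        refine MellinConvergent.const_smul ?_ _
        rw [neg_add_eq_sub]
        exact hc _ a2
      have h2 : MellinConvergent (fun v : ℝ => (Set.Iio 1).indicator (theta p m h) v⁻¹) (-s) := by
        refine (integrableOn_congr_fun (fun v hv => ?_) measurableSet_Ioi).1 h1
        simp only [e hv]
      have h3 := (MellinConvergent.comp_rpow (f := (Set.Iio 1).indicator (theta p m h)) (s := -s)
        (a := -1) (by norm_num)).1 (by simpa only [Real.rpow_neg_one] using h2)
      simpa using h3
    · have h1 := mellin_comp_inv ((Set.Iio 1).indicator (theta p m h)) (-s)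
      rw [neg_neg] at h1
      rw [← h1, mellin, setIntegral_congr_fun measurableSet_Ioi (g := fun v : ℝ => (v : ℂ) ^ (-s - 1) •
        ((v : ℂ) ^ (1 : ℂ) • (σ : ℂ) • (Set.Ioi 1).indicator (theta p m h) v))
        (fun v hv => by simp only [e hv])]
      change mellin _ (-s) = _
      rw [mellin_cpow_smul, mellin_const_smul, neg_add_eq_sub, smul_eq_mul]
  obtain ⟨k1, k2, k3⟩ := hconv
  have hsum : mellin (theta p m h) s = mellin ((Set.Ioi 1).indicator (theta p m h)) s +
      mellin ((Set.Iio 1).indicator (theta p m h)) s := by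
    rw [mellin, mellin, mellin, ← integral_add k1 k2]
    refine integral_congr_ae ?_
    have h1 : ∀ᵐ v ∂(volume.restrict (Set.Ioi (0 : ℝ))), v ≠ 1 := ae_restrict_of_ae (by
      rw [ae_iff]; simp)
    filter_upwards [h1] with v hv
    rcases lt_or_gt_of_ne hv with h2 | h2
    · simp [h2, h2.le]
    · simp [h2, h2.le]
  rw [hsum, k3, hF, hF, c1, c2, ← integral_const_mul, ← integral_add b1 (b2.const_mul _)]
  refine integral_congr_ae ?_
  filter_upwards [H.ae_pos] with t ht
  rw [integral_cpow_mul_gau_mul p s ht, integral_cpow_mul_gau_mul p (1 - s) ht, cutPow, neg_sub]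
  ring

end

/-! ### The completed Mellin transforms of the distributions -/

/-- The measure `δ_a + dt` on `[a, ∞)`. -/
def coreMeas (a : ℝ) : Measure ℝ := Measure.dirac a + volume.restrict (Set.Ioi a)

instance (a : ℝ) : SFinite (coreMeas a) := by
  unfold coreMeas
  infer_instance

/-- The density of `coreFun` with respect to `coreMeas`. -/
def coreDens (p : Parity) (σ a : ℝ) (t : ℝ) : ℂ :=
  Function.update (fun t => (σ * phi p σ a t : ℂ)) a 1 t

/-- The entire function which is the completed Mellin transform of `coreFun`. -/
def xi (p : Parity) (σ a : ℝ) (s : ℂ) : ℂ := coreFun p σ a (cutPow p σ s)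

section

variable {p : Parity} {σ a : ℝ}

lemma continuous_phi_ofReal (hσ : σ ^ 2 = 1) (ha : 0 < a) :
    Continuous fun t => (phi p σ a t : ℂ) :=
  Complex.continuous_ofReal.comp (continuous_phi hσ ha)

lemma integrableOn_phi_mul (hσ : σ ^ 2 = 1) (ha : 0 < a) {X : ℝ → ℂ}
    (hX : IntegrableOn X (Set.Ioi a)) :
    IntegrableOn (fun t => (phi p σ a t : ℂ) * X t) (Set.Ioi a) := by
  obtain ⟨C, _, hC⟩ := exists_bound_phi (p := p) hσ ha
  exact Integrable.bdd_mul (c := C) hX (continuous_phi_ofReal hσ ha).aestronglyMeasurable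
    (Filter.Eventually.of_forall hC)

lemma coreDens_self : coreDens p σ a a = 1 := by simp [coreDens]

lemma coreDens_of_gt {t : ℝ} (ht : t ∈ Set.Ioi a) : coreDens p σ a t = σ * phi p σ a t := by
  rw [coreDens, Function.update_of_ne (ne_of_gt (Set.mem_Ioi.1 ht))]

lemma integral_coreMeas {X : ℝ → ℂ} (hX : Integrable X (coreMeas a)) :
    ∫ t, X t ∂(coreMeas a) = X a + ∫ t in Set.Ioi a, X t := by
  rw [coreMeas] at hX ⊢
  rw [integral_add_measure hX.left_of_add_measure hX.right_of_add_measure, integral_dirac]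

lemma integral_coreDens {X : ℝ → ℂ} (hX : Integrable (fun t => coreDens p σ a t * X t) (coreMeas a)) :
    ∫ t, coreDens p σ a t * X t ∂(coreMeas a) = coreFun p σ a X := by
  rw [integral_coreMeas hX, coreDens_self, one_mul, coreFun, ← integral_const_mul]
  congr 1
  refine setIntegral_congr_fun measurableSet_Ioi fun t ht => ?_
  simp only [coreDens_of_gt ht, mul_assoc]

/-- Only boundedness of φ_a on (a, ∞) is available, hence the exponent r > 1. -/
lemma isMellinDensity_coreDens (hσ : σ ^ 2 = 1) (ha : 0 < a) {r : ℝ} (hr : 1 < r) :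
    IsMellinDensity (coreMeas a) (coreDens p σ a) a r := by
  have hm : Measurable (coreDens p σ a) := by
    have h0 : coreDens p σ a = fun t => if t = a then 1 else (σ * phi p σ a t : ℂ) := by
      ext t
      simp [coreDens, Function.update_apply]
    rw [h0]
    exact Measurable.ite (measurableSet_singleton a) measurable_const
      (continuous_const.mul (continuous_phi_ofReal hσ ha)).measurable
  obtain ⟨C, _, hC⟩ := exists_bound_phi (p := p) hσ ha
  refine ⟨ha, by linarith, ?_, hm.aestronglyMeasurable, ?_⟩
  · rw [coreMeas, ae_add_measure_iff]
    refine ⟨?_, ?_⟩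
    · rw [ae_dirac_iff measurableSet_Ici]
    · filter_upwards [ae_restrict_mem measurableSet_Ioi] with t ht using le_of_lt ht
  · rw [coreMeas]
    refine Integrable.add_measure (integrable_dirac enorm_lt_top) ?_
    refine ((integrableOn_Ioi_rpow_of_lt (by linarith : -r < -1) ha).const_mul (|σ| * C)).mono'
      (hm.norm.mul (by fun_prop : Measurable fun t : ℝ => t ^ (-r))).aestronglyMeasurable ?_
    filter_upwards [ae_restrict_mem measurableSet_Ioi] with t ht
    have h0 : 0 ≤ t ^ (-r) := Real.rpow_nonneg (ha.trans ht).le _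
    rw [coreDens_of_gt ht, norm_mul, norm_norm, Real.norm_of_nonneg h0, norm_mul,
      Complex.norm_real, Real.norm_eq_abs]
    exact mul_le_mul_of_nonneg_right (mul_le_mul_of_nonneg_left (hC t) (abs_nonneg σ)) h0

lemma continuousOn_cutPow (p : Parity) (σ : ℝ) (s : ℂ) :
    ContinuousOn (cutPow p σ s) (Set.Ioi 0) := fun _ ht =>
  (hasDerivAt_cutPow p σ s ht).continuousAt.continuousWithinAt

lemma theta_coreDens (hσ : σ ^ 2 = 1) (ha : 0 < a) {v : ℝ} (hv : 0 < v) :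
    theta p (coreMeas a) (coreDens p σ a) v = 2 * coreFun p σ a (fun t => gau p (v * t)) := by
  obtain ⟨C, _, hb⟩ := exists_gau_bound p zero_le_two
  rw [theta, integral_coreDens]
  exact (isMellinDensity_coreDens hσ ha one_lt_two).integrable_mul (C := C * v ^ (-2 : ℝ))
    (by fun_prop) fun t ht => norm_gau_mul_le hb hv ht

lemma theta_coreDens_inv (hσ : σ ^ 2 = 1) (ha : 0 < a) (v : ℝ) (hv : v > 0) :
    theta p (coreMeas a) (coreDens p σ a) v⁻¹ =
      σ * v * theta p (coreMeas a) (coreDens p σ a) v := by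
  rw [theta_coreDens hσ ha (inv_pos.2 hv), theta_coreDens hσ ha hv, coreFun_gau_inv hσ ha hv]
  ring

lemma mellin_coreDens (hσ : σ ^ 2 = 1) (ha : 0 < a) :
    mellin (theta p (coreMeas a) (coreDens p σ a)) = xi p σ a := by
  ext s
  rw [(isMellinDensity_coreDens hσ ha one_lt_two).mellin_eq_cutPow (theta_coreDens_inv hσ ha), xi,
    integral_coreDens]
  set r := max 2 (max (s.re + 1) (1 - s.re + 1)) with hr
  have h1 : 2 ≤ r := le_max_left _ _
  have h2 : s.re + 1 ≤ r := (le_max_left _ _).trans (le_max_right _ _)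
  have h3 : 1 - s.re + 1 ≤ r := (le_max_right _ _).trans (le_max_right _ _)
  obtain ⟨C, _, hb⟩ := exists_cutPow_bound p σ s (by linarith : 0 ≤ r) (by linarith) (by linarith)
  exact (isMellinDensity_coreDens hσ ha (by linarith : 1 < r)).integrable_mul
    (continuousOn_cutPow p σ s) hb

lemma differentiable_xi (hσ : σ ^ 2 = 1) (ha : 0 < a) : Differentiable ℂ (xi p σ a) := by
  rw [← mellin_coreDens hσ ha]
  exact (isMellinDensity_coreDens hσ ha one_lt_two).differentiable_mellin hσ
    (theta_coreDens_inv hσ ha)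

lemma continuousOn_ofReal_cpow (s : ℂ) : ContinuousOn (fun t : ℝ => (t : ℂ) ^ s) (Set.Ioi 0) :=
  fun t ht =>
    (Complex.continuousAt_ofReal_cpow_const t _ (Or.inr (ne_of_gt ht))).continuousWithinAt

lemma xi_eq (hσ : σ ^ 2 = 1) (ha : 0 < a) {s : ℂ} (hs : 1 < s.re) :
    xi p σ a s = gammaFactor p s * coreFun p σ a (fun t => (t : ℂ) ^ (-s)) := by
  obtain ⟨r, h1, h2⟩ := exists_between hs
  rw [← mellin_coreDens hσ ha, (isMellinDensity_coreDens hσ ha h1).mellin_eq h2, integral_coreDens]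
  refine (isMellinDensity_coreDens hσ ha hs).integrable_mul (C := 1) (continuousOn_ofReal_cpow _)
    fun t ht => ?_
  rw [Complex.norm_cpow_eq_rpow_re_of_pos ht, Complex.neg_re, one_mul]

/-! ### Right Mellin transforms -/

/-- The test function `t ^ (-s)` cut off near `0` and `∞`. -/
def cutTest (a : ℝ) (s : ℂ) (R t : ℝ) : ℂ :=
  (Real.smoothTransition (4 * t / a - 1) : ℂ) * (Real.smoothTransition (2 - t / R) : ℂ) *
    (t : ℂ) ^ (-s)

lemma cutTest_of_le (ha : 0 < a) (s : ℂ) (R : ℝ) {t : ℝ} (ht : t ≤ a / 4) : cutTest a s R t = 0 := by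
  have : 4 * t / a - 1 ≤ 0 := by
    rw [sub_nonpos, div_le_one ha]
    linarith
  simp [cutTest, Real.smoothTransition.zero_of_nonpos this]

lemma cutTest_of_ge (ha : 0 < a) (s : ℂ) (R : ℝ) {t : ℝ} (ht : a ≤ t) :
    cutTest a s R t = (Real.smoothTransition (2 - t / R) : ℂ) * (t : ℂ) ^ (-s) := by
  have : 1 ≤ 4 * t / a - 1 := by
    rw [le_sub_iff_add_le, le_div_iff₀ ha]
    linarith
  simp [cutTest, Real.smoothTransition.one_of_one_le this]

lemma contDiff_cutTest (ha : 0 < a) (s : ℂ) (R : ℝ) : ContDiff ℝ (⊤ : ℕ∞) (cutTest a s R) := by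
  rw [contDiff_iff_contDiffAt]
  intro t
  have hT : ∀ f : ℝ → ℝ, ContDiff ℝ (⊤ : ℕ∞) f →
      ContDiffAt ℝ (⊤ : ℕ∞) (fun t => (Real.smoothTransition (f t) : ℂ)) t := fun f hf =>
    (Complex.ofRealCLM.contDiff.comp (Real.smoothTransition.contDiff.comp hf)).contDiffAt
  rcases lt_or_ge t (a / 4) with h | h
  · refine (contDiffAt_const (c := (0 : ℂ))).congr_of_eventuallyEq ?_
    filter_upwards [Iio_mem_nhds h] with x hx using cutTest_of_le ha s R (le_of_lt hx)
  · have ht : 0 < t := by linarith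
    refine ((hT _ (by fun_prop)).mul (hT _ (by fun_prop))).mul ?_
    have h1 : ContDiffAt ℝ (⊤ : ℕ∞) (fun t : ℝ => Complex.exp (((Real.log t : ℝ) : ℂ) * -s)) t := by
      refine ContDiffAt.cexp (ContDiffAt.mul ?_ contDiffAt_const)
      exact Complex.ofRealCLM.contDiff.contDiffAt.comp t (Real.contDiffAt_log.2 ht.ne')
    refine h1.congr_of_eventuallyEq ?_
    filter_upwards [Ioi_mem_nhds ht] with x hx
    rw [Complex.cpow_def_of_ne_zero (by exact_mod_cast (ne_of_gt hx : x ≠ 0)),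
      Complex.ofReal_log (le_of_lt hx)]

lemma hasCompactSupport_cutTest (ha : 0 < a) (s : ℂ) {R : ℝ} (hR : 0 < R) :
    HasCompactSupport (cutTest a s R) := by
  refine HasCompactSupport.intro (K := Set.Icc (a / 4) (2 * R)) isCompact_Icc fun t ht => ?_
  by_cases h : t ≤ a / 4
  · exact cutTest_of_le ha s R h
  · have h1 : 2 * R ≤ t := by
      by_contra h2
      exact ht ⟨by linarith, by linarith⟩
    have : 2 - t / R ≤ 0 := by
      rw [sub_nonpos, le_div_iff₀ hR]
      exact h1
    simp [cutTest, Real.smoothTransition.zero_of_nonpos this]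

lemma tendsto_smoothTransition_cut (t : ℝ) :
    Filter.Tendsto (fun R : ℝ => (Real.smoothTransition (2 - t / R) : ℂ)) Filter.atTop (nhds 1) := by
  refine tendsto_const_nhds.congr' ?_
  filter_upwards [Filter.eventually_ge_atTop (max 1 t)] with R hR
  have h0 : 0 < R := one_pos.trans_le ((le_max_left _ _).trans hR)
  have h1 : t / R ≤ 1 := (div_le_one h0).2 ((le_max_right _ _).trans hR)
  rw [Real.smoothTransition.one_of_one_le (by linarith), Complex.ofReal_one]

/-- The cut-off near 0 does not affect the result: the test function vanishes on the negative half
of the support of the distribution and is not modified at `t ≥ a`. Only the truncation at infinity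
remains. -/
lemma coreDist_cutTest (hσ : σ ^ 2 = 1) (ha : 0 < a) {s : ℂ} {R : ℝ} (g : 𝓢(ℝ, ℂ))
    (hg : ∀ t, g t = cutTest a s R t) : coreDist p σ a g =
      coreFun p σ a (fun t => (Real.smoothTransition (2 - t / R) : ℂ) * (t : ℂ) ^ (-s)) := by
  have hi := integrable_phi_mul (p := p) hσ ha (g.integrable (μ := volume))
  rw [coreDist_apply hσ ha, hg (-a), cutTest_of_le ha s R (by linarith), coreFun, hg a,
    cutTest_of_ge ha s R le_rfl, mul_zero, add_zero]
  congr 2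
  rw [intervalIntegral.integral_of_le (by linarith), ← integral_add_compl
    (measurableSet_Ioc (a := -a) (b := a)) hi, add_sub_cancel_left]
  have h2 : (Set.Ioc (-a) a)ᶜ = Set.Iic (-a) ∪ Set.Ioi a := by
    ext x
    simp only [Set.mem_compl_iff, Set.mem_Ioc, Set.mem_union, Set.mem_Iic, Set.mem_Ioi, not_and_or,
      not_lt, not_le]
  rw [h2, setIntegral_union (Set.disjoint_left.2 fun x hx hx' => by
    simp only [Set.mem_Iic, Set.mem_Ioi] at hx hx'; linarith) measurableSet_Ioi hi.integrableOn
    hi.integrableOn]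
  have h3 : ∫ x in Set.Iic (-a), (phi p σ a x : ℂ) * g x = 0 := by
    rw [setIntegral_eq_zero_of_forall_eq_zero]
    intro x hx
    rw [hg, cutTest_of_le ha s R (by simp only [Set.mem_Iic] at hx; linarith), mul_zero]
  rw [h3, zero_add]
  refine setIntegral_congr_fun measurableSet_Ioi fun t ht => ?_
  simp only [hg, cutTest_of_ge ha s R (le_of_lt ht)]

lemma integrableOn_ofReal_cpow (ha : 0 < a) {s : ℂ} (hs : 1 < s.re) :
    IntegrableOn (fun t : ℝ => (t : ℂ) ^ (-s)) (Set.Ioi a) :=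
  integrableOn_Ioi_cpow_of_lt (by simpa using hs) ha

lemma hasRightMellin_coreDist (hσ : σ ^ 2 = 1) (ha : 0 < a) {s : ℂ} (hs : 1 < s.re) (c : ℂ) :
    HasRightMellin a (c • coreDist p σ a) s (c * coreFun p σ a (fun t => (t : ℂ) ^ (-s))) := by
  -- The value 0 for R ≤ 0 is a filler, irrelevant in the limit; compact support is available only
  -- for R > 0.
  refine ⟨fun R => if hR : 0 < R then
    (hasCompactSupport_cutTest ha s hR).toSchwartzMap (contDiff_cutTest ha s R) else 0, ?_, ?_⟩
  · intro R hR t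
    simp only [dif_pos (show 0 < R from hR)]
    rfl
  · have h1 : (fun R => c * coreFun p σ a
        (fun t => (Real.smoothTransition (2 - t / R) : ℂ) * (t : ℂ) ^ (-s))) =ᶠ[Filter.atTop]
        fun R => (c • coreDist p σ a) (if hR : 0 < R then
          (hasCompactSupport_cutTest ha s hR).toSchwartzMap (contDiff_cutTest ha s R) else 0) := by
      filter_upwards [Filter.eventually_gt_atTop 0] with R hR
      have : ∀ g : 𝓢(ℝ, ℂ), (c • coreDist p σ a) g = c * coreDist p σ a g := fun _ => rfl
      rw [dif_pos hR, this, coreDist_cutTest hσ ha (s := s) (R := R) _ fun t => rfl]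
    refine Filter.Tendsto.congr' h1 (Filter.Tendsto.const_mul c ?_)
    refine Filter.Tendsto.add ?_ (Filter.Tendsto.const_mul _ ?_)
    · simpa using (tendsto_smoothTransition_cut a).mul_const ((a : ℂ) ^ (-s))
    · have hi := integrableOn_phi_mul (p := p) hσ ha (integrableOn_ofReal_cpow ha hs)
      refine tendsto_integral_filter_of_dominated_convergence
        (fun t => ‖(phi p σ a t : ℂ) * (t : ℂ) ^ (-s)‖) ?_ ?_ hi.norm ?_
      · refine Filter.Eventually.of_forall fun R => ?_
        have hc : Continuous fun t => (Real.smoothTransition (2 - t / R) : ℂ) :=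
          Complex.continuous_ofReal.comp (Real.smoothTransition.continuous.comp (by fun_prop))
        exact (continuous_phi_ofReal hσ ha).aestronglyMeasurable.mul
          (hc.aestronglyMeasurable.mul
            (integrableOn_ofReal_cpow ha hs).aestronglyMeasurable)
      · refine Filter.Eventually.of_forall fun R => Filter.Eventually.of_forall fun t => ?_
        rw [mul_left_comm, norm_mul]
        refine mul_le_of_le_one_left (norm_nonneg _) ?_
        rw [Complex.norm_real, Real.norm_of_nonneg (Real.smoothTransition.nonneg _)]
        exact Real.smoothTransition.le_one _
      · refine Filter.Eventually.of_forall fun t => Filter.Tendsto.const_mul _ ?_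
        simpa using (tendsto_smoothTransition_cut t).mul_const ((t : ℂ) ^ (-s))

lemma HasRightMellin.unique {T : 𝓢'(ℝ, ℂ)} {s m m' : ℂ} (h : HasRightMellin a T s m)
    (h' : HasRightMellin a T s m') : m = m' := by
  obtain ⟨g, hg, hm⟩ := h
  obtain ⟨g', hg', hm'⟩ := h'
  refine tendsto_nhds_unique hm (hm'.congr' ?_)
  filter_upwards [Filter.eventually_gt_atTop 0] with R hR
  congr 1
  ext t
  rw [hg R hR, hg' R hR]

lemma eq_of_eq_re_gt {F G : ℂ → ℂ} (hF : Differentiable ℂ F) (hG : Differentiable ℂ G) (c : ℝ)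
    (h : ∀ s : ℂ, c < s.re → F s = G s) : F = G := by
  have hF' : AnalyticOnNhd ℂ F Set.univ := fun z _ => hF.analyticAt z
  have hG' : AnalyticOnNhd ℂ G Set.univ := fun z _ => hG.analyticAt z
  refine hF'.eq_of_eventuallyEq hG' (z₀ := ((c + 1 : ℝ) : ℂ)) ?_
  have ho : IsOpen {s : ℂ | c < s.re} := isOpen_lt continuous_const Complex.continuous_re
  filter_upwards [ho.mem_nhds (by simp : ((c + 1 : ℝ) : ℂ) ∈ {s : ℂ | c < s.re})] with s hs
  exact h s hs

lemma IsCompletedMellin.unique {T : 𝓢'(ℝ, ℂ)} {M M' : ℂ → ℂ} (h : IsCompletedMellin p a T M)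
    (h' : IsCompletedMellin p a T M') : M = M' := by
  obtain ⟨hd, c, hc⟩ := h
  obtain ⟨hd', c', hc'⟩ := h'
  refine eq_of_eq_re_gt hd hd' (max c c') fun s hs => ?_
  obtain ⟨m, hm, e⟩ := hc s ((le_max_left _ _).trans_lt hs)
  obtain ⟨m', hm', e'⟩ := hc' s ((le_max_right _ _).trans_lt hs)
  rw [e, e', hm.unique hm']

lemma completedMellin_eq {T : 𝓢'(ℝ, ℂ)} {M : ℂ → ℂ} (h : IsCompletedMellin p a T M) :
    completedMellin p a T = M := by
  have hex : ∃ M, IsCompletedMellin p a T M := ⟨M, h⟩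
  rw [completedMellin, dif_pos hex]
  exact hex.choose_spec.unique h

lemma isCompletedMellin_coreDist (hσ : σ ^ 2 = 1) (ha : 0 < a) (c : ℂ) :
    IsCompletedMellin p a (c • coreDist p σ a) (fun s => c * xi p σ a s) := by
  refine ⟨(differentiable_xi hσ ha).const_mul c, 1, fun s hs =>
    ⟨_, hasRightMellin_coreDist hσ ha hs c, ?_⟩⟩
  simp only [xi_eq hσ ha hs]
  ring

lemma isCompletedMellin_distA (p : Parity) (ha : 0 < a) :
    IsCompletedMellin p a (distA p a) (fun s => (Real.sqrt a : ℂ) / 2 * xi p 1 a s) := by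
  rw [distA_eq]
  exact isCompletedMellin_coreDist (by norm_num) ha _

lemma isCompletedMellin_distB (p : Parity) (ha : 0 < a) :
    IsCompletedMellin p a (distB p a)
      (fun s => Complex.I * (Real.sqrt a : ℂ) / 2 * xi p (-1) a s) := by
  rw [distB_eq]
  exact isCompletedMellin_coreDist (by norm_num) ha _

lemma calA_eq (p : Parity) (ha : 0 < a) :
    calA p a = fun s => (Real.sqrt a : ℂ) / 2 * xi p 1 a s :=
  completedMellin_eq (isCompletedMellin_distA p ha)

lemma calB_eq (p : Parity) (ha : 0 < a) :
    calB p a = fun s => Complex.I * (Real.sqrt a : ℂ) / 2 * xi p (-1) a s :=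
  completedMellin_eq (isCompletedMellin_distB p ha)

lemma xi_one_sub (hσ : σ ^ 2 = 1) (s : ℂ) : xi p σ a (1 - s) = σ * xi p σ a s := by
  have h : ∫ t in Set.Ioi a, (phi p σ a t : ℂ) * (σ * cutPow p σ s t) =
      σ * ∫ t in Set.Ioi a, (phi p σ a t : ℂ) * cutPow p σ s t := by
    rw [← integral_const_mul]
    refine integral_congr_ae (Filter.Eventually.of_forall fun t => ?_)
    simp only
    ring
  simp only [xi, coreFun, cutPow_one_sub hσ, h]
  ring

lemma star_xi (ha : 0 < a) (s : ℂ) : star (xi p σ a s) = xi p σ a (star s) := by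
  have hc : ∀ x : ℝ, star (x : ℂ) = x := Complex.conj_ofReal
  simp only [xi, coreFun, star_add, star_mul', star_cutPow p σ s ha, hc, star_integral]
  congr 2
  refine setIntegral_congr_fun measurableSet_Ioi fun t ht => ?_
  rw [star_cutPow p σ s (ha.trans ht)]

end

/-! ### Variation of `a` -/

/-- `X` is a rapidly decreasing test function on `(0, ∞)` with `X' = Xd / t`. -/
structure IsDecaying (X Xd : ℝ → ℂ) : Prop where
  deriv : ∀ t > 0, HasDerivAt X (Xd t / t) t
  cont : ContinuousOn Xd (Set.Ioi 0)
  decay : ∀ b > 0, ∃ C, 0 ≤ C ∧ ∀ t ≥ b, ‖X t‖ ≤ C / t ^ 3 ∧ ‖Xd t‖ ≤ C / t ^ 3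

lemma rpow_neg_le_of_ge {b t r : ℝ} (hb : 0 < b) (ht : b ≤ t) (hr : 3 ≤ r) :
    t ^ (-r) ≤ b ^ (3 - r) / t ^ 3 := by
  have ht0 := hb.trans_le ht
  rw [le_div_iff₀ (by positivity), ← Real.rpow_natCast, ← Real.rpow_add ht0]
  rw [show -r + ((3 : ℕ) : ℝ) = 3 - r by push_cast; ring]
  exact Real.rpow_le_rpow_of_nonpos hb ht (by linarith)

lemma isDecaying_cutPow (p : Parity) (σ : ℝ) (s : ℂ) :
    IsDecaying (cutPow p σ s) (fun t => (1 / 2 - s) * cutPow p (-σ) s t - 2 * (1 + σ) * gau p t -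
      (1 / 2) * cutPow p σ s t) where
  deriv := fun t ht => hasDerivAt_cutPow p σ s ht
  cont := (((continuousOn_cutPow p (-σ) s).const_mul _).sub (by fun_prop)).sub
    ((continuousOn_cutPow p σ s).const_mul _)
  decay := by
    intro b hb
    set r := max 3 (max (s.re + 1) (1 - s.re + 1)) with hr
    have h1 : 3 ≤ r := le_max_left _ _
    have h2 : s.re + 1 ≤ r := (le_max_left _ _).trans (le_max_right _ _)
    have h3 : 1 - s.re + 1 ≤ r := (le_max_right _ _).trans (le_max_right _ _)
    obtain ⟨C1, hC1, k1⟩ := exists_cutPow_bound p σ s (by linarith : 0 ≤ r) (by linarith) (by linarith)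
    obtain ⟨C2, hC2, k2⟩ := exists_cutPow_bound p (-σ) s (by linarith : 0 ≤ r) (by linarith)
      (by linarith)
    obtain ⟨C3, hC3, k3⟩ := exists_gau_bound p (by linarith : 0 ≤ r)
    have hk : 0 < b ^ (3 - r) := Real.rpow_pos_of_pos hb _
    refine ⟨(C1 + (‖(1 / 2 - s : ℂ)‖ * C2 + ‖(2 * (1 + σ) : ℂ)‖ * C3)) * b ^ (3 - r), by positivity,
      fun t ht => ?_⟩
    have ht0 := hb.trans_le ht
    have hle := rpow_neg_le_of_ge hb ht h1
    have hnn : 0 ≤ t ^ (-r) := Real.rpow_nonneg ht0.le _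
    have e : ∀ K : ℝ, 0 ≤ K → K * t ^ (-r) ≤ K * b ^ (3 - r) / t ^ 3 := fun K hK => by
      rw [mul_div_assoc]
      exact mul_le_mul_of_nonneg_left hle hK
    refine ⟨?_, ?_⟩
    · refine ((k1 t ht0).trans ?_).trans (e _ (by positivity))
      refine mul_le_mul_of_nonneg_right ?_ hnn
      have : 0 ≤ ‖(1 / 2 - s : ℂ)‖ * C2 + ‖(2 * (1 + σ) : ℂ)‖ * C3 := by positivity
      linarith
    · refine le_trans ?_ (e _ (by positivity))
      have b1 := k1 t ht0
      have b2 := mul_le_mul_of_nonneg_left (k2 t ht0) (norm_nonneg (1 / 2 - s : ℂ))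
      have b3 := mul_le_mul_of_nonneg_left (k3 t ht0) (norm_nonneg (2 * (1 + σ) : ℂ))
      have hx := norm_sub_le ((1 / 2 - s) * cutPow p (-σ) s t - 2 * (1 + σ) * gau p t)
        ((1 / 2) * cutPow p σ s t)
      have hx2 := norm_sub_le ((1 / 2 - s) * cutPow p (-σ) s t) (2 * (1 + σ) * gau p t)
      rw [norm_mul (1 / 2 - s)] at hx2
      rw [norm_mul (2 * (1 + σ) : ℂ)] at hx2
      rw [norm_mul (1 / 2 : ℂ)] at hx
      have h12 : ‖(1 / 2 : ℂ)‖ = 1 / 2 := by norm_num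
      rw [h12] at hx
      have hn := norm_nonneg (cutPow p σ s t)
      nlinarith

section

variable {p : Parity} {σ : ℝ} {X Xd : ℝ → ℂ}

lemma IsDecaying.continuousOn (H : IsDecaying X Xd) : ContinuousOn X (Set.Ioi 0) :=
  fun t ht => (H.deriv t ht).continuousAt.continuousWithinAt

/-- The substitution t = e^u y fixes the domain of integration, so that differentiation in u acts on
the integrand alone. -/
lemma coreFun_exp (hσ : σ ^ 2 = 1) (u : ℝ) (X : ℝ → ℂ) :
    coreFun p σ (Real.exp u) X = X (Real.exp u) +
      σ * (Real.exp u * ∫ y in Set.Ioi (1 : ℝ), Psi p σ u y * X (Real.exp u * y)) := by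
  have h := integral_comp_mul_left_Ioi (fun t => (phi p σ (Real.exp u) t : ℂ) * X t) 1
    (Real.exp_pos u)
  rw [mul_one] at h
  have h2 : ∫ y in Set.Ioi (1 : ℝ), Psi p σ u y * X (Real.exp u * y) =
      ∫ y in Set.Ioi (1 : ℝ), (phi p σ (Real.exp u) (Real.exp u * y) : ℂ) * X (Real.exp u * y) := by
    refine integral_congr_ae (Filter.Eventually.of_forall fun y => ?_)
    simp only [phi_exp_mul p hσ]
  rw [coreFun, h2, h, Complex.real_smul, Complex.ofReal_inv, mul_inv_cancel_left₀]
  exact_mod_cast (Real.exp_pos u).ne'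

lemma IsDecaying.exists_bound (H : IsDecaying X Xd) (u₀ : ℝ) : ∃ C, 0 ≤ C ∧
    ∀ u ∈ Set.Icc (u₀ - 1) (u₀ + 1), ∀ y ≥ (1 : ℝ),
      ‖X (Real.exp u * y)‖ ≤ C / y ^ 3 ∧ ‖Xd (Real.exp u * y)‖ ≤ C / y ^ 3 := by
  obtain ⟨C, hC, h⟩ := H.decay (Real.exp (u₀ - 1)) (Real.exp_pos _)
  refine ⟨C / Real.exp (u₀ - 1) ^ 3, by positivity, fun u hu y hy => ?_⟩
  have hy0 : 0 < y := one_pos.trans_le hy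
  have he : Real.exp (u₀ - 1) ≤ Real.exp u := Real.exp_le_exp.2 hu.1
  have h1 : Real.exp (u₀ - 1) * 1 ≤ Real.exp u * y :=
    mul_le_mul he hy zero_le_one (Real.exp_pos u).le
  have h2 : C / (Real.exp u * y) ^ 3 ≤ C / Real.exp (u₀ - 1) ^ 3 / y ^ 3 := by
    rw [div_div, ← mul_pow]
    exact div_le_div_of_nonneg_left hC (by positivity)
      (pow_le_pow_left₀ (by positivity) (mul_le_mul_of_nonneg_right he hy0.le) 3)
  obtain ⟨h3, h4⟩ := h _ (by simpa using h1)
  exact ⟨h3.trans h2, h4.trans h2⟩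

lemma integrableOn_Ioi_of_bound {f : ℝ → ℂ} {K : ℝ} (hf : ContinuousOn f (Set.Ioi 0))
    (hb : ∀ y ≥ (1 : ℝ), ‖f y‖ ≤ K / y ^ 2) : IntegrableOn f (Set.Ioi 1) := by
  have h1 : IntegrableOn (fun y : ℝ => K * y ^ (-2 : ℝ)) (Set.Ioi 1) :=
    (integrableOn_Ioi_rpow_of_lt (by norm_num) one_pos).const_mul K
  refine h1.mono' ((hf.mono (Set.Ioi_subset_Ioi zero_le_one)).aestronglyMeasurable
    measurableSet_Ioi) ?_
  filter_upwards [ae_restrict_mem measurableSet_Ioi] with y hy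
  refine (hb y (le_of_lt hy)).trans (le_of_eq ?_)
  rw [Real.rpow_neg (one_pos.trans hy).le, Real.rpow_two, div_eq_mul_inv]

lemma continuousOn_comp_exp_mul {f : ℝ → ℂ} (hf : ContinuousOn f (Set.Ioi 0)) (u : ℝ) :
    ContinuousOn (fun y => f (Real.exp u * y)) (Set.Ioi 0) :=
  hf.comp (by fun_prop) fun _ hy => mul_pos (Real.exp_pos u) hy

lemma hasDerivAt_comp_exp_mul (H : IsDecaying X Xd) {y : ℝ} (hy : 0 < y) (u : ℝ) :
    HasDerivAt (fun u => X (Real.exp u * y)) (Xd (Real.exp u * y)) u := by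
  have hpos : 0 < Real.exp u * y := mul_pos (Real.exp_pos u) hy
  have h1 : HasDerivAt (fun u => Real.exp u * y) (Real.exp u * y) u :=
    (Real.hasDerivAt_exp u).mul_const y
  have h2 := (H.deriv _ hpos).scomp u h1
  refine h2.congr_deriv ?_
  have : ((Real.exp u * y : ℝ) : ℂ) ≠ 0 := by exact_mod_cast hpos.ne'
  rw [Complex.real_smul, mul_div_cancel₀ _ this]

lemma mul_div_cube_le {A B y : ℝ} (hA : 0 ≤ A) (hB : 0 ≤ B) (hy : 1 ≤ y) {z : ℝ} (hz : z ≤ A * B) :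
    z / y ^ 3 ≤ A * B / y ^ 2 := by
  have hy0 : 0 < y := one_pos.trans_le hy
  have h0 : 0 ≤ A * B := mul_nonneg hA hB
  calc z / y ^ 3 ≤ A * B / y ^ 3 := by gcongr
    _ ≤ A * B / y ^ 2 :=
      div_le_div_of_nonneg_left h0 (by positivity) (pow_le_pow_right₀ hy (by norm_num))

lemma hasDerivAt_integral_Psi (hσ : σ ^ 2 = 1) (H : IsDecaying X Xd) (u₀ : ℝ) :
    HasDerivAt (fun u => ∫ y in Set.Ioi (1 : ℝ), Psi p σ u y * X (Real.exp u * y))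
      (∫ y in Set.Ioi (1 : ℝ), (PsiU p σ u₀ y * X (Real.exp u₀ * y) +
        Psi p σ u₀ y * Xd (Real.exp u₀ * y))) u₀ := by
  obtain ⟨C, hC, hb⟩ := exists_bound_Psi (p := p) hσ u₀
  obtain ⟨D, hD, hX⟩ := H.exists_bound u₀
  have hnhds : Set.Ioo (u₀ - 1) (u₀ + 1) ∈ nhds u₀ := Ioo_mem_nhds (by linarith) (by linarith)
  have hcΨ : ∀ u, ContinuousOn (fun y => Psi p σ u y * X (Real.exp u * y)) (Set.Ioi 0) := fun u =>
    (continuous_Psi (p := p) (σ := σ) u).continuousOn.mul (continuousOn_comp_exp_mul H.continuousOn u)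
  have hcU : ContinuousOn (fun y => PsiU p σ u₀ y * X (Real.exp u₀ * y) +
      Psi p σ u₀ y * Xd (Real.exp u₀ * y)) (Set.Ioi 0) :=
    ((continuous_PsiU (p := p) (σ := σ) u₀).continuousOn.mul (continuousOn_comp_exp_mul H.continuousOn u₀)).add
      ((continuous_Psi (p := p) (σ := σ) u₀).continuousOn.mul (continuousOn_comp_exp_mul H.cont u₀))
  have hs : Set.Ioi (1 : ℝ) ⊆ Set.Ioi 0 := Set.Ioi_subset_Ioi zero_le_one
  -- The linear growth of `PsiU` uses up one of the three powers of decay of X; y⁻² remains and is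
  -- integrable.
  have hbound : ∀ u ∈ Set.Icc (u₀ - 1) (u₀ + 1), ∀ y ≥ (1 : ℝ),
      ‖Psi p σ u y * X (Real.exp u * y)‖ ≤ C * D / y ^ 2 ∧
      ‖PsiU p σ u y * X (Real.exp u * y) + Psi p σ u y * Xd (Real.exp u * y)‖ ≤
        3 * (C * D) / y ^ 2 := by
    intro u hu y hy
    have hy0 : 0 < y := one_pos.trans_le hy
    obtain ⟨b1, b2, -⟩ := hb u hu y
    obtain ⟨x1, x2⟩ := hX u hu y hy
    rw [abs_of_pos hy0] at b2
    have key : ∀ z w : ℂ, ‖z‖ ≤ C → ‖w‖ ≤ D / y ^ 3 → ‖z * w‖ ≤ C * D / y ^ 2 := by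
      intro z w hz hw
      rw [norm_mul]
      refine (mul_le_mul hz hw (norm_nonneg _) hC).trans ?_
      rw [← mul_div_assoc]
      exact mul_div_cube_le hC hD hy le_rfl
    refine ⟨key _ _ b1 x1, (norm_add_le _ _).trans ?_⟩
    have h1 : ‖PsiU p σ u y * X (Real.exp u * y)‖ ≤ 2 * (C * D) / y ^ 2 := by
      rw [norm_mul]
      refine (mul_le_mul b2 x1 (norm_nonneg _) (by positivity)).trans ?_
      rw [← mul_div_assoc, div_le_div_iff₀ (by positivity) (by positivity)]
      have h0 : 0 ≤ C * D := mul_nonneg hC hD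
      calc C * (1 + y) * D * y ^ 2 = C * D * y ^ 2 * (1 + y) := by ring
        _ ≤ C * D * y ^ 2 * (2 * y) := mul_le_mul_of_nonneg_left (by linarith) (by positivity)
        _ = _ := by ring
    have h2 := key _ _ b1 x2
    calc _ ≤ 2 * (C * D) / y ^ 2 + C * D / y ^ 2 := add_le_add h1 h2
      _ = _ := by ring
  have hmem0 : u₀ ∈ Set.Icc (u₀ - 1) (u₀ + 1) := ⟨by linarith, by linarith⟩
  have hdom : IntegrableOn (fun y : ℝ => 3 * (C * D) * y ^ (-2 : ℝ)) (Set.Ioi 1) :=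
    (integrableOn_Ioi_rpow_of_lt (by norm_num) one_pos).const_mul _
  refine (hasDerivAt_integral_of_dominated_loc_of_deriv_le (μ := volume.restrict (Set.Ioi 1))
    (F := fun u y => Psi p σ u y * X (Real.exp u * y))
    (F' := fun u y => PsiU p σ u y * X (Real.exp u * y) + Psi p σ u y * Xd (Real.exp u * y))
    hnhds ?_ ?_ ?_ ?_ hdom ?_).2
  · exact Filter.Eventually.of_forall fun u => ((hcΨ u).mono hs).aestronglyMeasurable
      measurableSet_Ioi
  · exact integrableOn_Ioi_of_bound (hcΨ u₀) fun y hy => (hbound u₀ hmem0 y hy).1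
  · exact (hcU.mono hs).aestronglyMeasurable measurableSet_Ioi
  · filter_upwards [ae_restrict_mem measurableSet_Ioi] with y hy u hu
    refine ((hbound u (Set.Ioo_subset_Icc_self hu) y (le_of_lt hy)).2).trans (le_of_eq ?_)
    rw [Real.rpow_neg (one_pos.trans hy).le, Real.rpow_two, div_eq_mul_inv]
  · filter_upwards [ae_restrict_mem measurableSet_Ioi] with y hy u _
    exact (hasDerivAt_Psi_u hσ u y).mul (hasDerivAt_comp_exp_mul H (one_pos.trans hy) u)

lemma integral_add_add {m : Measure ℝ} {f g h : ℝ → ℂ} (hf : Integrable f m) (hg : Integrable g m)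
    (hh : Integrable h m) : ∫ x, (f x + g x + h x) ∂m = (∫ x, f x ∂m) + (∫ x, g x ∂m) + ∫ x, h x ∂m :=
  (integral_add (f := fun x => f x + g x) (hf.add hg) hh).trans (by rw [integral_add hf hg])

/-- Integration by parts for `y ↦ y Ψ(y) X(ay)`. -/
lemma integral_mul_PsiY (hσ : σ ^ 2 = 1) (H : IsDecaying X Xd) (u : ℝ) :
    IntegrableOn (fun y : ℝ => y * PsiY p σ u y * X (Real.exp u * y)) (Set.Ioi 1) ∧
    IntegrableOn (fun y : ℝ => Psi p σ u y * X (Real.exp u * y)) (Set.Ioi 1) ∧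
    IntegrableOn (fun y : ℝ => Psi p σ u y * Xd (Real.exp u * y)) (Set.Ioi 1) ∧
    (∫ y in Set.Ioi (1 : ℝ), y * PsiY p σ u y * X (Real.exp u * y)) =
      -(Psi p σ u 1 * X (Real.exp u)) -
      (∫ y in Set.Ioi (1 : ℝ), Psi p σ u y * X (Real.exp u * y)) -
      ∫ y in Set.Ioi (1 : ℝ), Psi p σ u y * Xd (Real.exp u * y) := by
  obtain ⟨C, hC, hb⟩ := exists_bound_Psi (p := p) hσ u
  obtain ⟨D, hD, hX⟩ := H.exists_bound u
  have hmem : u ∈ Set.Icc (u - 1) (u + 1) := ⟨by linarith, by linarith⟩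
  have hc0 := continuousOn_comp_exp_mul H.continuousOn u
  have hc1 := continuousOn_comp_exp_mul H.cont u
  have cΨ : ContinuousOn (fun y => Psi p σ u y) (Set.Ioi 0) := (continuous_Psi (p := p) (σ := σ) u).continuousOn
  have cY : ContinuousOn (fun y => PsiY p σ u y) (Set.Ioi 0) := (continuous_PsiY (p := p) (σ := σ) u).continuousOn
  have key : ∀ (y : ℝ), 1 ≤ y → ∀ z w : ℂ, ‖z‖ ≤ C → ‖w‖ ≤ D / y ^ 3 → ‖z * w‖ ≤ C * D / y ^ 3 := by
    intro y hy z w hz hw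
    rw [norm_mul]
    exact (mul_le_mul hz hw (norm_nonneg _) hC).trans (le_of_eq (mul_div_assoc _ _ _).symm)
  have i1 : IntegrableOn (fun y : ℝ => y * PsiY p σ u y * X (Real.exp u * y)) (Set.Ioi 1) := by
    refine integrableOn_Ioi_of_bound (K := C * D) ?_ fun y hy => ?_
    · exact ((Complex.continuous_ofReal.continuousOn).mul cY).mul hc0
    · have hy0 : 0 < y := one_pos.trans_le hy
      rw [mul_assoc, norm_mul, Complex.norm_real, Real.norm_of_nonneg hy0.le]
      refine (mul_le_mul_of_nonneg_left
        (key y hy _ _ (hb u hmem y).2.2 (hX u hmem y hy).1) hy0.le).trans (le_of_eq ?_)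
      field_simp
  have i2 : IntegrableOn (fun y : ℝ => Psi p σ u y * X (Real.exp u * y)) (Set.Ioi 1) :=
    integrableOn_Ioi_of_bound (K := C * D) (cΨ.mul hc0) fun y hy =>
      (key y hy _ _ (hb u hmem y).1 (hX u hmem y hy).1).trans (mul_div_cube_le hC hD hy le_rfl)
  have i3 : IntegrableOn (fun y : ℝ => Psi p σ u y * Xd (Real.exp u * y)) (Set.Ioi 1) :=
    integrableOn_Ioi_of_bound (K := C * D) (cΨ.mul hc1) fun y hy =>
      (key y hy _ _ (hb u hmem y).1 (hX u hmem y hy).2).trans (mul_div_cube_le hC hD hy le_rfl)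
  refine ⟨i1, i2, i3, ?_⟩
  have hd : ∀ y ∈ Set.Ici (1 : ℝ), HasDerivAt (fun y : ℝ => y * Psi p σ u y * X (Real.exp u * y))
      (Psi p σ u y * X (Real.exp u * y) + y * PsiY p σ u y * X (Real.exp u * y) +
        Psi p σ u y * Xd (Real.exp u * y)) y := by
    intro y hy
    have hy0 : 0 < y := one_pos.trans_le hy
    have hpos : 0 < Real.exp u * y := mul_pos (Real.exp_pos u) hy0
    have h1 : HasDerivAt (fun y => Real.exp u * y) (Real.exp u) y := by
      simpa using (hasDerivAt_id y).const_mul (Real.exp u)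
    have h2 := (H.deriv _ hpos).scomp y h1
    have h3 := ((hasDerivAt_id y).ofReal_comp.mul (hasDerivAt_Psi (p := p) (σ := σ) u y)).mul h2
    refine h3.congr_deriv ?_
    have e1 : ((Real.exp u : ℝ) : ℂ) ≠ 0 := by exact_mod_cast (Real.exp_pos u).ne'
    have e2 : (y : ℂ) ≠ 0 := by exact_mod_cast hy0.ne'
    simp only [Complex.real_smul, id, Complex.ofReal_mul, Complex.ofReal_one, Function.comp,
      Pi.mul_apply]
    field_simp
  have hlim : Filter.Tendsto (fun y : ℝ => y * Psi p σ u y * X (Real.exp u * y)) Filter.atTop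
      (nhds 0) := by
    have h0 : Filter.Tendsto (fun y : ℝ => C * D * (y⁻¹) ^ 2) Filter.atTop (nhds 0) := by
      simpa using (tendsto_inv_atTop_zero.pow 2).const_mul (C * D)
    refine squeeze_zero_norm' ?_ h0
    filter_upwards [Filter.eventually_ge_atTop 1] with y hy
    have hy0 : 0 < y := one_pos.trans_le hy
    rw [mul_assoc, norm_mul, Complex.norm_real, Real.norm_of_nonneg hy0.le]
    refine (mul_le_mul_of_nonneg_left
      (key y hy _ _ (hb u hmem y).1 (hX u hmem y hy).1) hy0.le).trans (le_of_eq ?_)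
    field_simp
  have hI := integral_Ioi_of_hasDerivAt_of_tendsto' hd ((i2.add i1).add i3) hlim
  rw [integral_add_add i2 i1 i3, mul_one, Complex.ofReal_one, one_mul] at hI
  linear_combination hI

/-- The derivative of `coreFun` with respect to `u = log a`. -/
lemma hasDerivAt_coreFun (hσ : σ ^ 2 = 1) (H : IsDecaying X Xd) (u : ℝ) :
    HasDerivAt (fun u => coreFun p σ (Real.exp u) X)
      (-(1 / 2 + σ * (Real.exp u * (Psi p σ u 1 + Psi p (-σ) u 1))) *
          coreFun p σ (Real.exp u) X +
        coreFun p (-σ) (Real.exp u) (fun t => (1 / 2) * X t + Xd t)) u := by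
  have hσ' : (-σ) ^ 2 = 1 := by rw [neg_sq, hσ]
  have he : HasDerivAt (fun u : ℝ => (Real.exp u : ℂ)) (Real.exp u : ℂ) u :=
    (Real.hasDerivAt_exp u).ofReal_comp
  have h1 : HasDerivAt (fun u => X (Real.exp u)) (Xd (Real.exp u)) u := by
    simpa using hasDerivAt_comp_exp_mul H one_pos u
  have h2 := h1.add ((he.mul (hasDerivAt_integral_Psi (p := p) hσ H u)).const_mul (σ : ℂ))
  have hfun : (fun u => coreFun p σ (Real.exp u) X) = fun u => X (Real.exp u) +
      σ * (Real.exp u * ∫ y in Set.Ioi (1 : ℝ), Psi p σ u y * X (Real.exp u * y)) :=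
    funext fun u => coreFun_exp hσ u X
  rw [hfun]
  refine h2.congr_deriv ?_
  rw [coreFun_exp hσ u X, coreFun_exp hσ' u]
  obtain ⟨i1, i2, i3, e⟩ := integral_mul_PsiY (p := p) hσ H u
  obtain ⟨i1', i2', i3', e'⟩ := integral_mul_PsiY (p := p) hσ' H u
  have k1 : ∫ y in Set.Ioi (1 : ℝ), Psi p (-σ) u y *
        ((1 / 2) * X (Real.exp u * y) + Xd (Real.exp u * y)) =
      (1 / 2) * (∫ y in Set.Ioi (1 : ℝ), Psi p (-σ) u y * X (Real.exp u * y)) +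
        ∫ y in Set.Ioi (1 : ℝ), Psi p (-σ) u y * Xd (Real.exp u * y) := by
    rw [← integral_const_mul, ← integral_add (i2'.const_mul _) i3']
    refine integral_congr_ae (Filter.Eventually.of_forall fun y => ?_)
    simp only
    ring
  -- The evolution equation is inserted; its terms with y d/dy are then integrated by parts. Their
  -- boundary terms, after multiplication by σ e^u, add up to -σμ X(a), exactly what completes the
  -- integral to -σμ times the whole of `coreFun`.
  have k2 : ∫ y in Set.Ioi (1 : ℝ), (PsiU p σ u y * X (Real.exp u * y) +
        Psi p σ u y * Xd (Real.exp u * y)) =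
      (∫ y in Set.Ioi (1 : ℝ), y * PsiY p σ u y * X (Real.exp u * y)) +
      (∫ y in Set.Ioi (1 : ℝ), y * PsiY p (-σ) u y * X (Real.exp u * y)) +
      (1 / 2) * (∫ y in Set.Ioi (1 : ℝ), Psi p (-σ) u y * X (Real.exp u * y)) +
      (-(1 / 2 + σ * (Real.exp u * (Psi p σ u 1 + Psi p (-σ) u 1)))) *
        (∫ y in Set.Ioi (1 : ℝ), Psi p σ u y * X (Real.exp u * y)) +
      ∫ y in Set.Ioi (1 : ℝ), Psi p σ u y * Xd (Real.exp u * y) := by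
    rw [← integral_const_mul, ← integral_const_mul, ← integral_add_add i1 i1' (i2'.const_mul _),
      ← integral_add_add (f := fun y : ℝ => y * PsiY p σ u y * X (Real.exp u * y) +
        y * PsiY p (-σ) u y * X (Real.exp u * y) + (1 / 2) * (Psi p (-σ) u y * X (Real.exp u * y)))
        ((i1.add i1').add (i2'.const_mul _)) (i2.const_mul _) i3]
    refine integral_congr_ae (Filter.Eventually.of_forall fun y => ?_)
    simp only [PsiU_eq hσ]
    ring
  rw [k1, k2, e, e']
  push_cast
  ring

/-- The functional equation at its fixed point v = 1. For σ = -1 it kills the pairing with the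
Gaussian, which disposes of the Gaussian term in the derivative of `cutPow`. -/
lemma coreFun_gau (hσ : σ ^ 2 = 1) {a : ℝ} (ha : 0 < a) :
    (1 - σ) * coreFun p σ a (gau p) = 0 := by
  have h := coreFun_gau_inv (p := p) hσ ha one_pos
  simp only [inv_one, one_mul, Complex.ofReal_one, mul_one] at h
  linear_combination h

lemma integrableOn_cutPow {a : ℝ} (ha : 0 < a) (s : ℂ) : IntegrableOn (cutPow p σ s) (Set.Ioi a) := by
  set r := max 2 (max (s.re + 1) (1 - s.re + 1)) with hr
  have h1 : 2 ≤ r := le_max_left _ _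
  have h2 : s.re + 1 ≤ r := (le_max_left _ _).trans (le_max_right _ _)
  have h3 : 1 - s.re + 1 ≤ r := (le_max_right _ _).trans (le_max_right _ _)
  obtain ⟨C, _, hb⟩ := exists_cutPow_bound p σ s (by linarith : 0 ≤ r) (by linarith) (by linarith)
  refine ((integrableOn_Ioi_rpow_of_lt (by linarith : -r < -1) ha).const_mul C).mono'
    (((continuousOn_cutPow p σ s).mono (Set.Ioi_subset_Ioi ha.le)).aestronglyMeasurable
      measurableSet_Ioi) ?_
  filter_upwards [ae_restrict_mem measurableSet_Ioi] with t ht using hb t (ha.trans ht)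

/-- The derivative of `xi` with respect to `u = log a`. -/
lemma hasDerivAt_xi (hσ : σ ^ 2 = 1) (s : ℂ) (u : ℝ) :
    HasDerivAt (fun u => xi p σ (Real.exp u) s)
      (-(1 / 2 + σ * (Real.exp u * (Psi p σ u 1 + Psi p (-σ) u 1))) * xi p σ (Real.exp u) s +
        (1 / 2 - s) * xi p (-σ) (Real.exp u) s) u := by
  have hσ' : (-σ) ^ 2 = 1 := by rw [neg_sq, hσ]
  have ha := Real.exp_pos u
  refine (hasDerivAt_coreFun (p := p) hσ (isDecaying_cutPow p σ s) u).congr_deriv ?_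
  have h1 := coreFun_gau (p := p) hσ' ha
  have h2 : coreFun p (-σ) (Real.exp u) (fun t => (1 / 2) * cutPow p σ s t +
      ((1 / 2 - s) * cutPow p (-σ) s t - 2 * (1 + σ) * gau p t - (1 / 2) * cutPow p σ s t)) =
      (1 / 2 - s) * coreFun p (-σ) (Real.exp u) (cutPow p (-σ) s) -
        2 * (1 + σ) * coreFun p (-σ) (Real.exp u) (gau p) := by
    have k1 := integrableOn_phi_mul (p := p) hσ' ha (integrableOn_cutPow (p := p) (σ := -σ) ha s)
    have k2 := integrableOn_phi_mul (p := p) hσ' ha (integrable_gau p).integrableOn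
    have k3 : ∫ t in Set.Ioi (Real.exp u), (phi p (-σ) (Real.exp u) t : ℂ) *
        ((1 / 2) * cutPow p σ s t + ((1 / 2 - s) * cutPow p (-σ) s t - 2 * (1 + σ) * gau p t -
          (1 / 2) * cutPow p σ s t)) =
        (1 / 2 - s) * (∫ t in Set.Ioi (Real.exp u),
          (phi p (-σ) (Real.exp u) t : ℂ) * cutPow p (-σ) s t) -
        2 * (1 + σ) * ∫ t in Set.Ioi (Real.exp u), (phi p (-σ) (Real.exp u) t : ℂ) * gau p t := by
      rw [← integral_const_mul, ← integral_const_mul,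
        ← integral_sub (k1.const_mul _) (k2.const_mul _)]
      refine integral_congr_ae (Filter.Eventually.of_forall fun y => ?_)
      simp only
      ring
    rw [coreFun, k3, coreFun, coreFun]
    ring
  rw [h2, xi, xi]
  push_cast at h1
  linear_combination (-2 : ℂ) * h1

end

/-! ### The Dirac system -/

lemma scrA_eq (p : Parity) (γ : ℂ) (u : ℝ) : scrA p γ u =
    (1 / 2) * (Real.exp (u / 2) * xi p 1 (Real.exp u) (1 / 2 + Complex.I * γ)) := by
  rw [scrA, calA_eq p (Real.exp_pos u), ← Real.exp_half]
  ring

lemma scrB_eq (p : Parity) (γ : ℂ) (u : ℝ) : scrB p γ u =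
    (Complex.I / 2) * (Real.exp (u / 2) * xi p (-1) (Real.exp u) (1 / 2 + Complex.I * γ)) := by
  rw [scrB, calB_eq p (Real.exp_pos u), ← Real.exp_half]
  ring

lemma hasDerivAt_exp_half (u : ℝ) : HasDerivAt (fun u : ℝ => (Real.exp (u / 2) : ℂ))
    ((1 / 2) * Real.exp (u / 2)) u := by
  have h := (((hasDerivAt_id u).div_const 2).exp).ofReal_comp
  refine h.congr_deriv ?_
  simp only [id]
  push_cast
  ring

/-- The factor √a = e^{u/2} absorbs the -1/2 in the equation for `xi`, and 1/2 - s = -iγ. -/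
lemma hasDerivAt_scrA (p : Parity) (γ : ℂ) (u : ℝ) :
    HasDerivAt (scrA p γ) (-γ * scrB p γ u - muU p u * scrA p γ u) u := by
  have h := ((hasDerivAt_exp_half u).mul (hasDerivAt_xi (p := p) (σ := 1) (by norm_num)
    (1 / 2 + Complex.I * γ) u)).const_mul (1 / 2)
  rw [show scrA p γ = _ from funext (scrA_eq p γ)]
  refine h.congr_deriv ?_
  simp only [scrB_eq, muU_eq, muPsi, Complex.ofReal_one]
  ring

lemma hasDerivAt_scrB (p : Parity) (γ : ℂ) (u : ℝ) :
    HasDerivAt (scrB p γ) (γ * scrA p γ u + muU p u * scrB p γ u) u := by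
  have h := ((hasDerivAt_exp_half u).mul (hasDerivAt_xi (p := p) (σ := -1) (by norm_num)
    (1 / 2 + Complex.I * γ) u)).const_mul (Complex.I / 2)
  rw [show scrB p γ = _ from funext (scrB_eq p γ)]
  refine h.congr_deriv ?_
  simp only [scrA_eq, muU_eq, muPsi, Complex.ofReal_neg, Complex.ofReal_one, neg_neg]
  linear_combination (-(1 / 2) * γ * Real.exp (u / 2) *
    xi p 1 (Real.exp u) (1 / 2 + Complex.I * γ)) * Complex.I_sq

lemma contDiff_muPsi (p : Parity) {n : ℕ∞} : ContDiff ℝ n (muPsi p) := by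
  have he : ContDiff ℝ n (fun u : ℝ => (Real.exp u : ℂ)) :=
    Complex.ofRealCLM.contDiff.comp Real.contDiff_exp
  exact he.mul ((contDiff_Psi (by norm_num) 1).add (contDiff_Psi (by norm_num) 1))

/-- Bootstrapping: since μ is smooth, each use of the Dirac system gains one derivative. -/
lemma contDiff_scr (p : Parity) (γ : ℂ) :
    ContDiff ℝ 2 (scrA p γ) ∧ ContDiff ℝ 2 (scrB p γ) := by
  have dA : deriv (scrA p γ) = fun u => -γ * scrB p γ u - muPsi p u * scrA p γ u :=
    funext fun u => by rw [(hasDerivAt_scrA p γ u).deriv, muU_eq]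
  have dB : deriv (scrB p γ) = fun u => γ * scrA p γ u + muPsi p u * scrB p γ u :=
    funext fun u => by rw [(hasDerivAt_scrB p γ u).deriv, muU_eq]
  have step : ∀ n : ℕ, ContDiff ℝ n (scrA p γ) → ContDiff ℝ n (scrB p γ) →
      ContDiff ℝ ((n + 1 : ℕ) : WithTop ℕ∞) (scrA p γ) ∧
      ContDiff ℝ ((n + 1 : ℕ) : WithTop ℕ∞) (scrB p γ) := by
    intro n hA hB
    have hμ : ContDiff ℝ n (muPsi p) := contDiff_muPsi p (n := n)
    push_cast
    refine ⟨contDiff_succ_iff_deriv.2 ⟨fun u => (hasDerivAt_scrA p γ u).differentiableAt, by simp,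
      ?_⟩, contDiff_succ_iff_deriv.2 ⟨fun u => (hasDerivAt_scrB p γ u).differentiableAt, by simp,
      ?_⟩⟩
    · rw [dA]
      exact (contDiff_const.mul hB).sub (hμ.mul hA)
    · rw [dB]
      exact (contDiff_const.mul hA).add (hμ.mul hB)
  have cA : Continuous (scrA p γ) :=
    continuous_iff_continuousAt.2 fun u => (hasDerivAt_scrA p γ u).continuousAt
  have cB : Continuous (scrB p γ) :=
    continuous_iff_continuousAt.2 fun u => (hasDerivAt_scrB p γ u).continuousAt
  obtain ⟨a1, b1⟩ := step 0 (by simpa using cA) (by simpa using cB)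
  exact step 1 a1 b1

/-- The cross terms ±γμℬ cancel, and the Riccati combination μ² - μ' is left. -/
lemma iteratedDeriv_two_scrA (p : Parity) (γ : ℂ) (u : ℝ) :
    iteratedDeriv 2 (scrA p γ) u =
      (-γ ^ 2 + muPsi p u ^ 2 - deriv (muPsi p) u) * scrA p γ u := by
  have dA : deriv (scrA p γ) = fun u => -γ * scrB p γ u - muPsi p u * scrA p γ u :=
    funext fun u => by rw [(hasDerivAt_scrA p γ u).deriv, muU_eq]
  have hμ : HasDerivAt (muPsi p) (deriv (muPsi p) u) u :=
    ((contDiff_muPsi p (n := 1)).differentiable one_ne_zero u).hasDerivAt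
  have h := ((hasDerivAt_scrB p γ u).const_mul (-γ)).sub (hμ.mul (hasDerivAt_scrA p γ u))
  rw [iteratedDeriv_succ, iteratedDeriv_one, dA]
  refine h.deriv.trans ?_
  rw [muU_eq]
  ring

lemma iteratedDeriv_two_scrB (p : Parity) (γ : ℂ) (u : ℝ) :
    iteratedDeriv 2 (scrB p γ) u =
      (-γ ^ 2 + muPsi p u ^ 2 + deriv (muPsi p) u) * scrB p γ u := by
  have dB : deriv (scrB p γ) = fun u => γ * scrA p γ u + muPsi p u * scrB p γ u :=
    funext fun u => by rw [(hasDerivAt_scrB p γ u).deriv, muU_eq]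
  have hμ : HasDerivAt (muPsi p) (deriv (muPsi p) u) u :=
    ((contDiff_muPsi p (n := 1)).differentiable one_ne_zero u).hasDerivAt
  have h := ((hasDerivAt_scrA p γ u).const_mul γ).add (hμ.mul (hasDerivAt_scrB p γ u))
  rw [iteratedDeriv_succ, iteratedDeriv_one, dB]
  refine h.deriv.trans ?_
  rw [muU_eq]
  ring

/-! ### Hadamard's inequality -/

/-- Up to sign the determinant is the oriented volume of the rows, bounded by the product of their
lengths. -/
lemma abs_det_le_prod_norm {n : ℕ} (A : Matrix (Fin n) (Fin n) ℝ) :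
    |A.det| ≤ ∏ i, ‖(WithLp.toLp 2 (A i) : EuclideanSpace ℝ (Fin n))‖ := by
  have hfin : Fact (Module.finrank ℝ (EuclideanSpace ℝ (Fin n)) = n) := ⟨by simp⟩
  let b := EuclideanSpace.basisFun (Fin n) ℝ
  let o : Orientation ℝ (EuclideanSpace ℝ (Fin n)) (Fin n) := b.toBasis.orientation
  have h := o.abs_volumeForm_apply_le fun i => (WithLp.toLp 2 (A i) : EuclideanSpace ℝ (Fin n))
  rw [o.volumeForm_robust' b, Module.Basis.det_apply] at h
  have e : b.toBasis.toMatrix (fun i => (WithLp.toLp 2 (A i) : EuclideanSpace ℝ (Fin n))) =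
      A.transpose := by
    ext i j
    simp [b, Module.Basis.toMatrix_apply]
  rwa [e, Matrix.det_transpose] at h

lemma abs_det_le {n : ℕ} {A : Matrix (Fin n) (Fin n) ℝ} (h : ∀ i j, |A i j| ≤ 1) :
    |A.det| ≤ Real.sqrt n ^ n := by
  refine (abs_det_le_prod_norm A).trans ?_
  have : Real.sqrt n ^ n = ∏ _i : Fin n, Real.sqrt n := by simp
  rw [this]
  refine Finset.prod_le_prod (fun i _ => norm_nonneg _) fun i _ => ?_
  rw [EuclideanSpace.norm_eq]
  refine Real.sqrt_le_sqrt ?_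
  calc ∑ j, ‖(WithLp.toLp 2 (A i) : EuclideanSpace ℝ (Fin n)) j‖ ^ 2 ≤ ∑ _j : Fin n, (1 : ℝ) := by
        refine Finset.sum_le_sum fun j _ => ?_
        rw [sq_le_one_iff₀ (norm_nonneg _)]
        exact h i j
    _ = n := by simp

/-! ### Fredholm determinants and minors -/

/-- The cube `[-a, a]^n`. -/
def box (n : ℕ) (a : ℝ) : Set (Fin n → ℝ) := Set.univ.pi fun _ => Set.Icc (-a) a

/-- The determinant `det k(x_i, x_j)`. -/
def kdet (k : ℝ → ℝ → ℝ) (n : ℕ) (x : Fin n → ℝ) : ℝ :=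
  Matrix.det (Matrix.of fun i j : Fin n => k (x i) (x j))

/-- The bordered determinant with first row at `y` and first column at `w`. -/
def kminor (k : ℝ → ℝ → ℝ) (n : ℕ) (y w : ℝ) (x : Fin n → ℝ) : ℝ :=
  Matrix.det (Matrix.of fun i j : Fin (n + 1) =>
    k ((Fin.cons y x : Fin (n + 1) → ℝ) i) ((Fin.cons w x : Fin (n + 1) → ℝ) j))

/-- The coefficients of the Fredholm determinant. -/
def fredD (k : ℝ → ℝ → ℝ) (n : ℕ) (a : ℝ) : ℝ := ∫ x in box n a, kdet k n x

/-- The coefficients of the Fredholm minor. -/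
def fredM (k : ℝ → ℝ → ℝ) (n : ℕ) (a y w : ℝ) : ℝ := ∫ x in box n a, kminor k n y w x

section

variable {k : ℝ → ℝ → ℝ} {n : ℕ} {a : ℝ}

lemma isCompact_box (n : ℕ) (a : ℝ) : IsCompact (box n a) :=
  isCompact_univ_pi fun _ => isCompact_Icc

lemma measurableSet_box (n : ℕ) (a : ℝ) : MeasurableSet (box n a) :=
  (isCompact_box n a).isClosed.measurableSet

lemma volume_box (n : ℕ) (ha : 0 ≤ a) : (volume : Measure (Fin n → ℝ)).real (box n a) = (2 * a) ^ n := by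
  have h : box n a = Set.Icc (fun _ => -a) (fun _ => a) := Set.pi_univ_Icc _ _
  rw [Measure.real, h, Real.volume_Icc_pi_toReal fun _ => by simp only; linarith]
  simp only [Finset.prod_const, Finset.card_univ, Fintype.card_fin]
  ring

lemma norm_integral_box_le (ha : 0 ≤ a) {F : (Fin n → ℝ) → ℝ} {C : ℝ} (h : ∀ x, ‖F x‖ ≤ C) :
    ‖∫ x in box n a, F x‖ ≤ C * (2 * a) ^ n := by
  rw [← volume_box n ha]
  exact norm_setIntegral_le_of_norm_le_const (isCompact_box n a).measure_lt_top fun x _ => h x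

lemma continuous_kminor (hk : Continuous (Function.uncurry k)) (n : ℕ) :
    Continuous fun z : (ℝ × ℝ) × (Fin n → ℝ) => kminor k n z.1.1 z.1.2 z.2 := by
  refine Continuous.matrix_det (continuous_matrix fun i j => ?_)
  have h1 : ∀ (f : (ℝ × ℝ) × (Fin n → ℝ) → ℝ), Continuous f → ∀ i : Fin (n + 1),
      Continuous fun z : (ℝ × ℝ) × (Fin n → ℝ) => (Fin.cons (f z) z.2 : Fin (n + 1) → ℝ) i := by
    intro f hf i
    refine Fin.cases ?_ (fun i => ?_) i
    · simpa using hf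
    · simp only [Fin.cons_succ]
      fun_prop
  exact hk.comp ((h1 _ (by fun_prop) i).prodMk (h1 _ (by fun_prop) j))

lemma continuous_kdet (hk : Continuous (Function.uncurry k)) (n : ℕ) : Continuous (kdet k n) := by
  refine Continuous.matrix_det (continuous_matrix fun i j => ?_)
  exact hk.comp (by fun_prop : Continuous fun x : Fin n → ℝ => (x i, x j))

lemma norm_kdet_le (hb : ∀ x y, |k x y| ≤ 1) (x : Fin n → ℝ) : ‖kdet k n x‖ ≤ Real.sqrt n ^ n :=
  abs_det_le fun _ _ => hb _ _

lemma norm_kminor_le (hb : ∀ x y, |k x y| ≤ 1) (y w : ℝ) (x : Fin n → ℝ) :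
    ‖kminor k n y w x‖ ≤ Real.sqrt (n + 1 : ℕ) ^ (n + 1) :=
  abs_det_le fun _ _ => hb _ _

lemma norm_fredD_le (hb : ∀ x y, |k x y| ≤ 1) (ha : 0 ≤ a) :
    ‖fredD k n a‖ ≤ Real.sqrt n ^ n * (2 * a) ^ n :=
  norm_integral_box_le ha (norm_kdet_le hb)

lemma norm_fredM_le (hb : ∀ x y, |k x y| ≤ 1) (ha : 0 ≤ a) (y w : ℝ) :
    ‖fredM k n a y w‖ ≤ Real.sqrt (n + 1 : ℕ) ^ (n + 1) * (2 * a) ^ n :=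
  norm_integral_box_le ha (norm_kminor_le hb y w)

lemma continuous_fredM (hk : Continuous (Function.uncurry k)) (n : ℕ) (a w : ℝ) :
    Continuous fun y => fredM k n a y w :=
  continuous_parametric_integral_of_continuous (f := fun y x => kminor k n y w x)
    ((continuous_kminor hk n).comp (by fun_prop :
      Continuous fun z : ℝ × (Fin n → ℝ) => ((z.1, w), z.2))) (isCompact_box n a)

/-- Expansion of the bordered determinant along the first row. -/
lemma kminor_succ (k : ℝ → ℝ → ℝ) (n : ℕ) (y w : ℝ) (x : Fin (n + 1) → ℝ) :
    kminor k (n + 1) y w x = k y w * kdet k (n + 1) x -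
      ∑ l : Fin (n + 1), k y (x l) * kminor k n (x l) w (l.removeNth x) := by
  rw [kminor, Matrix.det_succ_row_zero, Fin.sum_univ_succ, sub_eq_add_neg, ← Finset.sum_neg_distrib]
  congr 1
  · simp only [Fin.val_zero, pow_zero, one_mul, Matrix.of_apply, Fin.cons_zero]
    congr 1
  · refine Finset.sum_congr rfl fun l _ => ?_
    -- The Laplace minor has its rows in the order x, whereas `kminor` wants the row of `x l` first.
    -- The cycle bringing it there has sign (-1)^l, and the Laplace sign is (-1)^(l+1); their
    -- product is the -1 of the statement for every l.
    have hC : (Matrix.of fun i j : Fin (n + 1) =>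
        k ((Fin.cons (x l) (l.removeNth x) : Fin (n + 1) → ℝ) i)
          ((Fin.cons w (l.removeNth x) : Fin (n + 1) → ℝ) j)) =
        ((Matrix.of fun i j : Fin (n + 2) => k ((Fin.cons y x : Fin (n + 2) → ℝ) i)
          ((Fin.cons w x : Fin (n + 2) → ℝ) j)).submatrix Fin.succ l.succ.succAbove).submatrix
          l.cycleRange.symm id := by
      ext i j
      have h1 := congrFun (Fin.cons_removeNth_eq_comp_cycleRange_symm x l) i
      have h2 := congrFun (Fin.cons_comp_succ_succAbove w x l) j
      simp only [Function.comp_apply] at h1 h2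
      simp only [Matrix.of_apply, Matrix.submatrix_apply, id, h1, h2, Fin.cons_succ]
    rw [kminor, hC, Matrix.det_permute, Equiv.Perm.sign_symm, Fin.sign_cycleRange, Fin.val_succ,
      pow_succ]
    simp only [Matrix.of_apply, Fin.cons_zero, Fin.cons_succ]
    push_cast
    ring

lemma integral_box_succ (l : Fin (n + 1)) {g : ℝ × (Fin n → ℝ) → ℝ} (hg : Continuous g) (ha : 0 ≤ a) :
    ∫ x in box (n + 1) a, g (x l, l.removeNth x) =
      ∫ s in (-a)..a, ∫ x in box n a, g (s, x) := by
  have he := volume_preserving_piFinSuccAbove (fun _ : Fin (n + 1) => ℝ) l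
  have h1 := he.setIntegral_preimage_emb (MeasurableEquiv.measurableEmbedding _) g
    (Set.Icc (-a) a ×ˢ box n a)
  have h2 : (MeasurableEquiv.piFinSuccAbove (fun _ : Fin (n + 1) => ℝ) l) ⁻¹'
      (Set.Icc (-a) a ×ˢ box n a) = box (n + 1) a := by
    ext x
    simp only [box, Set.mem_preimage, Set.mem_prod, Set.mem_univ_pi, Fin.forall_iff_succAbove l]
    rfl
  rw [h2] at h1
  rw [intervalIntegral.integral_of_le (by linarith), ← integral_Icc_eq_integral_Ioc,
    ← setIntegral_prod]
  · exact h1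
  · exact hg.continuousOn.integrableOn_compact (isCompact_Icc.prod (isCompact_box n a))

/-- The Fredholm resolvent identity, coefficientwise. -/
lemma fredM_succ (hk : Continuous (Function.uncurry k)) (ha : 0 ≤ a) (n : ℕ) (y w : ℝ) :
    fredM k (n + 1) a y w = k y w * fredD k (n + 1) a -
      (n + 1) * ∫ s in (-a)..a, k y s * fredM k n a s w := by
  have hky : Continuous fun s => k y s := hk.comp (by fun_prop : Continuous fun s : ℝ => (y, s))
  have hg : Continuous fun z : ℝ × (Fin n → ℝ) => k y z.1 * kminor k n z.1 w z.2 :=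
    (hky.comp continuous_fst).mul ((continuous_kminor hk n).comp (by fun_prop :
      Continuous fun z : ℝ × (Fin n → ℝ) => ((z.1, w), z.2)))
  have hr : ∀ l : Fin (n + 1), Continuous fun x : Fin (n + 1) → ℝ => (x l, l.removeNth x) :=
    fun l => (continuous_apply l).prodMk (continuous_pi fun i => continuous_apply _)
  have h1 : ∀ l : Fin (n + 1), ∫ x in box (n + 1) a,
      k y (x l) * kminor k n (x l) w (l.removeNth x) = ∫ s in (-a)..a, k y s * fredM k n a s w := by
    intro l
    rw [integral_box_succ l hg ha]
    simp only [fredM, integral_const_mul]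
  have hi : ∀ l ∈ (Finset.univ : Finset (Fin (n + 1))), Integrable
      (fun x : Fin (n + 1) → ℝ => k y (x l) * kminor k n (x l) w (l.removeNth x))
      (volume.restrict (box (n + 1) a)) := fun l _ =>
    (hg.comp (hr l)).continuousOn.integrableOn_compact (isCompact_box _ _)
  have hi0 : IntegrableOn (kdet k (n + 1)) (box (n + 1) a) :=
    (continuous_kdet hk _).continuousOn.integrableOn_compact (isCompact_box _ _)
  rw [fredM]
  simp only [kminor_succ]
  rw [integral_sub (hi0.const_mul _) (integrable_finsetSum _ hi), integral_const_mul,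
    integral_finsetSum _ hi, fredD]
  simp [h1]

lemma fredM_zero (ha : 0 ≤ a) (y w : ℝ) : fredM k 0 a y w = k y w := by
  have h : ∀ x, kminor k 0 y w x = k y w := fun x => by
    simp [kminor, Matrix.det_unique]
  simp only [fredM, h]
  rw [setIntegral_const, volume_box 0 ha, pow_zero, one_smul]

lemma fredD_zero (ha : 0 ≤ a) : fredD k 0 a = 1 := by
  have h : ∀ x, kdet k 0 x = 1 := fun x => Matrix.det_isEmpty
  simp only [fredD, h]
  rw [setIntegral_const, volume_box 0 ha, pow_zero, one_smul]

/-! ### Differentiation of integrals over cubes -/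

open scoped Pointwise in
lemma smul_box (n : ℕ) (ha : 0 < a) : a • box n 1 = box n a := by
  ext x
  rw [Set.mem_smul_set_iff_inv_smul_mem₀ ha.ne']
  simp only [box, Set.mem_univ_pi, Pi.smul_apply, smul_eq_mul, Set.mem_Icc]
  refine forall_congr' fun i => ?_
  rw [inv_mul_le_iff₀ ha, le_inv_mul_iff₀ ha]
  simp

open scoped Pointwise in
lemma integral_box_eq (ha : 0 < a) (F : (Fin n → ℝ) → ℝ) :
    ∫ x in box n a, F x = a ^ n * ∫ x in box n 1, F (a • x) := by
  rw [Measure.setIntegral_comp_smul_of_pos volume F (box n 1) ha, smul_box n ha, smul_eq_mul,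
    Module.finrank_fin_fun, mul_inv_cancel_left₀ (pow_pos ha n).ne']

lemma hasDerivAt_integral_box_smul {F : (Fin n → ℝ) → ℝ} (hF : ContDiff ℝ 1 F) (a : ℝ) :
    HasDerivAt (fun a : ℝ => ∫ x in box n 1, F (a • x)) (∫ x in box n 1, fderiv ℝ F (a • x) x) a := by
  have hc : Continuous fun z : ℝ × (Fin n → ℝ) => fderiv ℝ F (z.1 • z.2) z.2 :=
    ((hF.continuous_fderiv one_ne_zero).comp (by fun_prop)).clm_apply continuous_snd
  obtain ⟨C, hC⟩ := ((isCompact_Icc (a := a - 1) (b := a + 1)).prod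
    (isCompact_box n 1)).exists_bound_of_continuousOn hc.continuousOn
  have hnhds : Set.Ioo (a - 1) (a + 1) ∈ nhds a := Ioo_mem_nhds (by linarith) (by linarith)
  have hfc : ∀ a : ℝ, Continuous fun x => F (a • x) := fun a => hF.continuous.comp (by fun_prop)
  refine (hasDerivAt_integral_of_dominated_loc_of_deriv_le (μ := volume.restrict (box n 1))
    (F := fun a x => F (a • x)) (F' := fun a x => fderiv ℝ F (a • x) x) (bound := fun _ => C)
    hnhds ?_ ?_ ?_ ?_ ?_ ?_).2
  · exact Filter.Eventually.of_forall fun a => (hfc a).aestronglyMeasurable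
  · exact (hfc a).continuousOn.integrableOn_compact (isCompact_box _ _)
  · exact (hc.comp (by fun_prop : Continuous fun x : Fin n → ℝ => (a, x))).aestronglyMeasurable
  · filter_upwards [ae_restrict_mem (measurableSet_box n 1)] with x hx b hb
    exact hC (b, x) ⟨Set.Ioo_subset_Icc_self hb, hx⟩
  · exact continuous_const.continuousOn.integrableOn_compact (isCompact_box _ _)
  · refine Filter.Eventually.of_forall fun x b _ => ?_
    have h1 : HasDerivAt (fun b : ℝ => b • x) x b := by
      simpa using (hasDerivAt_id b).smul_const x
    exact ((hF.differentiable one_ne_zero (b • x)).hasFDerivAt).comp_hasDerivAt b h1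

/-- The divergence theorem for the radial field of a function on a cube. -/
lemma integral_box_divergence {F : (Fin (n + 1) → ℝ) → ℝ} (hF : ContDiff ℝ 1 F) (a : ℝ) :
    ∫ x in box (n + 1) 1, (a * fderiv ℝ F (a • x) x + (n + 1) * F (a • x)) =
      ∑ i : Fin (n + 1), ((∫ x in box n 1, F (a • i.insertNth 1 x)) +
        ∫ x in box n 1, F (a • i.insertNth (-1) x)) := by
  have hbox : ∀ m : ℕ, box m 1 = Set.Icc (fun _ => (-1 : ℝ)) (fun _ => 1) := fun m =>
    Set.pi_univ_Icc _ _
  have hd : ∀ (i : Fin (n + 1)) (x : Fin (n + 1) → ℝ),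
      HasFDerivAt (fun x : Fin (n + 1) → ℝ => x i * F (a • x))
        (x i • ((fderiv ℝ F (a • x)).comp (a • ContinuousLinearMap.id ℝ (Fin (n + 1) → ℝ))) +
          F (a • x) • ContinuousLinearMap.proj i) x := by
    intro i x
    have h1 : HasFDerivAt (fun x : Fin (n + 1) → ℝ => a • x)
        (a • ContinuousLinearMap.id ℝ (Fin (n + 1) → ℝ)) x := (hasFDerivAt_id x).const_smul a
    have h2 := ((hF.differentiable one_ne_zero (a • x)).hasFDerivAt).comp x h1
    exact (hasFDerivAt_apply i x).mul h2
  have hsum : ∀ x : Fin (n + 1) → ℝ, ∑ i, (x i • ((fderiv ℝ F (a • x)).comp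
      (a • ContinuousLinearMap.id ℝ (Fin (n + 1) → ℝ))) +
          F (a • x) • ContinuousLinearMap.proj i : (Fin (n + 1) → ℝ) →L[ℝ] ℝ) (Pi.single i 1) =
      a * fderiv ℝ F (a • x) x + (n + 1) * F (a • x) := by
    intro x
    have hL : ∀ L : (Fin (n + 1) → ℝ) →L[ℝ] ℝ, L x = ∑ i, x i * L (Pi.single i 1) := by
      intro L
      conv_lhs => rw [pi_eq_sum_univ' x]
      simp only [map_sum, map_smul, smul_eq_mul]
    have hx := hL (fderiv ℝ F (a • x))
    simp only [_root_.add_apply, _root_.smul_apply,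
      ContinuousLinearMap.comp_apply, ContinuousLinearMap.proj_apply, Pi.single_eq_same, map_smul,
      ContinuousLinearMap.id_apply, smul_eq_mul, mul_one, Finset.sum_add_distrib, Finset.sum_const,
      Finset.card_univ, Fintype.card_fin, nsmul_eq_mul]
    rw [hx, Finset.mul_sum]
    push_cast
    congr 1
    exact Finset.sum_congr rfl fun i _ => by ring
  have hc : Continuous fun x : Fin (n + 1) → ℝ =>
      a * fderiv ℝ F (a • x) x + (n + 1) * F (a • x) :=
    (continuous_const.mul (((hF.continuous_fderiv one_ne_zero).comp (by fun_prop)).clm_apply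
      continuous_id)).add (continuous_const.mul (hF.continuous.comp (by fun_prop)))
  have key := integral_divergence_of_hasFDerivAt_off_countable' (fun _ : Fin (n + 1) => (-1 : ℝ))
    (fun _ => 1) (fun _ => by norm_num) (fun i x => x i * F (a • x)) _ ∅ Set.countable_empty
    (fun i => (by
      have := hF.continuous
      fun_prop : Continuous fun x : Fin (n + 1) → ℝ => x i * F (a • x)).continuousOn)
    (fun x _ i => hd i x) (by
      simp only [hsum]
      exact hc.continuousOn.integrableOn_compact isCompact_Icc)
  simp only [hsum] at key
  rw [hbox (n + 1), key, hbox n]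
  refine Finset.sum_congr rfl fun i _ => ?_
  have e1 : ((fun _ : Fin (n + 1) => (-1 : ℝ)) ∘ i.succAbove) = fun _ => -1 := rfl
  have e2 : ((fun _ : Fin (n + 1) => (1 : ℝ)) ∘ i.succAbove) = fun _ => 1 := rfl
  simp only [e1, e2, Fin.insertNth_apply_same, one_mul, neg_one_mul, integral_neg, sub_neg_eq_add]

/-- The derivative of the integral of a symmetric function, even in each variable, over a cube. -/
lemma hasDerivAt_integral_box {F : (Fin (n + 1) → ℝ) → ℝ} (hF : ContDiff ℝ 1 F)
    (hsym : ∀ (i : Fin (n + 1)) (c : ℝ) (x : Fin n → ℝ),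
      F (i.insertNth c x) = F (Fin.cons c x : Fin (n + 1) → ℝ))
    (hneg : ∀ (c : ℝ) (x : Fin n → ℝ),
      F (Fin.cons (-c) x : Fin (n + 1) → ℝ) = F (Fin.cons c x : Fin (n + 1) → ℝ)) (ha : 0 < a) :
    HasDerivAt (fun a => ∫ x in box (n + 1) a, F x)
      (2 * (n + 1) * ∫ x in box n a, F (Fin.cons a x : Fin (n + 1) → ℝ)) a := by
  have h1 := (hasDerivAt_pow (n + 1) a).mul (hasDerivAt_integral_box_smul hF a)
  refine (h1.congr_of_eventuallyEq ?_).congr_deriv ?_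
  · filter_upwards [Ioi_mem_nhds ha] with b hb using integral_box_eq hb F
  · have hs : ∀ (i : Fin (n + 1)) (c : ℝ) (x : Fin n → ℝ),
        a • (i.insertNth c x : Fin (n + 1) → ℝ) = i.insertNth (a * c) (a • x) := by
      intro i c x
      ext j
      refine Fin.succAboveCases i ?_ (fun j => ?_) j <;> simp
    -- The derivative of a^(n+1) ∫ F(ax) over the unit cube is a^n times the integral of the
    -- divergence of x F(ax). It becomes a sum over 2(n+1) faces, all equal by symmetry and
    -- evenness.
    have h2 := integral_box_divergence hF a
    have hint1 : IntegrableOn (fun x : Fin (n + 1) → ℝ => fderiv ℝ F (a • x) x) (box (n + 1) 1) :=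
      (((hF.continuous_fderiv one_ne_zero).comp (by fun_prop)).clm_apply
        continuous_id).continuousOn.integrableOn_compact (isCompact_box _ _)
    have hint2 : IntegrableOn (fun x : Fin (n + 1) → ℝ => F (a • x)) (box (n + 1) 1) :=
      (hF.continuous.comp (by fun_prop)).continuousOn.integrableOn_compact (isCompact_box _ _)
    rw [integral_add (hint1.const_mul _) (hint2.const_mul _), integral_const_mul,
      integral_const_mul] at h2
    simp only [hs, hsym, mul_neg, mul_one, hneg, Finset.sum_const, Finset.card_univ,
      Fintype.card_fin, nsmul_eq_mul] at h2
    rw [integral_box_eq ha fun x => F (Fin.cons a x : Fin (n + 1) → ℝ)]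
    push_cast at h2 ⊢
    linear_combination a ^ n * h2

lemma contDiff_kdet (hk : ContDiff ℝ 1 (Function.uncurry k)) (n : ℕ) : ContDiff ℝ 1 (kdet k n) := by
  unfold kdet
  simp only [Matrix.det_apply']
  refine ContDiff.sum fun τ _ => contDiff_const.mul (contDiff_prod fun i _ => ?_)
  simp only [Matrix.of_apply]
  exact hk.comp ((contDiff_apply ℝ ℝ (τ i)).prodMk (contDiff_apply ℝ ℝ i))

lemma kdet_insertNth (i : Fin (n + 1)) (c : ℝ) (x : Fin n → ℝ) :
    kdet k (n + 1) (i.insertNth c x) = kdet k (n + 1) (Fin.cons c x) := by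
  rw [← Fin.insertNth_comp_cycleRange_symm i c x]
  exact (Matrix.det_submatrix_equiv_self i.cycleRange.symm
    (Matrix.of fun j l : Fin (n + 1) => k ((i.insertNth c x : Fin (n + 1) → ℝ) j)
      ((i.insertNth c x : Fin (n + 1) → ℝ) l))).symm

/-- A change of sign of one variable multiplies one row and one column by ε, hence the determinant
by ε² = 1. For the sine kernel this makes the integrand even in each variable although the kernel is
odd. -/
lemma kdet_cons_neg {ε : ℝ} (hε : ε * ε = 1) (h1 : ∀ x y, k (-x) y = ε * k x y)
    (h2 : ∀ x y, k x (-y) = ε * k x y) (c : ℝ) (x : Fin n → ℝ) :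
    kdet k (n + 1) (Fin.cons (-c) x) = kdet k (n + 1) (Fin.cons c x) := by
  set d : Fin (n + 1) → ℝ := Fin.cons ε fun _ => 1 with hd
  have hprod : ∏ i, d i = ε := by simp [hd, Fin.prod_univ_succ]
  have hm : (Matrix.of fun i j : Fin (n + 1) => k ((Fin.cons (-c) x : Fin (n + 1) → ℝ) i)
      ((Fin.cons (-c) x : Fin (n + 1) → ℝ) j)) = Matrix.of fun i j => d i *
        (Matrix.of fun i j => d j * (Matrix.of fun i j : Fin (n + 1) =>
          k ((Fin.cons c x : Fin (n + 1) → ℝ) i) ((Fin.cons c x : Fin (n + 1) → ℝ) j)) i j) i j := by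
    ext i j
    simp only [Matrix.of_apply]
    refine Fin.cases ?_ (fun i => ?_) i <;> refine Fin.cases ?_ (fun j => ?_) j <;>
      simp [hd, h1, h2]
  rw [kdet, hm, Matrix.det_mul_column, Matrix.det_mul_row, hprod, ← mul_assoc, hε, one_mul, kdet]

/-- On the face where the first variable equals a, the determinant is by definition the bordered one
with y = w = a. -/
lemma hasDerivAt_fredD (hk : ContDiff ℝ 1 (Function.uncurry k)) {ε : ℝ} (hε : ε * ε = 1)
    (h1 : ∀ x y, k (-x) y = ε * k x y) (h2 : ∀ x y, k x (-y) = ε * k x y) (n : ℕ) (ha : 0 < a) :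
    HasDerivAt (fredD k (n + 1)) (2 * (n + 1) * fredM k n a a a) a :=
  hasDerivAt_integral_box (contDiff_kdet hk _) kdet_insertNth (kdet_cons_neg hε h1 h2) ha

end

/-! ### Fredholm series -/

/-- Convergence of the Fredholm series under Hadamard's bound. For the general term t one has 2t ≤
2^n t² + 2^{-n}, and n^n / n! ≤ e^n bounds 2^n t² by a term of an exponential series. -/
lemma summable_sqrt_pow {x : ℝ} (hx : 0 ≤ x) :
    Summable fun n : ℕ => Real.sqrt n ^ n * x ^ n / (n.factorial : ℝ) := by
  have h1 : Summable fun n : ℕ => (Real.exp 1 * (2 * x ^ 2)) ^ n / (n.factorial : ℝ) :=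
    Real.summable_pow_div_factorial _
  have h2 : Summable fun n : ℕ => (1 / 2 : ℝ) ^ n := summable_geometric_two
  refine Summable.of_nonneg_of_le (fun n => by positivity) (fun n => ?_) (h1.add h2)
  set t := Real.sqrt n ^ n * x ^ n / (n.factorial : ℝ) with ht
  have hn : (0 : ℝ) < n.factorial := by exact_mod_cast n.factorial_pos
  have ht0 : 0 ≤ t := by positivity
  have h3 : (n : ℝ) ^ n / n.factorial ≤ Real.exp n :=
    Real.pow_div_factorial_le_exp n (Nat.cast_nonneg n) n
  have h4 : t ^ 2 = (n : ℝ) ^ n / n.factorial * (x ^ 2) ^ n / n.factorial := by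
    have : (Real.sqrt n ^ n) ^ 2 = (n : ℝ) ^ n := by
      rw [← pow_mul, mul_comm, pow_mul, Real.sq_sqrt (Nat.cast_nonneg n)]
    rw [ht, div_pow, mul_pow, this, ← pow_mul, ← pow_mul, mul_comm n 2]
    field_simp
  have h5 : t ^ 2 * 2 ^ n ≤ (Real.exp 1 * (2 * x ^ 2)) ^ n / n.factorial := by
    rw [h4, mul_pow, mul_pow, ← Real.exp_nat_mul, mul_one]
    calc (n : ℝ) ^ n / n.factorial * (x ^ 2) ^ n / n.factorial * 2 ^ n =
        (n : ℝ) ^ n / n.factorial * (2 ^ n * (x ^ 2) ^ n / n.factorial) := by ring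
      _ ≤ Real.exp n * (2 ^ n * (x ^ 2) ^ n / n.factorial) :=
        mul_le_mul_of_nonneg_right h3 (by positivity)
      _ = _ := by ring
  have h6 : 0 ≤ (t * 2 ^ n - 1) ^ 2 / 2 ^ n := by positivity
  have h7 : (t * 2 ^ n - 1) ^ 2 / 2 ^ n = t ^ 2 * 2 ^ n - 2 * t + (1 / 2) ^ n := by
    have : (2 : ℝ) ^ n ≠ 0 := by positivity
    rw [one_div, inv_pow]
    field_simp
    ring
  linarith

/-- A majorant of the coefficients of the Fredholm minor. -/
def minorBound (R : ℝ) (n : ℕ) : ℝ :=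
  Real.sqrt (n + 1 : ℕ) ^ (n + 1) * (4 * R) ^ (n + 1) / ((n + 1).factorial : ℝ)

lemma summable_minorBound {R : ℝ} (hR : 0 ≤ R) : Summable (minorBound R) :=
  (summable_nat_add_iff 1).2 (summable_sqrt_pow (by positivity : 0 ≤ 4 * R))

/-- The Fredholm determinant as a series. -/
def fredDet (k : ℝ → ℝ → ℝ) (σ a : ℝ) : ℝ := ∑' n : ℕ, σ ^ n / (n.factorial : ℝ) * fredD k n a

/-- The Fredholm minor. -/
def fredMinor (k : ℝ → ℝ → ℝ) (σ a y w : ℝ) : ℝ :=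
  ∑' n : ℕ, σ ^ n / (n.factorial : ℝ) * fredM k n a y w

section

variable {k : ℝ → ℝ → ℝ} {σ a R : ℝ}

lemma abs_eq_one_of_sq (hσ : σ ^ 2 = 1) : |σ| = 1 := by
  rw [← Real.sqrt_sq_eq_abs, hσ, Real.sqrt_one]

lemma norm_coeff_mul (hσ : σ ^ 2 = 1) (n : ℕ) (x : ℝ) :
    ‖σ ^ n / (n.factorial : ℝ) * x‖ = ‖x‖ / n.factorial := by
  rw [norm_mul, norm_div, norm_pow, Real.norm_eq_abs σ, abs_eq_one_of_sq hσ, one_pow,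
    Real.norm_natCast]
  ring

lemma norm_fredD_term_le (hb : ∀ x y, |k x y| ≤ 1) (hσ : σ ^ 2 = 1) (ha : 0 ≤ a) (n : ℕ) :
    ‖σ ^ n / (n.factorial : ℝ) * fredD k n a‖ ≤
      Real.sqrt n ^ n * (2 * a) ^ n / (n.factorial : ℝ) := by
  rw [norm_coeff_mul hσ]
  exact div_le_div_of_nonneg_right (norm_fredD_le hb ha) (Nat.cast_nonneg _)

lemma summable_fredD (hb : ∀ x y, |k x y| ≤ 1) (hσ : σ ^ 2 = 1) (ha : 0 ≤ a) :
    Summable fun n : ℕ => σ ^ n / (n.factorial : ℝ) * fredD k n a :=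
  Summable.of_norm_bounded (summable_sqrt_pow (by positivity : 0 ≤ 2 * a))
    (norm_fredD_term_le hb hσ ha)

lemma norm_fredM_term_le (hb : ∀ x y, |k x y| ≤ 1) (hσ : σ ^ 2 = 1) (ha : 0 ≤ a) (haR : a ≤ R)
    (hR : 1 ≤ R) (n : ℕ) (y w : ℝ) :
    ‖σ ^ n / (n.factorial : ℝ) * fredM k n a y w‖ ≤ minorBound R n := by
  rw [norm_coeff_mul hσ]
  refine (div_le_div_of_nonneg_right (norm_fredM_le hb ha y w) (Nat.cast_nonneg _)).trans ?_
  have hn : (0 : ℝ) < n.factorial := by exact_mod_cast n.factorial_pos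
  -- The majorant is indexed by n + 1: this bound pays for passing from n! to (n + 1)!, and R ≥ 1
  -- pays for the extra power. Hence 4R in place of 2a.
  have h1 : ((n : ℝ) + 1) ≤ 2 ^ (n + 1) := by
    exact_mod_cast (Nat.lt_two_pow_self (n := n + 1)).le
  have h2 : (2 * a) ^ n ≤ (2 * R) ^ (n + 1) := by
    refine (pow_le_pow_left₀ (by positivity) (by linarith : 2 * a ≤ 2 * R) n).trans ?_
    exact pow_le_pow_right₀ (by linarith) (Nat.le_succ n)
  have h3 : ((n : ℝ) + 1) * (2 * a) ^ n ≤ (4 * R) ^ (n + 1) := by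
    calc ((n : ℝ) + 1) * (2 * a) ^ n ≤ 2 ^ (n + 1) * (2 * R) ^ (n + 1) :=
          mul_le_mul h1 h2 (by positivity) (by positivity)
      _ = (4 * R) ^ (n + 1) := by rw [← mul_pow]; ring
  rw [minorBound, Nat.factorial_succ, div_le_div_iff₀ hn (by positivity)]
  push_cast
  calc Real.sqrt ((n : ℝ) + 1) ^ (n + 1) * (2 * a) ^ n * (((n : ℝ) + 1) * n.factorial) =
      Real.sqrt ((n : ℝ) + 1) ^ (n + 1) * (((n : ℝ) + 1) * (2 * a) ^ n) * n.factorial := by ring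
    _ ≤ _ := by gcongr

lemma summable_fredM (hb : ∀ x y, |k x y| ≤ 1) (hσ : σ ^ 2 = 1) (ha : 0 ≤ a) (y w : ℝ) :
    Summable fun n : ℕ => σ ^ n / (n.factorial : ℝ) * fredM k n a y w :=
  Summable.of_norm_bounded (summable_minorBound (zero_le_one.trans (le_max_right a 1)))
    fun n => norm_fredM_term_le hb hσ ha (le_max_left a 1) (le_max_right a 1) n y w

lemma continuous_fredMinor (hk : Continuous (Function.uncurry k)) (hb : ∀ x y, |k x y| ≤ 1)
    (hσ : σ ^ 2 = 1) (ha : 0 ≤ a) (w : ℝ) : Continuous fun y => fredMinor k σ a y w :=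
  continuous_tsum (fun n => continuous_const.mul (continuous_fredM hk n a w))
    (summable_minorBound (zero_le_one.trans (le_max_right a 1)))
    fun n y => norm_fredM_term_le hb hσ ha (le_max_left a 1) (le_max_right a 1) n y w

/-- The Fredholm resolvent identity. -/
lemma fredMinor_eq (hk : Continuous (Function.uncurry k)) (hb : ∀ x y, |k x y| ≤ 1)
    (hσ : σ ^ 2 = 1) (ha : 0 ≤ a) (y w : ℝ) :
    fredMinor k σ a y w + σ * ∫ s in (-a)..a, k y s * fredMinor k σ a s w =
      fredDet k σ a * k y w := by
  have hky : Continuous fun s => k y s := hk.comp (by fun_prop : Continuous fun s : ℝ => (y, s))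
  have hsB := summable_minorBound (zero_le_one.trans (le_max_right a 1))
  have hle := fun n s => norm_fredM_term_le hb hσ ha (le_max_left a 1) (le_max_right a 1) n s w
  have hint : HasSum (fun n : ℕ => ∫ s in (-a)..a, k y s * (σ ^ n / (n.factorial : ℝ) *
      fredM k n a s w)) (∫ s in (-a)..a, k y s * fredMinor k σ a s w) := by
    refine intervalIntegral.hasSum_integral_of_dominated_convergence
      (fun n _ => minorBound (max a 1) n) ?_ ?_ ?_ ?_ ?_
    · exact fun n => (hky.mul (continuous_const.mul
        (continuous_fredM hk n a w))).aestronglyMeasurable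
    · refine fun n => Filter.Eventually.of_forall fun s _ => ?_
      rw [norm_mul]
      exact (mul_le_of_le_one_left (norm_nonneg _) (hb y s)).trans (hle n s)
    · exact Filter.Eventually.of_forall fun _ _ => hsB
    · exact intervalIntegrable_const
    · exact Filter.Eventually.of_forall fun s _ => (summable_fredM hb hσ ha s w).hasSum.mul_left _
  -- The factor n + 1 in `fredM_succ` turns (n + 1)! into n!, so the recursion shifts the index of
  -- the minor series by one, which becomes the integral term of the resolvent identity.
  have hterm : ∀ n : ℕ, σ ^ (n + 1) / ((n + 1).factorial : ℝ) * fredM k (n + 1) a y w =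
      k y w * (σ ^ (n + 1) / ((n + 1).factorial : ℝ) * fredD k (n + 1) a) -
        σ * ∫ s in (-a)..a, k y s * (σ ^ n / (n.factorial : ℝ) * fredM k n a s w) := by
    intro n
    have e : ∀ s, k y s * (σ ^ n / (n.factorial : ℝ) * fredM k n a s w) =
        σ ^ n / (n.factorial : ℝ) * (k y s * fredM k n a s w) := fun s => by ring
    simp only [e]
    rw [fredM_succ hk ha, intervalIntegral.integral_const_mul, Nat.factorial_succ]
    have h1 : (n.factorial : ℝ) ≠ 0 := by exact_mod_cast n.factorial_ne_zero
    have h2 : (n : ℝ) + 1 ≠ 0 := by positivity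
    push_cast
    field_simp
    ring
  have hD := summable_fredD hb hσ ha (k := k) (σ := σ)
  have hD1 := (summable_nat_add_iff 1).2 hD
  rw [← hint.tsum_eq, fredMinor, (summable_fredM hb hσ ha y w).tsum_eq_zero_add, fredDet,
    hD.tsum_eq_zero_add]
  simp only [hterm]
  rw [(hD1.mul_left _).tsum_sub (hint.summable.mul_left _), tsum_mul_left, tsum_mul_left,
    fredM_zero ha, fredD_zero ha]
  simp only [pow_zero, Nat.factorial_zero, Nat.cast_one, div_one, one_mul]
  ring

/-- Termwise differentiation: the coefficient of order n + 1 of the determinant differentiates into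
the coefficient of order n of the minor on the diagonal. -/
lemma hasDerivAt_fredDet (hk : ContDiff ℝ 1 (Function.uncurry k)) (hb : ∀ x y, |k x y| ≤ 1)
    {ε : ℝ} (hε : ε * ε = 1) (h1 : ∀ x y, k (-x) y = ε * k x y) (h2 : ∀ x y, k x (-y) = ε * k x y)
    (hσ : σ ^ 2 = 1) (ha : 0 < a) :
    HasDerivAt (fredDet k σ) (2 * σ * fredMinor k σ a a a) a := by
  set R := max (a + 1) 1 with hR
  have hR1 : 1 ≤ R := le_max_right _ _
  have haR : a < R := (lt_add_one a).trans_le (le_max_left _ _)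
  have hcoef : ∀ n : ℕ, ∀ b : ℝ, σ ^ (n + 1) / ((n + 1).factorial : ℝ) *
      (2 * (n + 1) * fredM k n b b b) = 2 * σ * (σ ^ n / (n.factorial : ℝ) * fredM k n b b b) := by
    intro n b
    have h1 : (n.factorial : ℝ) ≠ 0 := by exact_mod_cast n.factorial_ne_zero
    have h2 : (n : ℝ) + 1 ≠ 0 := by positivity
    rw [Nat.factorial_succ]
    push_cast
    field_simp
    ring
  have key := hasDerivAt_tsum_of_isPreconnected (𝕜 := ℝ) (t := Set.Ioo 0 R) (y₀ := a) (y := a)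
    (u := fun n => 2 * minorBound R n)
    (g := fun n b => σ ^ (n + 1) / ((n + 1).factorial : ℝ) * fredD k (n + 1) b)
    (g' := fun n b => 2 * σ * (σ ^ n / (n.factorial : ℝ) * fredM k n b b b))
    ((summable_minorBound (zero_le_one.trans hR1)).mul_left 2) isOpen_Ioo isPreconnected_Ioo
    (fun n b hb' => by
      rw [← hcoef]
      exact (hasDerivAt_fredD hk hε h1 h2 n hb'.1).const_mul _)
    (fun n b hb' => by
      rw [norm_mul, norm_mul, Real.norm_eq_abs σ, abs_eq_one_of_sq hσ, Real.norm_ofNat, mul_one]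
      exact mul_le_mul_of_nonneg_left
        (norm_fredM_term_le hb hσ hb'.1.le hb'.2.le hR1 n b b) zero_le_two)
    ⟨ha, haR⟩ ((summable_nat_add_iff 1).2 (summable_fredD hb hσ ha.le)) ⟨ha, haR⟩
  rw [tsum_mul_left] at key
  refine (key.const_add 1).congr_of_eventuallyEq ?_
  filter_upwards [Ioi_mem_nhds ha] with b hb'
  have hb0 : 0 ≤ b := le_of_lt hb'
  rw [fredDet, (summable_fredD hb hσ hb0).tsum_eq_zero_add, fredD_zero hb0]
  simp

/-- For a ≤ 1 the series without its constant term 1 is at most a S in absolute value, with S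
independent of a. -/
lemma exists_fredDet_pos (hb : ∀ x y, |k x y| ≤ 1) (hσ : σ ^ 2 = 1) :
    ∃ δ > 0, ∀ a, 0 < a → a < δ → 0 < fredDet k σ a := by
  have hS := (summable_nat_add_iff 1).2 (summable_sqrt_pow (zero_le_two (α := ℝ)))
  set S := ∑' n : ℕ, Real.sqrt (n + 1 : ℕ) ^ (n + 1) * 2 ^ (n + 1) / ((n + 1).factorial : ℝ) with hSd
  have hS0 : 0 ≤ S := tsum_nonneg fun n => by positivity
  refine ⟨min 1 (1 / (S + 1)), by positivity, fun a ha hlt => ?_⟩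
  have ha1 : a ≤ 1 := (hlt.trans_le (min_le_left _ _)).le
  have ha2 : a * (S + 1) < 1 := by
    rw [← lt_div_iff₀ (by positivity)]
    exact hlt.trans_le (min_le_right _ _)
  have hbound : ‖∑' n : ℕ, σ ^ (n + 1) / ((n + 1).factorial : ℝ) * fredD k (n + 1) a‖ ≤ a * S := by
    refine tsum_of_norm_bounded (hS.hasSum.mul_left a) fun n => ?_
    refine (norm_fredD_term_le hb hσ ha.le (n + 1)).trans ?_
    have h1 : a ^ (n + 1) ≤ a := by
      rw [pow_succ]
      exact mul_le_of_le_one_left ha.le (pow_le_one₀ ha.le ha1)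
    rw [mul_pow]
    calc Real.sqrt (n + 1 : ℕ) ^ (n + 1) * (2 ^ (n + 1) * a ^ (n + 1)) / ((n + 1).factorial : ℝ) =
        a ^ (n + 1) * (Real.sqrt (n + 1 : ℕ) ^ (n + 1) * 2 ^ (n + 1) / ((n + 1).factorial : ℝ)) := by
          ring
      _ ≤ _ := mul_le_mul_of_nonneg_right h1 (by positivity)
  rw [fredDet, (summable_fredD hb hσ ha.le).tsum_eq_zero_add, fredD_zero ha.le]
  have h3 := (abs_le.1 hbound).1
  simp only [pow_zero, Nat.factorial_zero, Nat.cast_one, div_one, one_mul]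
  linarith

end

/-! ### The determinants of the finite cosine and sine transforms -/

section

variable {p : Parity} {σ : ℝ}

/-- The kernel of the finite cosine (sine) transform. -/
def trigKer (p : Parity) (x y : ℝ) : ℝ := trig p (2 * Real.pi * x * y)

lemma detF_eq (p : Parity) (σ a : ℝ) : detF p σ a = fredDet (trigKer p) σ a := rfl

lemma contDiff_trigKer (p : Parity) : ContDiff ℝ 1 (Function.uncurry (trigKer p)) := by
  have h : ContDiff ℝ 1 fun z : ℝ × ℝ => 2 * Real.pi * z.1 * z.2 := by fun_prop
  cases p
  · exact Real.contDiff_cos.comp h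
  · exact Real.contDiff_sin.comp h

/-- Both sides solve the same integral equation, the left one by the resolvent identity. Keeping the
determinant as a factor avoids dividing by it, as it is not yet known to be nonzero. -/
lemma fredMinor_trigKer (hσ : σ ^ 2 = 1) {a : ℝ} (ha : 0 < a) (y : ℝ) :
    2 * fredMinor (trigKer p) σ a y a = detF p σ a * phi p σ a y := by
  have hc := continuous_fredMinor (σ := σ) (contDiff_trigKer p).continuous
    (fun x y => abs_trig_le p _) hσ ha.le a
  have hφ := isPhi_phi p hσ ha
  have h1 : ∀ x, (((2 * fredMinor (trigKer p) σ a x a : ℝ)) : ℂ) + σ * finT p a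
      (fun t => ((2 * fredMinor (trigKer p) σ a t a : ℝ) : ℂ)) x =
        ((detF p σ a * (2 * trigKer p x a) : ℝ) : ℂ) := by
    intro x
    have h := fredMinor_eq (σ := σ) (contDiff_trigKer p).continuous
      (fun x y => abs_trig_le p _) hσ ha.le x a
    have e : ∫ t in (-a)..a, trig p (2 * Real.pi * x * t) * (2 * fredMinor (trigKer p) σ a t a) =
        2 * ∫ t in (-a)..a, trigKer p x t * fredMinor (trigKer p) σ a t a := by
      rw [← intervalIntegral.integral_const_mul]
      refine intervalIntegral.integral_congr fun t _ => ?_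
      simp only [trigKer]
      ring
    rw [finT_ofReal p a (fun t => 2 * fredMinor (trigKer p) σ a t a), e, detF_eq]
    norm_cast
    linear_combination 2 * h
  have h2 : ∀ x, (((detF p σ a * phi p σ a x : ℝ)) : ℂ) + σ * finT p a
      (fun t => ((detF p σ a * phi p σ a t : ℝ) : ℂ)) x =
        ((detF p σ a * (2 * trigKer p x a) : ℝ) : ℂ) := by
    intro x
    have e : ∫ t in (-a)..a, trig p (2 * Real.pi * x * t) * (detF p σ a * phi p σ a t) =
        detF p σ a * ∫ t in (-a)..a, trig p (2 * Real.pi * x * t) * phi p σ a t := by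
      rw [← intervalIntegral.integral_const_mul]
      refine intervalIntegral.integral_congr fun t _ => ?_
      ring
    rw [finT_ofReal p a (fun t => detF p σ a * phi p σ a t), e]
    have h := hφ.2 x
    have e2 : trigKer p x a = trig p (2 * Real.pi * a * x) := by
      rw [trigKer]
      congr 1
      ring
    rw [e2]
    norm_cast
    linear_combination detF p σ a * h
  have h3 := congrFun (eq_of_finT_eq hσ ha (Complex.continuous_ofReal.comp (hc.const_mul 2))
    (Complex.continuous_ofReal.comp ((continuous_phi hσ ha).const_mul _)) h1 h2) y
  simp only [Function.comp_apply] at h3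
  exact_mod_cast h3

lemma hasDerivAt_detF (hσ : σ ^ 2 = 1) {a : ℝ} (ha : 0 < a) :
    HasDerivAt (detF p σ) (σ * phi p σ a a * detF p σ a) a := by
  obtain ⟨ε, hε, h1, h2⟩ : ∃ ε : ℝ, ε * ε = 1 ∧ (∀ x y, trigKer p (-x) y = ε * trigKer p x y) ∧
      ∀ x y, trigKer p x (-y) = ε * trigKer p x y := by
    cases p
    · exact ⟨1, by norm_num, fun x y => by simp [trigKer, trig], fun x y => by simp [trigKer, trig]⟩
    · exact ⟨-1, by norm_num, fun x y => by simp [trigKer, trig], fun x y => by simp [trigKer, trig]⟩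
  refine (hasDerivAt_fredDet (contDiff_trigKer p) (fun x y => abs_trig_le p _) hε h1 h2 hσ
    ha).congr_deriv ?_
  linear_combination σ * fredMinor_trigKer (p := p) hσ ha a

/-- The real function `u ↦ a φ_a(a)`, `a = exp u`. -/
def edge (p : Parity) (σ u : ℝ) : ℝ := Real.exp u * phi p σ (Real.exp u) (Real.exp u)

lemma edge_ofReal (hσ : σ ^ 2 = 1) (u : ℝ) :
    (edge p σ u : ℂ) = Real.exp u * Psi p σ u 1 := by
  rw [edge, Complex.ofReal_mul, phi_exp_self p hσ]

lemma contDiff_edge (hσ : σ ^ 2 = 1) {n : ℕ∞} : ContDiff ℝ n (edge p σ) := by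
  have h : edge p σ = fun u => ((Real.exp u * Psi p σ u 1 : ℂ)).re := by
    ext u
    rw [← edge_ofReal hσ, Complex.ofReal_re]
  have he : ContDiff ℝ n (fun u : ℝ => (Real.exp u : ℂ)) :=
    Complex.ofRealCLM.contDiff.comp Real.contDiff_exp
  rw [h]
  exact Complex.reCLM.contDiff.comp (he.mul (contDiff_Psi hσ 1))

lemma hasDerivAt_detF_exp (hσ : σ ^ 2 = 1) (u : ℝ) :
    HasDerivAt (fun u => detF p σ (Real.exp u)) (σ * edge p σ u * detF p σ (Real.exp u)) u := by
  refine ((hasDerivAt_detF (p := p) hσ (Real.exp_pos u)).comp u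
    (Real.hasDerivAt_exp u)).congr_deriv ?_
  rw [edge]
  ring

/-- The determinant D satisfies the linear equation D' = σ `edge` D in u, so D times the exponential
of minus the primitive of the coefficient is constant. Its sign is therefore the one it has for
small a. -/
lemma detF_exp_pos (hσ : σ ^ 2 = 1) (u : ℝ) : 0 < detF p σ (Real.exp u) := by
  obtain ⟨δ, hδ, hpos⟩ := exists_fredDet_pos (k := trigKer p) (σ := σ)
    (fun x y => abs_trig_le p _) hσ
  set u₀ := Real.log (δ / 2) with hu₀
  have h0 : 0 < detF p σ (Real.exp u₀) := by
    rw [hu₀, Real.exp_log (by positivity)]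
    exact hpos _ (by positivity) (by linarith)
  have hc : Continuous (edge p σ) := (contDiff_edge hσ (n := 0)).continuous
  have hG : ∀ v, HasDerivAt (fun v => ∫ t in u₀..v, σ * edge p σ t) (σ * edge p σ v) v := fun v =>
    (continuous_const.mul hc).integral_hasStrictDerivAt u₀ v |>.hasDerivAt
  have hconst : ∀ v, HasDerivAt (fun v => detF p σ (Real.exp v) *
      Real.exp (-∫ t in u₀..v, σ * edge p σ t)) 0 v := by
    intro v
    refine ((hasDerivAt_detF_exp (p := p) hσ v).mul (hG v).neg.exp).congr_deriv ?_
    ring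
  have h1 := is_const_of_deriv_eq_zero (fun v => (hconst v).differentiableAt)
    (fun v => (hconst v).deriv) u u₀
  simp only [intervalIntegral.integral_same, neg_zero, Real.exp_zero, mul_one] at h1
  rw [← h1] at h0
  exact (pos_iff_pos_of_mul_pos h0).2 (Real.exp_pos _)

lemma detF_pos (hσ : σ ^ 2 = 1) {a : ℝ} (ha : 0 < a) : 0 < detF p σ a := by
  rw [← Real.exp_log ha]
  exact detF_exp_pos hσ _

lemma hasDerivAt_logDetF (hσ : σ ^ 2 = 1) (u : ℝ) :
    HasDerivAt (logDetF p σ) (σ * edge p σ u) u := by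
  have h0 := (detF_exp_pos (p := p) hσ u).ne'
  refine ((hasDerivAt_detF_exp (p := p) hσ u).log h0).congr_deriv ?_
  field_simp

lemma contDiff_logDetF (hσ : σ ^ 2 = 1) : ContDiff ℝ 2 (logDetF p σ) := by
  have h1 : deriv (logDetF p σ) = fun u => σ * edge p σ u :=
    funext fun u => (hasDerivAt_logDetF hσ u).deriv
  rw [show (2 : WithTop ℕ∞) = 1 + 1 by norm_num]
  refine contDiff_succ_iff_deriv.2 ⟨fun u => (hasDerivAt_logDetF hσ u).differentiableAt, by simp, ?_⟩
  rw [h1]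
  exact contDiff_const.mul (contDiff_edge hσ (n := 1))

lemma potential_eq (hσ : σ ^ 2 = 1) (u : ℝ) :
    potential p σ u = -2 * (σ * deriv (edge p σ) u) := by
  have h1 : deriv (logDetF p σ) = fun u => σ * edge p σ u :=
    funext fun u => (hasDerivAt_logDetF hσ u).deriv
  rw [potential, iteratedDeriv_succ, iteratedDeriv_one, h1]
  rw [deriv_const_mul σ ((contDiff_edge hσ (n := 1)).differentiable one_ne_zero u)]

lemma hasDerivAt_edge (hσ : σ ^ 2 = 1) (u : ℝ) :
    HasDerivAt (fun u => (Real.exp u * Psi p σ u 1 : ℂ)) ((deriv (edge p σ) u : ℝ) : ℂ) u := by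
  have h := ((contDiff_edge (p := p) hσ (n := 1)).differentiable one_ne_zero u).hasDerivAt.ofReal_comp
  simpa only [edge_ofReal hσ] using h

lemma deriv_muPsi (p : Parity) (u : ℝ) :
    deriv (muPsi p) u = (deriv (edge p 1) u : ℝ) + (deriv (edge p (-1)) u : ℝ) := by
  have h1 := hasDerivAt_edge (p := p) (σ := 1) (by norm_num) u
  have h2 := hasDerivAt_edge (p := p) (σ := -1) (by norm_num) u
  have h3 : muPsi p = (fun u => (Real.exp u * Psi p 1 u 1 : ℂ)) +
      fun u => (Real.exp u * Psi p (-1) u 1 : ℂ) := by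
    ext v
    simp only [muPsi, Pi.add_apply]
    ring
  rw [h3, (h1.add h2).deriv]

lemma muPsi_sq_eq (p : Parity) (u : ℝ) :
    muPsi p u ^ 2 = (deriv (edge p (-1)) u : ℝ) - (deriv (edge p 1) u : ℝ) :=
  (muPsi_sq p u).unique ((hasDerivAt_edge (p := p) (σ := -1) (by norm_num) u).sub
    (hasDerivAt_edge (p := p) (σ := 1) (by norm_num) u))

/-- With e₊ and e₋ the edge values, μ' = e₊' + e₋' and μ² = e₋' - e₊'; hence μ² - μ' = -2 e₊', while
(log det)'' = e₊'. -/
lemma potential_one (p : Parity) (u : ℝ) :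
    (potential p 1 u : ℂ) = muPsi p u ^ 2 - deriv (muPsi p) u := by
  rw [deriv_muPsi, muPsi_sq_eq, potential_eq (by norm_num)]
  push_cast
  ring

lemma potential_neg_one (p : Parity) (u : ℝ) :
    (potential p (-1) u : ℂ) = muPsi p u ^ 2 + deriv (muPsi p) u := by
  rw [deriv_muPsi, muPsi_sq_eq, potential_eq (by norm_num)]
  push_cast
  ring

end

/-! ### The eigenspaces of the cosine and sine transforms in L² -/

/-- The Hilbert space `L²(ℝ)`. -/
abbrev L2R : Type := Lp ℂ 2 (volume : Measure ℝ)

/-- Reflection `f ↦ f (-·)` on `L²(ℝ)`. -/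
def reflect (f : L2R) : L2R :=
  Lp.compMeasurePreserving (fun x : ℝ => -x) (Measure.measurePreserving_neg volume) f

lemma reflect_ae (f : L2R) : ∀ᵐ x : ℝ, reflect f x = f (-x) :=
  Lp.coeFn_compMeasurePreserving f (Measure.measurePreserving_neg volume)

lemma continuous_reflect : Continuous reflect :=
  (Lp.isometry_compMeasurePreserving (Measure.measurePreserving_neg volume)).continuous

lemma fourierInv_eq_reflect (f : L2R) : 𝓕⁻ f = reflect (𝓕 f) := by
  refine DenseRange.induction_on (p := fun f : L2R => 𝓕⁻ f = reflect (𝓕 f))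
    (SchwartzMap.denseRange_toLpCLM (p := 2) ENNReal.ofNat_ne_top) f ?_ ?_
  · exact isClosed_eq (ContinuousFourierInv.continuous_fourierInv)
      (continuous_reflect.comp (ContinuousFourier.continuous_fourier))
  · intro g
    simp only [SchwartzMap.toLpCLM_apply]
    rw [SchwartzMap.toLp_fourierInv_eq, SchwartzMap.toLp_fourier_eq]
    refine Lp.ext ?_
    have h1 := (𝓕⁻ g).coeFn_toLp 2 (volume : Measure ℝ)
    have h2 := (𝓕 g).coeFn_toLp 2 (volume : Measure ℝ)
    have h3 := (Measure.measurePreserving_neg (volume : Measure ℝ)).quasiMeasurePreserving.ae h2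
    filter_upwards [h1, h3, reflect_ae ((𝓕 g).toLp 2)] with x h1 h3 h4
    rw [h1, h4, h3]
    rw [SchwartzMap.fourierInv_coe, SchwartzMap.fourier_coe]
    exact Real.fourierInv_eq_fourier_neg _ _

lemma fourier_reflect (f : L2R) : 𝓕 (reflect f) = (𝓕⁻ f : L2R) := by
  have h : 𝓕 (reflect (𝓕 (𝓕⁻ f : L2R))) = 𝓕 (𝓕⁻ (𝓕⁻ f : L2R) : L2R) := by
    rw [fourierInv_eq_reflect (𝓕⁻ f)]
  simpa using h

/-- The cosine (sine) transform on even (odd) square integrable functions. -/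
def parT (p : Parity) (f : L2R) : L2R := parUnit p • 𝓕 f

lemma parT_add (p : Parity) (f g : L2R) : parT p (f + g) = parT p f + parT p g := by
  simp [parT, FourierTransform.fourier_add]

lemma parT_smul (p : Parity) (c : ℂ) (f : L2R) : parT p (c • f) = c • parT p f := by
  simp only [parT, FourierTransform.fourier_smul]
  rw [smul_comm]

lemma inner_parT (p : Parity) (f g : L2R) : inner ℂ (parT p f) (parT p g) = inner ℂ f g := by
  rw [parT, parT, inner_smul_left, inner_smul_right, Lp.inner_fourier_eq, ← mul_assoc,
    mul_comm (starRingEnd ℂ _), Complex.mul_conj, Complex.normSq_eq_norm_sq, norm_parUnit]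
  simp

/-- `f` has the parity `p`. -/
def HasParity (p : Parity) (f : L2R) : Prop := ∀ᵐ x : ℝ, f (-x) = parSign p * f x

lemma hasParity_iff {p : Parity} {f : L2R} : HasParity p f ↔ reflect f = parSign p • f := by
  constructor
  · intro h
    refine Lp.ext ?_
    filter_upwards [h, reflect_ae f, Lp.coeFn_smul (parSign p) f] with x h1 h2 h3
    rw [h2, h1, h3]
    rfl
  · intro h
    have h3 := Lp.coeFn_smul (parSign p) f
    rw [← h] at h3
    filter_upwards [reflect_ae f, h3] with x h1 h2
    rw [← h1, h2]
    rfl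

lemma HasParity.parT {p : Parity} {f : L2R} (h : HasParity p f) : HasParity p (parT p f) := by
  rw [hasParity_iff] at h ⊢
  have h1 : reflect (𝓕 f) = parSign p • 𝓕 f := by
    rw [← fourierInv_eq_reflect, ← fourier_reflect, h, FourierTransform.fourier_smul]
  have h2 : HasParity p (𝓕 f) := hasParity_iff.2 h1
  rw [← hasParity_iff]
  have h3 := Lp.coeFn_smul (parUnit p) (𝓕 f)
  have h4 := (Measure.measurePreserving_neg (volume : Measure ℝ)).quasiMeasurePreserving.ae h3
  filter_upwards [h2, h3, h4] with x h2 h3 h4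
  simp only [FourierDirac.parT]
  rw [h4, h3]
  simp only [Pi.smul_apply, smul_eq_mul, h2]
  ring

lemma HasParity.parT_parT {p : Parity} {f : L2R} (h : HasParity p f) :
    FourierDirac.parT p (FourierDirac.parT p f) = f := by
  rw [hasParity_iff] at h
  have h1 : (𝓕⁻ f : L2R) = parSign p • 𝓕 f := by
    rw [← fourier_reflect, h, FourierTransform.fourier_smul]
  have h2 : f = parSign p • 𝓕 (𝓕 f) := by
    rw [← FourierTransform.fourier_smul, ← h1]
    simp
  rw [FourierDirac.parT, FourierDirac.parT, FourierTransform.fourier_smul, smul_smul,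
    parUnit_mul_self, ← h2]

lemma HasParity.add {p : Parity} {f g : L2R} (hf : HasParity p f) (hg : HasParity p g) :
    HasParity p (f + g) := by
  have h3 := Lp.coeFn_add f g
  have h4 := (Measure.measurePreserving_neg (volume : Measure ℝ)).quasiMeasurePreserving.ae h3
  filter_upwards [hf, hg, h3, h4] with x h1 h2 h3 h4
  rw [h4, h3]
  simp only [Pi.add_apply, h1, h2]
  ring

lemma HasParity.smul {p : Parity} {f : L2R} (hf : HasParity p f) (c : ℂ) :
    HasParity p (c • f) := by
  have h3 := Lp.coeFn_smul c f
  have h4 := (Measure.measurePreserving_neg (volume : Measure ℝ)).quasiMeasurePreserving.ae h3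
  filter_upwards [hf, h3, h4] with x h1 h3 h4
  rw [h4, h3]
  simp only [Pi.smul_apply, smul_eq_mul, h1]
  ring

/-- `f` vanishes almost everywhere on `(-a, a)`. -/
def VanishesNear (a : ℝ) (f : L2R) : Prop := ∀ᵐ x : ℝ, x ∈ Set.Ioo (-a) a → f x = 0

lemma VanishesNear.add {a : ℝ} {f g : L2R} (hf : VanishesNear a f) (hg : VanishesNear a g) :
    VanishesNear a (f + g) := by
  filter_upwards [hf, hg, Lp.coeFn_add f g] with x h1 h2 h3 hx
  rw [h3]
  simp [h1 hx, h2 hx]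

lemma VanishesNear.smul {a : ℝ} {f : L2R} (hf : VanishesNear a f) (c : ℂ) :
    VanishesNear a (c • f) := by
  filter_upwards [hf, Lp.coeFn_smul c f] with x h1 h3 hx
  rw [h3]
  simp [h1 hx]

lemma mem_sonineSpace_iff {p : Parity} {a : ℝ} {f : L2R} :
    f ∈ sonineSpace p a ↔ HasParity p f ∧ VanishesNear a f ∧ VanishesNear a (parT p f) := by
  refine and_congr_right fun _ => and_congr_right fun _ =>
    ⟨fun h => VanishesNear.smul h _, fun h => ?_⟩
  have h1 := h.smul (parUnit p)⁻¹
  rwa [parT, smul_smul, inv_mul_cancel₀ (parUnit_ne_zero p), one_smul] at h1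

/-- The elements of the Sonine space which are eigenvectors of the cosine (sine) transform. -/
structure IsSonineEigen (p : Parity) (σ a : ℝ) (f : L2R) : Prop where
  parity : HasParity p f
  vanish : VanishesNear a f
  eigen : parT p f = (σ : ℂ) • f

/-- The component of `f` in the eigenspace of the cosine (sine) transform for `σ`. -/
def eigenPart (p : Parity) (σ : ℝ) (f : L2R) : L2R := (1 / 2 : ℂ) • (f + (σ : ℂ) • parT p f)

lemma eigenPart_add_eigenPart (p : Parity) (f : L2R) :
    eigenPart p 1 f + eigenPart p (-1) f = f := by
  simp only [eigenPart, Complex.ofReal_one, Complex.ofReal_neg]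
  module

lemma parT_eigenPart {p : Parity} {σ : ℝ} (hσ : σ ^ 2 = 1) {f : L2R} (hf : HasParity p f) :
    parT p (eigenPart p σ f) = (σ : ℂ) • eigenPart p σ f := by
  have h2 : (σ : ℂ) ^ 2 = 1 := by exact_mod_cast hσ
  rw [eigenPart, parT_smul, parT_add, parT_smul, hf.parT_parT]
  have : (1 / 2 : ℂ) • (parT p f + (σ : ℂ) • f) =
    (1 / 2 : ℂ) • ((σ : ℂ) ^ 2 • parT p f + (σ : ℂ) • f) := by rw [h2, one_smul]
  rw [this]
  module

lemma isSonineEigen_eigenPart {p : Parity} {σ a : ℝ} (hσ : σ ^ 2 = 1) {f : L2R}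
    (hf : f ∈ sonineSpace p a) : IsSonineEigen p σ a (eigenPart p σ f) := by
  obtain ⟨h1, h2, h3⟩ := mem_sonineSpace_iff.1 hf
  exact ⟨(h1.add (h1.parT.smul _)).smul _, (h2.add (h3.smul _)).smul _, parT_eigenPart hσ h1⟩

lemma IsSonineEigen.mem {p : Parity} {σ a : ℝ} {f : L2R} (hf : IsSonineEigen p σ a f) :
    f ∈ sonineSpace p a :=
  mem_sonineSpace_iff.2 ⟨hf.parity, hf.vanish, by rw [hf.eigen]; exact hf.vanish.smul _⟩

lemma add_mem_sonineSpace {p : Parity} {a : ℝ} {f g : L2R} (hf : f ∈ sonineSpace p a)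
    (hg : g ∈ sonineSpace p a) : f + g ∈ sonineSpace p a := by
  obtain ⟨h1, h2, h3⟩ := mem_sonineSpace_iff.1 hf
  obtain ⟨k1, k2, k3⟩ := mem_sonineSpace_iff.1 hg
  exact mem_sonineSpace_iff.2 ⟨h1.add k1, h2.add k2, by rw [parT_add]; exact h3.add k3⟩

/-- The transform is isometric, so the inner product of eigenvectors for σ and -σ equals its own
negative. -/
lemma inner_eq_zero_of_eigen {p : Parity} {σ : ℝ} (hσ : σ ^ 2 = 1) {f g : L2R}
    (hf : parT p f = (σ : ℂ) • f) (hg : parT p g = ((-σ : ℝ) : ℂ) • g) : inner ℂ f g = 0 := by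
  have h := inner_parT p f g
  have h2 : (σ : ℂ) ^ 2 = 1 := by exact_mod_cast hσ
  rw [hf, hg, inner_smul_left, inner_smul_right, Complex.conj_ofReal] at h
  push_cast at h
  linear_combination (-1 / 2 : ℂ) * h - (1 / 2 : ℂ) * inner ℂ f g * h2

lemma inner_eigenPart {p : Parity} {σ : ℝ} (hσ : σ ^ 2 = 1) {f g : L2R}
    (hg : parT p g = (σ : ℂ) • g) : inner ℂ (eigenPart p σ f) g = inner ℂ f g := by
  have h := inner_parT p f g
  have h2 : (σ : ℂ) ^ 2 = 1 := by exact_mod_cast hσ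
  rw [hg, inner_smul_right] at h
  rw [eigenPart, inner_smul_left, inner_add_left, inner_smul_left, Complex.conj_ofReal]
  have h3 : (starRingEnd ℂ) (1 / 2 : ℂ) = 1 / 2 := by
    rw [show (1 / 2 : ℂ) = ((1 / 2 : ℝ) : ℂ) by push_cast; rfl, Complex.conj_ofReal]
  rw [h3]
  linear_combination (1 / 2 : ℂ) * h

lemma inner_eq_integral (f g : L2R) : inner ℂ f g = ∫ x, star (f x) * g x := by
  rw [L2.inner_def]
  refine integral_congr_ae (Filter.Eventually.of_forall fun x => ?_)
  simp only [RCLike.inner_apply]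
  rw [mul_comm]
  rfl

lemma parT_toLp_ae {p : Parity} {h : ℝ → ℂ} (hi : Integrable h) (h2 : MemLp h 2)
    (hp : ∀ x, h (-x) = parSign p * h x) :
    ∀ᵐ x : ℝ, parT p h2.toLp x = ∫ t, wave p (x * t) * h t := by
  filter_upwards [Lp.coeFn_smul (parUnit p) (𝓕 h2.toLp : L2R), fourier_toLp_ae_eq hi h2]
    with x h3 h4
  rw [parT, h3, ← parUnit_mul_fourier hi hp, Pi.smul_apply, h4, smul_eq_mul]

/-- Parseval's formula for an eigenvector f. Restricting h to L¹ ∩ L² makes its transform an honest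
integral, which can be computed for Gaussians. -/
lemma integral_star_mul_eigen {p : Parity} {σ a : ℝ} {f : L2R}
    (hf : IsSonineEigen p σ a f) {h : ℝ → ℂ} (hi : Integrable h) (h2 : MemLp h 2)
    (hp : ∀ x, h (-x) = parSign p * h x) :
    ∫ x, star (h x) * f x = σ * ∫ x, star (∫ t, wave p (x * t) * h t) * f x := by
  have e1 : ∫ x, star (h x) * f x = inner ℂ h2.toLp f := by
    rw [inner_eq_integral]
    refine integral_congr_ae ?_
    filter_upwards [h2.coeFn_toLp] with x hx
    rw [hx]
  have e2 : ∫ x, star (∫ t, wave p (x * t) * h t) * f x = inner ℂ (parT p h2.toLp) f := by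
    rw [inner_eq_integral]
    refine integral_congr_ae ?_
    filter_upwards [parT_toLp_ae hi h2 hp] with x hx
    rw [hx]
  rw [e1, e2, ← inner_parT p, hf.eigen, inner_smul_right]

/-! ### Completed Mellin transforms of elements of the Sonine space -/

variable {p : Parity} {σ a : ℝ}

lemma memLp_two_of_integrable_of_bound {h : ℝ → ℂ} {C : ℝ} (hi : Integrable h)
    (hb : ∀ x, ‖h x‖ ≤ C) : MemLp h 2 := by
  rw [memLp_two_iff_integrable_sq_norm hi.1]
  refine (hi.norm.bdd_mul (c := C) hi.norm.1 (Filter.Eventually.of_forall fun x => ?_)).congr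
    (Filter.Eventually.of_forall fun x => ?_)
  · simpa using hb x
  · simp [sq]

lemma integral_eq_two_mul_of_ae_even {G : ℝ → ℂ} (hi : Integrable G)
    (hG : ∀ᵐ x : ℝ, G (-x) = G x) : ∫ x, G x = 2 * ∫ x in Set.Ioi (0 : ℝ), G x := by
  have h1 := integral_comp_neg_Ioi (0 : ℝ) G
  rw [neg_zero] at h1
  have h2 : ∫ x in Set.Ioi (0 : ℝ), G (-x) = ∫ x in Set.Ioi (0 : ℝ), G x :=
    integral_congr_ae (ae_restrict_of_ae hG)
  rw [← intervalIntegral.integral_Iic_add_Ioi (b := 0) hi.integrableOn hi.integrableOn, ← h1, h2]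
  ring

lemma integral_Ioi_zero_of_vanish {G : ℝ → ℂ} (ha : 0 < a)
    (hG : ∀ᵐ x : ℝ, x ∈ Set.Ioo (-a) a → G x = 0) :
    ∫ x in Set.Ioi (0 : ℝ), G x = ∫ x in Set.Ioi a, G x := by
  refine setIntegral_eq_of_subset_of_ae_sdiff_eq_zero measurableSet_Ioi.nullMeasurableSet
    (Set.Ioi_subset_Ioi ha.le) ?_
  have h2 : ∀ᵐ x : ℝ, x ≠ a := by simp [ae_iff]
  filter_upwards [hG, h2] with x hx hxa hm
  refine hx ⟨by linarith [Set.mem_Ioi.1 hm.1], lt_of_le_of_ne ?_ hxa⟩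
  exact not_lt.1 hm.2

lemma integral_eq_two_mul_Ioi {G : ℝ → ℂ} (ha : 0 < a) (hi : Integrable G)
    (he : ∀ᵐ x : ℝ, G (-x) = G x) (hG : ∀ᵐ x : ℝ, x ∈ Set.Ioo (-a) a → G x = 0) :
    ∫ x, G x = 2 * ∫ x in Set.Ioi a, G x := by
  rw [integral_eq_two_mul_of_ae_even hi he, integral_Ioi_zero_of_vanish ha hG]

lemma memLp_two_rpow_Ioi (ha : 0 < a) {r : ℝ} (hr : 1 / 2 < r) :
    MemLp (fun t : ℝ => t ^ (-r)) 2 (volume.restrict (Set.Ioi a)) := by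
  have hc : ContinuousOn (fun t : ℝ => t ^ (-r)) (Set.Ioi a) := fun t ht =>
    (Real.continuousAt_rpow_const t _ (Or.inl (ha.trans ht).ne')).continuousWithinAt
  rw [memLp_two_iff_integrable_sq (hc.aestronglyMeasurable measurableSet_Ioi)]
  refine IntegrableOn.congr_fun (integrableOn_Ioi_rpow_of_lt (by linarith : -r * 2 < -1) ha)
    (fun t ht => ?_) measurableSet_Ioi
  rw [Real.rpow_mul (ha.trans ht).le]
  norm_cast

/-- By Cauchy–Schwarz: t^{-r} is square integrable on (a, ∞) exactly when r > 1/2. -/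
lemma isMellinDensity_L2R (ha : 0 < a) (f : L2R) {r : ℝ} (hr : 1 / 2 < r) :
    IsMellinDensity (volume.restrict (Set.Ioi a)) f a r where
  pos := ha
  nonneg := by linarith
  le := by
    filter_upwards [ae_restrict_mem measurableSet_Ioi] with t ht
    exact ht.le
  meas := (Lp.memLp f).1.restrict
  int := (((Lp.memLp f).restrict _).norm).integrable_mul (memLp_two_rpow_Ioi ha hr)

lemma integrable_mul_L2R (f : L2R) {h : ℝ → ℂ} (h2 : MemLp h 2) :
    Integrable fun x => f x * h x := (Lp.memLp f).integrable_mul h2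

lemma IsSonineEigen.theta_eq (ha : 0 < a) {f : L2R} (hf : IsSonineEigen p σ a f) {v : ℝ}
    (hm : MemLp (fun x => gau p (v * x)) 2) :
    theta p (volume.restrict (Set.Ioi a)) f v = ∫ x, star (gau p (v * x)) * f x := by
  rw [theta, ← integral_eq_two_mul_Ioi ha (integrable_mul_L2R f hm)]
  · refine integral_congr_ae (Filter.Eventually.of_forall fun x => ?_)
    simp only [star_gau, mul_comm]
  · filter_upwards [hf.parity] with x hx
    rw [hx, mul_neg, gau_neg]
    linear_combination f x * gau p (v * x) * parSign_mul_self p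
  · filter_upwards [hf.vanish] with x hx hm
    rw [hx hm, zero_mul]

lemma exists_norm_gau_le (p : Parity) : ∃ C, ∀ x, ‖gau p x‖ ≤ C := by
  obtain ⟨C, _, hb⟩ := exists_gau_bound p le_rfl
  have h0 : ∀ x > 0, ‖gau p x‖ ≤ max C ‖gau p 0‖ := fun x hx =>
    ((hb x hx).trans (by simp)).trans (le_max_left _ _)
  refine ⟨max C ‖gau p 0‖, fun x => ?_⟩
  rcases lt_trichotomy x 0 with hx | rfl | hx
  · have := h0 (-x) (by linarith)
    rwa [gau_neg, norm_mul, norm_parSign, one_mul] at this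
  · exact le_max_right _ _
  · exact h0 x hx

lemma memLp_gau_mul (p : Parity) {v : ℝ} (hv : v ≠ 0) : MemLp (fun x => gau p (v * x)) 2 := by
  obtain ⟨C, hC⟩ := exists_norm_gau_le p
  exact memLp_two_of_integrable_of_bound (integrable_gau_mul p hv) fun x => hC _

/-- As for the distributions: f is an eigenvector and the Gaussian transforms into one of inverse
width. The whole Mellin formalism for densities then applies to f. -/
lemma IsSonineEigen.theta_inv (ha : 0 < a) {f : L2R} (hf : IsSonineEigen p σ a f) (v : ℝ)
    (hv : v > 0) : theta p (volume.restrict (Set.Ioi a)) f v⁻¹ =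
      σ * v * theta p (volume.restrict (Set.Ioi a)) f v := by
  have h2 := memLp_gau_mul p (inv_pos.2 hv).ne'
  rw [hf.theta_eq ha (memLp_gau_mul p hv.ne'), hf.theta_eq ha h2]
  have h := integral_star_mul_eigen hf (integrable_gau_mul p (inv_pos.2 hv).ne') h2 fun x => by rw [mul_neg, gau_neg]
  rw [h, mul_assoc, ← integral_const_mul (v : ℂ)]
  congr 1
  refine integral_congr_ae (Filter.Eventually.of_forall fun x => ?_)
  simp only
  rw [integral_wave_mul_gau_mul p x (inv_pos.2 hv), div_inv_eq_mul, star_mul', star_gau, star_gau,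
    Complex.ofReal_inv, inv_inv, Complex.star_def, Complex.conj_ofReal, mul_comm x v, mul_assoc]

/-- The completed right Mellin transform of an eigenvector in the Sonine space. -/
def sonT (p : Parity) (a : ℝ) (f : L2R) : ℂ → ℂ :=
  mellin (theta p (volume.restrict (Set.Ioi a)) f)

lemma IsSonineEigen.isSonineTransform (hσ : σ ^ 2 = 1) (ha : 0 < a) {f : L2R}
    (hf : IsSonineEigen p σ a f) : IsSonineTransform p f (sonT p a f) := by
  refine ⟨(isMellinDensity_L2R ha f (by norm_num : (1 : ℝ) / 2 < 1)).differentiable_mellin hσ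
    (hf.theta_inv ha), fun s hs => ?_⟩
  obtain ⟨r, hr1, hr2⟩ := exists_between hs
  rw [sonT, (isMellinDensity_L2R ha f hr1).mellin_eq hr2, integral_Ioi_zero_of_vanish ha]
  filter_upwards [hf.vanish] with x hx hm
  rw [hx hm, zero_mul]

lemma IsSonineEigen.sonT_eq (ha : 0 < a) {f : L2R} (hf : IsSonineEigen p σ a f) (s : ℂ) :
    sonT p a f s = ∫ t in Set.Ioi a, f t * cutPow p σ s t :=
  (isMellinDensity_L2R ha f (by norm_num : (1 : ℝ) / 2 < 1)).mellin_eq_cutPow (hf.theta_inv ha) s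

lemma integrableOn_mul_cpow (ha : 0 < a) {f : L2R} (hf : VanishesNear a f) {s : ℂ}
    (hs : 1 / 2 < s.re) : IntegrableOn (fun t : ℝ => f t * (t : ℂ) ^ (-s)) (Set.Ioi 0) := by
  have h1 : IntegrableOn (fun t : ℝ => f t * (t : ℂ) ^ (-s)) (Set.Ioi a) := by
    refine (isMellinDensity_L2R ha f hs).integrable_mul (C := 1) (continuousOn_ofReal_cpow _)
      fun t ht => ?_
    rw [Complex.norm_cpow_eq_rpow_re_of_pos ht, Complex.neg_re, one_mul]
  refine h1.of_ae_sdiff_eq_zero measurableSet_Ioi.nullMeasurableSet ?_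
  have h2 : ∀ᵐ x : ℝ, x ≠ a := by simp [ae_iff]
  filter_upwards [hf, h2] with x hx hxa hm
  rw [hx ⟨by linarith [Set.mem_Ioi.1 hm.1], lt_of_le_of_ne (not_lt.1 hm.2) hxa⟩, zero_mul]

lemma IsSonineTransform.add (ha : 0 < a) {f g : L2R} (hf : VanishesNear a f)
    (hg : VanishesNear a g) {F G : ℂ → ℂ} (hF : IsSonineTransform p f F)
    (hG : IsSonineTransform p g G) : IsSonineTransform p (f + g) (F + G) := by
  refine ⟨hF.1.add hG.1, fun s hs => ?_⟩
  rw [Pi.add_apply, hF.2 s hs, hG.2 s hs, ← mul_add,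
    ← integral_add (integrableOn_mul_cpow ha hf hs) (integrableOn_mul_cpow ha hg hs)]
  congr 1
  refine integral_congr_ae (ae_restrict_of_ae ?_)
  filter_upwards [Lp.coeFn_add f g] with x hx
  rw [hx, Pi.add_apply, add_mul]

lemma IsSonineTransform.unique {f : L2R} {F G : ℂ → ℂ} (hF : IsSonineTransform p f F)
    (hG : IsSonineTransform p f G) : F = G :=
  eq_of_eq_re_gt hF.1 hG.1 (1 / 2) fun s hs => by rw [hF.2 s hs, hG.2 s hs]

lemma isSonineTransform_of_mem (ha : 0 < a) {f : L2R} (hf : f ∈ sonineSpace p a) :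
    IsSonineTransform p f (sonT p a (eigenPart p 1 f) + sonT p a (eigenPart p (-1) f)) := by
  have h1 := isSonineEigen_eigenPart (by norm_num : (1 : ℝ) ^ 2 = 1) hf
  have h2 := isSonineEigen_eigenPart (by norm_num : (-1 : ℝ) ^ 2 = 1) hf
  have h := (h1.isSonineTransform (by norm_num) ha).add ha h1.vanish h2.vanish
    (h2.isSonineTransform (by norm_num) ha)
  rwa [eigenPart_add_eigenPart] at h

/-- The functional equation with σ = -1 at v = 1 says that the theta value is its own negative. -/
lemma IsSonineEigen.integral_gau_eq_zero (ha : 0 < a) {f : L2R}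
    (hf : IsSonineEigen p (-1) a f) : ∫ t in Set.Ioi a, f t * gau p t = 0 := by
  have h := hf.theta_inv ha 1 one_pos
  simp only [theta, inv_one, one_mul] at h
  push_cast at h
  linear_combination (1 / 4 : ℂ) * h

/-! ### Explicit representers of integration over the tail on an eigenspace -/

section Representer

variable {p : Parity} {σ a : ℝ} {X Xd : ℝ → ℂ}

lemma IsDecaying.integrableOn (H : IsDecaying X Xd) (ha : 0 < a) :
    IntegrableOn X (Set.Ioi a) ∧ IntegrableOn Xd (Set.Ioi a) := by
  obtain ⟨C, _, hb⟩ := H.decay a ha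
  have hd : IntegrableOn (fun t : ℝ => C * t ^ (-3 : ℝ)) (Set.Ioi a) :=
    (integrableOn_Ioi_rpow_of_lt (by norm_num) ha).const_mul C
  have he : ∀ t > a, C / t ^ 3 = C * t ^ (-3 : ℝ) := fun t ht => by
    rw [Real.rpow_neg (ha.trans ht).le, div_eq_mul_inv]
    norm_cast
  refine ⟨Integrable.mono' hd ((H.continuousOn.mono (Set.Ioi_subset_Ioi
    ha.le)).aestronglyMeasurable measurableSet_Ioi) ?_, Integrable.mono' hd ((H.cont.mono
    (Set.Ioi_subset_Ioi ha.le)).aestronglyMeasurable measurableSet_Ioi) ?_⟩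
  · filter_upwards [ae_restrict_mem measurableSet_Ioi] with t ht
    exact (hb t ht.le).1.trans_eq (he t ht)
  · filter_upwards [ae_restrict_mem measurableSet_Ioi] with t ht
    exact (hb t ht.le).2.trans_eq (he t ht)

/-- The extension by parity of the restriction of `X` to `(a, ∞)`. -/
def parExt (p : Parity) (a : ℝ) (X : ℝ → ℂ) (t : ℝ) : ℂ :=
  (Set.Ioi a).indicator X t + parSign p * (Set.Ioi a).indicator X (-t)

/-- The cosine (sine) transform of `parExt`. -/
def tailT (p : Parity) (a : ℝ) (X : ℝ → ℂ) (x : ℝ) : ℂ :=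
  2 * ∫ t in Set.Ioi a, wave p (x * t) * X t

lemma parExt_neg (p : Parity) (a : ℝ) (X : ℝ → ℂ) (t : ℝ) :
    parExt p a X (-t) = parSign p * parExt p a X t := by
  rw [parExt, parExt, neg_neg]
  linear_combination (-(Set.Ioi a).indicator X (-t)) * parSign_mul_self p

lemma parExt_of_gt (ha : 0 < a) {t : ℝ} (ht : a < t) : parExt p a X t = X t := by
  rw [parExt, Set.indicator_of_mem (Set.mem_Ioi.2 ht), Set.indicator_of_notMem, mul_zero, add_zero]
  exact fun h => by linarith [Set.mem_Ioi.1 h]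

lemma parExt_of_mem {t : ℝ} (ht : t ∈ Set.Ioo (-a) a) : parExt p a X t = 0 := by
  rw [parExt, Set.indicator_of_notMem, Set.indicator_of_notMem, mul_zero, add_zero]
  · exact fun h => by linarith [Set.mem_Ioi.1 h, ht.1]
  · exact fun h => by linarith [Set.mem_Ioi.1 h, ht.2]

lemma integrable_indicator_Ioi (hX : IntegrableOn X (Set.Ioi a)) :
    Integrable ((Set.Ioi a).indicator X) := (integrable_indicator_iff measurableSet_Ioi).2 hX

lemma integrable_parExt (hX : IntegrableOn X (Set.Ioi a)) : Integrable (parExt p a X) :=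
  (integrable_indicator_Ioi hX).add ((integrable_indicator_Ioi hX).comp_neg.const_mul _)

lemma norm_parExt_le (ha : 0 < a) {C : ℝ} (hC : 0 ≤ C) (h : ∀ t > a, ‖X t‖ ≤ C) (t : ℝ) :
    ‖parExt p a X t‖ ≤ C := by
  have h0 : ∀ t > a, ‖parExt p a X t‖ ≤ C := fun t ht => by
    rw [parExt_of_gt ha ht]
    exact h t ht
  by_cases h1 : a < t
  · exact h0 t h1
  by_cases h2 : a < -t
  · have := h0 _ h2
    rwa [parExt_neg, norm_mul, norm_parSign, one_mul] at this
  · rw [parExt, Set.indicator_of_notMem (s := Set.Ioi a) h1,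
      Set.indicator_of_notMem (s := Set.Ioi a) h2]
    simpa using hC

lemma integral_mul_parExt (hX : IntegrableOn X (Set.Ioi a)) {w : ℝ → ℂ} (hw : Continuous w)
    {C : ℝ} (hC : ∀ t, ‖w t‖ ≤ C) (hp : ∀ t, w (-t) = parSign p * w t) :
    ∫ t, w t * parExt p a X t = 2 * ∫ t in Set.Ioi a, w t * X t := by
  have hi : Integrable fun t => w t * (Set.Ioi a).indicator X t :=
    (integrable_indicator_Ioi hX).bdd_mul (c := C) hw.aestronglyMeasurable
      (Filter.Eventually.of_forall hC)
  have h1 : ∫ t, w t * (Set.Ioi a).indicator X t = ∫ t in Set.Ioi a, w t * X t := by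
    rw [← integral_indicator measurableSet_Ioi]
    refine integral_congr_ae (Filter.Eventually.of_forall fun t => ?_)
    by_cases ht : t ∈ Set.Ioi a <;> simp [ht]
  have h2 := integral_neg_eq_self (fun t => w t * (Set.Ioi a).indicator X t) volume
  have h3 : ∀ t, w t * parExt p a X t = w t * (Set.Ioi a).indicator X t +
      w (-t) * (Set.Ioi a).indicator X (-t) := fun t => by
    rw [parExt, hp]
    ring
  simp only [h3]
  rw [integral_add hi hi.comp_neg, h2, h1]
  ring

lemma tailT_neg (p : Parity) (a : ℝ) (X : ℝ → ℂ) (x : ℝ) :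
    tailT p a X (-x) = parSign p * tailT p a X x := by
  simp only [tailT, neg_mul, wave_neg, mul_assoc, integral_const_mul]
  ring

lemma continuous_tailT (hX : IntegrableOn X (Set.Ioi a)) : Continuous (tailT p a X) := by
  refine continuous_const.mul (continuous_of_dominated (bound := fun t => ‖X t‖) ?_ ?_ hX.norm ?_)
  · exact fun x => (Continuous.aestronglyMeasurable (by fun_prop)).mul hX.1
  · refine fun x => Filter.Eventually.of_forall fun t => ?_
    rw [norm_mul]
    exact mul_le_of_le_one_left (norm_nonneg _) (norm_wave_le p _)
  · exact Filter.Eventually.of_forall fun t => by fun_prop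

/-- The solution `g` of `g + σ H g = σ tailT X`, where `H` is the finite cosine (sine)
transform. -/
def tailSol (p : Parity) (σ a : ℝ) (X : ℝ → ℂ) : ℝ → ℂ :=
  Classical.epsilon fun g => Continuous g ∧ ∀ x, g x + σ * finT p a g x = σ * tailT p a X x

lemma tailSol_spec (hσ : σ ^ 2 = 1) (ha : 0 < a) (hX : IntegrableOn X (Set.Ioi a)) :
    Continuous (tailSol p σ a X) ∧
      ∀ x, tailSol p σ a X x + σ * finT p a (tailSol p σ a X) x = σ * tailT p a X x :=
  Classical.epsilon_spec (p := fun g : ℝ → ℂ => Continuous g ∧ ∀ x, g x + σ * finT p a g x =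
    σ * tailT p a X x) (exists_solution p hσ ha (continuous_const.mul (continuous_tailT hX)))

lemma tailSol_neg (hσ : σ ^ 2 = 1) (ha : 0 < a) (hX : IntegrableOn X (Set.Ioi a)) (x : ℝ) :
    tailSol p σ a X (-x) = parSign p * tailSol p σ a X x := by
  have h := (tailSol_spec (p := p) hσ ha hX).2
  have h1 := h (-x)
  rw [finT_neg, tailT_neg] at h1
  linear_combination h1 - parSign p * h x

/-- The extension by parity of `X` on `(a, ∞)` and of `-tailSol` on `(0, a)`. -/
def repFun (p : Parity) (σ a : ℝ) (X : ℝ → ℂ) (t : ℝ) : ℂ :=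
  parExt p a X t - (Set.Icc (-a) a).indicator (tailSol p σ a X) t

lemma repFun_neg (hσ : σ ^ 2 = 1) (ha : 0 < a) (hX : IntegrableOn X (Set.Ioi a)) (t : ℝ) :
    repFun p σ a X (-t) = parSign p * repFun p σ a X t := by
  have h : (-t ∈ Set.Icc (-a) a) ↔ t ∈ Set.Icc (-a) a := by
    simp only [Set.mem_Icc]
    constructor <;> rintro ⟨h1, h2⟩ <;> constructor <;> linarith
  rw [repFun, repFun, parExt_neg, mul_sub]
  congr 1
  by_cases ht : t ∈ Set.Icc (-a) a
  · rw [Set.indicator_of_mem ht, Set.indicator_of_mem (h.2 ht), tailSol_neg hσ ha hX]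
  · rw [Set.indicator_of_notMem ht, Set.indicator_of_notMem (mt h.1 ht), mul_zero]

lemma integrable_indicator_Icc (a : ℝ) {g : ℝ → ℂ} (hg : Continuous g) :
    Integrable ((Set.Icc (-a) a).indicator g) :=
  (integrable_indicator_iff measurableSet_Icc).2 (hg.integrableOn_Icc)

lemma integrable_repFun (hσ : σ ^ 2 = 1) (ha : 0 < a) (hX : IntegrableOn X (Set.Ioi a)) :
    Integrable (repFun p σ a X) :=
  (integrable_parExt hX).sub (integrable_indicator_Icc a (tailSol_spec hσ ha hX).1)

lemma IsDecaying.exists_norm_le (H : IsDecaying X Xd) (ha : 0 < a) :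
    ∃ C, 0 ≤ C ∧ ∀ t > a, ‖X t‖ ≤ C := by
  obtain ⟨C, hC, hb⟩ := H.decay a ha
  refine ⟨C / a ^ 3, by positivity, fun t ht => (hb t ht.le).1.trans ?_⟩
  have h3 : a ^ 3 ≤ t ^ 3 := pow_le_pow_left₀ ha.le (Set.mem_Ioi.1 ht).le 3
  gcongr

lemma memLp_repFun (hσ : σ ^ 2 = 1) (ha : 0 < a) (H : IsDecaying X Xd) :
    MemLp (repFun p σ a X) 2 := by
  have hX := (H.integrableOn ha).1
  obtain ⟨C, hC, hb⟩ := H.exists_norm_le ha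
  obtain ⟨D, hD⟩ := (isCompact_Icc (a := -a) (b := a)).exists_bound_of_continuousOn
    (tailSol_spec (p := p) hσ ha hX).1.continuousOn
  refine memLp_two_of_integrable_of_bound (C := C + max D 0) (integrable_repFun hσ ha hX)
    fun t => (norm_sub_le _ _).trans (add_le_add (norm_parExt_le ha hC hb t) ?_)
  by_cases ht : t ∈ Set.Icc (-a) a
  · rw [Set.indicator_of_mem ht]
    exact (hD t ht).trans (le_max_left _ _)
  · rw [Set.indicator_of_notMem ht, norm_zero]
    exact le_max_right _ _

lemma integral_mul_indicator_Icc (ha : 0 < a) (w g : ℝ → ℂ) :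
    ∫ t, w t * (Set.Icc (-a) a).indicator g t = ∫ t in (-a)..a, w t * g t := by
  rw [intervalIntegral.integral_of_le (by linarith), ← integral_Icc_eq_integral_Ioc,
    ← integral_indicator measurableSet_Icc]
  refine integral_congr_ae (Filter.Eventually.of_forall fun t => ?_)
  by_cases ht : t ∈ Set.Icc (-a) a <;> simp only [Set.indicator, ht, if_true, if_false, mul_zero]

lemma integral_mul_repFun (hσ : σ ^ 2 = 1) (ha : 0 < a) (hX : IntegrableOn X (Set.Ioi a))
    {w : ℝ → ℂ} (hw : Continuous w) {C : ℝ} (hC : ∀ t, ‖w t‖ ≤ C)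
    (hp : ∀ t, w (-t) = parSign p * w t) :
    ∫ t, w t * repFun p σ a X t = 2 * (∫ t in Set.Ioi a, w t * X t) -
      ∫ t in (-a)..a, w t * tailSol p σ a X t := by
  have hm : ∀ {f : ℝ → ℂ}, Integrable f → Integrable fun t => w t * f t := fun hf =>
    hf.bdd_mul (c := C) hw.aestronglyMeasurable (Filter.Eventually.of_forall hC)
  simp only [repFun, mul_sub]
  rw [integral_sub (hm (integrable_parExt hX))
    (hm (integrable_indicator_Icc a (tailSol_spec hσ ha hX).1)), integral_mul_parExt hX hw hC hp,
    integral_mul_indicator_Icc ha]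

/-- The reason for the choice of the middle piece: by the integral equation the transform of
`repFun` is σ times `tailSol` on the whole line. Adding σ times this transform to `repFun` cancels
everything on (-a, a). -/
lemma integral_wave_mul_repFun (hσ : σ ^ 2 = 1) (ha : 0 < a) (hX : IntegrableOn X (Set.Ioi a))
    (x : ℝ) : ∫ t, wave p (x * t) * repFun p σ a X t = σ * tailSol p σ a X x := by
  have h2 : (σ : ℂ) ^ 2 = 1 := by exact_mod_cast hσ
  have h := (tailSol_spec (p := p) hσ ha hX).2 x
  rw [integral_mul_repFun hσ ha hX (by fun_prop) (fun _ => norm_wave_le p _) fun t => by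
    rw [mul_neg, wave_neg]]
  change tailT p a X x - finT p a _ x = _
  linear_combination (-σ : ℂ) * h + (finT p a (tailSol p σ a X) x - tailT p a X x) * h2

/-- The pairing of φ_a with `repFun` is computed twice: directly, and through `integral_phi_mul`,
where the transform of `repFun` is known. The integrals over [-a, a] cancel and the edge value of
`tailSol` appears. -/
lemma coreFun_eq_add_tailSol (hσ : σ ^ 2 = 1) (ha : 0 < a) (hX : IntegrableOn X (Set.Ioi a)) :
    coreFun p σ a X = X a + tailSol p σ a X a := by
  have h2 : (σ : ℂ) ^ 2 = 1 := by exact_mod_cast hσ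
  obtain ⟨C, _, hC⟩ := exists_bound_phi (p := p) hσ ha
  have h := integral_phi_mul (p := p) hσ ha (integrable_repFun (p := p) hσ ha hX)
  rw [integral_mul_repFun hσ ha hX (continuous_phi_ofReal hσ ha) hC (phi_neg hσ ha)] at h
  simp only [integral_wave_mul_repFun hσ ha hX, mul_left_comm _ (σ : ℂ)] at h
  rw [intervalIntegral.integral_const_mul] at h
  rw [coreFun]
  linear_combination (σ / 2 : ℂ) * h + (tailSol p σ a X a - σ / 2 *
    ∫ t in (-a)..a, (phi p σ a t : ℂ) * tailSol p σ a X t) * h2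

/-- The element of the Sonine space representing `f ↦ ∫_a^∞ conj X f` on the eigenspace of the
cosine (sine) transform for `σ`. -/
def repVec (hσ : σ ^ 2 = 1) (ha : 0 < a) (p : Parity) (H : IsDecaying X Xd) : L2R :=
  eigenPart p σ (memLp_repFun (p := p) hσ ha H).toLp

lemma hasParity_toLp_repFun (hσ : σ ^ 2 = 1) (ha : 0 < a) (H : IsDecaying X Xd) :
    HasParity p (memLp_repFun (p := p) hσ ha H).toLp := by
  have h1 := (memLp_repFun (p := p) hσ ha H).coeFn_toLp
  have h2 := (Measure.measurePreserving_neg (volume : Measure ℝ)).quasiMeasurePreserving.ae h1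
  filter_upwards [h1, h2] with x h1 h2
  rw [h1, h2, repFun_neg hσ ha (H.integrableOn ha).1]

lemma repVec_ae (hσ : σ ^ 2 = 1) (ha : 0 < a) (H : IsDecaying X Xd) :
    ∀ᵐ x : ℝ, repVec hσ ha p H x = (1 / 2 : ℂ) * (repFun p σ a X x + tailSol p σ a X x) := by
  have h2 : (σ : ℂ) ^ 2 = 1 := by exact_mod_cast hσ
  have hX := (H.integrableOn ha).1
  have hm := memLp_repFun (p := p) hσ ha H
  have e1 := Lp.coeFn_smul (1 / 2 : ℂ) (hm.toLp + (σ : ℂ) • parT p hm.toLp)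
  have e2 := Lp.coeFn_add hm.toLp ((σ : ℂ) • parT p hm.toLp)
  have e3 := Lp.coeFn_smul (σ : ℂ) (parT p hm.toLp)
  filter_upwards [e1, e2, e3, hm.coeFn_toLp, parT_toLp_ae (integrable_repFun hσ ha hX) hm
    (repFun_neg hσ ha hX)] with x e1 e2 e3 e4 e5
  rw [repVec, eigenPart, e1, Pi.smul_apply, e2, Pi.add_apply, e3, Pi.smul_apply, e4, e5,
    integral_wave_mul_repFun hσ ha hX, smul_eq_mul, smul_eq_mul]
  linear_combination (1 / 2 * tailSol p σ a X x) * h2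

lemma repVec_ae_of_gt (hσ : σ ^ 2 = 1) (ha : 0 < a) (H : IsDecaying X Xd) :
    ∀ᵐ x : ℝ, a < x → repVec hσ ha p H x = (1 / 2 : ℂ) * (X x + tailSol p σ a X x) := by
  filter_upwards [repVec_ae (p := p) hσ ha H] with x hx hax
  rw [hx, repFun, parExt_of_gt ha hax, Set.indicator_of_notMem, sub_zero]
  exact fun h => by linarith [h.2]

lemma isSonineEigen_repVec (hσ : σ ^ 2 = 1) (ha : 0 < a) (H : IsDecaying X Xd) :
    IsSonineEigen p σ a (repVec hσ ha p H) where
  parity := by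
    have h := hasParity_toLp_repFun (p := p) hσ ha H
    exact (h.add (h.parT.smul _)).smul _
  vanish := by
    filter_upwards [repVec_ae (p := p) hσ ha H] with x hx hm
    rw [hx, repFun, parExt_of_mem hm, Set.indicator_of_mem (Set.Ioo_subset_Icc_self hm)]
    ring
  eigen := parT_eigenPart hσ (hasParity_toLp_repFun hσ ha H)

lemma integrable_star_mul (f g : L2R) : Integrable fun x => star (f x) * g x :=
  (Lp.memLp f).star.integrable_mul (Lp.memLp g)

lemma inner_eq_two_mul_Ioi (ha : 0 < a) {f g : L2R} (hf : HasParity p f) (hg : HasParity p g)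
    (hv : VanishesNear a g) : inner ℂ f g = 2 * ∫ t in Set.Ioi a, star (f t) * g t := by
  rw [inner_eq_integral]
  refine integral_eq_two_mul_Ioi ha (integrable_star_mul f g) ?_ ?_
  · filter_upwards [hf, hg] with x h1 h2
    rw [h1, h2, star_mul', star_parSign]
    linear_combination (star (f x) * g x) * parSign_mul_self p
  · filter_upwards [hv] with x hx hm
    rw [hx hm, mul_zero]

/-- The projection onto the eigenspace can be moved to f, which it fixes, and the middle piece of
`repFun` is not seen by f, which vanishes there. -/
lemma inner_repVec (hσ : σ ^ 2 = 1) (ha : 0 < a) (H : IsDecaying X Xd) {f : L2R}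
    (hf : IsSonineEigen p σ a f) :
    inner ℂ (repVec hσ ha p H) f = 2 * ∫ t in Set.Ioi a, star (X t) * f t := by
  rw [repVec, inner_eigenPart hσ hf.eigen,
    inner_eq_two_mul_Ioi ha (hasParity_toLp_repFun hσ ha H) hf.parity hf.vanish]
  congr 1
  refine integral_congr_ae ?_
  filter_upwards [ae_restrict_of_ae (memLp_repFun (p := p) hσ ha H).coeFn_toLp,
    ae_restrict_mem measurableSet_Ioi] with t h1 h2
  rw [h1, repFun, parExt_of_gt ha h2, Set.indicator_of_notMem, sub_zero]
  exact fun h => by linarith [h.2, Set.mem_Ioi.1 h2]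

end Representer

/-! ### The Euler operator on the tail transform and on `tailSol` -/

section TailDeriv

variable {p : Parity} {σ a : ℝ} {X Xd : ℝ → ℂ}

lemma hasDerivAt_integral_wave_mul {m : Measure ℝ} {h : ℝ → ℂ} (h0 : Integrable h m)
    (h1 : Integrable (fun t : ℝ => (t : ℂ) * h t) m) (x : ℝ) :
    HasDerivAt (fun x => ∫ t, wave p (x * t) * h t ∂m)
      (∫ t, waveD p (x * t) * ((t : ℂ) * h t) ∂m) x := by
  refine (hasDerivAt_integral_of_dominated_loc_of_deriv_le
    (F := fun x t => wave p (x * t) * h t) (F' := fun x t => waveD p (x * t) * ((t : ℂ) * h t))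
    (bound := fun t : ℝ => 2 * Real.pi * ‖(t : ℂ) * h t‖) (s := Set.univ) Filter.univ_mem ?_ ?_ ?_ ?_ ?_ ?_).2
  · exact Filter.Eventually.of_forall fun y =>
      (Continuous.aestronglyMeasurable (by fun_prop)).mul h0.1
  · exact h0.bdd_mul (c := 1) (Continuous.aestronglyMeasurable (by fun_prop))
      (Filter.Eventually.of_forall fun t => norm_wave_le p _)
  · exact (Continuous.aestronglyMeasurable (by fun_prop)).mul h1.1
  · refine Filter.Eventually.of_forall fun t y _ => ?_
    rw [norm_mul]
    exact mul_le_mul_of_nonneg_right (norm_waveD_le p _) (norm_nonneg _)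
  · exact h1.norm.const_mul _
  · refine Filter.Eventually.of_forall fun t y _ => ?_
    have h2 : HasDerivAt (fun y : ℝ => y * t) t y := by simpa using (hasDerivAt_id y).mul_const t
    refine (((hasDerivAt_wave p (y * t)).scomp y h2).mul_const (h t)).congr_deriv ?_
    rw [Complex.real_smul]
    ring

lemma continuous_integral_waveD_mul {m : Measure ℝ} {h : ℝ → ℂ} (h0 : Integrable h m) :
    Continuous fun x => ∫ t, waveD p (x * t) * h t ∂m := by
  refine continuous_of_dominated (bound := fun t => 2 * Real.pi * ‖h t‖) ?_ ?_
    (h0.norm.const_mul _) ?_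
  · exact fun x => (Continuous.aestronglyMeasurable (by fun_prop)).mul h0.1
  · refine fun x => Filter.Eventually.of_forall fun t => ?_
    rw [norm_mul]
    exact mul_le_mul_of_nonneg_right (norm_waveD_le p _) (norm_nonneg _)
  · exact Filter.Eventually.of_forall fun t => by fun_prop

lemma IsDecaying.integrableOn_mul (H : IsDecaying X Xd) (ha : 0 < a) {w : ℝ → ℂ} {C : ℝ}
    (hw : ContinuousOn w (Set.Ioi 0)) (hC : ∀ t > a, ‖w t‖ ≤ C * t) :
    IntegrableOn (fun t => w t * X t) (Set.Ioi a) ∧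
      IntegrableOn (fun t => w t * Xd t) (Set.Ioi a) := by
  obtain ⟨D, hD, hb⟩ := H.decay a ha
  have hsub : Set.Ioi a ⊆ Set.Ioi 0 := Set.Ioi_subset_Ioi ha.le
  have hd : IntegrableOn (fun t : ℝ => C * D * t ^ (-2 : ℝ)) (Set.Ioi a) :=
    (integrableOn_Ioi_rpow_of_lt (by norm_num) ha).const_mul _
  have key : ∀ {Y : ℝ → ℂ} {t : ℝ}, a < t → ‖Y t‖ ≤ D / t ^ 3 →
      ‖w t * Y t‖ ≤ C * D * t ^ (-2 : ℝ) := by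
    intro Y t ht hY
    have ht0 := ha.trans ht
    have hCt : 0 ≤ C * t := (norm_nonneg _).trans (hC t ht)
    rw [norm_mul]
    refine (mul_le_mul (hC t ht) hY (norm_nonneg _) hCt).trans_eq ?_
    rw [Real.rpow_neg ht0.le]
    norm_cast
    field_simp
  refine ⟨Integrable.mono' hd (((hw.mul H.continuousOn).mono hsub).aestronglyMeasurable
    measurableSet_Ioi) ?_, Integrable.mono' hd (((hw.mul H.cont).mono hsub).aestronglyMeasurable
    measurableSet_Ioi) ?_⟩
  · filter_upwards [ae_restrict_mem measurableSet_Ioi] with t ht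
    exact key ht (hb t (Set.mem_Ioi.1 ht).le).1
  · filter_upwards [ae_restrict_mem measurableSet_Ioi] with t ht
    exact key ht (hb t (Set.mem_Ioi.1 ht).le).2

/-- Integration of the derivative of t w X: the adjoint of t d/dt is -(t d/dt + 1), with a boundary
term at a only. The linear growth allowed for w is compensated by the cubic decay of X. -/
lemma IsDecaying.integral_deriv_mul (H : IsDecaying X Xd) (ha : 0 < a) {w wd : ℝ → ℂ} {C D : ℝ}
    (hw : ∀ t > 0, HasDerivAt w (wd t / t) t) (hwd : ContinuousOn wd (Set.Ioi 0))
    (hC : ∀ t > a, ‖w t‖ ≤ C * t) (hD : ∀ t > a, ‖wd t‖ ≤ D * t) :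
    (∫ t in Set.Ioi a, wd t * X t) + (∫ t in Set.Ioi a, w t * X t) +
      (∫ t in Set.Ioi a, w t * Xd t) = -(a * w a * X a) := by
  have hwc : ContinuousOn w (Set.Ioi 0) := fun t ht =>
    (hw t ht).continuousAt.continuousWithinAt
  obtain ⟨i1, i2⟩ := H.integrableOn_mul ha hwc hC
  obtain ⟨i3, -⟩ := H.integrableOn_mul ha hwd hD
  have hd : ∀ t ∈ Set.Ici a, HasDerivAt (fun t : ℝ => (t : ℂ) * w t * X t)
      (wd t * X t + w t * X t + w t * Xd t) t := by
    intro t ht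
    have ht0 : 0 < t := ha.trans_le ht
    have ht0' : (t : ℂ) ≠ 0 := by exact_mod_cast ht0.ne'
    refine ((((hasDerivAt_id t).ofReal_comp).mul (hw t ht0)).mul (H.deriv t ht0)).congr_deriv ?_
    simp only [id, Complex.ofReal_one, Pi.mul_apply]
    field_simp
    ring
  have hlim : Filter.Tendsto (fun t : ℝ => (t : ℂ) * w t * X t) Filter.atTop (nhds 0) := by
    obtain ⟨B, hB, hb⟩ := H.decay a ha
    have h0 : Filter.Tendsto (fun t : ℝ => C * B * t⁻¹) Filter.atTop (nhds 0) := by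
      simpa using tendsto_inv_atTop_zero.const_mul (C * B)
    refine squeeze_zero_norm' ?_ h0
    filter_upwards [Filter.eventually_gt_atTop a] with t ht
    have ht0 := ha.trans ht
    have hCt : 0 ≤ C * t := (norm_nonneg _).trans (hC t ht)
    rw [norm_mul, norm_mul, Complex.norm_real, Real.norm_of_nonneg ht0.le]
    refine (mul_le_mul (mul_le_mul_of_nonneg_left (hC t ht) ht0.le) (hb t ht.le).1 (norm_nonneg _)
      (by positivity)).trans_eq ?_
    field_simp
  have h := integral_Ioi_of_hasDerivAt_of_tendsto' hd ((i3.add i1).add i2) hlim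
  rw [integral_add_add i3 i1 i2] at h
  rw [h]
  ring

lemma norm_wave_mul_le (ha : 0 < a) (x : ℝ) : ∀ t > a, ‖wave p (x * t)‖ ≤ a⁻¹ * t := fun t ht =>
  (norm_wave_le p _).trans (by rw [← div_eq_inv_mul, one_le_div ha]; exact ht.le)

/-- On `wave p (x * t)` the operators x d/dx and t d/dt agree, and the latter is moved onto X by
parts. -/
lemma exists_deriv_tailT (H : IsDecaying X Xd) (ha : 0 < a) : ∃ T : ℝ → ℂ, Continuous T ∧
    ∀ x, HasDerivAt (tailT p a X) (T x) x ∧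
      x * T x = -2 * a * wave p (a * x) * X a - tailT p a X x - tailT p a Xd x := by
  have hX := (H.integrableOn ha).1
  have hX1 : IntegrableOn (fun t : ℝ => (t : ℂ) * X t) (Set.Ioi a) :=
    (H.integrableOn_mul ha (C := 1) (by fun_prop) fun t ht => by
      rw [Complex.norm_real, Real.norm_of_nonneg (ha.trans ht).le, one_mul]).1
  refine ⟨fun x => 2 * ∫ t in Set.Ioi a, waveD p (x * t) * ((t : ℂ) * X t),
    continuous_const.mul (continuous_integral_waveD_mul hX1), fun x =>
    ⟨(hasDerivAt_integral_wave_mul hX hX1 x).const_mul 2, ?_⟩⟩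
  have h := H.integral_deriv_mul ha (w := fun t => wave p (x * t))
    (wd := fun t => (x * t : ℝ) * waveD p (x * t)) (C := a⁻¹) (D := |x| * (2 * Real.pi))
    (fun t ht => ?_) (by fun_prop) (norm_wave_mul_le ha x) (fun t ht => ?_)
  · simp only [tailT]
    have e : ∫ t in Set.Ioi a, ((x * t : ℝ) : ℂ) * waveD p (x * t) * X t =
        x * ∫ t in Set.Ioi a, waveD p (x * t) * ((t : ℂ) * X t) := by
      rw [← integral_const_mul]
      congr 1
      funext t
      push_cast
      ring
    rw [e] at h
    rw [mul_comm a x]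
    linear_combination 2 * h
  · have h2 : HasDerivAt (fun t : ℝ => x * t) x t := by simpa using (hasDerivAt_id t).const_mul x
    refine ((hasDerivAt_wave p (x * t)).scomp t h2).congr_deriv ?_
    have ht0' : (t : ℂ) ≠ 0 := by exact_mod_cast ht.ne'
    rw [Complex.real_smul]
    push_cast
    field_simp
  · have ht0 := ha.trans ht
    rw [norm_mul, Complex.norm_real, norm_mul, Real.norm_eq_abs, Real.norm_of_nonneg ht0.le]
    have := mul_le_mul_of_nonneg_left (norm_waveD_le p (x * t))
      (mul_nonneg (abs_nonneg x) ht0.le)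
    linarith

/-- The transform is differentiable for merely continuous g, whereas the formula for the Euler
operator needs g'. For a solution g of the integral equation the first fact provides g', and only
then the second applies; hence the order of the quantifiers. -/
lemma exists_deriv_finT (ha : 0 < a) {g : ℝ → ℂ} (hg : Continuous g) : ∃ T : ℝ → ℂ,
    Continuous T ∧ (∀ x, HasDerivAt (finT p a g) (T x) x) ∧ ∀ g' : ℝ → ℂ, Continuous g' →
      (∀ x, HasDerivAt g (g' x) x) → (∀ x, g (-x) = parSign p * g x) →
      ∀ x, x * T x = 2 * a * wave p (a * x) * g a - finT p a g x -
        finT p a (fun t => t * g' t) x := by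
  have hle : -a ≤ a := by linarith
  have hi : ∀ {f : ℝ → ℂ}, Continuous f → Integrable f (volume.restrict (Set.Ioc (-a) a)) :=
    fun hf => (intervalIntegrable_iff_integrableOn_Ioc_of_le hle).1 (hf.intervalIntegrable _ _)
  have hg1 : Continuous fun t : ℝ => (t : ℂ) * g t := by fun_prop
  refine ⟨fun x => ∫ t in Set.Ioc (-a) a, waveD p (x * t) * ((t : ℂ) * g t),
    continuous_integral_waveD_mul (hi hg1), fun x => ?_, fun g' hg' hd hp x => ?_⟩
  · have := hasDerivAt_integral_wave_mul (p := p) (hi hg) (hi hg1) x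
    refine this.congr_of_eventuallyEq (Filter.Eventually.of_forall fun y => ?_)
    rw [finT, intervalIntegral.integral_of_le hle]
  · have hder : ∀ t ∈ Set.uIcc (-a) a, HasDerivAt (fun t : ℝ => (t : ℂ) * g t * wave p (x * t))
        (g t * wave p (x * t) + t * g' t * wave p (x * t) +
          x * (waveD p (x * t) * (t * g t))) t := by
      intro t _
      have h2 : HasDerivAt (fun t : ℝ => x * t) x t := by simpa using (hasDerivAt_id t).const_mul x
      refine ((((hasDerivAt_id t).ofReal_comp).mul (hd t)).mul
        ((hasDerivAt_wave p (x * t)).scomp t h2)).congr_deriv ?_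
      simp only [id, Complex.ofReal_one, Pi.mul_apply, Complex.real_smul, Function.comp]
      ring
    have h := intervalIntegral.integral_eq_sub_of_hasDerivAt hder
      (Continuous.intervalIntegrable (by fun_prop) _ _)
    rw [intervalIntegral.integral_add (Continuous.intervalIntegrable (by fun_prop) _ _)
      (Continuous.intervalIntegrable (by fun_prop) _ _), intervalIntegral.integral_add
      (Continuous.intervalIntegrable (by fun_prop) _ _)
      (Continuous.intervalIntegrable (by fun_prop) _ _), intervalIntegral.integral_const_mul,
      hp, mul_neg, wave_neg] at h
    simp only
    rw [← intervalIntegral.integral_of_le hle, finT, finT]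
    simp only [mul_comm (wave p _)]
    rw [mul_comm a x]
    push_cast at h
    linear_combination h + a * g a * wave p (x * a) * parSign_mul_self p

/-- Since x d/dx + 1/2 anticommutes with the transform, applying it to the equation for σ produces
an equation for -σ. The boundary terms at a combine into a multiple of `wave p (a * x)`, the
right-hand side of the equation for φ_a of sign -σ. -/
lemma exists_deriv_tailSol (hσ : σ ^ 2 = 1) (H : IsDecaying X Xd) (ha : 0 < a) :
    ∃ g' : ℝ → ℂ, Continuous g' ∧ (∀ x, HasDerivAt (tailSol p σ a X) (g' x) x) ∧
      ∀ x, (x * g' x + 1 / 2 * tailSol p σ a X x) + ((-σ : ℝ) : ℂ) *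
        finT p a (fun x => x * g' x + 1 / 2 * tailSol p σ a X x) x =
        -2 * a * σ * (X a + tailSol p σ a X a) * wave p (a * x) -
          σ * (tailT p a Xd x + 1 / 2 * tailT p a X x) := by
  have hX := (H.integrableOn ha).1
  obtain ⟨hgc, hge⟩ := tailSol_spec (p := p) hσ ha hX
  obtain ⟨T, hT, hTd⟩ := exists_deriv_tailT (p := p) H ha
  obtain ⟨S, hS, hSd, hSe⟩ := exists_deriv_finT (p := p) ha hgc
  have hd : ∀ x, HasDerivAt (tailSol p σ a X) (σ * T x - σ * S x) x := by
    intro x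
    refine (((hTd x).1.const_mul (σ : ℂ)).sub ((hSd x).const_mul (σ : ℂ))).congr_of_eventuallyEq
      (Filter.Eventually.of_forall fun y => ?_)
    simp only [Pi.sub_apply]
    linear_combination hge y
  have hc : Continuous fun x => σ * T x - σ * S x := by fun_prop
  refine ⟨_, hc, hd, fun x => ?_⟩
  have h1 := hSe _ hc hd (tailSol_neg hσ ha hX) x
  have h2 := (hTd x).2
  have h3 : finT p a (fun x => x * (σ * T x - σ * S x) + 1 / 2 * tailSol p σ a X x) x =
      finT p a (fun x => x * (σ * T x - σ * S x)) x + 1 / 2 * finT p a (tailSol p σ a X) x := by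
    simp only [finT]
    rw [← intervalIntegral.integral_const_mul, ← intervalIntegral.integral_add
      (Continuous.intervalIntegrable (by fun_prop) _ _)
      (Continuous.intervalIntegrable (by fun_prop) _ _)]
    congr 1
    funext t
    ring
  rw [h3]
  push_cast
  linear_combination σ * h2 - σ * h1 + 1 / 2 * hge x

end TailDeriv

/-! ### A Christoffel–Darboux identity for the evaluators -/

section KernelIdentity

variable {p : Parity} {σ a : ℝ}

lemma integrableOn_wave_mul {X : ℝ → ℂ} (hX : IntegrableOn X (Set.Ioi a)) (x : ℝ) :
    IntegrableOn (fun t => wave p (x * t) * X t) (Set.Ioi a) :=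
  Integrable.bdd_mul (c := 1) hX (Continuous.aestronglyMeasurable (by fun_prop))
    (Filter.Eventually.of_forall fun t => norm_wave_le p _)

lemma tailT_lin {X Y Z : ℝ → ℂ} (hX : IntegrableOn X (Set.Ioi a)) (hY : IntegrableOn Y (Set.Ioi a))
    (hZ : IntegrableOn Z (Set.Ioi a)) (b c d : ℂ) (x : ℝ) :
    tailT p a (fun t => b * X t - c * Y t - d * Z t) x =
      b * tailT p a X x - c * tailT p a Y x - d * tailT p a Z x := by
  have h := integral_add_add ((integrableOn_wave_mul (p := p) hX x).const_mul b)
    ((integrableOn_wave_mul (p := p) hY x).const_mul (-c))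
    ((integrableOn_wave_mul (p := p) hZ x).const_mul (-d))
  simp only [integral_const_mul] at h
  simp only [tailT]
  have e : ∀ t, wave p (x * t) * (b * X t - c * Y t - d * Z t) = b * (wave p (x * t) * X t) +
    -c * (wave p (x * t) * Y t) + -d * (wave p (x * t) * Z t) := fun t => by ring
  simp only [e]
  linear_combination 2 * h

lemma finT_lin {X Y Z : ℝ → ℂ} (hX : Continuous X) (hY : Continuous Y) (hZ : Continuous Z)
    (b c d : ℂ) (x : ℝ) :
    finT p a (fun t => b * X t + c * Y t - d * Z t) x =
      b * finT p a X x + c * finT p a Y x - d * finT p a Z x := by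
  simp only [finT]
  rw [← intervalIntegral.integral_const_mul, ← intervalIntegral.integral_const_mul,
    ← intervalIntegral.integral_const_mul, ← intervalIntegral.integral_add
      (Continuous.intervalIntegrable (by fun_prop) _ _)
      (Continuous.intervalIntegrable (by fun_prop) _ _), ← intervalIntegral.integral_sub
      (Continuous.intervalIntegrable (by fun_prop) _ _)
      (Continuous.intervalIntegrable (by fun_prop) _ _)]
  congr 1
  funext t
  ring

lemma tailT_gau (ha : 0 < a) (x : ℝ) : tailT p a (gau p) x = gau p x - finT p a (gau p) x := by
  have h := integral_eq_of_even (f := fun t => wave p (x * t) * gau p t) ha (fun t => ?_)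
    ((integrable_gau p).bdd_mul (c := 1) (Continuous.aestronglyMeasurable (by fun_prop))
    (Filter.Eventually.of_forall fun t => norm_wave_le p _))
  · rw [tailT, h, integral_wave_mul_gau]
    rfl
  · rw [mul_neg, wave_neg, gau_neg]
    linear_combination (wave p (x * t) * gau p t) * parSign_mul_self p

/-- The representer (up to the factor `1 / 2`) of `f ↦ ∫_a^∞ f cutPow` on `(a, ∞)`. -/
def sonZ (p : Parity) (σ a : ℝ) (v : ℂ) (t : ℝ) : ℂ :=
  cutPow p σ v t + tailSol p σ a (cutPow p σ v) t

lemma sonZ_self (hσ : σ ^ 2 = 1) (ha : 0 < a) (v : ℂ) : sonZ p σ a v a = xi p σ a v :=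
  (coreFun_eq_add_tailSol hσ ha (integrableOn_cutPow ha v)).symm

/-- Both sides solve the equation for -σ. By the differential equation of `cutPow` the right-hand
side splits into a tail transform of `cutPow` for -σ, a Gaussian term, solved by the Gaussian itself
because it is its own transform, and a boundary wave, solved by φ_a of sign -σ. -/
lemma hasDerivAt_tailSol_cutPow (hσ : σ ^ 2 = 1) (ha : 0 < a) (v : ℂ) :
    ∃ g' : ℝ → ℂ, (∀ x, HasDerivAt (tailSol p σ a (cutPow p σ v)) (g' x) x) ∧
      ∀ x, x * g' x + 1 / 2 * tailSol p σ a (cutPow p σ v) x =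
        (1 / 2 - v) * tailSol p (-σ) a (cutPow p (-σ) v) x + 2 * (1 + σ) * gau p x -
          σ * a * xi p σ a v * phi p (-σ) a x := by
  have h2 : (σ : ℂ) ^ 2 = 1 := by exact_mod_cast hσ
  have hσ' : (-σ) ^ 2 = 1 := by rw [neg_sq, hσ]
  obtain ⟨g', hc, hd, he⟩ := exists_deriv_tailSol (p := p) hσ (isDecaying_cutPow p σ v) ha
  obtain ⟨hgc', hge'⟩ := tailSol_spec (p := p) hσ' ha (integrableOn_cutPow (p := p) (σ := -σ) ha v)
  have hgc := (tailSol_spec (p := p) hσ ha (integrableOn_cutPow (p := p) (σ := σ) ha v)).1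
  have hφ := continuous_phi_ofReal (p := p) hσ' ha
  refine ⟨g', hd, fun x => congrFun (eq_of_finT_eq (p := p) hσ' ha
    (f := fun x : ℝ => x * g' x + 1 / 2 * tailSol p σ a (cutPow p σ v) x) (g := fun x =>
      (1 / 2 - v) * tailSol p (-σ) a (cutPow p (-σ) v) x + 2 * (1 + σ) * gau p x -
          σ * a * xi p σ a v * phi p (-σ) a x) (by fun_prop) (by fun_prop) he fun x => ?_) x⟩
  have hphi := phi_eq (p := p) hσ' ha x
  rw [finT_lin hgc' (continuous_gau p) hφ, tailT_lin (integrableOn_cutPow ha v)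
    (integrable_gau p).integrableOn (integrableOn_cutPow ha v), tailT_gau ha]
  have hs : cutPow p σ v a + tailSol p σ a (cutPow p σ v) a = xi p σ a v := sonZ_self hσ ha v
  rw [hs]
  have h3 := hge' x
  push_cast at h3 hphi ⊢
  linear_combination (1 / 2 - v) * h3 - 2 * gau p x * h2 - σ * a * xi p σ a v * hphi

/-- The Gaussian terms of `cutPow` and of `tailSol` cancel, leaving a system which couples the two
signs and is driven by φ_a times the edge value. It holds on all of (0, ∞), also below a, which
`kerVec_ne_zero` needs. -/
lemma hasDerivAt_sonZ (hσ : σ ^ 2 = 1) (ha : 0 < a) (v : ℂ) {t : ℝ} (ht : 0 < t) :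
    HasDerivAt (sonZ p σ a v) (((1 / 2 - v) * sonZ p (-σ) a v t -
      σ * a * xi p σ a v * phi p (-σ) a t - 1 / 2 * sonZ p σ a v t) / t) t := by
  obtain ⟨g', hd, he⟩ := hasDerivAt_tailSol_cutPow (p := p) hσ ha v
  refine ((hasDerivAt_cutPow p σ v ht).add (hd t)).congr_deriv ?_
  have ht' : (t : ℂ) ≠ 0 := by exact_mod_cast ht.ne'
  rw [eq_div_iff ht', add_mul, div_mul_cancel₀ _ ht']
  simp only [sonZ]
  linear_combination he t

lemma continuousOn_sonZ (hσ : σ ^ 2 = 1) (ha : 0 < a) (v : ℂ) :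
    ContinuousOn (sonZ p σ a v) (Set.Ioi 0) := fun _ ht =>
  (hasDerivAt_sonZ hσ ha v ht).continuousAt.continuousWithinAt

lemma exists_bound_tailSol {X : ℝ → ℂ} (hσ : σ ^ 2 = 1) (ha : 0 < a)
    (hX : IntegrableOn X (Set.Ioi a)) : ∃ C, ∀ x, ‖tailSol p σ a X x‖ ≤ C := by
  obtain ⟨hgc, hge⟩ := tailSol_spec (p := p) hσ ha hX
  have hle : -a ≤ a := by linarith
  have hσn : ‖(σ : ℂ)‖ = 1 := by
    rw [Complex.norm_real, ← sq_eq_sq₀ (norm_nonneg _) zero_le_one, Real.norm_eq_abs, sq_abs, hσ,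
      one_pow]
  refine ⟨2 * (∫ t in Set.Ioi a, ‖X t‖) + ∫ t in (-a)..a, ‖tailSol p σ a X t‖, fun x => ?_⟩
  have h : tailSol p σ a X x = σ * (tailT p a X x - finT p a (tailSol p σ a X) x) := by
    linear_combination hge x
  have hw : ∀ t c, ‖wave p (x * t) * c‖ ≤ ‖c‖ := fun t c => by
    rw [norm_mul]
    exact mul_le_of_le_one_left (norm_nonneg _) (norm_wave_le p _)
  rw [h, norm_mul, hσn, one_mul]
  refine (norm_sub_le _ _).trans (add_le_add ?_ ?_)
  · rw [tailT, norm_mul, Complex.norm_ofNat]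
    exact mul_le_mul_of_nonneg_left (norm_integral_le_of_norm_le hX.norm
      (Filter.Eventually.of_forall fun t => hw t _)) zero_le_two
  · exact intervalIntegral.norm_integral_le_of_norm_le hle
      (Filter.Eventually.of_forall fun t _ => hw t _) (hgc.norm.intervalIntegrable _ _)

lemma exists_bound_sonZ (hσ : σ ^ 2 = 1) (ha : 0 < a) (v : ℂ) :
    ∃ C, 0 ≤ C ∧ ∀ t > a, ‖sonZ p σ a v t‖ ≤ C := by
  obtain ⟨C, hC, h1⟩ := (isDecaying_cutPow p σ v).exists_norm_le ha
  obtain ⟨D, h2⟩ := exists_bound_tailSol (p := p) hσ ha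
    (integrableOn_cutPow (p := p) (σ := σ) ha v)
  have hD : 0 ≤ D := (norm_nonneg _).trans (h2 0)
  exact ⟨C + D, by positivity, fun t ht => (norm_add_le _ _).trans (add_le_add (h1 t ht) (h2 t))⟩

lemma le_inv_mul_of_gt (ha : 0 < a) {C : ℝ} (hC : 0 ≤ C) {t : ℝ} (ht : a < t) :
    C ≤ C * a⁻¹ * t := by
  rw [mul_assoc, ← div_eq_inv_mul]
  exact le_mul_of_one_le_right hC ((one_le_div ha).2 ht.le)

lemma integrableOn_sonZ_mul {X Xd : ℝ → ℂ} (hσ : σ ^ 2 = 1) (ha : 0 < a) (v : ℂ)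
    (H : IsDecaying X Xd) : IntegrableOn (fun t => sonZ p σ a v t * X t) (Set.Ioi a) := by
  obtain ⟨C, hC, h⟩ := exists_bound_sonZ (p := p) hσ ha v
  exact (H.integrableOn_mul ha (continuousOn_sonZ hσ ha v) fun t ht =>
    (h t ht).trans (le_inv_mul_of_gt ha hC ht)).1

lemma integrableOn_sonZ_mul_gau (hσ : σ ^ 2 = 1) (ha : 0 < a) (v : ℂ) :
    IntegrableOn (fun t => sonZ p σ a v t * gau p t) (Set.Ioi a) := by
  obtain ⟨C, hC, h⟩ := exists_bound_sonZ (p := p) hσ ha v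
  refine Integrable.bdd_mul (c := C) (integrable_gau p).integrableOn
    (((continuousOn_sonZ hσ ha v).mono (Set.Ioi_subset_Ioi ha.le)).aestronglyMeasurable
    measurableSet_Ioi) ?_
  filter_upwards [ae_restrict_mem measurableSet_Ioi] with t ht
  exact h t ht

/-- Integration by parts of t times `sonZ` for σ at v times `cutPow` for -σ at z. The terms with 1/2
cancel, the boundary term at a and the integral against φ_a combine into `xi p (-σ) a z`, and `hg`
removes the Gaussian contribution. -/
lemma sonZ_identity (hσ : σ ^ 2 = 1) (ha : 0 < a) (v z : ℂ)
    (hg : (1 - σ : ℂ) * ∫ t in Set.Ioi a, sonZ p σ a v t * gau p t = 0) :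
    (1 / 2 - v) * (∫ t in Set.Ioi a, sonZ p (-σ) a v t * cutPow p (-σ) z t) +
      (1 / 2 - z) * (∫ t in Set.Ioi a, sonZ p σ a v t * cutPow p σ z t) +
      a * xi p σ a v * xi p (-σ) a z = 0 := by
  have h2 : (σ : ℂ) ^ 2 = 1 := by exact_mod_cast hσ
  have hσ' : (-σ) ^ 2 = 1 := by rw [neg_sq, hσ]
  have Hz := isDecaying_cutPow p (-σ) z
  obtain ⟨C, hC, h⟩ := exists_bound_sonZ (p := p) hσ ha v
  obtain ⟨C', hC', h'⟩ := exists_bound_sonZ (p := p) hσ' ha v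
  obtain ⟨D, hD, hφ⟩ := exists_bound_phi (p := p) hσ' ha
  set B := ‖1 / 2 - v‖ * C' + ‖σ * a * xi p σ a v‖ * D + ‖(1 / 2 : ℂ)‖ * C with hB
  have key := Hz.integral_deriv_mul ha (w := sonZ p σ a v) (wd := fun t =>
    (1 / 2 - v) * sonZ p (-σ) a v t - σ * a * xi p σ a v * phi p (-σ) a t -
      1 / 2 * sonZ p σ a v t) (C := C * a⁻¹) (D := B * a⁻¹)
    (fun t ht => hasDerivAt_sonZ hσ ha v ht)
    ((((continuousOn_sonZ hσ' ha v).const_mul _).sub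
      ((continuous_phi_ofReal hσ' ha).continuousOn.const_mul _)).sub
      ((continuousOn_sonZ hσ ha v).const_mul _))
    (fun t ht => (h t ht).trans (le_inv_mul_of_gt ha hC ht))
    (fun t ht => le_trans ?_ (le_inv_mul_of_gt ha (by positivity) ht))
  · have i1 := integrableOn_sonZ_mul (p := p) hσ' ha v Hz
    have i2 := integrableOn_sonZ_mul (p := p) hσ ha v Hz
    have i3 := integrableOn_phi_mul (p := p) hσ' ha (integrableOn_cutPow (p := p) (σ := -σ) ha z)
    have i4 := integrableOn_sonZ_mul (p := p) hσ ha v (isDecaying_cutPow p σ z)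
    have i5 := integrableOn_sonZ_mul_gau (p := p) hσ ha v
    have e1 := integral_add_add (i1.const_mul (1 / 2 - v))
      (i3.const_mul (-(σ * a * xi p σ a v))) (i2.const_mul (-1 / 2))
    have e2 := integral_add_add (i4.const_mul (1 / 2 - z))
      (i5.const_mul (-(2 * (1 - σ)))) (i2.const_mul (-1 / 2))
    simp only [integral_const_mul] at e1 e2
    have f1 : ∀ t, ((1 / 2 - v) * sonZ p (-σ) a v t - σ * a * xi p σ a v * phi p (-σ) a t -
      1 / 2 * sonZ p σ a v t) * cutPow p (-σ) z t =
        (1 / 2 - v) * (sonZ p (-σ) a v t * cutPow p (-σ) z t) +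
        -(σ * a * xi p σ a v) * (phi p (-σ) a t * cutPow p (-σ) z t) +
        -1 / 2 * (sonZ p σ a v t * cutPow p (-σ) z t) := fun t => by ring
    have f2 : ∀ t, sonZ p σ a v t * ((1 / 2 - z) * cutPow p (- -σ) z t -
        2 * (1 + ((-σ : ℝ) : ℂ)) * gau p t - 1 / 2 * cutPow p (-σ) z t) =
        (1 / 2 - z) * (sonZ p σ a v t * cutPow p σ z t) +
        -(2 * (1 - σ)) * (sonZ p σ a v t * gau p t) +
        -1 / 2 * (sonZ p σ a v t * cutPow p (-σ) z t) := fun t => by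
      rw [neg_neg]
      push_cast
      ring
    simp only [f1, f2] at key
    rw [e1, e2, sonZ_self hσ ha] at key
    have hxi : xi p (-σ) a z = cutPow p (-σ) z a + ((-σ : ℝ) : ℂ) *
      ∫ t in Set.Ioi a, (phi p (-σ) a t : ℂ) * cutPow p (-σ) z t := rfl
    rw [hxi]
    push_cast
    linear_combination key + 2 * hg
  · refine (norm_sub_le _ _).trans (add_le_add ((norm_sub_le _ _).trans (add_le_add ?_ ?_)) ?_)
    · rw [norm_mul]
      exact mul_le_mul_of_nonneg_left (h' t ht) (norm_nonneg _)
    · rw [norm_mul]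
      exact mul_le_mul_of_nonneg_left (hφ t) (norm_nonneg _)
    · rw [norm_mul]
      exact mul_le_mul_of_nonneg_left (h t ht) (norm_nonneg _)

end KernelIdentity

/-! ### The reproducing kernel and the Hermite–Biehler inequality -/

section StructurePair

variable {p : Parity} {σ a : ℝ}

lemma one_pow_two : (1 : ℝ) ^ 2 = 1 := by norm_num

lemma neg_one_pow_two : (-1 : ℝ) ^ 2 = 1 := by norm_num

/-- The eigenvector representing evaluation of the transform at `star v`. -/
def kerPart (hσ : σ ^ 2 = 1) (ha : 0 < a) (p : Parity) (v : ℂ) : L2R :=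
  repVec hσ ha p (isDecaying_cutPow p σ v)

lemma kerPart_ae (hσ : σ ^ 2 = 1) (ha : 0 < a) (v : ℂ) :
    ∀ᵐ t : ℝ, a < t → kerPart hσ ha p v t = (1 / 2 : ℂ) * sonZ p σ a v t :=
  repVec_ae_of_gt hσ ha _

lemma isSonineEigen_kerPart (hσ : σ ^ 2 = 1) (ha : 0 < a) (v : ℂ) :
    IsSonineEigen p σ a (kerPart hσ ha p v) := isSonineEigen_repVec hσ ha _

lemma inner_kerPart (hσ : σ ^ 2 = 1) (ha : 0 < a) (v : ℂ) {f : L2R}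
    (hf : IsSonineEigen p σ a f) :
    inner ℂ (kerPart hσ ha p v) f = 2 * sonT p a f (star v) := by
  rw [kerPart, inner_repVec hσ ha _ hf, hf.sonT_eq ha]
  congr 1
  refine setIntegral_congr_fun measurableSet_Ioi fun t ht => ?_
  rw [star_cutPow p σ v (ha.trans ht), mul_comm]

lemma sonT_kerPart (hσ : σ ^ 2 = 1) (ha : 0 < a) (v z : ℂ) :
    sonT p a (kerPart hσ ha p v) z =
      1 / 2 * ∫ t in Set.Ioi a, sonZ p σ a v t * cutPow p σ z t := by
  rw [(isSonineEigen_kerPart hσ ha v).sonT_eq ha, ← integral_const_mul]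
  refine integral_congr_ae ?_
  filter_upwards [ae_restrict_of_ae (kerPart_ae (p := p) hσ ha v),
    ae_restrict_mem measurableSet_Ioi] with t h1 h2
  rw [h1 h2, mul_assoc]

/-- The element of the Sonine space representing evaluation of the transform at `star v`. -/
def kerVec (ha : 0 < a) (p : Parity) (v : ℂ) : L2R :=
  kerPart one_pow_two ha p v + kerPart neg_one_pow_two ha p v

lemma kerVec_mem (ha : 0 < a) (v : ℂ) : kerVec ha p v ∈ sonineSpace p a :=
  add_mem_sonineSpace (isSonineEigen_kerPart _ ha v).mem (isSonineEigen_kerPart _ ha v).mem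

/-- The transform of `kerVec`. -/
def kerT (ha : 0 < a) (p : Parity) (v : ℂ) : ℂ → ℂ :=
  sonT p a (kerPart one_pow_two ha p v) + sonT p a (kerPart neg_one_pow_two ha p v)

lemma isSonineTransform_kerT (ha : 0 < a) (v : ℂ) :
    IsSonineTransform p (kerVec ha p v) (kerT ha p v) :=
  ((isSonineEigen_kerPart one_pow_two ha v).isSonineTransform one_pow_two ha).add ha
    (isSonineEigen_kerPart _ ha v).vanish (isSonineEigen_kerPart _ ha v).vanish
    ((isSonineEigen_kerPart neg_one_pow_two ha v).isSonineTransform neg_one_pow_two ha)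

/-- On each eigenspace the evaluator is the representer of `cutPow`, and orthogonality kills the
cross terms. The factor 2 is there because the inner product runs over the whole line and the Sonine
norm over half of it. -/
lemma inner_kerVec (ha : 0 < a) (v : ℂ) {f : L2R} (hf : f ∈ sonineSpace p a) {F : ℂ → ℂ}
    (hF : IsSonineTransform p f F) : inner ℂ (kerVec ha p v) f = 2 * F (star v) := by
  have h1 := isSonineEigen_eigenPart one_pow_two hf
  have h2 := isSonineEigen_eigenPart neg_one_pow_two hf
  have k1 := isSonineEigen_kerPart (p := p) one_pow_two ha v
  have k2 := isSonineEigen_kerPart (p := p) neg_one_pow_two ha v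
  rw [hF.unique (isSonineTransform_of_mem ha hf)]
  conv_lhs => rw [← eigenPart_add_eigenPart p f]
  have o1 := inner_eq_zero_of_eigen one_pow_two k1.eigen h2.eigen
  have o2 := inner_eq_zero_of_eigen neg_one_pow_two k2.eigen (by rw [neg_neg]; exact h1.eigen)
  rw [kerVec, inner_add_left, inner_add_right, inner_add_right, o1, o2,
    inner_kerPart one_pow_two ha v h1, inner_kerPart neg_one_pow_two ha v h2, Pi.add_apply]
  ring

lemma integral_star_kerVec (ha : 0 < a) (v : ℂ) {f : L2R} (hf : f ∈ sonineSpace p a) {F : ℂ → ℂ}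
    (hF : IsSonineTransform p f F) :
    F (star v) = ∫ t in Set.Ioi (0 : ℝ), star (kerVec ha p v t) * f t := by
  have hm := mem_sonineSpace_iff.1 hf
  have h := inner_kerVec ha v hf hF
  rw [inner_eq_two_mul_Ioi ha (mem_sonineSpace_iff.1 (kerVec_mem ha v)).1 hm.1 hm.2.1] at h
  rw [integral_Ioi_zero_of_vanish ha]
  · linear_combination -(1 / 2 : ℂ) * h
  · filter_upwards [hm.2.1] with x hx hmx
    rw [hx hmx, mul_zero]

lemma integral_sonZ_neg_one_mul_gau (ha : 0 < a) (v : ℂ) :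
    ∫ t in Set.Ioi a, sonZ p (-1) a v t * gau p t = 0 := by
  have h := (isSonineEigen_kerPart (p := p) neg_one_pow_two ha v).integral_gau_eq_zero ha
  have h2 : ∫ t in Set.Ioi a, kerPart neg_one_pow_two ha p v t * gau p t =
      1 / 2 * ∫ t in Set.Ioi a, sonZ p (-1) a v t * gau p t := by
    rw [← integral_const_mul]
    refine integral_congr_ae ?_
    filter_upwards [ae_restrict_of_ae (kerPart_ae (p := p) neg_one_pow_two ha v),
      ae_restrict_mem measurableSet_Ioi] with t h1 h2
    rw [h1 h2, mul_assoc]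
  rw [h2] at h
  linear_combination 2 * h

/-- In the sum of the two instances of `sonZ_identity` both integrals receive the same coefficient
(1/2 - v) + (1/2 - z) = 1 - v - z. -/
lemma kerT_mul (ha : 0 < a) (v z : ℂ) : (z + v - 1) * kerT ha p v z =
    a / 2 * (xi p 1 a v * xi p (-1) a z + xi p (-1) a v * xi p 1 a z) := by
  have h1 := sonZ_identity (p := p) one_pow_two ha v z (by norm_num)
  have h2 := sonZ_identity (p := p) neg_one_pow_two ha v z
    (by rw [integral_sonZ_neg_one_mul_gau ha, mul_zero])
  rw [neg_neg] at h2
  rw [kerT, Pi.add_apply, sonT_kerPart, sonT_kerPart]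
  linear_combination (-1 / 2 : ℂ) * h1 - 1 / 2 * h2

lemma structure_eq (ha : 0 < a) (s : ℂ) : calA p a s - Complex.I * calB p a s =
    (Real.sqrt a : ℂ) / 2 * (xi p 1 a s + xi p (-1) a s) := by
  rw [calA_eq p ha, calB_eq p ha]
  linear_combination (-(Real.sqrt a : ℂ) / 2 * xi p (-1) a s) * Complex.I_mul_I

lemma structure_one_sub_eq (ha : 0 < a) (s : ℂ) :
    calA p a (1 - s) - Complex.I * calB p a (1 - s) =
      (Real.sqrt a : ℂ) / 2 * (xi p 1 a s - xi p (-1) a s) := by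
  rw [structure_eq ha, xi_one_sub one_pow_two, xi_one_sub neg_one_pow_two]
  push_cast
  ring

lemma star_half_sqrt (a : ℝ) : star ((Real.sqrt a : ℂ) / 2) = (Real.sqrt a : ℂ) / 2 := by
  have : (Real.sqrt a : ℂ) / 2 = ((Real.sqrt a / 2 : ℝ) : ℂ) := by push_cast; rfl
  rw [this]
  exact Complex.conj_ofReal _

/-- E is √a/2 times the sum of the two `xi`, and s ↦ 1 - s changes the sum into the difference. The
rest is (b + c)(b' + c') - (b - c)(b' - c') = 2(bc' + cb'). -/
lemma kerT_mul_eq (ha : 0 < a) (w z : ℂ) : (z + star w - 1) * kerT ha p (star w) z =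
    (calA p a z - Complex.I * calB p a z) * star (calA p a w - Complex.I * calB p a w) -
      star (calA p a (1 - star z) - Complex.I * calB p a (1 - star z)) *
        (calA p a (1 - star w) - Complex.I * calB p a (1 - star w)) := by
  have hs : (Real.sqrt a : ℂ) * Real.sqrt a = a := by
    rw [← Complex.ofReal_mul, Real.mul_self_sqrt ha.le]
  rw [kerT_mul, structure_eq ha, structure_eq ha, structure_one_sub_eq ha, structure_one_sub_eq ha]
  simp only [star_mul', star_add, star_sub, star_half_sqrt, star_xi ha,
    star_star]
  linear_combination (-1 / 2 : ℂ) *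
    (xi p 1 a (star w) * xi p (-1) a z + xi p (-1) a (star w) * xi p 1 a z) * hs

lemma gammaFactor_ne_zero (p : Parity) {s : ℂ} (hs : 0 < s.re) : gammaFactor p s ≠ 0 := by
  cases p
  · exact Complex.Gammaℝ_ne_zero_of_re_pos hs
  · exact Complex.Gammaℝ_ne_zero_of_re_pos (by simpa using hs.trans (by linarith))

lemma tendsto_incMellin (p : Parity) {s : ℂ} (hs : 0 < s.re) :
    Filter.Tendsto (incMellin p s) (nhdsWithin 0 (Set.Ioi 0)) (nhds (mellin (gau p) s)) := by
  have hi : IntegrableOn (fun w : ℝ => (w : ℂ) ^ (s - 1) * gau p w) (Set.Ioi 0) := by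
    -- Without integrability the Mellin integral would be 0 by convention, but it is half the Gamma
    -- factor.
    by_contra hn
    refine gammaFactor_ne_zero p hs ?_
    rw [← mellin_gau p hs, mellin]
    simp only [smul_eq_mul]
    rw [integral_undef hn, mul_zero]
  have hid : Filter.Tendsto (fun t : ℝ => t) (nhdsWithin 0 (Set.Ioi 0)) (nhds 0) :=
    tendsto_nhdsWithin_of_tendsto_nhds Filter.tendsto_id
  have h := (aecover_Ioi_of_Ioi (μ := volume) hid).integral_tendsto_of_countably_generated hi
  refine (h.congr' ?_)
  filter_upwards [self_mem_nhdsWithin] with t ht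
  rw [Measure.restrict_restrict measurableSet_Ioi,
    Set.inter_eq_left.2 (Set.Ioi_subset_Ioi (le_of_lt ht))]
  rfl

/-- If the evaluator vanished, so would both orthogonal components, hence `sonZ` of both signs
beyond a and, by continuity at a, both values of `xi` at v. The differential system then loses its
inhomogeneity and forces the sum of the two `sonZ` to vanish on all of (0, ∞). Near 0 this sum is 4
t^{-v} times the incomplete Mellin transform plus bounded terms, so that transform would tend to 0,
whereas its limit is half the nonzero Gamma factor. -/
lemma kerVec_ne_zero (ha : 0 < a) {v : ℂ} (hv : 0 < v.re) : kerVec ha p v ≠ 0 := by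
  intro h0
  have k1 := isSonineEigen_kerPart (p := p) one_pow_two ha v
  have k2 := isSonineEigen_kerPart (p := p) neg_one_pow_two ha v
  have o := inner_eq_zero_of_eigen one_pow_two k1.eigen k2.eigen
  have z1 : kerPart one_pow_two ha p v = 0 := by
    rw [← inner_self_eq_zero (𝕜 := ℂ), ← add_zero (inner ℂ (kerPart _ ha p v) _), ← o,
      ← inner_add_right]
    change inner ℂ _ (kerVec ha p v) = _
    rw [h0, inner_zero_right, o]
  have z2 : kerPart neg_one_pow_two ha p v = 0 := by
    rw [kerVec, z1, zero_add] at h0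
    exact h0
  have key : ∀ {σ : ℝ} (hσ : σ ^ 2 = 1), kerPart hσ ha p v = 0 →
      (∀ t > a, sonZ p σ a v t = 0) ∧ xi p σ a v = 0 := by
    intro σ hσ hz
    have hc := continuousOn_sonZ (p := p) hσ ha v
    have hae : sonZ p σ a v =ᵐ[volume.restrict (Set.Ioi a)] 0 := by
      have hz' : ∀ᵐ t : ℝ, kerPart hσ ha p v t = 0 := by
        rw [hz]
        exact Lp.coeFn_zero ℂ 2 volume
      filter_upwards [ae_restrict_of_ae (kerPart_ae (p := p) hσ ha v), ae_restrict_of_ae hz',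
        ae_restrict_mem measurableSet_Ioi] with t h1 h2 h3
      have := h1 h3
      rw [h2] at this
      simpa using this.symm
    have hz1 : ∀ t > a, sonZ p σ a v t = 0 := fun t ht =>
      Measure.eqOn_of_ae_eq hae (hc.mono (Set.Ioi_subset_Ioi ha.le)) continuousOn_const
        (by rw [interior_Ioi]; exact subset_closure) ht
    refine ⟨hz1, ?_⟩
    rw [← sonZ_self hσ ha]
    have hca := (hasDerivAt_sonZ (p := p) hσ ha v ha).continuousAt
    have ht : Filter.Tendsto (sonZ p σ a v) (nhdsWithin a (Set.Ioi a)) (nhds 0) :=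
      tendsto_const_nhds.congr' (by
        filter_upwards [self_mem_nhdsWithin] with t ht
        exact (hz1 t ht).symm)
    exact tendsto_nhds_unique (hca.tendsto.mono_left nhdsWithin_le_nhds) ht
  obtain ⟨s1, x1⟩ := key one_pow_two z1
  obtain ⟨s2, x2⟩ := key neg_one_pow_two z2
  -- With both edge values zero, adding the two equations gives t S' = -v S for the sum S.
  have hW : ∀ t ∈ Set.Ioi (0 : ℝ), HasDerivAt (fun t : ℝ =>
      (t : ℂ) ^ v * (sonZ p 1 a v t + sonZ p (-1) a v t)) 0 t := by
    intro t ht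
    have ht' : (t : ℂ) ≠ 0 := by exact_mod_cast (Set.mem_Ioi.1 ht).ne'
    have d1 := hasDerivAt_sonZ (p := p) one_pow_two ha v ht
    have d2 := hasDerivAt_sonZ (p := p) neg_one_pow_two ha v ht
    have d0 : HasDerivAt (fun t : ℝ => (t : ℂ) ^ v) (v * (t : ℂ) ^ (v - 1)) t :=
      hasDerivAt_ofReal_cpow_const ht.ne' fun h => by simp [h] at hv
    rw [x1] at d1
    rw [x2, neg_neg] at d2
    refine (d0.mul (d1.add d2)).congr_deriv ?_
    rw [Complex.cpow_sub _ _ ht', Complex.cpow_one, Pi.add_apply]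
    field_simp
    ring
  have hconst : ∀ t > (0 : ℝ), (t : ℂ) ^ v * (sonZ p 1 a v t + sonZ p (-1) a v t) = 0 := by
    intro t ht
    have h := isOpen_Ioi.is_const_of_deriv_eq_zero isPreconnected_Ioi
      (fun t ht => (hW t ht).differentiableAt.differentiableWithinAt)
      (fun t ht => (hW t ht).deriv) (Set.mem_Ioi.2 ht) (Set.mem_Ioi.2 (by linarith : 0 < a + 1))
    rw [h, s1 _ (by linarith), s2 _ (by linarith), add_zero, mul_zero]
  obtain ⟨C, hC⟩ := exists_bound_tailSol (p := p) one_pow_two ha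
    (integrableOn_cutPow (p := p) (σ := 1) ha v)
  obtain ⟨D, hD⟩ := exists_bound_tailSol (p := p) neg_one_pow_two ha
    (integrableOn_cutPow (p := p) (σ := -1) ha v)
  have hle : ∀ t > (0 : ℝ), ‖incMellin p v t‖ ≤ t ^ v.re * (C + D) := by
    intro t ht
    have ht' : (t : ℂ) ≠ 0 := by exact_mod_cast ht.ne'
    have h := hconst t ht
    simp only [sonZ, cutPow] at h
    rw [Complex.cpow_neg] at h
    -- In the sum over σ = ±1 the second term of `cutPow` cancels and the first is doubled.
    have h4 : 4 * incMellin p v t = (t : ℂ) ^ v * (-tailSol p 1 a (cutPow p 1 v) t -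
        tailSol p (-1) a (cutPow p (-1) v) t) := by
      have hi : (t : ℂ) ^ v * ((t : ℂ) ^ v)⁻¹ = 1 :=
        mul_inv_cancel₀ (by simp [Complex.cpow_eq_zero_iff, ht'])
      push_cast at h
      linear_combination h - 4 * incMellin p v t * hi
    have h5 := congrArg norm h4
    rw [norm_mul, norm_mul, Complex.norm_ofNat, Complex.norm_cpow_eq_rpow_re_of_pos ht] at h5
    have h6 : ‖-tailSol p 1 a (cutPow p 1 v) t - tailSol p (-1) a (cutPow p (-1) v) t‖ ≤ C + D :=
      (norm_sub_le _ _).trans (by rw [norm_neg]; exact add_le_add (hC t) (hD t))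
    have h7 := mul_le_mul_of_nonneg_left h6 (Real.rpow_nonneg ht.le v.re)
    linarith [norm_nonneg (incMellin p v t)]
  have hlim : Filter.Tendsto (incMellin p v) (nhdsWithin 0 (Set.Ioi 0)) (nhds 0) := by
    have h1 : Filter.Tendsto (fun t : ℝ => t ^ v.re * (C + D)) (nhdsWithin 0 (Set.Ioi 0))
        (nhds 0) := by
      have := ((Real.continuousAt_rpow_const 0 v.re (Or.inr hv.le)).tendsto.mul_const
        (C + D)).mono_left (nhdsWithin_le_nhds (s := Set.Ioi 0))
      rwa [Real.zero_rpow hv.ne', zero_mul] at this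
    refine squeeze_zero_norm' ?_ h1
    filter_upwards [self_mem_nhdsWithin] with t ht
    exact hle t ht
  have := tendsto_nhds_unique hlim (tendsto_incMellin p hv)
  refine gammaFactor_ne_zero p hv ?_
  rw [← mellin_gau p hv, ← this, mul_zero]

/-- The kernel identity on the diagonal: |E(s)|² - |E(1 - s̄)|² is 2 Re s - 1 times half the squared
norm of the evaluator, which is not zero. -/
lemma norm_structure_one_sub_lt (ha : 0 < a) {s : ℂ} (hs : 1 / 2 < s.re) :
    ‖calA p a (1 - star s) - Complex.I * calB p a (1 - star s)‖ <
      ‖calA p a s - Complex.I * calB p a s‖ := by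
  have hv : 0 < (star s).re := by
    have : (star s).re = s.re := Complex.conj_re s
    rw [this]
    linarith
  have h1 := kerT_mul_eq (p := p) ha s s
  have h2 := inner_kerVec ha (star s) (kerVec_mem ha (star s)) (isSonineTransform_kerT (p := p) ha _)
  rw [star_star, inner_self_eq_norm_sq_to_K] at h2
  have h3 : 0 < ‖kerVec ha p (star s)‖ := norm_pos_iff.2 (kerVec_ne_zero ha hv)
  have h4 : s + star s - 1 = ((2 * s.re - 1 : ℝ) : ℂ) := by
    rw [Complex.star_def, Complex.add_conj]
    push_cast
    ring
  have h5 : ∀ z : ℂ, z * star z = ((‖z‖ ^ 2 : ℝ) : ℂ) := fun z => by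
    rw [Complex.star_def, Complex.mul_conj, Complex.normSq_eq_norm_sq]
  rw [h4, h5, mul_comm (star _), h5] at h1
  have h6 : (2 * s.re - 1) * (‖kerVec ha p (star s)‖ ^ 2 / 2) =
      ‖calA p a s - Complex.I * calB p a s‖ ^ 2 -
        ‖calA p a (1 - star s) - Complex.I * calB p a (1 - star s)‖ ^ 2 := by
    have : (((2 * s.re - 1) * (‖kerVec ha p (star s)‖ ^ 2 / 2) : ℝ) : ℂ) =
      ((‖calA p a s - Complex.I * calB p a s‖ ^ 2 -
        ‖calA p a (1 - star s) - Complex.I * calB p a (1 - star s)‖ ^ 2 : ℝ) : ℂ) := by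
      push_cast at h1 ⊢
      rw [← h1]
      have h7 : ((‖kerVec ha p (star s)‖ : ℂ)) ^ 2 = 2 * kerT ha p (star s) s := h2
      rw [h7]
      ring
    exact_mod_cast this
  have h7 : 0 < (2 * s.re - 1) * (‖kerVec ha p (star s)‖ ^ 2 / 2) :=
    mul_pos (by linarith) (by positivity)
  exact lt_of_pow_lt_pow_left₀ 2 (norm_nonneg _) (by linarith)

theorem isStructurePair (p : Parity) {a : ℝ} (ha : 0 < a) :
    IsStructurePair p a (calA p a) (calB p a) where
  entire_A := by
    rw [calA_eq p ha]
    exact (differentiable_xi one_pow_two ha).const_mul _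
  entire_B := by
    rw [calB_eq p ha]
    exact (differentiable_xi neg_one_pow_two ha).const_mul _
  symm_A s := by
    have hc : ∀ x : ℝ, star (x : ℂ) = x := Complex.conj_ofReal
    rw [calA_eq p ha]
    simp only [star_mul', star_half_sqrt, star_xi ha, star_star, xi_one_sub one_pow_two, hc]
    push_cast
    ring
  symm_B s := by
    have hc : ∀ x : ℝ, star (x : ℂ) = x := Complex.conj_ofReal
    have hI : Complex.I * (Real.sqrt a : ℂ) / 2 = Complex.I * ((Real.sqrt a : ℂ) / 2) := by ring
    have hI' : star Complex.I = -Complex.I := Complex.conj_I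
    rw [calB_eq p ha, hI]
    simp only [star_mul', star_half_sqrt, star_xi ha, star_star, xi_one_sub neg_one_pow_two, hI',
      hc]
    push_cast
    ring
  hermite_biehler _ hs := norm_structure_one_sub_lt ha hs
  transform_exists _ hf := ⟨_, isSonineTransform_of_mem ha hf⟩
  kernel w := by
    refine ⟨kerVec ha p (star w), kerVec_mem ha _, kerT ha p (star w), isSonineTransform_kerT ha _,
      fun f hf F hF => ?_, kerT_mul_eq ha w⟩
    have := integral_star_kerVec ha (star w) hf hF
    rwa [star_star] at this

end StructurePair

end FourierDirac

end

theorem mainTheorem2 (p : FourierDirac.Parity) :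
    -- the equations defining `φ_a^±` have unique solutions
    (∀ a > 0, (∃! φ, FourierDirac.IsPhi p 1 a φ) ∧ (∃! φ, FourierDirac.IsPhi p (-1) a φ)) ∧
    -- `A_a`, `B_a` are (anti-)invariant and vanish on `(-a, a)`
    (∀ a > 0, FourierDirac.IsSonineDistribution p a 1 (FourierDirac.distA p a) ∧
      FourierDirac.IsSonineDistribution p a (-1) (FourierDirac.distB p a)) ∧
    -- their completed right Mellin transforms are entire functions
    (∀ a > 0,
      FourierDirac.IsCompletedMellin p a (FourierDirac.distA p a) (FourierDirac.calA p a) ∧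
      FourierDirac.IsCompletedMellin p a (FourierDirac.distB p a) (FourierDirac.calB p a)) ∧
    -- these are the structure functions of the de Branges Sonine spaces
    (∀ a > 0, FourierDirac.IsStructurePair p a (FourierDirac.calA p a) (FourierDirac.calB p a)) ∧
    -- the Dirac system
    (∀ (γ : ℂ) (u : ℝ),
      HasDerivAt (FourierDirac.scrA p γ)
        (-γ * FourierDirac.scrB p γ u - FourierDirac.muU p u * FourierDirac.scrA p γ u) u ∧
      HasDerivAt (FourierDirac.scrB p γ)
        (γ * FourierDirac.scrA p γ u + FourierDirac.muU p u * FourierDirac.scrB p γ u) u) ∧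
    -- the determinants are positive and their logarithms are twice differentiable
    (∀ a > 0, 0 < FourierDirac.detF p 1 a ∧ 0 < FourierDirac.detF p (-1) a) ∧
    ContDiff ℝ 2 (FourierDirac.logDetF p 1) ∧ ContDiff ℝ 2 (FourierDirac.logDetF p (-1)) ∧
    -- the Schrödinger equations
    (∀ γ : ℂ, ContDiff ℝ 2 (FourierDirac.scrA p γ) ∧ ContDiff ℝ 2 (FourierDirac.scrB p γ)) ∧
    (∀ (γ : ℂ) (u : ℝ),
      -iteratedDeriv 2 (FourierDirac.scrA p γ) u +
          FourierDirac.potential p 1 u * FourierDirac.scrA p γ u =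
        γ ^ 2 * FourierDirac.scrA p γ u ∧
      -iteratedDeriv 2 (FourierDirac.scrB p γ) u +
          FourierDirac.potential p (-1) u * FourierDirac.scrB p γ u =
        γ ^ 2 * FourierDirac.scrB p γ u) := by
  have p1 : (1 : ℝ) ^ 2 = 1 := by norm_num
  have m1 : (-1 : ℝ) ^ 2 = 1 := by norm_num
  refine ⟨fun a ha => ⟨FourierDirac.existsUnique_isPhi p p1 ha,
    FourierDirac.existsUnique_isPhi p m1 ha⟩, fun a ha => ⟨?_, ?_⟩, fun a ha => ⟨?_, ?_⟩,
    fun a ha => FourierDirac.isStructurePair p ha, fun γ u => ⟨FourierDirac.hasDerivAt_scrA p γ u,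
      FourierDirac.hasDerivAt_scrB p γ u⟩, fun a ha => ⟨FourierDirac.detF_pos p1 ha,
      FourierDirac.detF_pos m1 ha⟩, FourierDirac.contDiff_logDetF p1,
    FourierDirac.contDiff_logDetF m1, FourierDirac.contDiff_scr p, fun γ u => ⟨?_, ?_⟩⟩
  · rw [FourierDirac.distA_eq]
    simpa using (FourierDirac.isSonineDistribution_coreDist p1 ha).smul ((Real.sqrt a : ℂ) / 2)
  · rw [FourierDirac.distB_eq]
    simpa using (FourierDirac.isSonineDistribution_coreDist m1 ha).smul
      (Complex.I * (Real.sqrt a : ℂ) / 2)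
  · rw [FourierDirac.calA_eq p ha]
    exact FourierDirac.isCompletedMellin_distA p ha
  · rw [FourierDirac.calB_eq p ha]
    exact FourierDirac.isCompletedMellin_distB p ha
  · rw [FourierDirac.iteratedDeriv_two_scrA, FourierDirac.potential_one]
    ring
  · rw [FourierDirac.iteratedDeriv_two_scrB, FourierDirac.potential_neg_one]
    ring
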